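/- Let $p$ be an odd prime, $\Lambda=\mathbb Z/p$, and $G$ a (discrete) group. **Conventions.** A $\Lambda$-complex is a $\mathbb Z$-graded cochain complex of $\Lambda$-modules with differential of degree $+1$; chain complexes are regarded as complexes in non-positive degrees, and $\deg$ denotes the resulting degree. Tensor products carry the usual signs, $K^n$ is the $n$-fold tensor power, and $\Sigma_n$ permutes the factors of $K^n$ (the factor in position $i$ moves to position $\sigma(i)$) with the Koszul sign. Let $\pi\subseteq\Sigma_p$ be the cyclic group generated by $\alpha:i\mapsto i+1$, and $W$ the standard $\Lambda[\pi]$-free resolution of $\Lambda$ with one generator $e_i$ in (homological) degree $i\ge 0$, $d e_{2i+1}=(\alpha-1)e_{2i}$, $d e_{2i}=(1+\alpha+\dots+\alpha^{p-1})e_{2i-1}$, and augmentation $\epsilon(\alpha^je_0)=1$. Homotopies are cochain homotopies; $\Lambda[\Gamma]$-homotopies are those equivariant under the group $\Gamma$. Groups act diagonally on tensor products and trivially on targets $K$. **Adem objects.** An object of $\mathfrak C(p)$ is a pair $(K,\theta)$ where $K$ is a $\Lambda$-complex with a homotopy associative morphism of complexes $K\otimes K\to K$ and $\theta:W\otimes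 K^p\to K$ is a morphism of $\Lambda[\pi]$-complexes such that (1) $\theta$ restricted to $e_0\otimes K^p$ is $\Lambda$-homotopic to the iterated product $K^p\to K$, associated in some order; (2) for every $\Lambda[\Sigma_p]$-free resolution $V$ of $\Lambda$ and every $\Lambda[\pi]$-morphism $j:W\to V$ over $\Lambda$, $\theta$ is $\Lambda[\pi]$-homotopic to $\phi(j\otimes 1)$ for some morphism $\phi:V\otimes K^p\to K$ of $\Lambda[\Sigma_p]$-complexes. Let $\Sigma_{p^2}$ permute the symbols $(i,j)$, $1\le i,j\le p$. Let $\alpha(i,j)=(i+1,j)$, $\alpha_i(i,j)=(i,j+1)$, $\alpha_i(k,j)=(k,j)$ for $k\ne i$ (indices mod $p$), $\beta=\alpha_1\cdots\alpha_p$ and $\tau=\langle\alpha_1,\dots,\alpha_p,\alpha\rangle\subseteq\Sigma_{p^2}$. Let $W_1=W$, and let $W_2=W$ with $\beta$ acting as the generator. If $\beta$ acts on $M$, then $\tau$ acts on $W_1\otimes M^p$: $\alpha$ acts diagonally, by cyclic permutation on $M^p$, and $\alpha_i$ acts trivially on $W_1$ and as $\beta$ on the $i$-th factor $M$. This applies to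 $M=W_2$ and to $M=W_2\otimes K^p$, on which $\beta$ acts diagonally, by cyclic permutation on $K^p$. The $(i,j)$-th factor of $K^{p^2}=(K^p)^p$ is the $j$-th factor of the $i$-th $K^p$. An object $(K,\theta)$ of $\mathfrak C(p)$ is an *Adem object* if for every $\Lambda[\Sigma_{p^2}]$-free resolution $Y$ of $\Lambda$ with $Y_0=\Lambda[\Sigma_{p^2}]$ and every $\tau$-morphism $w:W_1\otimes W_2^p\to Y$ over $\Lambda$ there is a morphism $\eta:Y\otimes K^{p^2}\to K$ of $\Lambda[\Sigma_{p^2}]$-complexes such that $$W_1\otimes(W_2\otimes K^p)^p\xrightarrow{\ \tilde U\ }(W_1\otimes W_2^p)\otimes K^{p^2}\xrightarrow{w\otimes \mathrm{id}}Y\otimes K^{p^2}\xrightarrow{\ \eta\ }K\quad\text{and}\quad W_1\otimes(W_2\otimes K^p)^p\xrightarrow{\mathrm{id}\otimes\theta^p}W_1\otimes K^p\xrightarrow{\ \theta\ }K$$ are $\Lambda[\tau]$-homotopic, where $\tilde U$ is the shuffle of the factors (with Koszul signs). **Equivariant cochains.** Let $O_G$ be the category of the $G$-sets $G/H$ and $G$-maps.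 An object $(T,M_0,\rho)$ of $\mathcal A_\Lambda$ consists of contravariant functors $T$, $M_0$, $\rho$ from $O_G$ to simplicial sets, commutative unital $\Lambda$-algebras and groups, respectively, with actions of $\rho(G/H)$ on $T(G/H)$ and (by algebra automorphisms) on $M_0(G/H)$, natural in $G/H$. Let $C$ denote normalized chains over $\Lambda$. $C^n_\rho(T;M_0)$ is the module of natural transformations $C_n(T)\to M_0$ that are equivariant under $\rho$; for $f\in C^n_\rho(T;M_0)$ let $\delta f=(-1)^{n+1}f\circ\partial$. The cup product is $f\cup g=\alpha(f\otimes g)\circ\xi\circ D_*$, where $D$ is the diagonal, $\xi$ the Alexander–Whitney map, and $$\alpha(f_1\otimes\dots\otimes f_n)(x_1\otimes\dots\otimes x_n)=(-1)^{\sum_{i<j}\deg x_i\deg x_j}f_1(x_1)\cdots f_n(x_n).$$ An *Eilenberg–Zilber map* is a family of morphisms of complexes $\Phi:W\otimes C(L_1\times\dots\times L_p)\to W\otimes C(L_1)\otimes\dots\otimes C(L_p)$, defined for all $p$-tuples of simplicial sets, natural in the $L_i$, compatible with the action of $\pi$ by permuting the factors, equal to the identity on $W\otimes C_0(L_1\times\dots\times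 L_p)$, with $\Phi(e_0\otimes x)=e_0\otimes\xi(x)$ for the $p$-fold Alexander–Whitney map $\xi$, and with $\Phi(W\otimes C_j(L_1\times\dots\times L_p))\subseteq\sum_{k\le pj}W\otimes[C(L_1)\otimes\dots\otimes C(L_p)]_k$. Given $\Phi$, let $\Delta:W\otimes C(L)\to C(L)^p$ be the composite of $\mathrm{id}\otimes D_*$ (with $D:L\to L^p$ the diagonal), $\Phi$ and $\epsilon\otimes\mathrm{id}$, and define $\theta:W\otimes C^*_\rho(T;M_0)^p\to C^*_\rho(T;M_0)$ by $$\theta(w\otimes f)(x)=(-1)^{\deg w\,\deg f}\,\alpha(f)(\Delta(w\otimes x)).$$ **Proposition 5.12.** Eilenberg–Zilber maps $\Phi$ exist, and for every such $\Phi$, every $G$ and every $(T,M_0,\rho)$ in $\mathcal A_\Lambda$, the pair $(C^*_\rho(T;M_0),\theta)$, with the cup product as product, is an Adem object of $\mathfrak C(p)$ (in particular an object of $\mathfrak C(p)$). -/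

import Mathlib

open TensorProduct

universe v v' u w w'

namespace SteenrodDG

noncomputable section

/-! ### Differential graded modules -/

/-- A complex over `Λ` ("`Λ`-complex"): a `ℤ`-graded `Λ`-module with a differential of degree `+1`.
The complex is given by the total module `⨁ n, K n` together with its homogeneous parts. -/
structure DGMod (Λ : Type) [Field Λ] where
  carrier : Type v
  [acg : AddCommGroup carrier]
  [mod : Module Λ carrier]
  /-- the homogeneous elements of degree `n` -/
  gr : ℤ → Submodule Λ carrier
  internal : DirectSum.IsInternal gr
  d : carrier →ₗ[Λ] carrier
  d_mem : ∀ {n : ℤ} {x : carrier}, x ∈ gr n → d x ∈ gr (n + 1)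
  d_d : ∀ x : carrier, d (d x) = 0

attribute [instance] DGMod.acg DGMod.mod

instance (Λ : Type) [Field Λ] : CoeSort (DGMod.{v} Λ) (Type v) := ⟨DGMod.carrier⟩

variable {Λ : Type} [Field Λ]

/-- A criterion for a family of submodules to be a direct sum decomposition. -/
theorem isInternal_of_components {M : Type v} [AddCommGroup M] [Module Λ M]
    (gr : ℤ → Submodule Λ M) {I : Type v'} (N : I → Type w)
    [∀ i, AddCommGroup (N i)] [∀ i, Module Λ (N i)] (φ : ∀ i, M →ₗ[Λ] N i) (deg : I → ℤ)
    (hinj : ∀ x, (∀ i, φ i x = 0) → x = 0)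
    (hφ : ∀ n, ∀ x ∈ gr n, ∀ i, deg i ≠ n → φ i x = 0) (htop : ∀ x, x ∈ ⨆ n, gr n) :
    DirectSum.IsInternal gr := by
  refine DirectSum.isInternal_submodule_of_iSupIndep_of_iSup_eq_top ?_
    (eq_top_iff.2 fun x _ => htop x)
  intro n
  rw [Submodule.disjoint_def]
  intro x hx hx'
  apply hinj
  intro i
  by_cases h : deg i = n
  · have : (⨆ j, ⨆ (_ : j ≠ n), gr j) ≤ LinearMap.ker (φ i) := by
      refine iSup₂_le fun j hj y hy => ?_
      exact hφ j y hy i (by rw [h]; exact hj.symm)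
    exact this hx'
  · exact hφ n x hx i h

namespace DGMod

theorem iSup_gr (K : DGMod.{v} Λ) : ⨆ n, K.gr n = ⊤ :=
  K.internal.submodule_iSup_eq_top

/-- Induction over homogeneous elements. -/
theorem hom_induction (K : DGMod.{v} Λ) {P : K → Prop} (x : K)
    (h : ∀ n, ∀ y ∈ K.gr n, P y) (h0 : P 0) (ha : ∀ y z, P y → P z → P (y + z)) : P x :=
  Submodule.iSup_induction K.gr (motive := P) (by rw [K.iSup_gr]; trivial) h h0 ha

/-- The decomposition isomorphism of a complex. -/
def decomp (A : DGMod.{v} Λ) : A ≃ₗ[Λ] DirectSum ℤ (fun n => A.gr n) :=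
  (LinearEquiv.ofBijective (DirectSum.coeLinearMap A.gr) A.internal).symm

theorem decomp_of_mem (A : DGMod.{v} Λ) {n : ℤ} {x : A} (hx : x ∈ A.gr n) :
    A.decomp x = DirectSum.lof Λ ℤ (fun n => A.gr n) n ⟨x, hx⟩ := by
  rw [decomp, LinearEquiv.symm_apply_eq]
  exact (DirectSum.coeLinearMap_lof A.gr n ⟨x, hx⟩).symm

/-- The operator multiplying the elements of degree `n` by `c n`. -/
def scale (K : DGMod.{v} Λ) (c : ℤ → Λ) : K →ₗ[Λ] K :=
  DirectSum.toModule Λ ℤ K (fun n => c n • (K.gr n).subtype) ∘ₗ K.decomp.toLinearMap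

theorem scale_of_mem (K : DGMod.{v} Λ) (c : ℤ → Λ) {n : ℤ} {x : K} (hx : x ∈ K.gr n) :
    K.scale c x = c n • x := by
  simp [scale, decomp_of_mem K hx]

/-- The sign operator `x ↦ (-1) ^ deg x • x`. -/
def par (K : DGMod.{v} Λ) : K →ₗ[Λ] K := K.scale fun n => if Even n then 1 else -1

/-- The projection onto the part of odd degree. -/
def odd (K : DGMod.{v} Λ) : K →ₗ[Λ] K := K.scale fun n => if Even n then 0 else 1

/-- The projection onto the part of even degree. -/
def even (K : DGMod.{v} Λ) : K →ₗ[Λ] K := K.scale fun n => if Even n then 1 else 0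

theorem par_of_mem (K : DGMod.{v} Λ) {n : ℤ} {x : K} (hx : x ∈ K.gr n) :
    K.par x = (if Even n then 1 else -1 : Λ) • x := K.scale_of_mem _ hx

theorem par_mem (K : DGMod.{v} Λ) {n : ℤ} {x : K} (hx : x ∈ K.gr n) : K.par x ∈ K.gr n := by
  rw [K.par_of_mem hx]; exact Submodule.smul_mem _ _ hx

theorem par_d (K : DGMod.{v} Λ) (x : K) : K.par (K.d x) = - K.d (K.par x) := by
  induction x using K.hom_induction with
  | h n y hy =>
    rw [K.par_of_mem hy, K.par_of_mem (K.d_mem hy)]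
    by_cases h : Even n <;> simp [h, parity_simps]
  | h0 => simp
  | ha y z hy hz => simp only [map_add, hy, hz, neg_add]

theorem d_par_d (K : DGMod.{v} Λ) (x : K) : K.d (K.par (K.d x)) = 0 := by
  rw [par_d, map_neg, K.d_d, neg_zero]

/-! ### Complexes with a homogeneous basis -/

/-- The complex with `Λ`-basis `B`, where `b : B` has degree `deg b` and differential `d b`. -/
def ofBasis (B : Type v) (deg : B → ℤ) (d : B → (B →₀ Λ))
    (hd : ∀ b, d b ∈ Finsupp.supported Λ Λ {b' | deg b' = deg b + 1})
    (hdd : ∀ b, Finsupp.linearCombination Λ d (d b) = 0) : DGMod.{v} Λ where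
  carrier := B →₀ Λ
  gr n := Finsupp.supported Λ Λ {b | deg b = n}
  internal := by
    refine isInternal_of_components _ (I := B) (fun _ => Λ) (fun b => Finsupp.lapply b) deg
      (fun x h => Finsupp.ext h) (fun n x hx b hb => ?_) (fun x => ?_)
    · rw [Finsupp.mem_supported'] at hx
      exact hx b hb
    · induction x using Finsupp.induction_linear with
      | zero => exact Submodule.zero_mem _
      | add f g hf hg => exact Submodule.add_mem _ hf hg
      | single b c =>
        exact Submodule.mem_iSup_of_mem (deg b) (Finsupp.single_mem_supported _ _ rfl)
  d := Finsupp.linearCombination Λ d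
  d_mem := by
    intro n x hx
    rw [Finsupp.linearCombination_apply, Finsupp.sum]
    refine Submodule.sum_mem _ fun b hb => Submodule.smul_mem _ _ ?_
    have hb' : deg b = n := (Finsupp.mem_supported _ _).1 hx hb
    have := hd b
    rwa [hb'] at this
  d_d := by
    intro x
    induction x using Finsupp.induction_linear with
    | zero => simp
    | add f g hf hg => simp only [map_add, hf, hg, add_zero]
    | single b c => simp [hdd]

/-! ### Tensor products -/

theorem mem_iSup_tmul (A : DGMod.{v} Λ) (B : DGMod.{v'} Λ)
    (gr : ℤ → Submodule Λ (A ⊗[Λ] B))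
    (h : ∀ i j, ∀ a ∈ A.gr i, ∀ b ∈ B.gr j, a ⊗ₜ[Λ] b ∈ gr (i + j)) (x : A ⊗[Λ] B) :
    x ∈ ⨆ n, gr n := by
  induction x using TensorProduct.induction_on with
  | zero => exact Submodule.zero_mem _
  | add x y hx hy => exact Submodule.add_mem _ hx hy
  | tmul a b =>
    induction a using A.hom_induction with
    | h0 => rw [TensorProduct.zero_tmul]; exact Submodule.zero_mem _
    | ha y z hy hz => rw [TensorProduct.add_tmul]; exact Submodule.add_mem _ hy hz
    | h i a ha =>
      induction b using B.hom_induction with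
      | h0 => rw [TensorProduct.tmul_zero]; exact Submodule.zero_mem _
      | ha y z hy hz => rw [TensorProduct.tmul_add]; exact Submodule.add_mem _ hy hz
      | h j b hb => exact Submodule.mem_iSup_of_mem (i + j) (h i j a ha b hb)

/-- The homogeneous parts of a tensor product. -/
def tensorGr (A : DGMod.{v} Λ) (B : DGMod.{v'} Λ) (n : ℤ) : Submodule Λ (A ⊗[Λ] B) :=
  Submodule.span Λ {x | ∃ (i j : ℤ) (a : A) (b : B),
    a ∈ A.gr i ∧ b ∈ B.gr j ∧ i + j = n ∧ a ⊗ₜ[Λ] b = x}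

theorem tmul_mem_tensorGr (A : DGMod.{v} Λ) (B : DGMod.{v'} Λ) {i j : ℤ} {a : A} {b : B}
    (ha : a ∈ A.gr i) (hb : b ∈ B.gr j) : a ⊗ₜ[Λ] b ∈ tensorGr A B (i + j) :=
  Submodule.subset_span ⟨i, j, a, b, ha, hb, rfl, rfl⟩

/-- The tensor product `A ⊗ B`, with `d (a ⊗ b) = d a ⊗ b + (-1) ^ deg a • a ⊗ d b`. -/
abbrev tensor (A : DGMod.{v} Λ) (B : DGMod.{v'} Λ) : DGMod.{max v v'} Λ where
  carrier := A ⊗[Λ] B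
  gr := tensorGr A B
  internal := by
    let e : A ⊗[Λ] B ≃ₗ[Λ] _ := TensorProduct.congr A.decomp B.decomp ≪≫ₗ
      TensorProduct.directSum Λ Λ (fun n => A.gr n) (fun n => B.gr n)
    refine isInternal_of_components _ (I := ℤ × ℤ) (fun q => A.gr q.1 ⊗[Λ] B.gr q.2)
      (fun q => DirectSum.component Λ _ _ q ∘ₗ e.toLinearMap) (fun q => q.1 + q.2)
      (fun x h => ?_) (fun n x hx q hq => ?_)
      (mem_iSup_tmul A B _ fun i j a ha b hb => tmul_mem_tensorGr A B ha hb)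
    · apply e.injective
      rw [map_zero]
      exact DFinsupp.ext h
    · induction hx using Submodule.span_induction with
      | zero => simp
      | add y z _ _ hy hz => rw [map_add, hy, hz, add_zero]
      | smul c y _ hy => rw [map_smul, hy, smul_zero]
      | mem y hy =>
        obtain ⟨i, j, a, b, ha, hb, hij, rfl⟩ := hy
        have hne : (i, j) ≠ q := by rintro rfl; exact hq hij
        simp only [e, LinearMap.comp_apply, LinearEquiv.coe_coe, LinearEquiv.trans_apply,
          TensorProduct.congr_tmul, decomp_of_mem A ha, decomp_of_mem B hb,
          TensorProduct.directSum_lof_tmul_lof]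
        rw [DirectSum.component.of, dif_neg hne]
  d := TensorProduct.map A.d LinearMap.id + TensorProduct.map A.par B.d
  d_mem := by
    intro n x hx
    induction hx using Submodule.span_induction with
    | zero => rw [map_zero]; exact Submodule.zero_mem _
    | add y z _ _ hy hz => rw [map_add]; exact Submodule.add_mem _ hy hz
    | smul c y _ hy => rw [map_smul]; exact Submodule.smul_mem _ _ hy
    | mem y hy =>
      obtain ⟨i, j, a, b, ha, hb, rfl, rfl⟩ := hy
      simp only [LinearMap.add_apply, TensorProduct.map_tmul, LinearMap.id_apply]
      refine Submodule.add_mem _ ?_ ?_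
      · rw [show i + j + 1 = (i + 1) + j by ring]
        exact tmul_mem_tensorGr A B (A.d_mem ha) hb
      · rw [add_assoc]
        exact tmul_mem_tensorGr A B (A.par_mem ha) (B.d_mem hb)
  d_d := by
    intro x
    induction x using TensorProduct.induction_on with
    | zero => simp
    | add x y hx hy => simp only [map_add, hx, hy, add_zero]
    | tmul a b =>
      simp [A.d_d, B.d_d, A.par_d, TensorProduct.neg_tmul]

section Pi

variable {ι : Type} [Fintype ι]

/-- The homogeneous parts of a tensor product `⨂ i, A i`. -/
def piGr (A : ι → DGMod.{v} Λ) (n : ℤ) : Submodule Λ (⨂[Λ] i, (A i).carrier) :=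
  Submodule.span Λ {x | ∃ (e : ι → ℤ) (a : ∀ i, A i),
    (∀ i, a i ∈ (A i).gr (e i)) ∧ ∑ i, e i = n ∧ PiTensorProduct.tprod Λ a = x}

theorem tprod_mem_piGr (A : ι → DGMod.{v} Λ) {e : ι → ℤ} {a : ∀ i, A i}
    (ha : ∀ i, a i ∈ (A i).gr (e i)) : PiTensorProduct.tprod Λ a ∈ piGr A (∑ i, e i) :=
  Submodule.subset_span ⟨e, a, ha, rfl, rfl⟩

theorem span_hom_tprod (A : ι → DGMod.{v} Λ) :
    (Submodule.span Λ {x | ∃ (e : ι → ℤ) (a : ∀ i, A i), (∀ i, a i ∈ (A i).gr (e i)) ∧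
      PiTensorProduct.tprod Λ a = x} : Submodule Λ (⨂[Λ] i, (A i).carrier)) = ⊤ := by
  have h := PiTensorProduct.submodule_span_eq_top (R := Λ) (M := fun i => (A i).carrier)
    (γ := fun i => Σ n, (A i).gr n) (g := fun i q => (q.2 : (A i).carrier)) (fun i => by
      refine eq_top_iff.2 fun x _ => ?_
      induction x using (A i).hom_induction with
      | h0 => exact Submodule.zero_mem _
      | ha y z hy hz => exact Submodule.add_mem _ (hy trivial) (hz trivial)
      | h n y hy => exact Submodule.subset_span ⟨⟨n, ⟨y, hy⟩⟩, rfl⟩)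
  rw [eq_top_iff, ← h]
  refine Submodule.span_mono ?_
  rintro _ ⟨j, rfl⟩
  exact ⟨fun i => (j i).1, fun i => (j i).2, fun i => (j i).2.2, rfl⟩

/-- Induction over the tensors of homogeneous elements. -/
theorem pi_induction (A : ι → DGMod.{v} Λ) {P : (⨂[Λ] i, (A i).carrier) → Prop}
    (x : ⨂[Λ] i, (A i).carrier)
    (h : ∀ (e : ι → ℤ) (a : ∀ i, A i), (∀ i, a i ∈ (A i).gr (e i)) →
      P (PiTensorProduct.tprod Λ a)) (h0 : P 0) (ha : ∀ y z, P y → P z → P (y + z))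
    (hs : ∀ (c : Λ) y, P y → P (c • y)) : P x := by
  have hx : x ∈ (⊤ : Submodule Λ (⨂[Λ] i, (A i).carrier)) := trivial
  rw [← span_hom_tprod A] at hx
  induction hx using Submodule.span_induction with
  | zero => exact h0
  | add y z _ _ hy hz => exact ha y z hy hz
  | smul c y _ hy => exact hs c y hy
  | mem y hy =>
    obtain ⟨e, a, hea, rfl⟩ := hy
    exact h e a hea

end Pi

section PiD

variable {ι : Type} [LinearOrder ι]

/-- The `i`-th summand of the differential of `⨂ i, A i`: apply `d` to the `i`-th factor, with the
sign `(-1) ^ (deg a_j)` for every factor `j < i`. -/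
def piD (A : ι → DGMod.{v} Λ) (i : ι) :
    (⨂[Λ] i, (A i).carrier) →ₗ[Λ] ⨂[Λ] i, (A i).carrier :=
  PiTensorProduct.map fun j =>
    if j < i then (A j).par else if j = i then (A j).d else LinearMap.id

theorem piD_mem [Fintype ι] (A : ι → DGMod.{v} Λ) (i : ι) {n : ℤ} {x : ⨂[Λ] i, (A i).carrier}
    (hx : x ∈ piGr A n) : piD A i x ∈ piGr A (n + 1) := by
  induction hx using Submodule.span_induction with
  | zero => rw [map_zero]; exact Submodule.zero_mem _
  | add y z _ _ hy hz => rw [map_add]; exact Submodule.add_mem _ hy hz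
  | smul c y _ hy => rw [map_smul]; exact Submodule.smul_mem _ _ hy
  | mem y hy =>
    obtain ⟨e, a, ha, rfl, rfl⟩ := hy
    rw [piD, PiTensorProduct.map_tprod]
    have : ∑ j, e j + 1 = ∑ j, Function.update e i (e i + 1) j := by
      rw [Finset.sum_update_of_mem (Finset.mem_univ i),
        ← Finset.sum_sdiff (Finset.subset_univ {i})]
      simp
      ring
    rw [this]
    refine tprod_mem_piGr A fun j => ?_
    rcases lt_trichotomy j i with h | h | h
    · simpa [h, h.ne] using (A j).par_mem (ha j)
    · subst h; simpa using (A j).d_mem (ha j)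
    · simpa [h.not_gt, h.ne'] using ha j

theorem piD_piD_self (A : ι → DGMod.{v} Λ) (i : ι) (x : ⨂[Λ] i, (A i).carrier) :
    piD A i (piD A i x) = 0 := by
  induction x using PiTensorProduct.induction_on with
  | add x y hx hy => simp only [map_add, hx, hy, add_zero]
  | smul_tprod r a =>
    rw [map_smul, map_smul, piD, PiTensorProduct.map_tprod, PiTensorProduct.map_tprod,
      (PiTensorProduct.tprod Λ).map_coord_zero i, smul_zero]
    simp [(A i).d_d]

theorem piD_anticomm (A : ι → DGMod.{v} Λ) {i j : ι} (hij : i < j)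
    (x : ⨂[Λ] i, (A i).carrier) : piD A i (piD A j x) + piD A j (piD A i x) = 0 := by
  induction x using PiTensorProduct.induction_on with
  | add x y hx hy =>
    simp only [map_add]
    rw [add_add_add_comm, hx, hy, add_zero]
  | smul_tprod r a =>
    simp only [map_smul, ← smul_add]
    rw [piD, piD]
    simp only [PiTensorProduct.map_tprod]
    set b := fun k => (if k < j then (A k).par else if k = j then (A k).d else LinearMap.id)
      ((if k < i then (A k).par else if k = i then (A k).d else LinearMap.id) (a k)) with hb
    have h : (fun k => (if k < i then (A k).par else if k = i then (A k).d else LinearMap.id)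
      ((if k < j then (A k).par else if k = j then (A k).d else LinearMap.id) (a k))) =
        Function.update b i ((-1 : Λ) • b i) := by
      funext k
      by_cases hk : k = i
      · subst hk
        simp [hb, hij, (A k).par_d]
      · rw [Function.update_of_ne hk, hb]
        rcases lt_or_gt_of_ne hk with h | h
        · simp [h, h.trans hij]
        · simp [h.not_gt, hk]
    rw [h, MultilinearMap.map_update_smul, Function.update_eq_self]
    simp

variable [Fintype ι]

/-- The tensor product `⨂ i, A i` of a finite family of complexes over a linearly ordered index
type, with the differential
`d (⨂ a_i) = ∑ i, (-1) ^ (∑ j < i, deg a_j) • (⋯ ⊗ d a_i ⊗ ⋯)`. -/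
abbrev pi (A : ι → DGMod.{v} Λ) : DGMod.{v} Λ where
  carrier := ⨂[Λ] i, (A i).carrier
  gr := piGr A
  internal := by
    let e : (⨂[Λ] i, (A i).carrier) ≃ₗ[Λ] _ :=
      PiTensorProduct.congr (fun i => (A i).decomp) ≪≫ₗ
        PiTensorProduct.ofDirectSumEquiv (R := Λ) (M := fun i n => (A i).gr n)
    refine isInternal_of_components _ (I := ι → ℤ) (fun q => ⨂[Λ] i, (A i).gr (q i))
      (fun q => DirectSum.component Λ _ _ q ∘ₗ e.toLinearMap) (fun q => ∑ i, q i)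
      (fun x h => ?_) (fun n x hx q hq => ?_) (fun x => ?_)
    · apply e.injective
      rw [map_zero]
      exact DFinsupp.ext h
    · induction hx using Submodule.span_induction with
      | zero => simp
      | add y z _ _ hy hz => rw [map_add, hy, hz, add_zero]
      | smul c y _ hy => rw [map_smul, hy, smul_zero]
      | mem y hy =>
        obtain ⟨f, a, ha, hf, rfl⟩ := hy
        have hne : f ≠ q := by rintro rfl; exact hq hf
        have h1 : e (PiTensorProduct.tprod Λ a) = DirectSum.lof Λ (ι → ℤ)
            (fun q => ⨂[Λ] i, (A i).gr (q i)) f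
            (PiTensorProduct.tprod Λ fun i => ⟨a i, ha i⟩) := by
          simp only [e, LinearEquiv.trans_apply, PiTensorProduct.congr_tprod]
          have h2 : (fun i => (A i).decomp (a i)) =
              fun i => DirectSum.lof Λ ℤ (fun n => (A i).gr n) (f i) ⟨a i, ha i⟩ :=
            funext fun i => decomp_of_mem _ (ha i)
          rw [h2]
          convert PiTensorProduct.ofDirectSumEquiv_tprod_lof (R := Λ)
            (M := fun i n => (A i).gr n) f (fun i => ⟨a i, ha i⟩)
        rw [LinearMap.comp_apply, LinearEquiv.coe_coe, h1]
        exact DFinsupp.single_eq_of_ne hne.symm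
    · induction x using pi_induction A with
      | h0 => exact Submodule.zero_mem _
      | ha y z hy hz => exact Submodule.add_mem _ hy hz
      | hs c y hy => exact Submodule.smul_mem _ _ hy
      | h e a ha => exact Submodule.mem_iSup_of_mem _ (tprod_mem_piGr A ha)
  d := ∑ i, piD A i
  d_mem := by
    intro n x hx
    rw [LinearMap.sum_apply]
    exact Submodule.sum_mem _ fun i _ => piD_mem A i hx
  d_d := by
    intro x
    simp only [LinearMap.sum_apply, map_sum]
    rw [← Finset.sum_product']
    refine Finset.sum_involution (fun q _ => (q.2, q.1)) ?_ ?_ ?_ ?_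
    · rintro ⟨i, j⟩ _
      rcases lt_trichotomy i j with h | h | h
      · rw [add_comm]; exact piD_anticomm A h x
      · subst h; simp [piD_piD_self]
      · exact piD_anticomm A h x
    · rintro ⟨i, j⟩ _ hne heq
      simp only [Prod.mk.injEq] at heq
      obtain ⟨rfl, _⟩ := heq
      exact hne (piD_piD_self A _ x)
    · simp
    · simp

/-- The tensor power `K ^ ι`. -/
abbrev pow (K : DGMod.{v} Λ) (ι : Type) [Fintype ι] [LinearOrder ι] : DGMod.{v} Λ :=
  pi fun _ : ι => K

end PiD

/-! ### Signed permutations and shuffles of tensor factors -/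

section Koszul

variable {ι : Type} [Fintype ι] [LinearOrder ι]

/-- The projection of `⨂ i, A i` onto the span of the homogeneous tensors `⨂ a_i` for which
`deg a_i` is odd exactly for `i ∈ S`. -/
def parityPart (A : ι → DGMod.{v} Λ) (S : Finset ι) : pi A →ₗ[Λ] pi A :=
  PiTensorProduct.map fun i => if i ∈ S then (A i).odd else (A i).even

/-- The permutation `⨂ a_i ↦ ± ⨂ a_{σ⁻¹ i}` of tensor factors (the factor in position `i` is moved
to position `σ i`), with the Koszul sign: `-1` for every pair of factors of odd degree whose order
is reversed. -/
def permMap (A : ι → DGMod.{v} Λ) (σ : Equiv.Perm ι) :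
    pi A →ₗ[Λ] pi (fun i => A (σ.symm i)) :=
  ∑ S : Finset ι,
    (-1 : Λ) ^ ((S ×ˢ S).filter fun q => q.1 < q.2 ∧ σ q.2 < σ q.1).card •
      ((PiTensorProduct.reindex Λ (fun i => (A i).carrier) σ).toLinearMap ∘ₗ parityPart A S)

/-- The map `(⨂ a_i) ⊗ (⨂ b_i) ↦ ⨂ (a_i ⊗ b_i)`, without signs. -/
def zip (A : ι → DGMod.{v} Λ) (B : ι → DGMod.{v'} Λ) :
    (⨂[Λ] i, (A i).carrier) ⊗[Λ] (⨂[Λ] i, (B i).carrier) →ₗ[Λ]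
      ⨂[Λ] i, ((A i).carrier ⊗[Λ] (B i).carrier) :=
  TensorProduct.lift (PiTensorProduct.map₂ fun i => TensorProduct.mk Λ (A i) (B i))

theorem zip_bijective (A : ι → DGMod.{v} Λ) (B : ι → DGMod.{v'} Λ) :
    Function.Bijective (zip A B) := by
  let b := fun i => Module.Basis.ofVectorSpace Λ (A i)
  let c := fun i => Module.Basis.ofVectorSpace Λ (B i)
  have h : zip A B = (((Basis.piTensorProduct b).tensorProduct
      (Basis.piTensorProduct c)).equiv
      (Basis.piTensorProduct fun i => (b i).tensorProduct (c i))
      (Equiv.arrowProdEquivProdArrow _ _ _).symm).toLinearMap := by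
    refine ((Basis.piTensorProduct b).tensorProduct (Basis.piTensorProduct c)).ext fun q => ?_
    rw [LinearEquiv.coe_coe, Module.Basis.equiv_apply, Module.Basis.tensorProduct_apply,
      Basis.piTensorProduct_apply, Basis.piTensorProduct_apply, Basis.piTensorProduct_apply]
    simp only [zip, TensorProduct.lift.tmul, PiTensorProduct.map₂_tprod_tprod]
    simp
  rw [h]
  exact LinearEquiv.bijective _

/-- The map `⨂ (a_i ⊗ b_i) ↦ ± (⨂ a_i) ⊗ (⨂ b_i)` with the Koszul sign: `-1` for every pair
`i < j` with `b_i` and `a_j` both of odd degree. -/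
def unzip (A : ι → DGMod.{v} Λ) (B : ι → DGMod.{v'} Λ) :
    pi (fun i => tensor (A i) (B i)) →ₗ[Λ] tensor (pi A) (pi B) :=
  (∑ S : Finset ι, ∑ T : Finset ι,
    (-1 : Λ) ^ ((T ×ˢ S).filter fun q => q.1 < q.2).card •
      TensorProduct.map (parityPart A S) (parityPart B T)) ∘ₗ
  (LinearEquiv.ofBijective (zip A B) (zip_bijective A B)).symm.toLinearMap

variable {κ : Type} [Fintype κ] [LinearOrder κ]

theorem nest_update {M ι κ : Type*} [AddCommGroup M] [Module Λ M] [DecidableEq ι] [DecidableEq κ]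
    [DecidableEq (ι ×ₗ κ)] (a : ι ×ₗ κ → M) (q : ι ×ₗ κ) (z : M) :
    (fun i => PiTensorProduct.tprod Λ fun j => Function.update a q z (toLex (i, j))) =
      Function.update (fun i => PiTensorProduct.tprod Λ fun j => a (toLex (i, j))) (ofLex q).1
        (PiTensorProduct.tprod Λ
          (Function.update (fun j => a (toLex ((ofLex q).1, j))) (ofLex q).2 z)) := by
  obtain ⟨⟨i', j'⟩, rfl⟩ := toLex.surjective q
  funext i
  by_cases hi : i = i'
  · subst hi
    rw [ofLex_toLex, Function.update_self]
    congr 1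
    funext j
    by_cases hj : j = j'
    · subst hj; simp
    · rw [Function.update_of_ne hj, Function.update_of_ne]
      simpa using hj
  · rw [ofLex_toLex, Function.update_of_ne hi]
    congr 1
    funext j
    rw [Function.update_of_ne]
    simp [hi]

/-- The map `⨂_{(i,j)} a_{ij} ↦ ⨂_i ⨂_j a_{ij}`. -/
def nest (K : DGMod.{v} Λ) (ι κ : Type) [Fintype ι] [LinearOrder ι] [Fintype κ] [LinearOrder κ] :
    (⨂[Λ] _ : ι ×ₗ κ, K.carrier) →ₗ[Λ] ⨂[Λ] _ : ι, ⨂[Λ] _ : κ, K.carrier :=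
  PiTensorProduct.lift <| MultilinearMap.mk'
    (fun a => PiTensorProduct.tprod Λ fun i => PiTensorProduct.tprod Λ fun j => a (toLex (i, j)))
    (fun a q x y => by simp only [nest_update, MultilinearMap.map_update_add])
    (fun a q c x => by simp only [nest_update, MultilinearMap.map_update_smul])

theorem nest_bijective (K : DGMod.{v} Λ) (ι κ : Type) [Fintype ι] [LinearOrder ι] [Fintype κ]
    [LinearOrder κ] : Function.Bijective (nest K ι κ) := by
  let b := Module.Basis.ofVectorSpace Λ K
  have h : nest K ι κ = ((Basis.piTensorProduct fun _ : ι ×ₗ κ => b).equiv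
      (Basis.piTensorProduct fun _ : ι => Basis.piTensorProduct fun _ : κ => b)
      ((Equiv.arrowCongr (toLex (α := ι × κ)).symm (Equiv.refl _)).trans
        (Equiv.curry ι κ _))).toLinearMap := by
    refine (Basis.piTensorProduct fun _ : ι ×ₗ κ => b).ext fun q => ?_
    rw [LinearEquiv.coe_coe, Module.Basis.equiv_apply]
    simp only [Basis.piTensorProduct_apply]
    simp [nest, Function.curry]
  rw [h]
  exact LinearEquiv.bijective _

/-- The identification `⨂_i ⨂_j a_{ij} ↦ ⨂_{(i,j)} a_{ij}` of `(K ^ κ) ^ ι` with `K ^ (ι × κ)`,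
where the pairs `(i, j)` are ordered lexicographically. -/
def flatten (K : DGMod.{v} Λ) (ι κ : Type) [Fintype ι] [LinearOrder ι] [Fintype κ]
    [LinearOrder κ] : pow (pow K κ) ι →ₗ[Λ] pow K (ι ×ₗ κ) :=
  (LinearEquiv.ofBijective (nest K ι κ) (nest_bijective K ι κ)).symm.toLinearMap

end Koszul

/-! ### Morphisms and homotopies -/

/-- A morphism of complexes: a linear map of degree `0` that commutes with the differentials. -/
structure IsChainMap (A : DGMod.{v} Λ) (B : DGMod.{v'} Λ) (f : A →ₗ[Λ] B) : Prop where
  degree : ∀ n, ∀ x ∈ A.gr n, f x ∈ B.gr n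
  comm : ∀ x, f (A.d x) = B.d (f x)

/-- Two maps `f, g : A → B` are homotopic by a homotopy `h : A → B` of degree `-1` that is invariant
under a set `Γ` of operators on `A`. For `Γ = ∅` this is `Λ`-homotopy. If a group acts on
`A`, and trivially on `B`, and `Γ` is the set of the operators on `A` of a generating set of the
group, it is equivariant homotopy. -/
def Homotopic (A : DGMod.{v} Λ) (B : DGMod.{v'} Λ) (Γ : Set (A →ₗ[Λ] A)) (f g : A →ₗ[Λ] B) :
    Prop :=
  ∃ h : A →ₗ[Λ] B, (∀ n, ∀ x ∈ A.gr n, h x ∈ B.gr (n - 1)) ∧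
    (∀ x, f x - g x = B.d (h x) + h (A.d x)) ∧ ∀ γ ∈ Γ, h ∘ₗ γ = h

end DGMod

open DGMod

/-! ### Resolutions -/

/-- A free resolution of `Λ` over the group ring `Λ[Γ]`, as a non-positively graded complex:
`⋯ → X_{-2} → X_{-1} → X_0 → Λ → 0` is exact, and `X` has a homogeneous basis over `Λ[Γ]`. -/
structure FreeResolution (Λ : Type) [Field Λ] (Γ : Type) [Group Γ] where
  X : DGMod.{v} Λ
  act : Γ →* (X →ₗ[Λ] X)
  isChainMap_act : ∀ γ, IsChainMap X X (act γ)
  /-- the augmentation -/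
  ε : X →ₗ[Λ] Λ
  ε_act : ∀ γ x, ε (act γ x) = ε x
  ε_gr : ∀ n, n ≠ 0 → ∀ x ∈ X.gr n, ε x = 0
  ε_d : ∀ x, ε (X.d x) = 0
  gr_pos : ∀ n, 0 < n → X.gr n = ⊥
  ε_surjective : Function.Surjective ε
  exact_zero : ∀ x ∈ X.gr 0, ε x = 0 → ∃ y ∈ X.gr (-1), X.d y = x
  exact_neg : ∀ n < 0, ∀ x ∈ X.gr n, X.d x = 0 → ∃ y ∈ X.gr (n - 1), X.d y = x
  free : ∃ (I : Type v) (deg : I → ℤ) (b : Module.Basis (Γ × I) Λ X),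
    ∀ γ i, b (γ, i) ∈ X.gr (deg i) ∧ b (γ, i) = act γ (b (1, i))

/-- The degree `0` part of the resolution is the group ring `Λ[Γ]`: there is `e ∈ X_0` such that
the elements `γ • e`, `γ ∈ Γ`, form a basis of `X_0`. -/
def FreeResolution.IsGroupRingInDegreeZero {Γ : Type} [Group Γ]
    (Y : FreeResolution.{v} Λ Γ) : Prop :=
  ∃ e : Y.X, LinearIndependent Λ (fun γ => Y.act γ e) ∧
    Submodule.span Λ (Set.range fun γ => Y.act γ e) = Y.X.gr 0

section W

variable (Λ) (p : ℕ) [NeZero p]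

/-- The differential of the resolution `W` on the basis element `(i, k)`, which stands for
`α ^ k e_i`: `d (e_{2i+1}) = (α - 1) e_{2i}` and `d (e_{2i}) = (1 + α + ⋯ + α ^ (p-1)) e_{2i-1}`. -/
def stdD : ℕ × ZMod p → (ℕ × ZMod p →₀ Λ)
  | (0, _) => 0
  | (i + 1, k) =>
    if Even i then Finsupp.single (i, k + 1) 1 - Finsupp.single (i, k) 1
    else ∑ l : ZMod p, Finsupp.single (i, l) 1

/-- The canonical `Λ[π]`-free resolution `W` of `Λ` for the cyclic group `π` of order `p` with
generator `α`, with `Λ`-basis `α ^ k e_i` for `i : ℕ` and `k : ZMod p`, in non-positive degrees. -/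
def stdRes : DGMod.{0} Λ :=
  ofBasis (ℕ × ZMod p) (fun q => -(q.1 : ℤ)) (stdD Λ p)
    (by
      rintro ⟨_ | i, k⟩
      · exact Submodule.zero_mem _
      · have h : ∀ l : ZMod p, (Finsupp.single (i, l) 1 : ℕ × ZMod p →₀ Λ) ∈
            Finsupp.supported Λ Λ {b : ℕ × ZMod p | -(b.1 : ℤ) = -((i + 1 : ℕ) : ℤ) + 1} := by
          intro l
          refine Finsupp.single_mem_supported _ _ ?_
          simp
        simp only [stdD]
        split_ifs
        · exact Submodule.sub_mem _ (h _) (h _)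
        · exact Submodule.sum_mem _ fun l _ => h l)
    (by
      rintro ⟨_ | _ | i, k⟩
      · simp [stdD]
      · simp [stdD]
      · by_cases h : Even i
        · have h' : ¬ Even (i + 1) := by simp [h, parity_simps]
          simp only [stdD, h', if_false, map_sum, Finsupp.linearCombination_single, one_smul, h,
            if_true, Finset.sum_sub_distrib, sub_eq_zero]
          exact Fintype.sum_equiv (Equiv.addRight 1) _ _ fun _ => rfl
        · have h' : Even (i + 1) := by simpa [parity_simps] using h
          simp [stdD, h, h'])

/-- The action of the generator `α` on `W`. -/
def stdAlpha : stdRes Λ p →ₗ[Λ] stdRes Λ p :=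
  Finsupp.lmapDomain Λ Λ fun q : ℕ × ZMod p => (q.1, q.2 + 1)

/-- The augmentation of `W`. -/
def stdEps : stdRes Λ p →ₗ[Λ] Λ :=
  Finsupp.linearCombination Λ fun q : ℕ × ZMod p => if q.1 = 0 then 1 else 0

/-- The generator `e_0` of `W`. -/
def stdE0 : stdRes Λ p := (Finsupp.single (0, 0) 1 : ℕ × ZMod p →₀ Λ)

end W

/-! ### The category `ℭ(p)` and Adem objects -/

section Cp

variable (p : ℕ) [NeZero p]

/-- The action of the generator `α` of `π` on `K ^ p`: the cyclic permutation moving the `i`-th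
factor to position `i + 1`. -/
def cyc (K : DGMod.{v} Λ) : pow K (Fin p) →ₗ[Λ] pow K (Fin p) :=
  permMap (fun _ => K) (finRotate p)

/-- The diagonal action of `α` on `W ⊗ K ^ p`. -/
def alphaAct (K : DGMod.{v} Λ) :
    tensor (stdRes Λ p) (pow K (Fin p)) →ₗ[Λ] tensor (stdRes Λ p) (pow K (Fin p)) :=
  TensorProduct.map (stdAlpha Λ p) (cyc p K)

/-- `IsIteratedProduct μ n g`: the map `g : K ^ n → K` is the `n`-fold iterate of the product
`μ : K ⊗ K → K`, associated in some order. -/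
inductive IsIteratedProduct {K : DGMod.{v} Λ} (μ : tensor K K →ₗ[Λ] K) :
    ∀ n : ℕ, (pow K (Fin n) →ₗ[Λ] K) → Prop
  | one : IsIteratedProduct μ 1
      (PiTensorProduct.subsingletonEquiv (R := Λ) (s := fun _ : Fin 1 => K.carrier) 0).toLinearMap
  | mul {m n : ℕ} {f : pow K (Fin m) →ₗ[Λ] K} {g : pow K (Fin n) →ₗ[Λ] K} :
      IsIteratedProduct μ m f → IsIteratedProduct μ n g →
      IsIteratedProduct μ (m + n) (μ ∘ₗ TensorProduct.map f g ∘ₗ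
        (TensorPower.mulEquiv (R := Λ) (M := K.carrier) (n := m) (m := n)).symm.toLinearMap)

/-- `K` with the product `μ` is a homotopy associative differential `Λ`-algebra. -/
structure IsHomotopyAssocAlgebra (K : DGMod.{v} Λ) (μ : tensor K K →ₗ[Λ] K) : Prop where
  isChainMap : IsChainMap (tensor K K) K μ
  assoc : Homotopic (tensor (tensor K K) K) K ∅ (μ ∘ₗ TensorProduct.map μ LinearMap.id)
    (μ ∘ₗ TensorProduct.map LinearMap.id μ ∘ₗ
      (TensorProduct.assoc Λ K.carrier K.carrier K.carrier).toLinearMap)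

/-- `f : X ⊗ K ^ ι → K` is a morphism of `Λ[Σ_ι]`-complexes, where `X` is a free resolution over the
symmetric group `Σ_ι`, which acts diagonally on `X ⊗ K ^ ι` and trivially on `K`. -/
structure IsSymmetricMorphism {ι : Type} [Fintype ι] [LinearOrder ι]
    (X : FreeResolution.{v'} Λ (Equiv.Perm ι)) (K : DGMod.{v} Λ)
    (f : tensor X.X (pow K ι) →ₗ[Λ] K) : Prop where
  isChainMap : IsChainMap (tensor X.X (pow K ι)) K f
  equivariant : ∀ σ : Equiv.Perm ι,
    f ∘ₗ TensorProduct.map (X.act σ) (permMap (fun _ => K) σ) = f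

/-- `(K, θ)`, where `K` carries the product `μ`, is an object of the category `ℭ(p)`. -/
structure IsCpObject (K : DGMod.{v} Λ) (μ : tensor K K →ₗ[Λ] K)
    (θ : tensor (stdRes Λ p) (pow K (Fin p)) →ₗ[Λ] K) : Prop where
  algebra : IsHomotopyAssocAlgebra K μ
  isChainMap : IsChainMap (tensor (stdRes Λ p) (pow K (Fin p))) K θ
  equivariant : θ ∘ₗ alphaAct p K = θ
  /-- the restriction of `θ` to `e_0 ⊗ K ^ p` is homotopic to an iterated product -/
  restriction : ∃ g : pow K (Fin p) →ₗ[Λ] K, IsIteratedProduct μ p g ∧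
    Homotopic (pow K (Fin p)) K ∅ (TensorProduct.curry θ (stdE0 Λ p)) g
  /-- `θ` is `Λ[π]`-homotopic to `ϕ ∘ (j ⊗ 1)` for a morphism `ϕ : V ⊗ K ^ p → K` of
  `Λ[Σ_p]`-complexes, where `V` is a `Λ[Σ_p]`-free resolution of `Λ` and `j : W → V` is a
  `Λ[π]`-morphism over `Λ` -/
  extension : ∀ (V : FreeResolution.{v'} Λ (Equiv.Perm (Fin p))) (j : stdRes Λ p →ₗ[Λ] V.X),
    IsChainMap (stdRes Λ p) V.X j → V.ε ∘ₗ j = stdEps Λ p →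
    j ∘ₗ stdAlpha Λ p = V.act (finRotate p) ∘ₗ j →
    ∃ ϕ : tensor V.X (pow K (Fin p)) →ₗ[Λ] K, IsSymmetricMorphism V K ϕ ∧
      Homotopic (tensor (stdRes Λ p) (pow K (Fin p))) K {alphaAct p K} θ
        (ϕ ∘ₗ TensorProduct.map j LinearMap.id)

/-- The permutation `α (i, j) = (i + 1, j)` of the symbols `(i, j)`. -/
def permAlpha : Equiv.Perm (Fin p ×ₗ Fin p) :=
  (toLex (α := Fin p × Fin p)).permCongr (Equiv.prodCongr (finRotate p) (Equiv.refl (Fin p)))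

/-- The permutation `α_i (i, j) = (i, j + 1)`, `α_i (k, j) = (k, j)` for `k ≠ i`. -/
def permAlphaAt (i : Fin p) : Equiv.Perm (Fin p ×ₗ Fin p) :=
  (toLex (α := Fin p × Fin p)).permCongr (Equiv.Perm.prodExtendRight i (finRotate p))

/-- The action of `α` on `W₁ ⊗ M ^ p`: diagonal, by cyclic permutation on `M ^ p`. -/
def tauAlpha (M : DGMod.{v} Λ) :
    tensor (stdRes Λ p) (pow M (Fin p)) →ₗ[Λ] tensor (stdRes Λ p) (pow M (Fin p)) :=
  TensorProduct.map (stdAlpha Λ p) (cyc p M)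

/-- The action of `α_i` on `W₁ ⊗ M ^ p`: trivial on `W₁`, and by the given action of the generator
`β` of `ν` on the `i`-th factor `M`. -/
def tauAlphaAt (M : DGMod.{v} Λ) (β : M →ₗ[Λ] M) (i : Fin p) :
    tensor (stdRes Λ p) (pow M (Fin p)) →ₗ[Λ] tensor (stdRes Λ p) (pow M (Fin p)) :=
  TensorProduct.map LinearMap.id
    (PiTensorProduct.map (Function.update (fun _ => LinearMap.id) i β))

/-- `w : W₁ ⊗ W₂ ^ p → Y` is a morphism of `Λ[τ]`-complexes over `Λ`, where the group
`τ = ⟨α_1, …, α_p, α⟩ ⊆ Σ_{p²}` acts on `Y` through `Σ_{p²}`. -/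
structure IsTauMorphism (Y : FreeResolution.{v'} Λ (Equiv.Perm (Fin p ×ₗ Fin p)))
    (w : tensor (stdRes Λ p) (pow (stdRes Λ p) (Fin p)) →ₗ[Λ] Y.X) : Prop where
  isChainMap : IsChainMap (tensor (stdRes Λ p) (pow (stdRes Λ p) (Fin p))) Y.X w
  augmentation : ∀ (x : stdRes Λ p) (y : Fin p → stdRes Λ p),
    Y.ε (w (x ⊗ₜ[Λ] PiTensorProduct.tprod Λ y)) = stdEps Λ p x * ∏ i, stdEps Λ p (y i)
  map_alpha : w ∘ₗ tauAlpha p (stdRes Λ p) = Y.act (permAlpha p) ∘ₗ w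
  map_alphaAt : ∀ i, w ∘ₗ tauAlphaAt p (stdRes Λ p) (stdAlpha Λ p) i =
    Y.act (permAlphaAt p i) ∘ₗ w

/-- The shuffle `W₁ ⊗ (W₂ ⊗ K ^ p) ^ p → (W₁ ⊗ W₂ ^ p) ⊗ K ^ (p²)`. -/
def shuffle (K : DGMod.{v} Λ) :
    tensor (stdRes Λ p) (pow (tensor (stdRes Λ p) (pow K (Fin p))) (Fin p)) →ₗ[Λ]
      tensor (tensor (stdRes Λ p) (pow (stdRes Λ p) (Fin p))) (pow K (Fin p ×ₗ Fin p)) :=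
  (TensorProduct.assoc Λ _ _ _).symm.toLinearMap ∘ₗ
    TensorProduct.map LinearMap.id (TensorProduct.map LinearMap.id (flatten K (Fin p) (Fin p)) ∘ₗ
      unzip (fun _ : Fin p => stdRes Λ p) (fun _ : Fin p => pow K (Fin p)))

/-- `(K, θ)`, where `K` carries the product `μ`, is an Adem object of `ℭ(p)`. -/
structure IsAdemObject (K : DGMod.{v} Λ) (μ : tensor K K →ₗ[Λ] K)
    (θ : tensor (stdRes Λ p) (pow K (Fin p)) →ₗ[Λ] K) : Prop where
  isCpObject : IsCpObject.{v, v'} p K μ θ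
  /-- For every free resolution `Y` of `Λ` over `Λ[Σ_{p²}]` with `Y_0 = Λ[Σ_{p²}]` and every
  `τ`-morphism `w : W₁ ⊗ W₂ ^ p → Y` over `Λ` there is a `Σ_{p²}`-morphism `η` such that
  `η ∘ (w ⊗ id) ∘ shuffle` and `θ ∘ (id ⊗ θ ^ p)` are `Λ[τ]`-homotopic. -/
  adem : ∀ (Y : FreeResolution.{v'} Λ (Equiv.Perm (Fin p ×ₗ Fin p))),
    Y.IsGroupRingInDegreeZero →
    ∀ w : tensor (stdRes Λ p) (pow (stdRes Λ p) (Fin p)) →ₗ[Λ] Y.X, IsTauMorphism p Y w →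
    ∃ η : tensor Y.X (pow K (Fin p ×ₗ Fin p)) →ₗ[Λ] K, IsSymmetricMorphism Y K η ∧
      Homotopic (tensor (stdRes Λ p) (pow (tensor (stdRes Λ p) (pow K (Fin p))) (Fin p))) K
        ({tauAlpha p (tensor (stdRes Λ p) (pow K (Fin p)))} ∪
          Set.range (tauAlphaAt p (tensor (stdRes Λ p) (pow K (Fin p))) (alphaAct p K)))
        (η ∘ₗ TensorProduct.map w LinearMap.id ∘ₗ shuffle p K)
        (θ ∘ₗ TensorProduct.map LinearMap.id (PiTensorProduct.map fun _ => θ))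

end Cp

/-! ### Normalized chains of simplicial sets -/

section Boundary

open CategoryTheory Opposite

variable (Λ)

open scoped Classical in
/-- The class of a simplex in the free module on the nondegenerate simplices: `0` if the simplex is
degenerate. -/
def cls (X : SSet.{u}) {n : ℕ} (x : X.obj (op (SimplexCategory.mk n))) :
    (Σ n, X.nonDegenerate n) →₀ Λ :=
  if h : x ∈ X.nonDegenerate n then Finsupp.single ⟨n, x, h⟩ 1 else 0

/-- The boundary `∑ i, (-1) ^ i • ∂_i x` of a simplex. -/
def bd (X : SSet.{u}) :
    ∀ n : ℕ, X.obj (op (SimplexCategory.mk n)) → ((Σ n, X.nonDegenerate n) →₀ Λ)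
  | 0 => fun _ => 0
  | n + 1 => fun x =>
    ∑ i : Fin (n + 2), (-1 : Λ) ^ (i : ℕ) • cls Λ X (SimplicialObject.δ X i x)

end Boundary

section Simplicial

open CategoryTheory Opposite Simplicial

theorem bd_zero (X : SSet.{u}) (x : X _⦋0⦌) : bd Λ X 0 x = 0 := rfl

theorem bd_succ (X : SSet.{u}) {n : ℕ} (x : X _⦋n + 1⦌) :
    bd Λ X (n + 1) x = ∑ i : Fin (n + 2), (-1 : Λ) ^ (i : ℕ) • cls Λ X (X.δ i x) := rfl

theorem cls_of_degenerate (X : SSet.{u}) {n : ℕ} {x : X _⦋n⦌} (h : x ∈ X.degenerate n) :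
    cls Λ X x = 0 :=
  dif_neg (by rwa [← SSet.mem_degenerate_iff_notMem_nonDegenerate])

theorem cls_nonDegenerate (X : SSet.{u}) (b : Σ n, X.nonDegenerate n) :
    cls Λ X (b.2 : X _⦋b.1⦌) = Finsupp.single b 1 :=
  dif_pos b.2.2

theorem mem_degenerate_of_not_injective (X : SSet.{u}) {n m : ℕ} (g : ⦋n⦌ ⟶ ⦋m⦌)
    (hg : ¬ Function.Injective g.toOrderHom) (y : X _⦋m⦌) :
    X.map g.op y ∈ X.degenerate n := by
  cases n with
  | zero => exact absurd (Function.injective_of_subsingleton (α := Fin 1) _) hg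
  | succ n =>
    obtain ⟨i, θ, rfl⟩ := SimplexCategory.eq_σ_comp_of_not_injective g hg
    rw [SSet.degenerate_eq_iUnion_range_σ]
    refine Set.mem_iUnion.2 ⟨i, X.map θ.op y, ?_⟩
    simp [SimplicialObject.σ]

theorem bd_degenerate (X : SSet.{u}) {n : ℕ} {x : X _⦋n⦌} (h : x ∈ X.degenerate n) :
    bd Λ X n x = 0 := by
  cases n with
  | zero => rfl
  | succ n =>
    rw [SSet.degenerate_eq_iUnion_range_σ] at h
    obtain ⟨j, y, rfl⟩ := Set.mem_iUnion.1 h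
    have hne : j.castSucc ≠ j.succ := (Fin.castSucc_lt_succ).ne
    rw [bd_succ, ← Finset.sum_subset (Finset.subset_univ {j.castSucc, j.succ}), Finset.sum_pair hne]
    · have h1 : X.δ j.castSucc (X.σ j y) = y := by
        rw [← CategoryTheory.comp_apply, SimplicialObject.δ_comp_σ_self]; rfl
      have h2 : X.δ j.succ (X.σ j y) = y := by
        rw [← CategoryTheory.comp_apply, SimplicialObject.δ_comp_σ_succ]; rfl
      rw [h1, h2]
      simp [pow_succ]
    · intro i _ hi
      simp only [Finset.mem_insert, Finset.mem_singleton, not_or] at hi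
      rw [cls_of_degenerate, smul_zero]
      have h3 : X.δ i (X.σ j y) = X.map (SimplexCategory.δ i ≫ SimplexCategory.σ j).op y := by
        rw [op_comp, Functor.map_comp, CategoryTheory.comp_apply]; rfl
      rw [h3]
      apply mem_degenerate_of_not_injective
      intro hinj
      obtain ⟨a, ha⟩ := Fin.exists_succAbove_eq (Ne.symm hi.1)
      obtain ⟨b, hb⟩ := Fin.exists_succAbove_eq (Ne.symm hi.2)
      have hab : a = b := by
        apply hinj
        change j.predAbove (i.succAbove a) = j.predAbove (i.succAbove b)
        rw [ha, hb]
        simp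
      rw [hab, hb] at ha
      exact hne ha.symm

theorem linearCombination_bd_cls (X : SSet.{u}) {n : ℕ} (x : X _⦋n⦌) :
    Finsupp.linearCombination Λ (fun b : Σ n, X.nonDegenerate n => bd Λ X b.1 b.2) (cls Λ X x) =
      bd Λ X n x := by
  by_cases h : x ∈ X.nonDegenerate n
  · rw [cls_nonDegenerate X ⟨n, x, h⟩]
    simp
  · have h' : x ∈ X.degenerate n := by rwa [SSet.mem_degenerate_iff_notMem_nonDegenerate]
    rw [cls_of_degenerate X h', bd_degenerate X h', map_zero]

theorem bd_bd (X : SSet.{u}) {n : ℕ} (x : X _⦋n⦌) :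
    Finsupp.linearCombination Λ (fun b : Σ n, X.nonDegenerate n => bd Λ X b.1 b.2) (bd Λ X n x) =
      0 := by
  rcases n with _ | _ | n
  · simp [bd_zero]
  · simp only [bd_succ X (n := 0), map_sum, map_smul, linearCombination_bd_cls, bd_zero, smul_zero,
      Finset.sum_const_zero]
  · simp only [bd_succ X (n := n + 1), map_sum, map_smul, linearCombination_bd_cls,
      bd_succ X (n := n), Finset.smul_sum, smul_smul]
    rw [← Finset.sum_product', Finset.univ_product_univ]
    let S : Finset (Fin (n + 3) × Fin (n + 2)) :=
      Finset.univ.filter fun ij => (ij.1 : ℕ) ≤ (ij.2 : ℕ)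
    rw [← Finset.sum_add_sum_compl S, ← eq_neg_iff_add_eq_zero, ← Finset.sum_neg_distrib]
    refine Finset.sum_bij (fun ij hij => (ij.2.succ, Fin.castLT ij.1
      (lt_of_le_of_lt (Finset.mem_filter.mp hij).right (Fin.is_lt ij.2)))) ?_ ?_ ?_ ?_
    · intro ij hij
      simp_rw [S, Finset.compl_filter, Finset.mem_filter_univ, Fin.val_succ,
        Fin.val_castLT] at hij ⊢
      lia
    · rintro ⟨i, j⟩ hij ⟨i', j'⟩ hij' h
      simp only [Prod.mk.injEq, Fin.ext_iff, Fin.val_castLT, Fin.val_succ] at h ⊢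
      exact ⟨h.2, by omega⟩
    · rintro ⟨i', j'⟩ hij'
      simp_rw [S, Finset.compl_filter, Finset.mem_filter_univ, not_le] at hij'
      refine ⟨(Fin.castSucc j', i'.pred <| ?_), ?_, ?_⟩
      · rintro rfl
        simp only [Fin.val_zero, not_lt_zero] at hij'
      · simpa [S] using Nat.le_sub_one_of_lt hij'
      · simp
    · rintro ⟨i, j⟩ hij
      have hij' : i ≤ j.castSucc := by simpa [S, Fin.le_def] using hij
      dsimp only
      have h := congrArg (fun f => f x) (SimplicialObject.δ_comp_δ'' X (i := i) (j := j) hij')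
      simp only [CategoryTheory.comp_apply] at h
      rw [← h, ← neg_smul]
      congr 1
      simp [pow_succ]
      ring

variable (Λ) in
/-- The normalized chain complex `C(X; Λ)` of a simplicial set: the free `Λ`-module on the
nondegenerate simplices with the usual boundary, the `n`-chains being placed in degree `-n`. -/
def chains (X : SSet.{u}) : DGMod.{u} Λ :=
  ofBasis (Σ n, X.nonDegenerate n) (fun b => -(b.1 : ℤ)) (fun b => bd Λ X b.1 b.2)
    (by
      rintro ⟨_ | n, x⟩
      · exact Submodule.zero_mem _
      · refine Submodule.sum_mem _ fun i _ => Submodule.smul_mem _ _ ?_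
        rw [cls]
        split_ifs with h
        · refine Finsupp.single_mem_supported _ _ ?_
          simp
        · exact Submodule.zero_mem _)
    (fun b => bd_bd X _)

variable (Λ) in
/-- The generator `[x]` of the normalized chains given by a simplex `x`. -/
def gen (X : SSet.{u}) {n : ℕ} (x : X _⦋n⦌) : chains Λ X := cls Λ X x

theorem gen_mem (X : SSet.{u}) {n : ℕ} (x : X _⦋n⦌) : gen Λ X x ∈ (chains Λ X).gr (-(n : ℤ)) := by
  rw [gen, cls]
  split_ifs with h
  · exact Finsupp.single_mem_supported _ _ rfl
  · exact Submodule.zero_mem _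

theorem gen_of_degenerate (X : SSet.{u}) {n : ℕ} {x : X _⦋n⦌} (h : x ∈ X.degenerate n) :
    gen Λ X x = 0 := cls_of_degenerate X h

/-- Linear maps on chains are determined by their values on nondegenerate simplices. -/
theorem chains_ext (X : SSet.{u}) {N : Type*} [AddCommGroup N] [Module Λ N]
    {f g : chains Λ X →ₗ[Λ] N}
    (h : ∀ (n : ℕ) (x : X _⦋n⦌), x ∈ X.nonDegenerate n → f (gen Λ X x) = g (gen Λ X x)) :
    f = g := by
  refine Finsupp.lhom_ext' fun b => LinearMap.ext_ring ?_
  have := h b.1 b.2 b.2.2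
  rwa [gen, cls_nonDegenerate X b] at this

/-- The linear map on the normalized chains with prescribed values `v n x` on the nondegenerate
simplices `x`. -/
def chainsLift (X : SSet.{u}) {N : Type*} [AddCommGroup N] [Module Λ N]
    (v : ∀ n : ℕ, X _⦋n⦌ → N) : chains Λ X →ₗ[Λ] N :=
  Finsupp.linearCombination Λ fun b : Σ n, X.nonDegenerate n => v b.1 b.2

theorem chainsLift_gen (X : SSet.{u}) {N : Type*} [AddCommGroup N] [Module Λ N]
    (v : ∀ n : ℕ, X _⦋n⦌ → N) (hv : ∀ n, ∀ x ∈ X.degenerate n, v n x = 0) {n : ℕ} (x : X _⦋n⦌) :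
    chainsLift X v (gen Λ X x) = v n x := by
  by_cases h : x ∈ X.nonDegenerate n
  · rw [gen, cls_nonDegenerate X ⟨n, x, h⟩]
    exact (Finsupp.linearCombination_single _ _ _).trans (one_smul _ _)
  · have h' : x ∈ X.degenerate n := by rwa [SSet.mem_degenerate_iff_notMem_nonDegenerate]
    rw [gen_of_degenerate X h', hv n x h', map_zero]

theorem chains_induction (X : SSet.{u}) {P : chains Λ X → Prop} {k : ℤ} {c : chains Λ X}
    (hc : c ∈ (chains Λ X).gr k) (h : ∀ (n : ℕ) (x : X _⦋n⦌), -(n : ℤ) = k → P (gen Λ X x))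
    (h0 : P 0) (ha : ∀ y z, P y → P z → P (y + z)) (hs : ∀ (r : Λ) y, P y → P (r • y)) : P c := by
  change c ∈ Finsupp.supported Λ Λ _ at hc
  rw [Finsupp.supported_eq_span_single] at hc
  induction hc using Submodule.span_induction with
  | zero => exact h0
  | add y z _ _ hy hz => exact ha y z hy hz
  | smul r y _ hy => exact hs r y hy
  | mem y hy =>
    obtain ⟨b, hb, rfl⟩ := hy
    have := h b.1 b.2 hb
    rwa [gen, cls_nonDegenerate X b] at this

/-- The map of normalized chains induced by a map of simplicial sets. -/
def chainsMap {X Y : SSet.{u}} (f : X ⟶ Y) : chains Λ X →ₗ[Λ] chains Λ Y :=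
  chainsLift X fun n x => gen Λ Y (f.app (op ⦋n⦌) x)

theorem chainsMap_gen {X Y : SSet.{u}} (f : X ⟶ Y) {n : ℕ} (x : X _⦋n⦌) :
    chainsMap f (gen Λ X x) = gen Λ Y (f.app (op ⦋n⦌) x) :=
  chainsLift_gen X _ (fun _ _ hx => gen_of_degenerate Y (SSet.degenerate_app_apply hx f)) x

theorem chainsMap_mem {X Y : SSet.{u}} (f : X ⟶ Y) {k : ℤ} {c : chains Λ X}
    (hc : c ∈ (chains Λ X).gr k) : chainsMap f c ∈ (chains Λ Y).gr k := by
  refine chains_induction X (P := fun c => chainsMap f c ∈ (chains Λ Y).gr k) hc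
    (fun n x hn => ?_) ?_ (fun y z hy hz => ?_) (fun r y hy => ?_)
  · rw [chainsMap_gen, ← hn]; exact gen_mem Y _
  · rw [map_zero]; exact Submodule.zero_mem _
  · rw [map_add]; exact Submodule.add_mem _ hy hz
  · rw [map_smul]; exact Submodule.smul_mem _ _ hy

theorem chains_d_gen_zero (X : SSet.{u}) (x : X _⦋0⦌) :
    (chains Λ X).d (gen Λ X x) = 0 := linearCombination_bd_cls X x

theorem chains_d_gen (X : SSet.{u}) {n : ℕ} (x : X _⦋n + 1⦌) :
    (chains Λ X).d (gen Λ X x) =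
      ∑ i : Fin (n + 2), (-1 : Λ) ^ (i : ℕ) • gen Λ X (X.δ i x) := linearCombination_bd_cls X x

theorem chainsMap_d {X Y : SSet.{u}} (f : X ⟶ Y) (c : chains Λ X) :
    chainsMap f ((chains Λ X).d c) = (chains Λ Y).d (chainsMap f c) := by
  suffices h : chainsMap f ∘ₗ (chains Λ X).d = (chains Λ Y).d ∘ₗ chainsMap f from
    DFunLike.congr_fun h c
  refine chains_ext X fun n x _ => ?_
  simp only [LinearMap.comp_apply]
  cases n with
  | zero => simp only [chains_d_gen_zero, chainsMap_gen, map_zero]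
  | succ n =>
    simp only [chains_d_gen, chainsMap_gen, map_sum, map_smul]
    refine Finset.sum_congr rfl fun i _ => ?_
    congr 2
    exact NatTrans.naturality_apply f (SimplexCategory.δ i).op x

/-! ### Products of simplicial sets and the Alexander–Whitney map -/

/-- The product `∏ i, L i` of simplicial sets. -/
def piSSet {ι : Type} (L : ι → SSet.{u}) : SSet.{u} where
  obj U := ∀ i, (L i).obj U
  map f := ↾ fun x i => (L i).map f (x i)

/-- The product of maps of simplicial sets. -/
def piSSetMap {ι : Type} {L L' : ι → SSet.{u}} (g : ∀ i, L i ⟶ L' i) : piSSet L ⟶ piSSet L' where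
  app U := ↾ fun x i => (g i).app U (x i)
  naturality U V f := by
    ext x
    funext i
    exact NatTrans.naturality_apply (g i) f (x i)

/-- The permutation of factors `∏ i, L i → ∏ i, L (σ⁻¹ i)`, moving the factor in position `i` to
position `σ i`. -/
def piSSetPerm {ι : Type} (L : ι → SSet.{u}) (σ : Equiv.Perm ι) :
    piSSet L ⟶ piSSet (fun i => L (σ.symm i)) where
  app U := ↾ fun x i => x (σ.symm i)

/-- The diagonal `X → X ^ ι`. -/
def diag (X : SSet.{u}) (ι : Type) : X ⟶ piSSet (fun _ : ι => X) where
  app U := ↾ fun x _ => x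

/-- The value of the Alexander–Whitney map `C(∏ i, L i) → ⨂ i, C(L i)` on an `n`-simplex `(x_i)`: the
sum of `⨂ i, [x_i restricted to the vertices a_i, …, a_i + e_i]` over all `e : ι → ℕ` with
`∑ i, e_i = n`, where `a_i = ∑ j < i, e_j` (so that always `a_i + e_i ≤ n`). -/
def aw {ι : Type} [Fintype ι] [LinearOrder ι] (L : ι → SSet.{u}) {n : ℕ}
    (x : ∀ i, (L i) _⦋n⦌) : pi (fun i => chains Λ (L i)) :=
  ∑ e ∈ Finset.piAntidiag Finset.univ n, PiTensorProduct.tprod Λ fun i =>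
    if h : (∑ j with j < i, e j) + e i ≤ n then
      gen Λ (L i) ((L i).map (SimplexCategory.subinterval (∑ j with j < i, e j) (e i) h).op (x i))
    else 0

/-- The composite `C(X) → C(X × X) → C(X) ⊗ C(X)` of the diagonal and the Alexander–Whitney map:
`[x] ↦ ∑ k, [x restricted to 0, …, k] ⊗ [x restricted to k, …, n]`. -/
def awDiag (X : SSet.{u}) : chains Λ X →ₗ[Λ] tensor (chains Λ X) (chains Λ X) :=
  chainsLift X fun n x => ∑ k : Fin (n + 1),
    gen Λ X (X.map (SimplexCategory.subinterval 0 k (by omega)).op x) ⊗ₜ[Λ]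
      gen Λ X (X.map (SimplexCategory.subinterval k (n - k) (by omega)).op x)

theorem awDiag_gen (X : SSet.{u}) {n : ℕ} (x : X _⦋n⦌) :
    awDiag X (gen Λ X x) = ∑ k : Fin (n + 1),
      gen Λ X (X.map (SimplexCategory.subinterval 0 k (by omega)).op x) ⊗ₜ[Λ]
        gen Λ X (X.map (SimplexCategory.subinterval k (n - k) (by omega)).op x) := by
  refine chainsLift_gen X (fun n (x : X _⦋n⦌) => ∑ k : Fin (n + 1),
    gen Λ X (X.map (SimplexCategory.subinterval 0 k (by omega)).op x) ⊗ₜ[Λ]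
      gen Λ X (X.map (SimplexCategory.subinterval k (n - k) (by omega)).op x)) ?_ x
  intro n x hx
  cases n with
  | zero => simp at hx
  | succ n =>
    rw [SSet.degenerate_eq_iUnion_range_σ] at hx
    obtain ⟨j, y, rfl⟩ := Set.mem_iUnion.1 hx
    refine Finset.sum_eq_zero fun k _ => ?_
    have key : ∀ {m : ℕ} (g : ⦋m⦌ ⟶ ⦋n + 1⦌),
        (∃ a b : Fin (m + 1), g.toOrderHom a = j.castSucc ∧ g.toOrderHom b = j.succ) →
        gen Λ X (X.map g.op (X.σ j y)) = 0 := by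
      rintro m g ⟨a, b, ha, hb⟩
      refine gen_of_degenerate X ?_
      have h3 : X.map g.op (X.σ j y) = X.map (g ≫ SimplexCategory.σ j).op y := by
        rw [op_comp, Functor.map_comp, CategoryTheory.comp_apply]; rfl
      rw [h3]
      apply mem_degenerate_of_not_injective
      intro hinj
      have hab : a = b := by
        apply hinj
        change j.predAbove (g.toOrderHom a) = j.predAbove (g.toOrderHom b)
        rw [ha, hb]
        simp
      rw [hab, hb] at ha
      exact (Fin.castSucc_lt_succ).ne ha.symm
    by_cases hk : (j : ℕ) + 1 ≤ k
    · rw [key, TensorProduct.zero_tmul]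
      refine ⟨⟨j, by omega⟩, ⟨j + 1, by omega⟩, ?_, ?_⟩ <;>
      · ext
        simp [SimplexCategory.subinterval]
    · rw [key (m := n + 1 - k), TensorProduct.tmul_zero]
      refine ⟨⟨j - k, by omega⟩, ⟨j + 1 - k, by omega⟩, ?_, ?_⟩ <;>
      · ext
        simp only [Fin.val_castSucc, Fin.val_succ]
        exact Nat.sub_add_cancel (by omega)

theorem awDiag_natural {X Y : SSet.{u}} (f : X ⟶ Y) :
    TensorProduct.map (chainsMap f) (chainsMap f) ∘ₗ awDiag X =
      awDiag (Λ := Λ) Y ∘ₗ chainsMap f := by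
  refine chains_ext X fun n x _ => ?_
  rw [LinearMap.comp_apply, LinearMap.comp_apply, chainsMap_gen, awDiag_gen, awDiag_gen, map_sum]
  refine Finset.sum_congr rfl fun k _ => ?_
  rw [TensorProduct.map_tmul, chainsMap_gen, chainsMap_gen]
  congr 2 <;> exact NatTrans.naturality_apply f _ x

theorem awDiag_mem (X : SSet.{u}) {k : ℤ} {c : chains Λ X} (hc : c ∈ (chains Λ X).gr k) :
    awDiag X c ∈ (tensor (chains Λ X) (chains Λ X)).gr k := by
  refine chains_induction X (P := fun c => awDiag X c ∈ (tensor (chains Λ X) (chains Λ X)).gr k) hc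
    (fun n x hn => ?_) ?_ (fun y z hy hz => ?_) (fun r y hy => ?_)
  · rw [awDiag_gen]
    refine Submodule.sum_mem _ fun j _ => ?_
    have : k = -((j : ℕ) : ℤ) + -((n - j : ℕ) : ℤ) := by omega
    rw [this]
    exact tmul_mem_tensorGr _ _ (gen_mem X _) (gen_mem X _)
  · rw [map_zero]; exact Submodule.zero_mem _
  · rw [map_add]; exact Submodule.add_mem _ hy hz
  · rw [map_smul]; exact Submodule.smul_mem _ _ hy

/-- A natural equivariant map `Φ : W ⊗ C(L_1 × ⋯ × L_p) → W ⊗ C(L_1) ⊗ ⋯ ⊗ C(L_p)` of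
Eilenberg–Zilber type, for all `p`-tuples of simplicial sets. -/
structure EilenbergZilberMap (Λ : Type) [Field Λ] (p : ℕ) [NeZero p] where
  toFun : ∀ L : Fin p → SSet.{u}, tensor (stdRes Λ p) (chains Λ (piSSet L)) →ₗ[Λ]
    tensor (stdRes Λ p) (pi fun i => chains Λ (L i))
  isChainMap : ∀ L, IsChainMap (tensor (stdRes Λ p) (chains Λ (piSSet L)))
    (tensor (stdRes Λ p) (pi fun i => chains Λ (L i))) (toFun L)
  /-- naturality in the `L_i` -/
  natural : ∀ {L L' : Fin p → SSet.{u}} (g : ∀ i, L i ⟶ L' i),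
    toFun L' ∘ₗ TensorProduct.map LinearMap.id (chainsMap (piSSetMap g)) =
      TensorProduct.map LinearMap.id (PiTensorProduct.map fun i => chainsMap (g i)) ∘ₗ toFun L
  /-- compatibility with the generator `α` of `π`, hence with all of `π` -/
  equivariant : ∀ L : Fin p → SSet.{u},
    toFun (fun i => L ((finRotate p).symm i)) ∘ₗ
        TensorProduct.map (stdAlpha Λ p) (chainsMap (piSSetPerm L (finRotate p))) =
      TensorProduct.map (stdAlpha Λ p) (permMap (fun i => chains Λ (L i)) (finRotate p)) ∘ₗ
        toFun L
  /-- `Φ` is the identity on `W ⊗ C_0(L_1 × ⋯ × L_p)` -/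
  vertices : ∀ (L : Fin p → SSet.{u}) (w : stdRes Λ p) (x : ∀ i, (L i) _⦋0⦌),
    toFun L (w ⊗ₜ[Λ] gen Λ (piSSet L) (n := 0) x) =
      w ⊗ₜ[Λ] PiTensorProduct.tprod Λ fun i => gen Λ (L i) (x i)
  /-- on `e_0 ⊗ C(L_1 × ⋯ × L_p)` the map `Φ` is the Alexander–Whitney map -/
  alexanderWhitney : ∀ (L : Fin p → SSet.{u}) (n : ℕ) (x : ∀ i, (L i) _⦋n⦌),
    toFun L (stdE0 Λ p ⊗ₜ[Λ] gen Λ (piSSet L) (n := n) x) = stdE0 Λ p ⊗ₜ[Λ] aw L x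
  /-- `Φ (W ⊗ C_j) ⊆ ∑ k ≤ p * j, W ⊗ (C(L_1) ⊗ ⋯ ⊗ C(L_p))_k` -/
  filtration : ∀ (L : Fin p → SSet.{u}) (j : ℕ) (w : stdRes Λ p) (c : chains Λ (piSSet L)),
    c ∈ (chains Λ (piSSet L)).gr (-(j : ℤ)) →
    toFun L (w ⊗ₜ[Λ] c) ∈ Submodule.span Λ {y | ∃ (k : ℕ) (w' : stdRes Λ p)
      (b : pi fun i => chains Λ (L i)), k ≤ p * j ∧
      b ∈ (pi fun i => chains Λ (L i)).gr (-(k : ℤ)) ∧ w' ⊗ₜ[Λ] b = y}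

end Simplicial

/-! ### `O_G`-simplicial sets and equivariant cochains -/

open CategoryTheory

/-- The category `O_G` of canonical orbits: the objects are the `G`-sets `G/H` for the subgroups `H`
of `G`. -/
structure OrbitCat (G : Type w) [Group G] where
  subgroup : Subgroup G

/-- The morphisms `G/H → G/K` of `O_G` are the `G`-maps. -/
instance (G : Type w) [Group G] : Category (OrbitCat G) where
  Hom H K := (G ⧸ H.subgroup) →[G] (G ⧸ K.subgroup)
  id H := MulActionHom.id G
  comp f g := g.comp f

/-- The objects `(T, M₀, ρ)` of the category `𝒜_Λ`: an `O_G`-simplicial set `T`, an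
`O_G`-`Λ`-algebra `M₀` and an `O_G`-group `ρ` that acts on both of them. -/
structure AObj (Λ : Type) [Field Λ] (G : Type w) [Group G] where
  T : (OrbitCat G)ᵒᵖ ⥤ SSet.{u}
  M₀ : (OrbitCat G)ᵒᵖ ⥤ CommAlgCat.{v} Λ
  ρ : (OrbitCat G)ᵒᵖ ⥤ GrpCat.{w'}
  actT : ∀ X, ρ.obj X →* End (T.obj X)
  actM : ∀ X, ρ.obj X →* (M₀.obj X →ₐ[Λ] M₀.obj X)
  actT_natural : ∀ {X Y} (f : X ⟶ Y) (a : ρ.obj X),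
    (actT X a : T.obj X ⟶ T.obj X) ≫ T.map f = T.map f ≫ actT Y ((ρ.map f).hom a)
  actM_natural : ∀ {X Y} (f : X ⟶ Y) (a : ρ.obj X) (m : M₀.obj X),
    (M₀.map f).hom (actM X a m) = actM Y ((ρ.map f).hom a) ((M₀.map f).hom m)

section Cochains

variable {G : Type w} [Group G] (A : AObj.{v, u, w, w'} Λ G)

/-- Families of linear maps `φ_H : C(T(G/H)) → M₀(G/H)`. -/
def AObj.Fam : Type (max w u v) :=
  ∀ X : (OrbitCat G)ᵒᵖ, chains Λ (A.T.obj X) →ₗ[Λ] A.M₀.obj X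

instance : AddCommGroup A.Fam :=
  inferInstanceAs (AddCommGroup (∀ X : (OrbitCat G)ᵒᵖ, chains Λ (A.T.obj X) →ₗ[Λ] A.M₀.obj X))

instance : Module Λ A.Fam :=
  inferInstanceAs (Module Λ (∀ X : (OrbitCat G)ᵒᵖ, chains Λ (A.T.obj X) →ₗ[Λ] A.M₀.obj X))

theorem AObj.Fam_add_apply (φ ψ : A.Fam) (X : (OrbitCat G)ᵒᵖ) (c : chains Λ (A.T.obj X)) :
    (φ + ψ) X c = φ X c + ψ X c := rfl

theorem AObj.Fam_smul_apply (r : Λ) (φ : A.Fam) (X : (OrbitCat G)ᵒᵖ)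
    (c : chains Λ (A.T.obj X)) : (r • φ) X c = r • φ X c := rfl

theorem AObj.Fam_zero_apply (X : (OrbitCat G)ᵒᵖ) (c : chains Λ (A.T.obj X)) :
    (0 : A.Fam) X c = 0 := rfl

/-- `Hom_ρ(C_n(T), M₀)`: the natural transformations `C_n(T) → M₀` which respect the action of `ρ`,
extended by `0` to all of `C(T)`. -/
def AObj.homρ (n : ℤ) : Submodule Λ A.Fam where
  carrier := {φ |
    (∀ {X Y} (f : X ⟶ Y) c, (A.M₀.map f).hom (φ X c) = φ Y (chainsMap (A.T.map f) c)) ∧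
    (∀ X (a : A.ρ.obj X) c, A.actM X a (φ X c) = φ X (chainsMap (A.actT X a) c)) ∧
    ∀ X (k : ℤ), k ≠ -n → ∀ c ∈ (chains Λ (A.T.obj X)).gr k, φ X c = 0}
  add_mem' := by
    rintro φ ψ ⟨h1, h2, h3⟩ ⟨h1', h2', h3'⟩
    refine ⟨fun f c => ?_, fun X a c => ?_, fun X k hk c hc => ?_⟩
    · simp only [A.Fam_add_apply, map_add, h1, h1']
    · simp only [A.Fam_add_apply, map_add, h2, h2']
    · simp only [A.Fam_add_apply, h3 X k hk c hc, h3' X k hk c hc, add_zero]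
  zero_mem' := by
    refine ⟨fun f c => ?_, fun X a c => ?_, fun X k hk c hc => rfl⟩ <;>
    simp only [A.Fam_zero_apply, map_zero]
  smul_mem' := by
    rintro r φ ⟨h1, h2, h3⟩
    refine ⟨fun f c => ?_, fun X a c => ?_, fun X k hk c hc => ?_⟩
    · simp only [A.Fam_smul_apply, map_smul, h1]
    · simp only [A.Fam_smul_apply, map_smul, h2]
    · simp only [A.Fam_smul_apply, h3 X k hk c hc, smul_zero]

/-- The total module `⨁ n, Hom_ρ(C_n(T), M₀)` of the equivariant cochains. -/
def AObj.total : Submodule Λ A.Fam := ⨆ n, A.homρ n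

/-- The coboundary `(δ φ)(c) = (-1) ^ (deg c) • φ (∂ c)`, i.e. `δ φ = (-1) ^ (deg φ + 1) • φ ∘ ∂`. -/
def AObj.coboundary : A.Fam →ₗ[Λ] A.Fam where
  toFun φ X := φ X ∘ₗ (chains Λ (A.T.obj X)).d ∘ₗ (chains Λ (A.T.obj X)).par
  map_add' _ _ := rfl
  map_smul' _ _ := rfl

/-- A map of degree `0` commutes with the operators `scale c`. -/
theorem DGMod.scale_comm {K : DGMod.{v} Λ} {L : DGMod.{v'} Λ} (f : K →ₗ[Λ] L)
    (hf : ∀ n, ∀ x ∈ K.gr n, f x ∈ L.gr n) (c : ℤ → Λ) (x : K) :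
    f (K.scale c x) = L.scale c (f x) := by
  induction x using K.hom_induction with
  | h n y hy => rw [K.scale_of_mem c hy, L.scale_of_mem c (hf n y hy), map_smul]
  | h0 => simp
  | ha y z hy hz => simp only [map_add, hy, hz]

theorem AObj.coboundary_apply (φ : A.Fam) (X : (OrbitCat G)ᵒᵖ) (c : chains Λ (A.T.obj X)) :
    A.coboundary φ X c = φ X ((chains Λ (A.T.obj X)).d ((chains Λ (A.T.obj X)).par c)) := rfl

theorem chainsMap_par {X Y : SSet.{u}} (f : X ⟶ Y) (c : chains Λ X) :
    chainsMap f ((chains Λ X).par c) = (chains Λ Y).par (chainsMap f c) :=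
  DGMod.scale_comm _ (fun _ _ hx => chainsMap_mem f hx) _ c

theorem AObj.coboundary_mem {n : ℤ} {φ : A.Fam} (h : φ ∈ A.homρ n) :
    A.coboundary φ ∈ A.homρ (n + 1) := by
  obtain ⟨h1, h2, h3⟩ := h
  refine ⟨fun {X Y} f c => ?_, fun X a c => ?_, fun X k hk c hc => ?_⟩
  · rw [A.coboundary_apply, A.coboundary_apply, h1, chainsMap_d, chainsMap_par]
  · rw [A.coboundary_apply, A.coboundary_apply, h2, chainsMap_d, chainsMap_par]
  · rw [A.coboundary_apply]
    have hk' : k + 1 ≠ -n := fun h => hk (by omega)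
    exact h3 X (k + 1) hk' _
      ((chains Λ (A.T.obj X)).d_mem ((chains Λ (A.T.obj X)).par_mem hc))

theorem AObj.coboundary_mem_total {φ : A.Fam} (h : φ ∈ A.total) : A.coboundary φ ∈ A.total := by
  induction h using Submodule.iSup_induction' with
  | mem n x hx => exact Submodule.mem_iSup_of_mem (n + 1) (A.coboundary_mem hx)
  | zero => rw [map_zero]; exact Submodule.zero_mem _
  | add x y _ _ hx hy => rw [map_add]; exact Submodule.add_mem _ hx hy

/-- Evaluation of a family of linear maps at a chain. -/
def AObj.evalAt (X : (OrbitCat G)ᵒᵖ) (c : chains Λ (A.T.obj X)) : A.Fam →ₗ[Λ] A.M₀.obj X where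
  toFun φ := φ X c
  map_add' _ _ := rfl
  map_smul' _ _ := rfl

theorem AObj.Fam_ext {φ ψ : A.Fam}
    (h : ∀ X (k : ℤ) (c : (chains Λ (A.T.obj X)).gr k), φ X c = ψ X c) : φ = ψ := by
  refine funext fun X => LinearMap.ext fun c => ?_
  induction c using DGMod.hom_induction with
  | h k c hc => exact h X k ⟨c, hc⟩
  | h0 => rw [map_zero, map_zero]
  | ha y z hy hz => rw [map_add, map_add, hy, hz]

theorem AObj.mem_iSup_comap (φ : A.total) :
    φ ∈ ⨆ n, (A.homρ n).comap A.total.subtype := by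
  have h : (φ : A.Fam) ∈ Submodule.map A.total.subtype
      (⨆ n, (A.homρ n).comap A.total.subtype) := by
    rw [Submodule.map_iSup]
    have h2 : ∀ n, Submodule.map A.total.subtype ((A.homρ n).comap A.total.subtype) =
        A.homρ n := by
      intro n
      rw [Submodule.map_comap_subtype]
      exact inf_eq_right.2 (le_iSup A.homρ n)
    simp only [h2]
    exact φ.2
  obtain ⟨ψ, hψ, h⟩ := h
  rwa [← Subtype.ext h]

theorem AObj.total_internal :
    DirectSum.IsInternal fun n => (A.homρ n).comap A.total.subtype := by
  refine isInternal_of_components _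
    (I := Σ (X : (OrbitCat G)ᵒᵖ) (k : ℤ), (chains Λ (A.T.obj X)).gr k) (fun i => A.M₀.obj i.1)
    (fun i => A.evalAt i.1 i.2.2 ∘ₗ A.total.subtype) (fun i => -i.2.1) ?_ ?_ A.mem_iSup_comap
  · intro φ h
    exact Subtype.ext (A.Fam_ext fun X k c => h ⟨X, k, c⟩)
  · intro n φ hφ i hi
    have h3 := (Submodule.mem_comap.1 hφ).2.2 i.1 i.2.1 (fun h => hi (by omega)) _ i.2.2.2
    exact h3

theorem AObj.coboundary_coboundary (φ : A.Fam) : A.coboundary (A.coboundary φ) = 0 := by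
  refine funext fun X => LinearMap.ext fun c => ?_
  rw [A.coboundary_apply, A.coboundary_apply, DGMod.d_par_d, map_zero]
  rfl

/-- The cochain complex `C_ρ^*(T; M₀)`. -/
def AObj.cochains : DGMod.{max w u v} Λ where
  carrier := A.total
  gr n := (A.homρ n).comap A.total.subtype
  internal := A.total_internal
  d := A.coboundary.restrict fun _ h => A.coboundary_mem_total h
  d_mem := fun {_ _} h => A.coboundary_mem h
  d_d φ := Subtype.ext (A.coboundary_coboundary φ)

/-- Evaluation of cochains at `G/H`. -/
def AObj.ev (X : (OrbitCat G)ᵒᵖ) :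
    A.cochains →ₗ[Λ] (chains Λ (A.T.obj X) →ₗ[Λ] A.M₀.obj X) where
  toFun φ := φ.1 X
  map_add' _ _ := rfl
  map_smul' _ _ := rfl

/-- A family of linear maps `φ_H : C(T(G/H)) → M₀(G/H)`. -/
def AObj.toFam (φ : ∀ X : (OrbitCat G)ᵒᵖ, chains Λ (A.T.obj X) →ₗ[Λ] A.M₀.obj X) : A.Fam := φ

theorem AObj.ev_mem {n : ℤ} {φ : A.cochains} (h : φ ∈ A.cochains.gr n) :
    A.toFam (fun X => A.ev X φ) ∈ A.homρ n := h

/-- A family of maps `F_H : K → Hom(C(T(G/H)), M₀(G/H))` of degree `0`, natural in `G/H` and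
equivariant under `ρ`, gives a map `K → C_ρ^*(T; M₀)`. -/
theorem AObj.mem_total_of_hom {K : DGMod.{v'} Λ}
    (F : ∀ X : (OrbitCat G)ᵒᵖ, K →ₗ[Λ] chains Λ (A.T.obj X) →ₗ[Λ] A.M₀.obj X)
    (hnat : ∀ {X Y} (f : X ⟶ Y) z c,
      (A.M₀.map f).hom (F X z c) = F Y z (chainsMap (A.T.map f) c))
    (hact : ∀ X (a : A.ρ.obj X) z c, A.actM X a (F X z c) = F X z (chainsMap (A.actT X a) c))
    (hdeg : ∀ X (n k : ℤ), k ≠ -n → ∀ z ∈ K.gr n, ∀ c ∈ (chains Λ (A.T.obj X)).gr k,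
      F X z c = 0) (z : K) :
    A.toFam (fun X => F X z) ∈ A.total := by
  induction z using K.hom_induction with
  | h n y hy =>
    exact Submodule.mem_iSup_of_mem n ⟨fun f c => hnat f y c, fun X a c => hact X a y c,
      fun X k hk c hc => hdeg X n k hk y hy c hc⟩
  | h0 =>
    have h : A.toFam (fun X => F X 0) = 0 := funext fun X => map_zero (F X)
    rw [h]
    exact Submodule.zero_mem A.total
  | ha y z hy hz =>
    have h : A.toFam (fun X => F X (y + z)) =
        A.toFam (fun X => F X y) + A.toFam (fun X => F X z) :=
      funext fun X => map_add (F X) y z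
    rw [h]
    exact Submodule.add_mem A.total hy hz

/-- The map `K → C_ρ^*(T; M₀)` with the components `F_H`. -/
def AObj.intoCochains {K : DGMod.{v'} Λ}
    (F : ∀ X : (OrbitCat G)ᵒᵖ, K →ₗ[Λ] chains Λ (A.T.obj X) →ₗ[Λ] A.M₀.obj X)
    (hF : ∀ z, A.toFam (fun X => F X z) ∈ A.total) : K →ₗ[Λ] A.cochains where
  toFun z := ⟨A.toFam fun X => F X z, hF z⟩
  map_add' y z := Subtype.ext (funext fun X => map_add (F X) y z)
  map_smul' r z := Subtype.ext (funext fun X => map_smul (F X) r z)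

theorem AObj.ev_natural {X Y : (OrbitCat G)ᵒᵖ} (f : X ⟶ Y) (φ : A.cochains)
    (c : chains Λ (A.T.obj X)) :
    (A.M₀.map f).hom (A.ev X φ c) = A.ev Y φ (chainsMap (A.T.map f) c) := by
  induction φ using A.cochains.hom_induction with
  | h n y hy => exact (A.ev_mem hy).1 f c
  | h0 => simp only [map_zero, LinearMap.zero_apply]
  | ha y z hy hz => simp only [map_add, LinearMap.add_apply, hy, hz]

theorem AObj.ev_act {X : (OrbitCat G)ᵒᵖ} (a : A.ρ.obj X) (φ : A.cochains)
    (c : chains Λ (A.T.obj X)) :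
    A.actM X a (A.ev X φ c) = A.ev X φ (chainsMap (A.actT X a) c) := by
  induction φ using A.cochains.hom_induction with
  | h n y hy => exact (A.ev_mem hy).2.1 X a c
  | h0 => simp only [map_zero, LinearMap.zero_apply]
  | ha y z hy hz => simp only [map_add, LinearMap.add_apply, hy, hz]

theorem AObj.ev_degree (X : (OrbitCat G)ᵒᵖ) {n k : ℤ} (hk : k ≠ -n) {φ : A.cochains}
    (hφ : φ ∈ A.cochains.gr n) {c : chains Λ (A.T.obj X)}
    (hc : c ∈ (chains Λ (A.T.obj X)).gr k) : A.ev X φ c = 0 :=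
  (A.ev_mem hφ).2.2 X k hk c hc

/-! ### The cup product -/

theorem DGMod.scale_mem (K : DGMod.{v} Λ) (c : ℤ → Λ) {n : ℤ} {x : K} (hx : x ∈ K.gr n) :
    K.scale c x ∈ K.gr n := by
  rw [K.scale_of_mem c hx]; exact Submodule.smul_mem _ _ hx

/-- The sign operator `a ⊗ b ↦ (-1) ^ (deg a * deg b) • a ⊗ b`. -/
def DGMod.swapSign (K : DGMod.{v} Λ) (L : DGMod.{v'} Λ) : K ⊗[Λ] L →ₗ[Λ] K ⊗[Λ] L :=
  LinearMap.id - (2 : Λ) • TensorProduct.map K.odd L.odd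

theorem DGMod.swapSign_mem (K : DGMod.{v} Λ) (L : DGMod.{v'} Λ) {n : ℤ} {t : K ⊗[Λ] L}
    (ht : t ∈ tensorGr K L n) : swapSign K L t ∈ tensorGr K L n := by
  refine Submodule.sub_mem _ ht (Submodule.smul_mem _ _ ?_)
  induction ht using Submodule.span_induction with
  | zero => rw [map_zero]; exact Submodule.zero_mem _
  | add y z _ _ hy hz => rw [map_add]; exact Submodule.add_mem _ hy hz
  | smul r y _ hy => rw [map_smul]; exact Submodule.smul_mem _ _ hy
  | mem y hy =>
    obtain ⟨i, j, a, b, ha, hb, rfl, rfl⟩ := hy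
    rw [TensorProduct.map_tmul]
    exact tmul_mem_tensorGr K L (K.scale_mem _ ha) (L.scale_mem _ hb)

theorem DGMod.swapSign_natural {K K' : DGMod.{v} Λ} {L L' : DGMod.{v'} Λ} (f : K →ₗ[Λ] K')
    (g : L →ₗ[Λ] L') (hf : ∀ n, ∀ x ∈ K.gr n, f x ∈ K'.gr n)
    (hg : ∀ n, ∀ x ∈ L.gr n, g x ∈ L'.gr n) (t : K ⊗[Λ] L) :
    TensorProduct.map f g (swapSign K L t) = swapSign K' L' (TensorProduct.map f g t) := by
  induction t using TensorProduct.induction_on with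
  | zero => simp only [map_zero]
  | add y z hy hz => simp only [map_add, hy, hz]
  | tmul a b =>
    simp only [swapSign, LinearMap.sub_apply, LinearMap.id_apply, LinearMap.smul_apply,
      TensorProduct.map_tmul, map_sub, map_smul, odd, scale_comm f hf, scale_comm g hg]

/-- `α(f ⊗ g)(x ⊗ y) = (-1) ^ (deg x * deg y) • f(x) g(y)`. -/
def AObj.alpha₂ (X : (OrbitCat G)ᵒᵖ) :
    A.cochains ⊗[Λ] A.cochains →ₗ[Λ]
      (chains Λ (A.T.obj X) ⊗[Λ] chains Λ (A.T.obj X)) →ₗ[Λ] A.M₀.obj X :=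
  LinearMap.lcomp Λ (A.M₀.obj X)
      (DGMod.swapSign (chains Λ (A.T.obj X)) (chains Λ (A.T.obj X))) ∘ₗ
    LinearMap.llcomp Λ _ _ _ (LinearMap.mul' Λ (A.M₀.obj X)) ∘ₗ
    TensorProduct.homTensorHomMap _ _ _ _ _ ∘ₗ TensorProduct.map (A.ev X) (A.ev X)

theorem AObj.alpha₂_tmul (X : (OrbitCat G)ᵒᵖ) (f g : A.cochains)
    (t : chains Λ (A.T.obj X) ⊗[Λ] chains Λ (A.T.obj X)) :
    A.alpha₂ X (f ⊗ₜ[Λ] g) t = LinearMap.mul' Λ (A.M₀.obj X)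
      (TensorProduct.map (A.ev X f) (A.ev X g) (DGMod.swapSign _ _ t)) := rfl

theorem AObj.alpha₂_natural {X Y : (OrbitCat G)ᵒᵖ} (m : A.M₀.obj X →ₐ[Λ] A.M₀.obj Y)
    (u : A.T.obj X ⟶ A.T.obj Y)
    (h : ∀ (φ : A.cochains) c, m (A.ev X φ c) = A.ev Y φ (chainsMap u c))
    (z : A.cochains ⊗[Λ] A.cochains) (t : chains Λ (A.T.obj X) ⊗[Λ] chains Λ (A.T.obj X)) :
    m (A.alpha₂ X z t) =
      A.alpha₂ Y z (TensorProduct.map (chainsMap u) (chainsMap u) t) := by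
  induction z using TensorProduct.induction_on with
  | zero => simp only [map_zero, LinearMap.zero_apply]
  | add y z hy hz => simp only [map_add, LinearMap.add_apply, hy, hz]
  | tmul f g =>
    rw [A.alpha₂_tmul, A.alpha₂_tmul, ← DGMod.swapSign_natural _ _
      (fun n x hx => chainsMap_mem u hx) (fun n x hx => chainsMap_mem u hx)]
    generalize DGMod.swapSign _ _ t = t'
    induction t' using TensorProduct.induction_on with
    | zero => simp only [map_zero]
    | add y z hy hz => simp only [map_add, hy, hz]
    | tmul x y => simp only [TensorProduct.map_tmul, LinearMap.mul'_apply, map_mul, h]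

theorem AObj.alpha₂_degree (X : (OrbitCat G)ᵒᵖ) {n k : ℤ} (hk : k ≠ -n)
    {z : A.cochains ⊗[Λ] A.cochains} (hz : z ∈ tensorGr A.cochains A.cochains n)
    {t : chains Λ (A.T.obj X) ⊗[Λ] chains Λ (A.T.obj X)}
    (ht : t ∈ tensorGr (chains Λ (A.T.obj X)) (chains Λ (A.T.obj X)) k) :
    A.alpha₂ X z t = 0 := by
  induction hz using Submodule.span_induction with
  | zero => simp only [map_zero, LinearMap.zero_apply]
  | add y z _ _ hy hz => simp only [map_add, LinearMap.add_apply, hy, hz, add_zero]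
  | smul r y _ hy => simp only [map_smul, LinearMap.smul_apply, hy, smul_zero]
  | mem y hy =>
    obtain ⟨i, j, f, g, hf, hg, rfl, rfl⟩ := hy
    rw [A.alpha₂_tmul]
    have ht' := DGMod.swapSign_mem _ _ ht
    generalize DGMod.swapSign _ _ t = t' at ht'
    induction ht' using Submodule.span_induction with
    | zero => simp only [map_zero]
    | add y z _ _ hy hz => simp only [map_add, hy, hz, add_zero]
    | smul r y _ hy => simp only [map_smul, hy, smul_zero]
    | mem y hy =>
      obtain ⟨i', j', a, b, ha, hb, rfl, rfl⟩ := hy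
      rw [TensorProduct.map_tmul, LinearMap.mul'_apply]
      by_cases h : i' = -i
      · rw [A.ev_degree X (fun h' => hk (by omega)) hg hb, mul_zero]
      · rw [A.ev_degree X h hf ha, zero_mul]

/-- The components `f ⊗ g ↦ α(f ⊗ g) ∘ ξ ∘ D` of the cup product. -/
def AObj.cupAt (X : (OrbitCat G)ᵒᵖ) :
    A.cochains ⊗[Λ] A.cochains →ₗ[Λ] chains Λ (A.T.obj X) →ₗ[Λ] A.M₀.obj X :=
  LinearMap.lcomp Λ (A.M₀.obj X) (awDiag (A.T.obj X)) ∘ₗ A.alpha₂ X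

theorem AObj.cupAt_apply (X : (OrbitCat G)ᵒᵖ) (z : A.cochains ⊗[Λ] A.cochains)
    (c : chains Λ (A.T.obj X)) : A.cupAt X z c = A.alpha₂ X z (awDiag (A.T.obj X) c) := rfl

theorem AObj.cupAt_natural {X Y : (OrbitCat G)ᵒᵖ} (m : A.M₀.obj X →ₐ[Λ] A.M₀.obj Y)
    (u : A.T.obj X ⟶ A.T.obj Y)
    (h : ∀ (φ : A.cochains) c, m (A.ev X φ c) = A.ev Y φ (chainsMap u c))
    (z : A.cochains ⊗[Λ] A.cochains) (c : chains Λ (A.T.obj X)) :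
    m (A.cupAt X z c) = A.cupAt Y z (chainsMap u c) := by
  rw [A.cupAt_apply, A.cupAt_apply, A.alpha₂_natural m u h]
  exact congrArg _ (LinearMap.congr_fun (awDiag_natural u) c)

/-- The cup product on `C_ρ^*(T; M₀)`. -/
def AObj.cup : tensor A.cochains A.cochains →ₗ[Λ] A.cochains :=
  A.intoCochains (K := tensor A.cochains A.cochains) A.cupAt <|
    A.mem_total_of_hom (K := tensor A.cochains A.cochains) A.cupAt
      (fun f => A.cupAt_natural _ _ (A.ev_natural f))
      (fun _ a => A.cupAt_natural _ _ (A.ev_act a))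
      (fun X _ _ hk _ hz _ hc => A.alpha₂_degree X hk hz (awDiag_mem _ hc))

/-! ### The morphism `θ` -/

section Theta

variable {ι : Type} [Fintype ι] [LinearOrder ι]

/-- The sign operator on `⨂ i, A i` which multiplies a tensor of homogeneous elements by
`(-1) ^ (∑ i < j, deg a_i * deg a_j)`. -/
def DGMod.revSign (K : ι → DGMod.{v} Λ) : pi K →ₗ[Λ] pi K :=
  ∑ S : Finset ι, (-1 : Λ) ^ (S.card.choose 2) • parityPart K S

theorem DGMod.parityPart_natural {K L : ι → DGMod.{v} Λ} (f : ∀ i, K i →ₗ[Λ] L i)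
    (hf : ∀ i n, ∀ x ∈ (K i).gr n, f i x ∈ (L i).gr n) (S : Finset ι) (t : pi K) :
    PiTensorProduct.map f (parityPart K S t) = parityPart L S (PiTensorProduct.map f t) := by
  induction t using PiTensorProduct.induction_on with
  | add x y hx hy => simp only [map_add, hx, hy]
  | smul_tprod r a =>
    simp only [map_smul, parityPart, PiTensorProduct.map_tprod]
    congr 2
    funext i
    split_ifs
    · exact scale_comm (f i) (hf i) _ _
    · exact scale_comm (f i) (hf i) _ _

theorem DGMod.revSign_natural {K L : ι → DGMod.{v} Λ} (f : ∀ i, K i →ₗ[Λ] L i)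
    (hf : ∀ i n, ∀ x ∈ (K i).gr n, f i x ∈ (L i).gr n) (t : pi K) :
    PiTensorProduct.map f (revSign K t) = revSign L (PiTensorProduct.map f t) := by
  simp only [revSign, LinearMap.sum_apply, LinearMap.smul_apply, map_sum, map_smul,
    parityPart_natural f hf]

theorem DGMod.revSign_mem (K : ι → DGMod.{v} Λ) {n : ℤ} {t : pi K} (ht : t ∈ piGr K n) :
    revSign K t ∈ piGr K n := by
  rw [revSign, LinearMap.sum_apply]
  refine Submodule.sum_mem _ fun S _ => ?_
  rw [LinearMap.smul_apply]
  refine Submodule.smul_mem _ _ ?_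
  induction ht using Submodule.span_induction with
  | zero => rw [map_zero]; exact Submodule.zero_mem _
  | add y z _ _ hy hz => rw [map_add]; exact Submodule.add_mem _ hy hz
  | smul r y _ hy => rw [map_smul]; exact Submodule.smul_mem _ _ hy
  | mem y hy =>
    obtain ⟨e, a, ha, rfl, rfl⟩ := hy
    rw [parityPart, PiTensorProduct.map_tprod]
    refine tprod_mem_piGr K fun i => ?_
    split_ifs
    · exact (K i).scale_mem _ (ha i)
    · exact (K i).scale_mem _ (ha i)

/-- `α(f_1 ⊗ ⋯ ⊗ f_p)(x_1 ⊗ ⋯ ⊗ x_p) = (-1) ^ (∑ i < j, deg x_i * deg x_j) • f_1(x_1) ⋯ f_p(x_p)`. -/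
def AObj.alphaPow (ι : Type) [Fintype ι] [LinearOrder ι] (X : (OrbitCat G)ᵒᵖ) :
    pow A.cochains ι →ₗ[Λ] pow (chains Λ (A.T.obj X)) ι →ₗ[Λ] A.M₀.obj X :=
  LinearMap.lcomp Λ (A.M₀.obj X) (DGMod.revSign fun _ : ι => chains Λ (A.T.obj X)) ∘ₗ
    LinearMap.llcomp Λ _ _ _
      (PiTensorProduct.lift (MultilinearMap.mkPiAlgebra Λ ι (A.M₀.obj X))) ∘ₗ
    PiTensorProduct.piTensorHomMap ∘ₗ PiTensorProduct.map fun _ => A.ev X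

theorem AObj.alphaPow_tprod (X : (OrbitCat G)ᵒᵖ) (f : ι → A.cochains)
    (t : pow (chains Λ (A.T.obj X)) ι) :
    A.alphaPow ι X (PiTensorProduct.tprod Λ f) t =
      PiTensorProduct.lift (MultilinearMap.mkPiAlgebra Λ ι (A.M₀.obj X))
        (PiTensorProduct.map (fun i => A.ev X (f i)) (DGMod.revSign _ t)) := by
  rw [← PiTensorProduct.piTensorHomMap_tprod_eq_map]
  simp only [alphaPow, LinearMap.comp_apply, PiTensorProduct.map_tprod]
  rfl

theorem AObj.alphaPow_natural {X Y : (OrbitCat G)ᵒᵖ} (m : A.M₀.obj X →ₐ[Λ] A.M₀.obj Y)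
    (u : A.T.obj X ⟶ A.T.obj Y)
    (h : ∀ (φ : A.cochains) c, m (A.ev X φ c) = A.ev Y φ (chainsMap u c))
    (z : pow A.cochains ι) (t : pow (chains Λ (A.T.obj X)) ι) :
    m (A.alphaPow ι X z t) =
      A.alphaPow ι Y z (PiTensorProduct.map (fun _ => chainsMap u) t) := by
  induction z using PiTensorProduct.induction_on with
  | add y z hy hz => simp only [map_add, LinearMap.add_apply, hy, hz]
  | smul_tprod r f =>
    rw [map_smul, map_smul, LinearMap.smul_apply, LinearMap.smul_apply, map_smul]
    congr 1
    rw [A.alphaPow_tprod, A.alphaPow_tprod, ← DGMod.revSign_natural _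
      (fun _ n x hx => chainsMap_mem u hx)]
    generalize DGMod.revSign _ t = t'
    induction t' using PiTensorProduct.induction_on with
    | add y z hy hz => simp only [map_add, hy, hz]
    | smul_tprod r x =>
      simp only [map_smul, PiTensorProduct.map_tprod, PiTensorProduct.lift.tprod,
        MultilinearMap.mkPiAlgebra_apply, map_prod, h]

theorem AObj.alphaPow_degree (X : (OrbitCat G)ᵒᵖ) {n k : ℤ} (hk : k ≠ -n)
    {z : pow A.cochains ι} (hz : z ∈ piGr (fun _ : ι => A.cochains) n)
    {t : pow (chains Λ (A.T.obj X)) ι}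
    (ht : t ∈ piGr (fun _ : ι => chains Λ (A.T.obj X)) k) : A.alphaPow ι X z t = 0 := by
  induction hz using Submodule.span_induction with
  | zero => simp only [map_zero, LinearMap.zero_apply]
  | add y z _ _ hy hz => simp only [map_add, LinearMap.add_apply, hy, hz, add_zero]
  | smul r y _ hy => simp only [map_smul, LinearMap.smul_apply, hy, smul_zero]
  | mem y hy =>
    obtain ⟨e, f, hf, rfl, rfl⟩ := hy
    rw [A.alphaPow_tprod]
    have ht' := DGMod.revSign_mem _ ht
    generalize DGMod.revSign _ t = t' at ht'
    induction ht' using Submodule.span_induction with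
    | zero => simp only [map_zero]
    | add y z _ _ hy hz => simp only [map_add, hy, hz, add_zero]
    | smul r y _ hy => simp only [map_smul, hy, smul_zero]
    | mem y hy =>
      obtain ⟨e', x, hx, rfl, rfl⟩ := hy
      rw [PiTensorProduct.map_tprod, PiTensorProduct.lift.tprod, MultilinearMap.mkPiAlgebra_apply]
      have hne : ∃ i, e' i ≠ -e i := by
        by_contra! hcon
        exact hk (by simp only [hcon, Finset.sum_neg_distrib])
      obtain ⟨i, hi⟩ := hne
      exact Finset.prod_eq_zero (Finset.mem_univ i) (A.ev_degree X hi (hf i) (hx i))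

end Theta

section Delta

variable {p : ℕ} [NeZero p] (Φ : EilenbergZilberMap.{u} Λ p)

/-- The map `Δ : W ⊗ C(L) → C(L) ^ p`, the composite of `id ⊗ D_*` for the diagonal `D : L → L ^ p`,
of `Φ`, and of the augmentation `W ⊗ C(L) ^ p → C(L) ^ p`. -/
def delta (L : SSet.{u}) :
    tensor (stdRes Λ p) (chains Λ L) →ₗ[Λ] pow (chains Λ L) (Fin p) :=
  (TensorProduct.lid Λ _).toLinearMap ∘ₗ TensorProduct.map (stdEps Λ p) LinearMap.id ∘ₗ
    Φ.toFun (fun _ => L) ∘ₗ TensorProduct.map LinearMap.id (chainsMap (diag L (Fin p)))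

theorem chainsMap_comp {X Y Z : SSet.{u}} (f : X ⟶ Y) (g : Y ⟶ Z) (c : chains Λ X) :
    chainsMap g (chainsMap f c) = chainsMap (f ≫ g) c := by
  suffices h : chainsMap g ∘ₗ chainsMap f = chainsMap (Λ := Λ) (f ≫ g) from
    LinearMap.congr_fun h c
  refine chains_ext X fun n x _ => ?_
  rw [LinearMap.comp_apply, chainsMap_gen, chainsMap_gen, chainsMap_gen]
  rfl

theorem delta_natural {L L' : SSet.{u}} (g : L ⟶ L') (w : stdRes Λ p) (c : chains Λ L) :
    PiTensorProduct.map (fun _ => chainsMap g) (delta Φ L (w ⊗ₜ[Λ] c)) =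
      delta Φ L' (w ⊗ₜ[Λ] chainsMap g c) := by
  have h := LinearMap.congr_fun (Φ.natural (fun _ : Fin p => g))
    (w ⊗ₜ[Λ] chainsMap (diag L (Fin p)) c)
  have h2 : diag L (Fin p) ≫ piSSetMap (fun _ : Fin p => g) = g ≫ diag L' (Fin p) := rfl
  simp only [LinearMap.comp_apply, TensorProduct.map_tmul, LinearMap.id_apply, chainsMap_comp,
    h2] at h
  simp only [delta, LinearMap.comp_apply, TensorProduct.map_tmul, LinearMap.id_apply,
    chainsMap_comp, h, LinearEquiv.coe_coe]
  generalize Φ.toFun (fun _ => L) _ = t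
  induction t using TensorProduct.induction_on with
  | zero => simp only [map_zero]
  | add y z hy hz => simp only [map_add, hy, hz]
  | tmul a b =>
    simp only [TensorProduct.map_tmul, LinearMap.id_apply, TensorProduct.lid_tmul, map_smul]

theorem stdEps_of_mem {n : ℤ} (hn : n ≠ 0) {w : stdRes Λ p} (hw : w ∈ (stdRes Λ p).gr n) :
    stdEps Λ p w = 0 := by
  change w ∈ Finsupp.supported Λ Λ _ at hw
  rw [Finsupp.supported_eq_span_single] at hw
  induction hw using Submodule.span_induction with
  | zero => exact map_zero _
  | add y z _ _ hy hz => rw [map_add, hy, hz, add_zero]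
  | smul r y _ hy => rw [map_smul, hy, smul_zero]
  | mem y hy =>
    obtain ⟨b, hb, rfl⟩ := hy
    have hb' : b.1 ≠ 0 := by
      rintro h
      apply hn
      have hb2 : -(b.1 : ℤ) = n := hb
      rw [← hb2, h]; rfl
    exact (Finsupp.linearCombination_single _ _ _).trans (by rw [if_neg hb', smul_zero])

theorem delta_mem (L : SSet.{u}) {n : ℤ} {t : tensor (stdRes Λ p) (chains Λ L)}
    (ht : t ∈ tensorGr (stdRes Λ p) (chains Λ L) n) :
    delta Φ L t ∈ piGr (fun _ : Fin p => chains Λ L) n := by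
  have h1 : TensorProduct.map LinearMap.id (chainsMap (diag L (Fin p))) t ∈
      tensorGr (stdRes Λ p) (chains Λ (piSSet fun _ : Fin p => L)) n := by
    induction ht using Submodule.span_induction with
    | zero => rw [map_zero]; exact Submodule.zero_mem _
    | add y z _ _ hy hz => rw [map_add]; exact Submodule.add_mem _ hy hz
    | smul r y _ hy => rw [map_smul]; exact Submodule.smul_mem _ _ hy
    | mem y hy =>
      obtain ⟨i, j, a, b, ha, hb, rfl, rfl⟩ := hy
      exact tmul_mem_tensorGr _ _ ha (chainsMap_mem _ hb)
  have h2 := (Φ.isChainMap fun _ => L).degree n _ h1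
  simp only [delta, LinearMap.comp_apply]
  generalize Φ.toFun (fun _ => L) _ = t' at h2
  change t' ∈ tensorGr _ _ n at h2
  induction h2 using Submodule.span_induction with
  | zero => simp only [map_zero]; exact Submodule.zero_mem _
  | add y z _ _ hy hz => simp only [map_add]; exact Submodule.add_mem _ hy hz
  | smul r y _ hy => simp only [map_smul]; exact Submodule.smul_mem _ _ hy
  | mem y hy =>
    obtain ⟨i, j, a, b, ha, hb, rfl, rfl⟩ := hy
    simp only [TensorProduct.map_tmul, LinearMap.id_apply, LinearEquiv.coe_coe,
      TensorProduct.lid_tmul]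
    by_cases hi : i = 0
    · rw [hi, zero_add]; exact Submodule.smul_mem _ _ hb
    · rw [stdEps_of_mem hi ha, zero_smul]; exact Submodule.zero_mem _

/-- The components of `θ`: `θ(w ⊗ f)(x) = (-1) ^ (deg w * deg f) • α(f)(Δ(w ⊗ x))`. -/
def AObj.thetaAt (X : (OrbitCat G)ᵒᵖ) :
    stdRes Λ p ⊗[Λ] (pow A.cochains (Fin p)).carrier →ₗ[Λ]
      chains Λ (A.T.obj X) →ₗ[Λ] A.M₀.obj X :=
  TensorProduct.lift
      ((LinearMap.llcomp Λ _ _ _ ∘ₗ A.alphaPow (Fin p) X).flip ∘ₗ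
        TensorProduct.curry (delta Φ (A.T.obj X))) ∘ₗ
    DGMod.swapSign (stdRes Λ p) (pow A.cochains (Fin p))

theorem AObj.thetaAt_apply (X : (OrbitCat G)ᵒᵖ)
    (z : stdRes Λ p ⊗[Λ] (pow A.cochains (Fin p)).carrier) (c : chains Λ (A.T.obj X)) :
    A.thetaAt Φ X z c = TensorProduct.lift
      ((LinearMap.llcomp Λ _ _ _ ∘ₗ A.alphaPow (Fin p) X).flip ∘ₗ
        TensorProduct.curry (delta Φ (A.T.obj X)))
      (DGMod.swapSign (stdRes Λ p) (pow A.cochains (Fin p)) z) c := rfl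

theorem AObj.lift_tmul_apply (X : (OrbitCat G)ᵒᵖ) (w : stdRes Λ p) (f : pow A.cochains (Fin p))
    (c : chains Λ (A.T.obj X)) :
    TensorProduct.lift
      ((LinearMap.llcomp Λ _ _ _ ∘ₗ A.alphaPow (Fin p) X).flip ∘ₗ
        TensorProduct.curry (delta Φ (A.T.obj X))) (w ⊗ₜ[Λ] f) c =
      A.alphaPow (Fin p) X f (delta Φ (A.T.obj X) (w ⊗ₜ[Λ] c)) := rfl

theorem AObj.thetaAt_natural {X Y : (OrbitCat G)ᵒᵖ} (m : A.M₀.obj X →ₐ[Λ] A.M₀.obj Y)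
    (u : A.T.obj X ⟶ A.T.obj Y)
    (h : ∀ (φ : A.cochains) c, m (A.ev X φ c) = A.ev Y φ (chainsMap u c))
    (z : stdRes Λ p ⊗[Λ] (pow A.cochains (Fin p)).carrier) (c : chains Λ (A.T.obj X)) :
    m (A.thetaAt Φ X z c) = A.thetaAt Φ Y z (chainsMap u c) := by
  rw [A.thetaAt_apply, A.thetaAt_apply]
  generalize DGMod.swapSign _ _ z = z'
  induction z' using TensorProduct.induction_on with
  | zero => simp only [map_zero, LinearMap.zero_apply]
  | add y z hy hz => simp only [map_add, LinearMap.add_apply, hy, hz]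
  | tmul w f =>
    rw [A.lift_tmul_apply, A.lift_tmul_apply, A.alphaPow_natural m u h, delta_natural]

theorem AObj.thetaAt_degree (X : (OrbitCat G)ᵒᵖ) {n k : ℤ} (hk : k ≠ -n)
    {z : stdRes Λ p ⊗[Λ] (pow A.cochains (Fin p)).carrier}
    (hz : z ∈ tensorGr (stdRes Λ p) (pow A.cochains (Fin p)) n) {c : chains Λ (A.T.obj X)}
    (hc : c ∈ (chains Λ (A.T.obj X)).gr k) : A.thetaAt Φ X z c = 0 := by
  rw [A.thetaAt_apply]
  have hz' := DGMod.swapSign_mem _ _ hz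
  generalize DGMod.swapSign _ _ z = z' at hz'
  induction hz' using Submodule.span_induction with
  | zero => simp only [map_zero, LinearMap.zero_apply]
  | add y z _ _ hy hz => simp only [map_add, LinearMap.add_apply, hy, hz, add_zero]
  | smul r y _ hy => simp only [map_smul, LinearMap.smul_apply, hy, smul_zero]
  | mem y hy =>
    obtain ⟨i, j, w, f, hw, hf, rfl, rfl⟩ := hy
    rw [A.lift_tmul_apply]
    exact A.alphaPow_degree X (n := j) (k := i + k) (by omega) hf
      (delta_mem Φ _ (tmul_mem_tensorGr _ _ hw hc))

/-- The morphism `θ : W ⊗ C_ρ^*(T; M₀) ^ p → C_ρ^*(T; M₀)` given by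
`θ(w ⊗ f)(x) = (-1) ^ (deg w * deg f) • α(f)(Δ(w ⊗ x))`. -/
def AObj.theta : tensor (stdRes Λ p) (pow A.cochains (Fin p)) →ₗ[Λ] A.cochains :=
  A.intoCochains (K := tensor (stdRes Λ p) (pow A.cochains (Fin p))) (A.thetaAt Φ) <|
    A.mem_total_of_hom (K := tensor (stdRes Λ p) (pow A.cochains (Fin p))) (A.thetaAt Φ)
      (fun f => A.thetaAt_natural Φ _ _ (A.ev_natural f))
      (fun _ a => A.thetaAt_natural Φ _ _ (A.ev_act a))
      (fun X _ _ hk _ hz _ hc => A.thetaAt_degree Φ X hk hz hc)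

end Delta

end Cochains

end

end SteenrodDG

/-! The proof is the method of acyclic models, carried out once, equivariantly, in a complex of
natural operations. For a finite ordered set ι consider all natural linear maps C(L) → C(L)^ι, with
D z = d z - (-1)^(deg z) z d (`natOps`). By Yoneda such an operation amounts to its values on the
fundamental simplices of the Δ[n], subject to vanishing under the degeneracies. Coning contracts
C(Δ[n]) onto vertex 0, the contraction passes to tensor powers, and it commutes with every map of
simplices fixing vertex 0, in particular with the degeneracies. Solving D s = g dimension by
dimension with this contraction shows that, apart from the augmentation (the value on a point), the
operations are acyclic in degrees ≤ 0 (`natOps.exists_D_eq`).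

Consequently, if F is a non-positive complex, free over a group mapping to the permutations of ι,
then equivariant chain maps from F to the operations exist with a prescribed invariant augmentation,
and two of them with the same augmentation are equivariantly homotopic
(`FreeAction.exists_opFamily`, `FreeAction.exists_opHomotopy`). Such a family E acts on cochains by
x ⊗ f ↦ ± α(f) ∘ E(x). Since the pairing α is invariant under permutations and exchanges the
differentials up to sign (`AObj.alphaPow_perm`, `AObj.alphaPow_d`), families give equivariant chain
maps F ⊗ C^ι → C, and homotopies of families give homotopies of actions (`AObj.isChainMap_opAct`,
`AObj.opAct_homotopic`).

Three applications give the theorem. Existence of Φ: a family over W starting with the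
Alexander–Whitney map at e_0 is applied to the product of the L_i, projected to the factors, and
combined with an equivariant diagonal W → W ⊗ W (`exists_eilenbergZilberMap`). Membership in ℭ(p): θ
is the action of the family Δ; at e_0 it is the strictly associative iterated cup product, and a
family over V pulled back along j has the same augmentation as Δ (`AObj.isCpObject`). The Adem
property: θ(id ⊗ θ^p) is, after the shuffle, the action of a τ-equivariant family over W ⊗ W^p
(`AObj.theta_theta_eq`); this complex is free over the wreath product, and a family over Y pulled
back along w has the same augmentation, so the two are homotopic (`AObj.isAdemObject`).

The remaining work is signs. Every Koszul sign is written as (-1) to a quadratic or bilinear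
expression in the degrees modulo 2, so each compatibility becomes an identity in ZMod 2. -/

namespace SteenrodDG

noncomputable section

set_option linter.unusedSectionVars false

variable {Λ : Type} [Field Λ]

open CategoryTheory Opposite Simplicial DGMod

section

/-! ### Signs -/

variable (Λ) in
/-- The sign `(-1) ^ x` of a parity `x`. -/
def sgn (x : ZMod 2) : Λ := if x = 0 then 1 else -1

@[simp] theorem sgn_zero : sgn Λ 0 = 1 := if_pos rfl

@[simp] theorem sgn_one : sgn Λ 1 = -1 := if_neg (by decide)

theorem zmod_two_cases (x : ZMod 2) : x = 0 ∨ x = 1 := by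
  revert x; decide

theorem sgn_add (x y : ZMod 2) : sgn Λ (x + y) = sgn Λ x * sgn Λ y := by
  rcases zmod_two_cases x with rfl | rfl <;> rcases zmod_two_cases y with rfl | rfl <;>
    simp [CharTwo.add_self_eq_zero]

@[simp] theorem sgn_mul_self (x : ZMod 2) : sgn Λ x * sgn Λ x = 1 := by
  rw [← sgn_add, CharTwo.add_self_eq_zero, sgn_zero]

theorem sgn_add_one (x : ZMod 2) : sgn Λ (x + 1) = -sgn Λ x := by
  rw [sgn_add, sgn_one, mul_neg_one]

theorem sgn_ne_zero (x : ZMod 2) : sgn Λ x ≠ 0 := by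
  intro h
  have := sgn_mul_self (Λ := Λ) x
  simp [h] at this

theorem neg_one_pow_eq_sgn (n : ℕ) : (-1 : Λ) ^ n = sgn Λ (n : ZMod 2) := by
  induction n with
  | zero => simp
  | succ n ih => rw [pow_succ, ih, Nat.cast_succ, sgn_add_one, mul_neg_one]

theorem intCast_eq_ite (n : ℤ) : (n : ZMod 2) = if Even n then 0 else 1 := by
  split_ifs with h
  · exact (ZMod.intCast_zmod_eq_zero_iff_dvd n 2).2 (even_iff_two_dvd.1 h)
  · refine (zmod_two_cases _).resolve_left fun h' => h ?_
    exact even_iff_two_dvd.2 ((ZMod.intCast_zmod_eq_zero_iff_dvd n 2).1 h')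

theorem ite_even_eq_sgn (n : ℤ) : (if Even n then 1 else -1 : Λ) = sgn Λ (n : ZMod 2) := by
  rw [intCast_eq_ite]
  split_ifs <;> simp

/-! ### Sign operators evaluated on homogeneous elements -/

namespace DGMod

theorem par_eq_sgn (K : DGMod.{v} Λ) {n : ℤ} {x : K} (hx : x ∈ K.gr n) :
    K.par x = sgn Λ (n : ZMod 2) • x := by
  rw [K.par_of_mem hx, ite_even_eq_sgn]

theorem odd_of_mem (K : DGMod.{v} Λ) {n : ℤ} {x : K} (hx : x ∈ K.gr n) :
    K.odd x = if Even n then 0 else x := by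
  rw [odd, K.scale_of_mem _ hx]; split_ifs <;> simp

theorem even_of_mem (K : DGMod.{v} Λ) {n : ℤ} {x : K} (hx : x ∈ K.gr n) :
    K.even x = if Even n then x else 0 := by
  rw [even, K.scale_of_mem _ hx]; split_ifs <;> simp

/-- Linear maps out of a complex are determined by their values on homogeneous elements. -/
theorem hom_ext (K : DGMod.{v} Λ) {M : Type*} [AddCommGroup M] [Module Λ M] {f g : K →ₗ[Λ] M}
    (h : ∀ n, ∀ x ∈ K.gr n, f x = g x) : f = g := by
  refine LinearMap.ext fun x => ?_
  induction x using K.hom_induction with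
  | h n y hy => exact h n y hy
  | h0 => simp only [map_zero]
  | ha y z hy hz => simp only [map_add, hy, hz]

theorem tensor_hom_ext (A : DGMod.{v} Λ) (B : DGMod.{v'} Λ) {M : Type*} [AddCommGroup M]
    [Module Λ M] {f g : A ⊗[Λ] B →ₗ[Λ] M}
    (h : ∀ i j, ∀ a ∈ A.gr i, ∀ b ∈ B.gr j, f (a ⊗ₜ b) = g (a ⊗ₜ b)) : f = g := by
  refine TensorProduct.ext (A.hom_ext fun i a ha => B.hom_ext fun j b hb => ?_)
  exact h i j a ha b hb

/-! ### Homogeneous elements in tensor products -/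

theorem tensor_d_tmul (A : DGMod.{v} Λ) (B : DGMod.{v'} Λ) {i : ℤ} {a : A} (ha : a ∈ A.gr i)
    (b : B) : (tensor A B).d (a ⊗ₜ b) = A.d a ⊗ₜ b + sgn Λ (i : ZMod 2) • a ⊗ₜ[Λ] B.d b := by
  change A.d a ⊗ₜ b + A.par a ⊗ₜ[Λ] B.d b = _
  rw [A.par_eq_sgn ha, TensorProduct.smul_tmul']

/-- Subtracting twice the odd-odd component negates that component and leaves the other three alone,
which is the sign with exponent i * j. -/
theorem swapSign_tmul (K : DGMod.{v} Λ) (L : DGMod.{v'} Λ) {i j : ℤ} {a : K} {b : L}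
    (ha : a ∈ K.gr i) (hb : b ∈ L.gr j) :
    swapSign K L (a ⊗ₜ b) = sgn Λ (i * j : ZMod 2) • a ⊗ₜ[Λ] b := by
  rw [swapSign, LinearMap.sub_apply, LinearMap.smul_apply, TensorProduct.map_tmul,
    LinearMap.id_apply, odd_of_mem _ ha, odd_of_mem _ hb, intCast_eq_ite, intCast_eq_ite]
  split_ifs <;> simp
  rw [two_smul]; abel

section Pi

variable {ι : Type} [Fintype ι]

theorem pi_hom_ext (A : ι → DGMod.{v} Λ) {M : Type*} [AddCommGroup M] [Module Λ M]
    {f g : (⨂[Λ] i, (A i).carrier) →ₗ[Λ] M}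
    (h : ∀ (e : ι → ℤ) (a : ∀ i, A i), (∀ i, a i ∈ (A i).gr (e i)) →
      f (PiTensorProduct.tprod Λ a) = g (PiTensorProduct.tprod Λ a)) : f = g := by
  refine LinearMap.ext fun x => ?_
  induction x using pi_induction A with
  | h e a ha => exact h e a ha
  | h0 => simp only [map_zero]
  | ha y z hy hz => simp only [map_add, hy, hz]
  | hs c y hy => simp only [map_smul, hy]

variable [LinearOrder ι]

/-- The sum of the products `e_i f_j` over the pairs `i < j`. -/
def pairSum (e f : ι → ZMod 2) : ZMod 2 := ∑ q : ι × ι with q.1 < q.2, e q.1 * f q.2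

/-- The sum of the products `e_i e_j` over the inversions of `σ`. -/
def invSum (σ : Equiv.Perm ι) (e : ι → ZMod 2) : ZMod 2 :=
  ∑ q : ι × ι with q.1 < q.2 ∧ σ q.2 < σ q.1, e q.1 * e q.2

/-- The set of the positions of odd degree. -/
def oddSet (e : ι → ℤ) : Finset ι := Finset.univ.filter fun i => ¬ Even (e i)

/-- Signs defined by counting pairs of odd positions become bilinear expressions in the degrees
modulo 2; from here on they can be handled by ring arithmetic in ZMod 2. -/
theorem card_prod_filter (e f : ι → ℤ) (P : ι × ι → Prop) [DecidablePred P] :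
    (((oddSet e ×ˢ oddSet f).filter P).card : ZMod 2) =
      ∑ q : ι × ι with P q, (e q.1 : ZMod 2) * f q.2 := by
  rw [Finset.card_eq_sum_ones, Nat.cast_sum, oddSet, oddSet, ← Finset.univ_product_univ,
    ← Finset.filter_product, Finset.filter_filter, Finset.sum_filter, Finset.sum_filter]
  refine Finset.sum_congr rfl fun q _ => ?_
  rw [intCast_eq_ite, intCast_eq_ite]
  by_cases h1 : Even (e q.1) <;> by_cases h2 : Even (f q.2) <;> by_cases h3 : P q <;>
    simp [h1, h2, h3]

/-- A homogeneous tensor has exactly one parity pattern, so each sum over subsets in `permMap`,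
`unzip` and `revSign` collapses to the single term of the odd positions. -/
theorem parityPart_tprod (A : ι → DGMod.{v} Λ) {e : ι → ℤ} {a : ∀ i, A i}
    (ha : ∀ i, a i ∈ (A i).gr (e i)) (S : Finset ι) :
    parityPart A S (PiTensorProduct.tprod Λ a) =
      if S = oddSet e then PiTensorProduct.tprod Λ a else 0 := by
  rw [parityPart, PiTensorProduct.map_tprod]
  split_ifs with h
  · congr 1
    funext i
    have hi : i ∈ S ↔ ¬ Even (e i) := by rw [h]; simp [oddSet]
    split_ifs with h'
    · rw [odd_of_mem _ (ha i), if_neg (hi.1 h')]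
    · rw [even_of_mem _ (ha i), if_pos (not_not.1 (mt hi.2 h'))]
  · have : ∃ i, ¬ (i ∈ S ↔ ¬ Even (e i)) := by
      by_contra! hc
      exact h (Finset.ext fun i => by rw [hc i]; simp [oddSet])
    obtain ⟨i, hi⟩ := this
    refine (PiTensorProduct.tprod Λ).map_coord_zero i ?_
    by_cases h1 : i ∈ S <;> by_cases h2 : Even (e i)
    · rw [if_pos h1, odd_of_mem _ (ha i), if_pos h2]
    · exact absurd (by simp [h1, h2]) hi
    · exact absurd (by simp [h1, h2]) hi
    · rw [if_neg h1, even_of_mem _ (ha i), if_neg h2]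

theorem permMap_tprod (A : ι → DGMod.{v} Λ) (σ : Equiv.Perm ι) {e : ι → ℤ} {a : ∀ i, A i}
    (ha : ∀ i, a i ∈ (A i).gr (e i)) :
    permMap A σ (PiTensorProduct.tprod Λ a) = sgn Λ (invSum σ fun i => (e i : ZMod 2)) •
      PiTensorProduct.tprod Λ fun i => a (σ.symm i) := by
  rw [permMap, LinearMap.sum_apply, Finset.sum_eq_single (oddSet e)]
  · rw [LinearMap.smul_apply, LinearMap.comp_apply, parityPart_tprod A ha, if_pos rfl,
      neg_one_pow_eq_sgn, card_prod_filter]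
    exact congrArg _ (PiTensorProduct.reindex_tprod σ a)
  · intro S _ hS
    rw [LinearMap.smul_apply, LinearMap.comp_apply, parityPart_tprod A ha, if_neg hS, map_zero,
      smul_zero]
  · exact fun h => absurd (Finset.mem_univ _) h

/-- The sign operator in the definition of `unzip`. -/
def zipSign (A : ι → DGMod.{v} Λ) (B : ι → DGMod.{v'} Λ) :
    pi A ⊗[Λ] (pi B).carrier →ₗ[Λ] pi A ⊗[Λ] (pi B).carrier :=
  ∑ S : Finset ι, ∑ T : Finset ι,
    (-1 : Λ) ^ ((T ×ˢ S).filter fun q => q.1 < q.2).card •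
      TensorProduct.map (parityPart A S) (parityPart B T)

theorem zipSign_tmul (A : ι → DGMod.{v} Λ) (B : ι → DGMod.{v'} Λ) {e f : ι → ℤ}
    {a : ∀ i, A i} {b : ∀ i, B i} (ha : ∀ i, a i ∈ (A i).gr (e i))
    (hb : ∀ i, b i ∈ (B i).gr (f i)) :
    zipSign A B (PiTensorProduct.tprod Λ a ⊗ₜ PiTensorProduct.tprod Λ b) =
      sgn Λ (pairSum (fun i => (f i : ZMod 2)) fun i => (e i : ZMod 2)) •
        PiTensorProduct.tprod Λ a ⊗ₜ[Λ] PiTensorProduct.tprod Λ b := by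
  rw [zipSign, LinearMap.sum_apply, Finset.sum_eq_single (oddSet e)]
  · rw [LinearMap.sum_apply, Finset.sum_eq_single (oddSet f)]
    · rw [LinearMap.smul_apply, TensorProduct.map_tmul, parityPart_tprod A ha, if_pos rfl,
        parityPart_tprod B hb, if_pos rfl, neg_one_pow_eq_sgn, card_prod_filter]
      rfl
    · intro T _ hT
      rw [LinearMap.smul_apply, TensorProduct.map_tmul, parityPart_tprod B hb, if_neg hT,
        TensorProduct.tmul_zero, smul_zero]
    · exact fun h => absurd (Finset.mem_univ _) h
  · intro S _ hS
    rw [LinearMap.sum_apply]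
    refine Finset.sum_eq_zero fun T _ => ?_
    rw [LinearMap.smul_apply, TensorProduct.map_tmul, parityPart_tprod A ha, if_neg hS,
        TensorProduct.zero_tmul, smul_zero]
  · exact fun h => absurd (Finset.mem_univ _) h

theorem zip_tmul (A : ι → DGMod.{v} Λ) (B : ι → DGMod.{v'} Λ) (a : ∀ i, A i) (b : ∀ i, B i) :
    zip A B (PiTensorProduct.tprod Λ a ⊗ₜ PiTensorProduct.tprod Λ b) =
      PiTensorProduct.tprod Λ fun i => a i ⊗ₜ[Λ] b i := by
  rw [zip, TensorProduct.lift.tmul, PiTensorProduct.map₂_tprod_tprod]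
  rfl

theorem unzip_tprod (A : ι → DGMod.{v} Λ) (B : ι → DGMod.{v'} Λ) {e f : ι → ℤ}
    {a : ∀ i, A i} {b : ∀ i, B i} (ha : ∀ i, a i ∈ (A i).gr (e i))
    (hb : ∀ i, b i ∈ (B i).gr (f i)) :
    unzip A B (PiTensorProduct.tprod Λ fun i => a i ⊗ₜ[Λ] b i) =
      sgn Λ (pairSum (fun i => (f i : ZMod 2)) fun i => (e i : ZMod 2)) •
        PiTensorProduct.tprod Λ a ⊗ₜ[Λ] PiTensorProduct.tprod Λ b := by
  rw [← zipSign_tmul A B ha hb, unzip, LinearMap.comp_apply]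
  refine congrArg (zipSign A B) ?_
  rw [LinearEquiv.coe_coe, LinearEquiv.symm_apply_eq]
  exact (zip_tmul A B a b).symm

/-- The inverse of `unzip`. -/
def zipS (A : ι → DGMod.{v} Λ) (B : ι → DGMod.{v'} Λ) :
    tensor (pi A) (pi B) →ₗ[Λ] pi (fun i => tensor (A i) (B i)) :=
  zip A B ∘ₗ zipSign A B

theorem zipS_tmul (A : ι → DGMod.{v} Λ) (B : ι → DGMod.{v'} Λ) {e f : ι → ℤ}
    {a : ∀ i, A i} {b : ∀ i, B i} (ha : ∀ i, a i ∈ (A i).gr (e i))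
    (hb : ∀ i, b i ∈ (B i).gr (f i)) :
    zipS A B (PiTensorProduct.tprod Λ a ⊗ₜ PiTensorProduct.tprod Λ b) =
      sgn Λ (pairSum (fun i => (f i : ZMod 2)) fun i => (e i : ZMod 2)) •
        PiTensorProduct.tprod Λ fun i => a i ⊗ₜ[Λ] b i := by
  rw [zipS, LinearMap.comp_apply, zipSign_tmul A B ha hb, map_smul, zip_tmul]

theorem tensor_pi_hom_ext (A : ι → DGMod.{v} Λ) (B : ι → DGMod.{v'} Λ) {M : Type*}
    [AddCommGroup M] [Module Λ M] {f g : pi A ⊗[Λ] (pi B).carrier →ₗ[Λ] M}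
    (h : ∀ (e k : ι → ℤ) (a : ∀ i, A i) (b : ∀ i, B i), (∀ i, a i ∈ (A i).gr (e i)) →
      (∀ i, b i ∈ (B i).gr (k i)) →
      f (PiTensorProduct.tprod Λ a ⊗ₜ PiTensorProduct.tprod Λ b) =
        g (PiTensorProduct.tprod Λ a ⊗ₜ PiTensorProduct.tprod Λ b)) : f = g := by
  refine TensorProduct.ext (pi_hom_ext A fun e a ha => pi_hom_ext B fun k b hb => ?_)
  exact h e k a b ha hb

theorem unzip_comp_zipS (A : ι → DGMod.{v} Λ) (B : ι → DGMod.{v'} Λ) :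
    unzip A B ∘ₗ zipS A B = LinearMap.id := by
  refine tensor_pi_hom_ext A B fun e f a b ha hb => ?_
  rw [LinearMap.comp_apply, zipS_tmul A B ha hb, map_smul, unzip_tprod A B ha hb, smul_smul,
    sgn_mul_self, one_smul, LinearMap.id_apply]

/-- `zipS` is surjective, because `zip` is and the sign operator is an involution; a one-sided
inverse of a surjection is two-sided. -/
theorem zipS_comp_unzip (A : ι → DGMod.{v} Λ) (B : ι → DGMod.{v'} Λ) :
    zipS A B ∘ₗ unzip A B = LinearMap.id := by
  have h : Function.Surjective (zipS A B) := by
    have hs : Function.Surjective (zipSign A B) := by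
      have : zipSign A B ∘ₗ zipSign A B = LinearMap.id := by
        refine tensor_pi_hom_ext A B fun e f a b ha hb => ?_
        rw [LinearMap.comp_apply, zipSign_tmul A B ha hb, map_smul, zipSign_tmul A B ha hb,
          smul_smul, sgn_mul_self, one_smul, LinearMap.id_apply]
      exact fun y => ⟨_, LinearMap.congr_fun this y⟩
    exact (zip_bijective A B).2.comp hs
  refine LinearMap.ext fun x => ?_
  obtain ⟨y, rfl⟩ := h x
  rw [LinearMap.comp_apply]
  exact congrArg _ (LinearMap.congr_fun (unzip_comp_zipS A B) y)

/-- Two linear maps on `⨂ (A i ⊗ B i)` agree if they agree on tensors of homogeneous elements. -/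
theorem pi_tensor_hom_ext (A : ι → DGMod.{v} Λ) (B : ι → DGMod.{v'} Λ) {M : Type*}
    [AddCommGroup M] [Module Λ M] {f g : (pi fun i => tensor (A i) (B i)).carrier →ₗ[Λ] M}
    (h : ∀ (e k : ι → ℤ) (a : ∀ i, A i) (b : ∀ i, B i), (∀ i, a i ∈ (A i).gr (e i)) →
      (∀ i, b i ∈ (B i).gr (k i)) →
      f (PiTensorProduct.tprod Λ fun i => a i ⊗ₜ[Λ] b i) =
        g (PiTensorProduct.tprod Λ fun i => a i ⊗ₜ[Λ] b i)) : f = g := by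
  have key : f ∘ₗ zip A B = g ∘ₗ zip A B := by
    refine tensor_pi_hom_ext A B fun e k a b ha hb => ?_
    rw [LinearMap.comp_apply, LinearMap.comp_apply, zip_tmul]
    exact h e k a b ha hb
  refine LinearMap.ext fun x => ?_
  obtain ⟨y, rfl⟩ := (zip_bijective A B).2 x
  exact LinearMap.congr_fun key y

theorem revSign_tprod (A : ι → DGMod.{v} Λ) {e : ι → ℤ} {a : ∀ i, A i}
    (ha : ∀ i, a i ∈ (A i).gr (e i)) :
    revSign A (PiTensorProduct.tprod Λ a) =
      sgn Λ (pairSum (fun i => (e i : ZMod 2)) fun i => (e i : ZMod 2)) •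
        PiTensorProduct.tprod Λ a := by
  rw [revSign, LinearMap.sum_apply, Finset.sum_eq_single (oddSet e)]
  · rw [LinearMap.smul_apply, parityPart_tprod A ha, if_pos rfl, neg_one_pow_eq_sgn]
    congr 2
    rw [pairSum, ← card_prod_filter]
    congr 1
    generalize oddSet e = S
    -- The binomial coefficient counts the ordered pairs i < j in the set. Adding a new maximum to s
    -- adds one pair for each element of s, matching Pascal's rule.
    induction S using Finset.induction_on_max with
    | empty => simp
    | insert a s hs ih =>
      have hns : a ∉ s := fun h => lt_irrefl _ (hs a h)
      rw [Finset.card_insert_of_notMem hns, Nat.choose_succ_succ', Nat.choose_one_right, ih]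
      have : ((insert a s ×ˢ insert a s).filter fun q : ι × ι => q.1 < q.2) =
          (s.image fun i => (i, a)) ∪
            (s ×ˢ s).filter fun q : ι × ι => q.1 < q.2 := by
        ext ⟨i, j⟩
        simp only [Finset.mem_filter, Finset.mem_product, Finset.mem_insert, Finset.mem_union,
          Finset.mem_image, Prod.mk.injEq]
        constructor
        · rintro ⟨⟨rfl | hi, rfl | hj⟩, h⟩
          · exact absurd h (lt_irrefl _)
          · exact absurd (h.trans (hs _ hj)) (lt_irrefl _)
          · exact Or.inl ⟨i, hi, rfl, rfl⟩
          · exact Or.inr ⟨⟨hi, hj⟩, h⟩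
        · rintro (⟨k, hk, rfl, rfl⟩ | ⟨⟨hi, hj⟩, h⟩)
          · exact ⟨⟨Or.inr hk, Or.inl rfl⟩, hs _ hk⟩
          · exact ⟨⟨Or.inr hi, Or.inr hj⟩, h⟩
      rw [this, Finset.card_union_of_disjoint,
        Finset.card_image_of_injective _ fun i j h => (Prod.mk.inj h).1]
      rw [Finset.disjoint_left]
      rintro ⟨i, j⟩ h1 h2
      simp only [Finset.mem_filter, Finset.mem_product, Finset.mem_image, Prod.mk.injEq] at h1 h2
      obtain ⟨k, _, rfl, rfl⟩ := h1
      exact hns h2.1.2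
  · intro S _ hS
    rw [LinearMap.smul_apply, parityPart_tprod A ha, if_neg hS, smul_zero]
  · exact fun h => absurd (Finset.mem_univ _) h

theorem piD_tprod (A : ι → DGMod.{v} Λ) {e : ι → ℤ} {a : ∀ i, A i}
    (ha : ∀ i, a i ∈ (A i).gr (e i)) (i : ι) :
    piD A i (PiTensorProduct.tprod Λ a) = sgn Λ (∑ j with j < i, (e j : ZMod 2)) •
      PiTensorProduct.tprod Λ (Function.update a i ((A i).d (a i))) := by
  rw [piD, PiTensorProduct.map_tprod]
  -- The signs of the factors before i are pulled out one at a time by multilinearity; allowing an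
  -- arbitrary set S of earlier positions makes the induction possible.
  have h : ∀ S : Finset ι, (∀ j ∈ S, j < i) →
      (PiTensorProduct.tprod Λ fun j => (if j ∈ S then (A j).par else if j = i then (A j).d
        else LinearMap.id) (a j)) = sgn Λ (∑ j ∈ S, (e j : ZMod 2)) •
      PiTensorProduct.tprod Λ (Function.update a i ((A i).d (a i))) := by
    intro S
    induction S using Finset.induction_on with
    | empty =>
      intro _
      simp only [Finset.notMem_empty, if_false, Finset.sum_empty, sgn_zero, one_smul]
      congr 1
      funext j
      by_cases hj : j = i
      · subst hj; simp
      · simp [hj]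
    | insert k S hk ih =>
      intro hS
      rw [Finset.sum_insert hk, sgn_add, mul_smul, ← ih fun j hj =>
        hS j (Finset.mem_insert_of_mem hj)]
      set b := fun j => (if j ∈ S then (A j).par else if j = i then (A j).d
        else LinearMap.id) (a j) with hb
      have hki : k ≠ i := (hS k (Finset.mem_insert_self _ _)).ne
      have hbk : b k = a k := by simp [hb, hk, hki]
      have : (fun j => (if j ∈ insert k S then (A j).par else if j = i then (A j).d
        else LinearMap.id) (a j)) =
          Function.update b k (sgn Λ (e k : ZMod 2) • b k) := by
        funext j
        by_cases hj : j = k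
        · subst hj
          rw [Function.update_self, hbk, if_pos (Finset.mem_insert_self _ _), par_eq_sgn _ (ha j)]
        · rw [Function.update_of_ne hj]
          simp [hb, hj]
      rw [this, MultilinearMap.map_update_smul, Function.update_eq_self]
  have := h (Finset.univ.filter (· < i)) (by simp)
  simp only [Finset.mem_filter, Finset.mem_univ, true_and] at this
  exact this

theorem pi_d_tprod (A : ι → DGMod.{v} Λ) {e : ι → ℤ} {a : ∀ i, A i}
    (ha : ∀ i, a i ∈ (A i).gr (e i)) :
    (pi A).d (PiTensorProduct.tprod Λ a) = ∑ i, sgn Λ (∑ j with j < i, (e j : ZMod 2)) •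
      PiTensorProduct.tprod Λ (Function.update a i ((A i).d (a i))) := by
  change (∑ i, piD A i) _ = _
  rw [LinearMap.sum_apply]
  exact Finset.sum_congr rfl fun i _ => piD_tprod A ha i

/-- The standard way to bound the degree of a map out of a tensor product: the target family S is
arbitrary, so shifts of degree are covered as well. -/
theorem pi_mem_iff_induction (A : ι → DGMod.{v} Λ) {M : Type*} [AddCommGroup M] [Module Λ M]
    (f : pi A →ₗ[Λ] M) (S : ℤ → Submodule Λ M)
    (h : ∀ (e : ι → ℤ) (a : ∀ i, A i), (∀ i, a i ∈ (A i).gr (e i)) →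
      f (PiTensorProduct.tprod Λ a) ∈ S (∑ i, e i)) {n : ℤ} {x : pi A} (hx : x ∈ (pi A).gr n) :
    f x ∈ S n := by
  change x ∈ piGr A n at hx
  induction hx using Submodule.span_induction with
  | zero => rw [map_zero]; exact Submodule.zero_mem _
  | add y z _ _ hy hz => rw [map_add]; exact Submodule.add_mem _ hy hz
  | smul c y _ hy => rw [map_smul]; exact Submodule.smul_mem _ _ hy
  | mem y hy =>
    obtain ⟨e, a, ha, rfl, rfl⟩ := hy
    exact h e a ha

theorem tensor_mem_induction (A : DGMod.{v} Λ) (B : DGMod.{v'} Λ) {M : Type*} [AddCommGroup M]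
    [Module Λ M] (f : tensor A B →ₗ[Λ] M) (S : ℤ → Submodule Λ M)
    (h : ∀ i j, ∀ a ∈ A.gr i, ∀ b ∈ B.gr j, f (a ⊗ₜ b) ∈ S (i + j)) {n : ℤ} {x : tensor A B}
    (hx : x ∈ (tensor A B).gr n) : f x ∈ S n := by
  change x ∈ tensorGr A B n at hx
  induction hx using Submodule.span_induction with
  | zero => rw [map_zero]; exact Submodule.zero_mem _
  | add y z _ _ hy hz => rw [map_add]; exact Submodule.add_mem _ hy hz
  | smul c y _ hy => rw [map_smul]; exact Submodule.smul_mem _ _ hy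
  | mem y hy =>
    obtain ⟨i, j, a, b, ha, hb, rfl, rfl⟩ := hy
    exact h i j a ha b hb

end Pi

end DGMod

end

section

/-! ### Sums over pairs -/

section Sums

variable {ι : Type} [Fintype ι] [LinearOrder ι] {M : Type*} [AddCommMonoid M]

/-- The sum of `g i j` over the pairs `i < j`. -/
def sumLt (g : ι → ι → M) : M := ∑ i, ∑ j, if i < j then g i j else 0

theorem sumLt_add (g h : ι → ι → M) :
    sumLt (fun i j => g i j + h i j) = sumLt g + sumLt h := by
  simp only [sumLt, ← Finset.sum_add_distrib]
  refine Finset.sum_congr rfl fun i _ => Finset.sum_congr rfl fun j _ => ?_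
  split_ifs <;> simp

theorem sumLt_congr {g h : ι → ι → M} (H : ∀ i j, i < j → g i j = h i j) : sumLt g = sumLt h := by
  refine Finset.sum_congr rfl fun i _ => Finset.sum_congr rfl fun j _ => ?_
  split_ifs with hij
  · exact H i j hij
  · rfl

/-- For symmetric g this is a sum over unordered pairs, which a permutation only rearranges. Both
sides split into the pairs kept and the pairs inverted by τ. -/
theorem sumLt_perm (g : ι → ι → M) (hg : ∀ i j, g i j = g j i) (τ : Equiv.Perm ι) :
    sumLt (fun i j => g (τ i) (τ j)) = sumLt g := by
  have h1 : sumLt (fun i j => g (τ i) (τ j)) =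
      (∑ i, ∑ j, if i < j ∧ τ i < τ j then g (τ i) (τ j) else 0) +
        ∑ i, ∑ j, if i < j ∧ τ j < τ i then g (τ j) (τ i) else 0 := by
    simp only [sumLt, ← Finset.sum_add_distrib]
    refine Finset.sum_congr rfl fun i _ => Finset.sum_congr rfl fun j _ => ?_
    by_cases hij : i < j
    · rcases lt_trichotomy (τ i) (τ j) with h | h | h
      · simp [hij, h, h.not_gt]
      · exact absurd (τ.injective h) hij.ne
      · simp [hij, h, h.not_gt, hg (τ j)]
    · simp [hij]
  have h2 : sumLt g = (∑ i, ∑ j, if i < j ∧ τ i < τ j then g (τ i) (τ j) else 0) +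
      ∑ i, ∑ j, if j < i ∧ τ i < τ j then g (τ i) (τ j) else 0 := by
    have : sumLt g = ∑ i, ∑ j, if τ i < τ j then g (τ i) (τ j) else 0 := by
      rw [sumLt, ← Equiv.sum_comp τ]
      exact Finset.sum_congr rfl fun i _ => (Equiv.sum_comp τ _).symm
    simp only [this, ← Finset.sum_add_distrib]
    refine Finset.sum_congr rfl fun i _ => Finset.sum_congr rfl fun j _ => ?_
    by_cases hij : τ i < τ j
    · rcases lt_trichotomy i j with h | h | h
      · simp [hij, h, h.not_gt]
      · exact absurd (congrArg τ h) hij.ne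
      · simp [hij, h, h.not_gt]
    · simp [hij]
  rw [h1, h2]
  congr 1
  exact Finset.sum_comm

theorem sumLt_add_swap (g : ι → ι → M) (h : ∀ i, g i i = 0) :
    sumLt (fun i j => g i j + g j i) = ∑ i, ∑ j, g i j := by
  rw [sumLt_add]
  have : sumLt (fun i j => g j i) = ∑ i, ∑ j, if j < i then g i j else 0 := Finset.sum_comm
  rw [this, sumLt, ← Finset.sum_add_distrib]
  refine Finset.sum_congr rfl fun i _ => ?_
  rw [← Finset.sum_add_distrib]
  refine Finset.sum_congr rfl fun j _ => ?_
  rcases lt_trichotomy i j with hij | rfl | hij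
  · simp [hij, hij.not_gt]
  · simp [h]
  · simp [hij, hij.not_gt]

theorem sum_lex {κ : Type} [Fintype κ] [LinearOrder κ] (f : ι ×ₗ κ → M) :
    ∑ q, f q = ∑ i, ∑ j, f (toLex (i, j)) := by
  rw [← Equiv.sum_comp toLex, Fintype.sum_prod_type]

/-- Signs on p² factors separate into a part between blocks and a part inside each block. -/
theorem sumLt_lex {κ : Type} [Fintype κ] [LinearOrder κ] (g : ι ×ₗ κ → ι ×ₗ κ → M) :
    sumLt g = sumLt (fun i i' => ∑ j, ∑ j', g (toLex (i, j)) (toLex (i', j'))) +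
      ∑ i, sumLt fun j j' => g (toLex (i, j)) (toLex (i, j')) := by
  simp only [sumLt, sum_lex, ← Finset.sum_add_distrib, Prod.Lex.toLex_lt_toLex]
  refine Finset.sum_congr rfl fun i _ => ?_
  rw [Finset.sum_comm]
  have h : ∀ i', (∑ j, ∑ j', if i < i' ∨ i = i' ∧ j < j' then g (toLex (i, j)) (toLex (i', j'))
      else 0) = (if i < i' then ∑ j, ∑ j', g (toLex (i, j)) (toLex (i', j')) else 0) +
      if i = i' then ∑ j, ∑ j', (if j < j' then g (toLex (i, j)) (toLex (i', j')) else 0)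
        else 0 := by
    intro i'
    by_cases h1 : i < i'
    · simp [h1, h1.ne]
    · by_cases h2 : i = i'
      · simp [h2]
      · simp [h1, h2]
  rw [Finset.sum_congr rfl fun i' _ => h i', Finset.sum_add_distrib]
  simp

end Sums

/-! ### Inversion parities and the Koszul sign cocycle -/

section Inv

variable {ι : Type} [Fintype ι] [LinearOrder ι]

/-- The parity of the number of inversions of `σ` on the pair `{i, j}`. -/
def inv (σ : Equiv.Perm ι) (i j : ι) : ZMod 2 := if i < j ↔ σ i < σ j then 0 else 1

theorem inv_comm (σ : Equiv.Perm ι) (i j : ι) : inv σ i j = inv σ j i := by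
  unfold inv
  rcases lt_trichotomy i j with h | rfl | h
  · rcases lt_trichotomy (σ i) (σ j) with h' | h' | h'
    · simp [h, h', h.not_gt, h'.not_gt]
    · exact absurd (σ.injective h') h.ne
    · simp [h, h', h.not_gt, h'.not_gt]
  · rfl
  · rcases lt_trichotomy (σ i) (σ j) with h' | h' | h'
    · simp [h, h', h.not_gt, h'.not_gt]
    · exact absurd (σ.injective h') h.ne'
    · simp [h, h', h.not_gt, h'.not_gt]

theorem inv_self (σ : Equiv.Perm ι) (i : ι) : inv σ i i = 0 := by simp [inv]

/-- A pair is inverted by the composite exactly when one, and only one, of the two steps inverts it.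
-/
theorem inv_mul (σ τ : Equiv.Perm ι) (i j : ι) :
    inv (σ * τ) i j = inv τ i j + inv σ (τ i) (τ j) := by
  unfold inv
  by_cases h1 : i < j <;> by_cases h2 : τ i < τ j <;> by_cases h3 : σ (τ i) < σ (τ j) <;>
    simp [h1, h2, h3, CharTwo.add_self_eq_zero]

theorem invSum_eq (σ : Equiv.Perm ι) (e : ι → ZMod 2) :
    DGMod.invSum σ e = sumLt fun i j => inv σ i j * (e i * e j) := by
  rw [DGMod.invSum, Finset.sum_filter, Fintype.sum_prod_type]
  refine Finset.sum_congr rfl fun i _ => Finset.sum_congr rfl fun j _ => ?_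
  by_cases h : i < j
  · rcases lt_trichotomy (σ i) (σ j) with h' | h' | h'
    · simp [h, h', h'.not_gt, inv]
    · exact absurd (σ.injective h') h.ne
    · simp [h, h', h'.not_gt, inv]
  · simp [h]

theorem pairSum_eq (e f : ι → ZMod 2) :
    DGMod.pairSum e f = sumLt fun i j => e i * f j := by
  rw [DGMod.pairSum, Finset.sum_filter, Fintype.sum_prod_type]
  rfl

/-- The cocycle identity of the Koszul signs; it is what makes signed permutation of tensor factors
a group action. -/
theorem invSum_mul (σ τ : Equiv.Perm ι) (e : ι → ZMod 2) :
    DGMod.invSum (σ * τ) e = DGMod.invSum τ e + DGMod.invSum σ (fun i => e (τ.symm i)) := by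
  rw [invSum_eq, invSum_eq, invSum_eq, ← sumLt_perm
    (fun i j => inv σ i j * (e (τ.symm i) * e (τ.symm j)))
    (fun i j => by rw [inv_comm, mul_comm (e _)]) τ, ← sumLt_add]
  refine sumLt_congr fun i j _ => ?_
  rw [inv_mul, Equiv.symm_apply_apply, Equiv.symm_apply_apply]
  ring

/-- Applying the differential to the i-th factor raises one degree by 1. This lemma and the two
similar ones below record how the sign exponents react. -/
theorem invSum_add_single (σ : Equiv.Perm ι) (e : ι → ZMod 2) (i : ι) :
    DGMod.invSum σ (e + Pi.single i 1) = DGMod.invSum σ e + ∑ j, inv σ i j * e j := by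
  have h : ∑ a, ∑ b, inv σ a b * ((Pi.single i 1 : ι → ZMod 2) a * e b) =
      ∑ j, inv σ i j * e j := by
    rw [Finset.sum_eq_single i]
    · simp
    · intro a _ ha
      simp [Pi.single_eq_of_ne ha]
    · exact fun h => absurd (Finset.mem_univ _) h
  rw [← h, ← sumLt_add_swap _ (fun a => by rw [inv_self, zero_mul]), invSum_eq, invSum_eq,
    ← sumLt_add]
  refine sumLt_congr fun a b hab => ?_
  have hs : (Pi.single i 1 : ι → ZMod 2) a * (Pi.single i 1 : ι → ZMod 2) b = 0 := by
    by_cases ha : a = i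
    · subst ha; rw [Pi.single_eq_of_ne hab.ne', mul_zero]
    · rw [Pi.single_eq_of_ne ha, zero_mul]
  rw [inv_comm σ b a, Pi.add_apply, Pi.add_apply]
  linear_combination inv σ a b * hs

theorem pairSum_add_single_left (e f : ι → ZMod 2) (i : ι) :
    DGMod.pairSum (e + Pi.single i 1) f = DGMod.pairSum e f + ∑ j with i < j, f j := by
  have h : (sumLt fun a b => (Pi.single i 1 : ι → ZMod 2) a * f b) = ∑ j with i < j, f j := by
    rw [sumLt, Finset.sum_eq_single i]
    · simp [Finset.sum_filter]
    · intro a _ ha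
      simp [Pi.single_eq_of_ne ha]
    · exact fun h => absurd (Finset.mem_univ _) h
  rw [← h, pairSum_eq, pairSum_eq, ← sumLt_add]
  exact sumLt_congr fun a b _ => by rw [Pi.add_apply]; ring

theorem pairSum_add_single_right (e f : ι → ZMod 2) (i : ι) :
    DGMod.pairSum e (f + Pi.single i 1) = DGMod.pairSum e f + ∑ j with j < i, e j := by
  have h : (sumLt fun a b => e a * (Pi.single i 1 : ι → ZMod 2) b) = ∑ j with j < i, e j := by
    rw [sumLt, Finset.sum_comm, Finset.sum_eq_single i]
    · simp [Finset.sum_filter]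
    · intro a _ ha
      simp [Pi.single_eq_of_ne ha]
    · exact fun h => absurd (Finset.mem_univ _) h
  rw [← h, pairSum_eq, pairSum_eq, ← sumLt_add]
  exact sumLt_congr fun a b _ => by rw [Pi.add_apply]; ring

theorem sum_split (e : ι → ZMod 2) (i : ι) :
    ∑ j, e j = (∑ j with j < i, e j) + e i + ∑ j with i < j, e j := by
  have : e i = ∑ j with j = i, e j := by rw [Finset.sum_filter]; simp
  rw [this, Finset.sum_filter, Finset.sum_filter, Finset.sum_filter, ← Finset.sum_add_distrib,
    ← Finset.sum_add_distrib]
  refine Finset.sum_congr rfl fun j _ => ?_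
  rcases lt_trichotomy j i with h | rfl | h
  · simp [h, h.ne, h.not_gt]
  · simp
  · simp [h, h.ne', h.not_gt]

theorem cast_update (e : ι → ℤ) (i : ι) :
    (fun j => ((Function.update e i (e i + 1) j : ℤ) : ZMod 2)) =
      (fun j => (e j : ZMod 2)) + Pi.single i 1 := by
  funext j
  by_cases h : j = i
  · subst h; simp
  · simp [h]

/-- The factors standing before position σ i after the permutation are those that stood before i,
except that every factor whose order relative to i is reversed changes sides. This is the whole sign
content of `isChainMap_powPerm`. -/
theorem invSum_rotate_aux (σ : Equiv.Perm ι) (e : ι → ZMod 2) (i : ι) :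
    (∑ j, inv σ i j * e j) + ∑ j with j < i, e j = ∑ j with j < σ i, e (σ.symm j) := by
  rw [Finset.sum_filter, Finset.sum_filter, ← Finset.sum_add_distrib,
    ← Equiv.sum_comp σ fun j => if j < σ i then e (σ.symm j) else 0]
  refine Finset.sum_congr rfl fun j _ => ?_
  rw [Equiv.symm_apply_apply]
  have h2 : e j + e j = 0 := CharTwo.add_self_eq_zero _
  rcases lt_trichotomy i j with h | rfl | h
  · rcases lt_trichotomy (σ i) (σ j) with h' | h' | h'
    · simp [h, h', h.not_gt, h'.not_gt, inv]
    · exact absurd (σ.injective h') h.ne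
    · simp [h, h', h.not_gt, h'.not_gt, inv]
  · simp [inv]
  · rcases lt_trichotomy (σ i) (σ j) with h' | h' | h'
    · simp [h, h', h.not_gt, h'.not_gt, inv, h2]
    · exact absurd (σ.injective h') h.ne'
    · simp [h, h', h.not_gt, h'.not_gt, inv]

end Inv

namespace DGMod

/-! ### Maps of degree `0` and chain maps -/

theorem IsChainMap.comp {A : DGMod.{v} Λ} {B : DGMod.{v'} Λ} {C : DGMod.{w} Λ} {g : B →ₗ[Λ] C}
    {f : A →ₗ[Λ] B} (hg : IsChainMap B C g) (hf : IsChainMap A B f) : IsChainMap A C (g ∘ₗ f) :=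
  ⟨fun n x hx => hg.degree n _ (hf.degree n x hx), fun x => by
    rw [LinearMap.comp_apply, hf.comm, hg.comm]; rfl⟩

theorem IsChainMap.id (A : DGMod.{v} Λ) : IsChainMap A A LinearMap.id :=
  ⟨fun _ _ hx => hx, fun _ => rfl⟩

/-- The projection to degree n is itself a `scale` operator, so its fixed points are homogeneous.
Degrees of maps can then be tested by commutation with `scale`. -/
theorem mem_gr_of_scale (A : DGMod.{v} Λ) {n : ℤ} {x : A}
    (h : A.scale (fun m => if m = n then 1 else 0) x = x) : x ∈ A.gr n := by
  rw [← h]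
  clear h
  induction x using A.hom_induction with
  | h m y hy =>
    rw [A.scale_of_mem _ hy]
    split_ifs with h
    · subst h; exact Submodule.smul_mem _ _ hy
    · rw [zero_smul]; exact Submodule.zero_mem _
  | h0 => rw [map_zero]; exact Submodule.zero_mem _
  | ha y z hy hz => rw [map_add]; exact Submodule.add_mem _ hy hz

/-- A linear map that commutes with the operators `scale c` has degree `0`. -/
theorem degree_of_comm_scale {A : DGMod.{v} Λ} {B : DGMod.{v'} Λ} (f : A →ₗ[Λ] B)
    (h : ∀ c, f ∘ₗ A.scale c = B.scale c ∘ₗ f) {n : ℤ} {x : A} (hx : x ∈ A.gr n) :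
    f x ∈ B.gr n := by
  refine B.mem_gr_of_scale ?_
  rw [← LinearMap.comp_apply, ← h, LinearMap.comp_apply, A.scale_of_mem _ hx, if_pos rfl, one_smul]

theorem tensorMap_mem {A A' : DGMod.{v} Λ} {B B' : DGMod.{v'} Λ} {f : A →ₗ[Λ] A'} {g : B →ₗ[Λ] B'}
    (hf : ∀ n, ∀ x ∈ A.gr n, f x ∈ A'.gr n) (hg : ∀ n, ∀ x ∈ B.gr n, g x ∈ B'.gr n) {n : ℤ}
    {x : A ⊗[Λ] B} (hx : x ∈ tensorGr A B n) : TensorProduct.map f g x ∈ tensorGr A' B' n :=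
  tensor_mem_induction A B (TensorProduct.map f g) (tensorGr A' B')
    (fun _ _ _ ha _ hb => tmul_mem_tensorGr A' B' (hf _ _ ha) (hg _ _ hb)) hx

theorem IsChainMap.tensorMap {A : DGMod.{v} Λ} {A' : DGMod.{w} Λ} {B : DGMod.{v'} Λ}
    {B' : DGMod.{w'} Λ} {f : A →ₗ[Λ] A'}
    {g : B →ₗ[Λ] B'} (hf : IsChainMap A A' f) (hg : IsChainMap B B' g) :
    IsChainMap (tensor A B) (tensor A' B') (TensorProduct.map f g) := by
  refine ⟨fun n x hx => tensor_mem_induction A B (TensorProduct.map f g) (tensorGr A' B')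
    (fun _ _ _ ha _ hb => tmul_mem_tensorGr A' B' (hf.degree _ _ ha) (hg.degree _ _ hb)) hx, ?_⟩
  refine LinearMap.congr_fun (f := TensorProduct.map f g ∘ₗ (tensor A B).d)
    (g := (tensor A' B').d ∘ₗ TensorProduct.map f g) ?_
  refine tensor_hom_ext A B fun i j a ha b hb => ?_
  rw [LinearMap.comp_apply, LinearMap.comp_apply, tensor_d_tmul A B ha, TensorProduct.map_tmul,
    tensor_d_tmul A' B' (hf.degree _ _ ha), map_add, map_smul, TensorProduct.map_tmul,
    TensorProduct.map_tmul, hf.comm, hg.comm]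

section Pi

variable {ι : Type} [Fintype ι] [LinearOrder ι]

theorem update_mem (A : ι → DGMod.{v} Λ) {e : ι → ℤ} {a : ∀ i, A i}
    (ha : ∀ i, a i ∈ (A i).gr (e i)) (i : ι) (j : ι) :
    Function.update a i ((A i).d (a i)) j ∈ (A j).gr (Function.update e i (e i + 1) j) := by
  by_cases h : j = i
  · subst h; simpa using (A j).d_mem (ha j)
  · simpa [h] using ha j

theorem piMap_mem {A : ι → DGMod.{v} Λ} {B : ι → DGMod.{v'} Λ} {f : ∀ i, A i →ₗ[Λ] B i}
    (hf : ∀ i n, ∀ x ∈ (A i).gr n, f i x ∈ (B i).gr n) {n : ℤ} {x : pi A} (hx : x ∈ (pi A).gr n) :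
    PiTensorProduct.map f x ∈ (pi B).gr n :=
  pi_mem_iff_induction A (PiTensorProduct.map f) (piGr B) (fun e a ha => by
    rw [PiTensorProduct.map_tprod]; exact tprod_mem_piGr B fun i => hf i _ _ (ha i)) hx

theorem IsChainMap.piMap {A : ι → DGMod.{v} Λ} {B : ι → DGMod.{v'} Λ} {f : ∀ i, A i →ₗ[Λ] B i}
    (hf : ∀ i, IsChainMap (A i) (B i) (f i)) :
    IsChainMap (pi A) (pi B) (PiTensorProduct.map f) := by
  refine ⟨fun n x hx => piMap_mem (fun i => (hf i).degree) hx, ?_⟩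
  refine LinearMap.congr_fun (f := PiTensorProduct.map f ∘ₗ (pi A).d)
    (g := (pi B).d ∘ₗ PiTensorProduct.map f) (pi_hom_ext A fun e a ha => ?_)
  rw [LinearMap.comp_apply, LinearMap.comp_apply, pi_d_tprod A ha, PiTensorProduct.map_tprod,
    pi_d_tprod B fun i => (hf i).degree _ _ (ha i), map_sum]
  refine Finset.sum_congr rfl fun i _ => ?_
  rw [map_smul, PiTensorProduct.map_tprod]
  congr 2
  funext j
  by_cases h : j = i
  · subst h; simp [(hf j).comm]
  · simp [h]

theorem permMap_natural {A : ι → DGMod.{v} Λ} {B : ι → DGMod.{v'} Λ} {f : ∀ i, A i →ₗ[Λ] B i}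
    (hf : ∀ i n, ∀ x ∈ (A i).gr n, f i x ∈ (B i).gr n) (σ : Equiv.Perm ι) :
    PiTensorProduct.map (fun i => f (σ.symm i)) ∘ₗ permMap A σ =
      permMap B σ ∘ₗ PiTensorProduct.map f := by
  refine pi_hom_ext A fun e a ha => ?_
  rw [LinearMap.comp_apply, LinearMap.comp_apply, permMap_tprod A σ ha, PiTensorProduct.map_tprod,
    permMap_tprod B σ fun i => hf i _ _ (ha i), map_smul]
  exact congrArg _ (PiTensorProduct.map_tprod _ _)

variable (K : DGMod.{v} Λ)

/-- The action of a permutation on a tensor power. -/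
abbrev powPerm (σ : Equiv.Perm ι) : pow K ι →ₗ[Λ] pow K ι := permMap (fun _ => K) σ

theorem powPerm_tprod (σ : Equiv.Perm ι) {e : ι → ℤ} {a : ι → K} (ha : ∀ i, a i ∈ K.gr (e i)) :
    powPerm K σ (PiTensorProduct.tprod Λ a) = sgn Λ (invSum σ fun i => (e i : ZMod 2)) •
      PiTensorProduct.tprod Λ fun i => a (σ.symm i) :=
  permMap_tprod (fun _ => K) σ ha

theorem powPerm_mul (σ τ : Equiv.Perm ι) : powPerm K (σ * τ) = powPerm K σ ∘ₗ powPerm K τ := by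
  refine pi_hom_ext _ fun e a ha => ?_
  rw [LinearMap.comp_apply, powPerm_tprod K _ ha, powPerm_tprod K _ ha, map_smul,
    powPerm_tprod K σ (e := fun i => e (τ.symm i)) (fun i => ha _), smul_smul, ← sgn_add,
    invSum_mul]
  rfl

theorem powPerm_one : powPerm K (1 : Equiv.Perm ι) = LinearMap.id := by
  refine pi_hom_ext _ fun e a ha => ?_
  rw [powPerm_tprod K _ ha, invSum_eq]
  have : (fun i j : ι => inv (1 : Equiv.Perm ι) i j * ((e i : ZMod 2) * e j)) = 0 := by
    funext i j; simp [inv]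
  rw [this]
  simp [sumLt]
  rfl

theorem powPerm_natural {K : DGMod.{v} Λ} {L : DGMod.{v'} Λ} {f : K →ₗ[Λ] L}
    (hf : ∀ n, ∀ x ∈ K.gr n, f x ∈ L.gr n) (σ : Equiv.Perm ι) :
    PiTensorProduct.map (fun _ => f) ∘ₗ powPerm K σ =
      powPerm L σ ∘ₗ PiTensorProduct.map (fun _ => f) :=
  permMap_natural (A := fun _ => K) (B := fun _ => L) (fun _ => hf) σ

/-- The summand differentiating factor i corresponds to the one differentiating position σ i after
permuting, and the signs agree by `invSum_rotate_aux`. -/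
theorem isChainMap_powPerm (σ : Equiv.Perm ι) : IsChainMap (pow K ι) (pow K ι) (powPerm K σ) := by
  constructor
  · intro n x hx
    refine pi_mem_iff_induction _ (powPerm K σ) (piGr fun _ => K) (fun e a ha => ?_) hx
    rw [powPerm_tprod K σ ha]
    have h := tprod_mem_piGr (fun _ : ι => K) (e := fun i => e (σ.symm i))
      (a := fun i => a (σ.symm i)) fun i => ha _
    rw [Equiv.sum_comp σ.symm e] at h
    exact Submodule.smul_mem _ _ h
  · refine LinearMap.congr_fun (f := powPerm K σ ∘ₗ (pow K ι).d)
      (g := (pow K ι).d ∘ₗ powPerm K σ) (pi_hom_ext _ fun e a ha => ?_)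
    rw [LinearMap.comp_apply, LinearMap.comp_apply, pi_d_tprod _ ha, powPerm_tprod K σ ha,
      map_smul, pi_d_tprod (fun _ => K) (e := fun i => e (σ.symm i)) fun i => ha _, map_sum,
      Finset.smul_sum, ← Equiv.sum_comp σ fun i => sgn Λ (invSum σ fun i => (e i : ZMod 2)) •
        sgn Λ (∑ j with j < i, (e (σ.symm j) : ZMod 2)) • PiTensorProduct.tprod Λ
          (Function.update (fun k => a (σ.symm k)) i (K.d (a (σ.symm i))))]
    refine Finset.sum_congr rfl fun i _ => ?_
    rw [map_smul, powPerm_tprod K σ (update_mem (fun _ => K) ha i), smul_smul, smul_smul,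
      cast_update, invSum_add_single, ← sgn_add, ← sgn_add]
    have : (fun k => Function.update a i (K.d (a i)) (σ.symm k)) =
        Function.update (fun k => a (σ.symm k)) (σ i) (K.d (a (σ.symm (σ i)))) := by
      funext k
      by_cases h : k = σ i
      · subst h; simp
      · rw [Function.update_of_ne h, Function.update_of_ne]
        rintro rfl
        exact h (by simp)
    rw [this, ← invSum_rotate_aux σ (fun j => (e j : ZMod 2)) i]
    congr 2
    ring

/-! ### Shuffles -/

variable (A : ι → DGMod.{v} Λ) (B : ι → DGMod.{v'} Λ)

/-- For each i, the differential of a_i ⊗ b_i has a term in d a_i and a term in d b_i; these match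
the i-th terms of the differentials of the two separated tensor products, with equal signs. -/
theorem isChainMap_unzip :
    IsChainMap (pi fun i => tensor (A i) (B i)) (tensor (pi A) (pi B)) (unzip A B) := by
  have hcomm : unzip A B ∘ₗ (pi fun i => tensor (A i) (B i)).d =
      (tensor (pi A) (pi B)).d ∘ₗ unzip A B := by
    refine pi_tensor_hom_ext A B fun e f a b ha hb => ?_
    have hab : ∀ i, a i ⊗ₜ[Λ] b i ∈ (tensor (A i) (B i)).gr (e i + f i) :=
      fun i => tmul_mem_tensorGr _ _ (ha i) (hb i)
    rw [LinearMap.comp_apply, LinearMap.comp_apply, unzip_tprod A B ha hb,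
      pi_d_tprod (fun i => tensor (A i) (B i)) hab, map_smul,
      tensor_d_tmul _ _ (tprod_mem_piGr A ha), pi_d_tprod A ha, pi_d_tprod B hb, map_sum,
      TensorProduct.sum_tmul, TensorProduct.tmul_sum, Finset.smul_sum, smul_add, Finset.smul_sum,
      Finset.smul_sum, ← Finset.sum_add_distrib]
    refine Finset.sum_congr rfl fun i _ => ?_
    have h1 : (PiTensorProduct.tprod Λ) (Function.update (fun i => a i ⊗ₜ[Λ] b i) i
        ((tensor (A i) (B i)).d (a i ⊗ₜ[Λ] b i))) =
        PiTensorProduct.tprod Λ (fun j => Function.update a i ((A i).d (a i)) j ⊗ₜ[Λ] b j) +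
        sgn Λ (e i : ZMod 2) •
          PiTensorProduct.tprod Λ (fun j => a j ⊗ₜ[Λ] Function.update b i ((B i).d (b i)) j) := by
      rw [tensor_d_tmul _ _ (ha i), MultilinearMap.map_update_add, MultilinearMap.map_update_smul]
      congr 2
      · funext j
        by_cases h : j = i
        · subst h; simp
        · simp [h]
      · congr 1
        funext j
        by_cases h : j = i
        · subst h; simp
        · simp [h]
    rw [h1, map_smul, map_add, map_smul, unzip_tprod A B (update_mem A ha i) hb,
      unzip_tprod A B ha (update_mem B hb i), cast_update, cast_update, pairSum_add_single_left,
      pairSum_add_single_right]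
    simp only [← TensorProduct.smul_tmul', TensorProduct.tmul_smul, smul_add, smul_smul, ← sgn_add,
      Int.cast_sum]
    rw [sum_split (fun j => (e j : ZMod 2)) i]
    have h2 : ∀ x : ZMod 2, x + x = 0 := fun x => CharTwo.add_self_eq_zero x
    simp only [Int.cast_add, Finset.sum_add_distrib]
    congr 3
    -- The degrees of the b_j with j < i occur twice: once from the Leibniz sign and once from
    -- moving d a_i past them.
    · linear_combination h2 (∑ j with j < i, (f j : ZMod 2))
    · ring
  refine ⟨fun n x hx => ?_, LinearMap.congr_fun hcomm⟩
  -- The graded pieces are spanned by tensors of homogeneous elements of A i ⊗ B i, not visibly by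
  -- tensors of pure ones. Commutation with `scale` is a linear identity and may be checked on the
  -- pure ones.
  refine degree_of_comm_scale (unzip A B) (fun c => ?_) hx
  refine pi_tensor_hom_ext A B fun e f a b ha hb => ?_
  have hab : ∀ i, a i ⊗ₜ[Λ] b i ∈ (tensor (A i) (B i)).gr (e i + f i) :=
    fun i => tmul_mem_tensorGr _ _ (ha i) (hb i)
  rw [LinearMap.comp_apply, LinearMap.comp_apply, scale_of_mem _ c (tprod_mem_piGr _ hab),
    unzip_tprod A B ha hb, map_smul, unzip_tprod A B ha hb, map_smul,
    scale_of_mem _ c (tmul_mem_tensorGr _ _ (tprod_mem_piGr A ha) (tprod_mem_piGr B hb)),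
    Finset.sum_add_distrib, smul_comm]

end Pi

end DGMod

end

/-! ### Shuffles, permutations and naturality -/

section

namespace DGMod

variable {ι κ : Type} [Fintype ι] [LinearOrder ι] [Fintype κ] [LinearOrder κ]

/-- The inverse of an isomorphism of complexes is again a morphism. -/
theorem isChainMap_zipS (A : ι → DGMod.{v} Λ) (B : ι → DGMod.{v'} Λ) :
    IsChainMap (tensor (pi A) (pi B)) (pi fun i => tensor (A i) (B i)) (zipS A B) := by
  have hu := isChainMap_unzip A B
  have h1 : ∀ x, unzip A B (zipS A B x) = x := LinearMap.congr_fun (unzip_comp_zipS A B)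
  have h2 : ∀ x, zipS A B (unzip A B x) = x := LinearMap.congr_fun (zipS_comp_unzip A B)
  constructor
  · intro n x hx
    refine degree_of_comm_scale (zipS A B) (fun c => ?_) hx
    refine LinearMap.ext fun y => ?_
    rw [← h1 y]
    generalize zipS A B y = z
    rw [LinearMap.comp_apply, LinearMap.comp_apply, h2, ← scale_comm _ hu.degree, h2]
  · intro x
    rw [← h1 x]
    generalize zipS A B x = z
    rw [h2, ← hu.comm, h2]

/-- Permuting the pairs and then separating them has the same sign as separating first. The
discrepancy of both sides is carried by the mixed terms e_i f_j + e_j f_i over the inverted pairs.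
-/
theorem pairSum_perm_add (σ : Equiv.Perm ι) (e f : ι → ZMod 2) :
    invSum σ (e + f) + pairSum (fun i => f (σ.symm i)) (fun i => e (σ.symm i)) =
      invSum σ e + invSum σ f + pairSum f e := by
  have h1 : pairSum (fun i => f (σ.symm i)) (fun i => e (σ.symm i)) + pairSum f e =
      sumLt fun i j => inv σ i j * (e i * f j + e j * f i) := by
    have h2 : pairSum (fun i => f (σ.symm i)) (fun i => e (σ.symm i)) =
        ∑ i, ∑ j, if σ i < σ j then f i * e j else 0 := by
      rw [pairSum_eq, sumLt, ← Equiv.sum_comp σ]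
      refine Finset.sum_congr rfl fun i _ => ?_
      rw [← Equiv.sum_comp σ]
      simp
    have h3 : (sumLt fun i j => inv σ i j * (e i * f j + e j * f i)) =
        ∑ i, ∑ j, inv σ i j * (f i * e j) := by
      rw [← sumLt_add_swap _ (fun i => by rw [inv_self, zero_mul])]
      exact sumLt_congr fun i j _ => by rw [inv_comm σ j i]; ring
    rw [h2, h3, pairSum_eq, sumLt, ← Finset.sum_add_distrib]
    refine Finset.sum_congr rfl fun i _ => ?_
    rw [← Finset.sum_add_distrib]
    refine Finset.sum_congr rfl fun j _ => ?_
    unfold inv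
    by_cases h4 : i < j <;> by_cases h5 : σ i < σ j <;> simp [h4, h5, CharTwo.add_self_eq_zero]
  have h6 : invSum σ (e + f) = invSum σ e + invSum σ f +
      sumLt fun i j => inv σ i j * (e i * f j + e j * f i) := by
    rw [invSum_eq, invSum_eq, invSum_eq, ← sumLt_add, ← sumLt_add]
    exact sumLt_congr fun i j _ => by simp only [Pi.add_apply]; ring
  rw [h6, ← h1]
  have h7 : ∀ x : ZMod 2, x + x = 0 := fun x => CharTwo.add_self_eq_zero x
  linear_combination h7 (pairSum (fun i => f (σ.symm i)) (fun i => e (σ.symm i)))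

theorem unzip_powPerm (A : DGMod.{v} Λ) (B : DGMod.{v'} Λ) (σ : Equiv.Perm ι) :
    unzip (fun _ => A) (fun _ => B) ∘ₗ powPerm (tensor A B) σ =
      TensorProduct.map (powPerm A σ) (powPerm B σ) ∘ₗ unzip (fun _ => A) (fun _ => B) := by
  refine pi_tensor_hom_ext _ _ fun e f a b ha hb => ?_
  have hab : ∀ i, a i ⊗ₜ[Λ] b i ∈ (tensor A B).gr (e i + f i) :=
    fun i => tmul_mem_tensorGr _ _ (ha i) (hb i)
  rw [LinearMap.comp_apply, LinearMap.comp_apply, powPerm_tprod _ σ hab, map_smul,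
    unzip_tprod (fun _ => A) (fun _ => B) (e := fun i => e (σ.symm i)) (f := fun i => f (σ.symm i))
      (fun i => ha _) (fun i => hb _), unzip_tprod _ _ ha hb, map_smul, TensorProduct.map_tmul,
    powPerm_tprod A σ ha, powPerm_tprod B σ hb]
  simp only [← TensorProduct.smul_tmul', TensorProduct.tmul_smul, smul_smul, ← sgn_add,
    Int.cast_add]
  have := pairSum_perm_add σ (fun i => (e i : ZMod 2)) (fun i => (f i : ZMod 2))
  congr 2
  linear_combination this

theorem unzip_map {A A' : ι → DGMod.{v} Λ} {B B' : ι → DGMod.{v'} Λ} (f : ∀ i, A i →ₗ[Λ] A' i)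
    (g : ∀ i, B i →ₗ[Λ] B' i) (hf : ∀ i n, ∀ x ∈ (A i).gr n, f i x ∈ (A' i).gr n)
    (hg : ∀ i n, ∀ x ∈ (B i).gr n, g i x ∈ (B' i).gr n) :
    unzip A' B' ∘ₗ PiTensorProduct.map (fun i => TensorProduct.map (f i) (g i)) =
      TensorProduct.map (PiTensorProduct.map f) (PiTensorProduct.map g) ∘ₗ unzip A B := by
  refine pi_tensor_hom_ext _ _ fun e k a b ha hb => ?_
  rw [LinearMap.comp_apply, LinearMap.comp_apply, PiTensorProduct.map_tprod,
    unzip_tprod A B ha hb, map_smul, TensorProduct.map_tmul, PiTensorProduct.map_tprod,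
    PiTensorProduct.map_tprod]
  simp only [TensorProduct.map_tmul]
  exact unzip_tprod A' B' (fun i => hf i _ _ (ha i)) (fun i => hg i _ _ (hb i))

theorem zipS_of_unzip {A A' : ι → DGMod.{v} Λ} {B B' : ι → DGMod.{v'} Λ}
    {F : pi (fun i => tensor (A i) (B i)) →ₗ[Λ] pi (fun i => tensor (A' i) (B' i))}
    {H : tensor (pi A) (pi B) →ₗ[Λ] tensor (pi A') (pi B')}
    (h : unzip A' B' ∘ₗ F = H ∘ₗ unzip A B) : F ∘ₗ zipS A B = zipS A' B' ∘ₗ H := by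
  refine LinearMap.ext fun x => ?_
  have h1 := LinearMap.congr_fun h (zipS A B x)
  have h2 := LinearMap.congr_fun (unzip_comp_zipS A B) x
  have h3 := LinearMap.congr_fun (zipS_comp_unzip A' B') (F (zipS A B x))
  simp only [LinearMap.comp_apply, LinearMap.id_apply] at h1 h2 h3 ⊢
  rw [← h3, h1, h2]

theorem zipS_powPerm (A : DGMod.{v} Λ) (B : DGMod.{v'} Λ) (σ : Equiv.Perm ι) :
    powPerm (tensor A B) σ ∘ₗ zipS (fun _ => A) (fun _ => B) =
      zipS (fun _ => A) (fun _ => B) ∘ₗ TensorProduct.map (powPerm A σ) (powPerm B σ) :=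
  zipS_of_unzip (unzip_powPerm A B σ)

theorem zipS_map {A A' : ι → DGMod.{v} Λ} {B B' : ι → DGMod.{v'} Λ} (f : ∀ i, A i →ₗ[Λ] A' i)
    (g : ∀ i, B i →ₗ[Λ] B' i) (hf : ∀ i n, ∀ x ∈ (A i).gr n, f i x ∈ (A' i).gr n)
    (hg : ∀ i n, ∀ x ∈ (B i).gr n, g i x ∈ (B' i).gr n) :
    PiTensorProduct.map (fun i => TensorProduct.map (f i) (g i)) ∘ₗ zipS A B =
      zipS A' B' ∘ₗ TensorProduct.map (PiTensorProduct.map f) (PiTensorProduct.map g) :=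
  zipS_of_unzip (unzip_map f g hf hg)

/-! ### Iterated tensor powers -/

variable (K : DGMod.{v} Λ)

theorem nest_tprod (a : ι ×ₗ κ → K) :
    nest K ι κ (PiTensorProduct.tprod Λ a) = PiTensorProduct.tprod Λ fun i =>
      PiTensorProduct.tprod Λ fun j => a (toLex (i, j)) := by
  rw [nest, PiTensorProduct.lift.tprod]
  rfl

theorem flatten_nest (x : pow K (ι ×ₗ κ)) : flatten K ι κ (nest K ι κ x) = x :=
  (LinearEquiv.ofBijective (nest K ι κ) (nest_bijective K ι κ)).symm_apply_apply x

theorem flatten_tprod (a : ι → κ → K) :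
    flatten K ι κ (PiTensorProduct.tprod Λ fun i => PiTensorProduct.tprod Λ (a i)) =
      PiTensorProduct.tprod Λ fun q : ι ×ₗ κ => a (ofLex q).1 (ofLex q).2 := by
  rw [← flatten_nest K (PiTensorProduct.tprod Λ fun q : ι ×ₗ κ => a (ofLex q).1 (ofLex q).2),
    nest_tprod]
  rfl

theorem nest_flatten (x : pow (pow K κ) ι) : nest K ι κ (flatten K ι κ x) = x :=
  (LinearEquiv.ofBijective (nest K ι κ) (nest_bijective K ι κ)).apply_symm_apply x

/-- Two linear maps on `(K ^ κ) ^ ι` agree if they agree on tensors of homogeneous elements. -/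
theorem pow_pow_hom_ext {M : Type*} [AddCommGroup M] [Module Λ M]
    {f g : (pow (pow K κ) ι).carrier →ₗ[Λ] M}
    (h : ∀ (e : ι → κ → ℤ) (a : ι → κ → K), (∀ i j, a i j ∈ K.gr (e i j)) →
      f (PiTensorProduct.tprod Λ fun i => PiTensorProduct.tprod Λ (a i)) =
        g (PiTensorProduct.tprod Λ fun i => PiTensorProduct.tprod Λ (a i))) : f = g := by
  have key : f ∘ₗ nest K ι κ = g ∘ₗ nest K ι κ := by
    refine pi_hom_ext _ fun e a ha => ?_
    rw [LinearMap.comp_apply, LinearMap.comp_apply, nest_tprod]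
    exact h (fun i j => e (toLex (i, j))) (fun i j => a (toLex (i, j))) fun i j => ha _
  refine LinearMap.ext fun x => ?_
  rw [← nest_flatten K x]
  exact LinearMap.congr_fun key _

theorem tprod_mem_pow_pow {e : ι → κ → ℤ} {a : ι → κ → K} (ha : ∀ i j, a i j ∈ K.gr (e i j))
    (i : ι) : PiTensorProduct.tprod Λ (a i) ∈ (pow K κ).gr (∑ j, e i j) :=
  tprod_mem_piGr _ (ha i)

theorem sum_filter_lt_lex {M : Type*} [AddCommMonoid M] (f : ι → κ → M) (i : ι) (j : κ) :
    ∑ q : ι ×ₗ κ with q < toLex (i, j), f (ofLex q).1 (ofLex q).2 =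
      (∑ i' with i' < i, ∑ j', f i' j') + ∑ j' with j' < j, f i j' := by
  rw [Finset.sum_filter, sum_lex, Finset.sum_filter]
  simp only [Prod.Lex.toLex_lt_toLex, ofLex_toLex]
  have h : ∀ i', (∑ j', if i' < i ∨ i' = i ∧ j' < j then f i' j' else 0) =
      (if i' < i then ∑ j', f i' j' else 0) +
        if i' = i then ∑ j' with j' < j, f i j' else 0 := by
    intro i'
    by_cases h1 : i' < i
    · simp [h1, h1.ne]
    · by_cases h2 : i' = i
      · subst h2; simp [Finset.sum_filter]
      · simp [h1, h2]
  rw [Finset.sum_congr rfl fun i' _ => h i', Finset.sum_add_distrib]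
  simp

/-- No sign is needed: what precedes (i, j) lexicographically is the union of the earlier blocks and
the earlier entries of block i, so the two Leibniz signs multiply to the one in K^(ι × κ). -/
theorem isChainMap_flatten :
    IsChainMap (pow (pow K κ) ι) (pow K (ι ×ₗ κ)) (flatten K ι κ) := by
  have hgr : ∀ (e : ι → κ → ℤ) (a : ι → κ → K), (∀ i j, a i j ∈ K.gr (e i j)) →
      (PiTensorProduct.tprod Λ fun q : ι ×ₗ κ => a (ofLex q).1 (ofLex q).2) ∈
        (pow K (ι ×ₗ κ)).gr (∑ i, ∑ j, e i j) := by
    intro e a ha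
    have := tprod_mem_piGr (fun _ : ι ×ₗ κ => K) (e := fun q => e (ofLex q).1 (ofLex q).2)
      (a := fun q => a (ofLex q).1 (ofLex q).2) fun q => ha _ _
    rwa [sum_lex] at this
  constructor
  · intro n x hx
    refine degree_of_comm_scale (flatten K ι κ) (fun c => ?_) hx
    refine pow_pow_hom_ext K fun e a ha => ?_
    rw [LinearMap.comp_apply, LinearMap.comp_apply,
      scale_of_mem _ c (tprod_mem_piGr _ (tprod_mem_pow_pow K ha)), map_smul, flatten_tprod,
      scale_of_mem _ c (hgr e a ha)]
  · refine LinearMap.congr_fun (f := flatten K ι κ ∘ₗ (pow (pow K κ) ι).d)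
      (g := (pow K (ι ×ₗ κ)).d ∘ₗ flatten K ι κ) (pow_pow_hom_ext K fun e a ha => ?_)
    rw [LinearMap.comp_apply, LinearMap.comp_apply, flatten_tprod,
      pi_d_tprod _ (tprod_mem_pow_pow K ha),
      pi_d_tprod (fun _ : ι ×ₗ κ => K) (e := fun q => e (ofLex q).1 (ofLex q).2)
        (a := fun q => a (ofLex q).1 (ofLex q).2) (fun q => ha _ _), sum_lex, map_sum]
    refine Finset.sum_congr rfl fun i _ => ?_
    rw [map_smul, pi_d_tprod _ (ha i), MultilinearMap.map_update_sum, map_sum, Finset.smul_sum]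
    refine Finset.sum_congr rfl fun j _ => ?_
    rw [MultilinearMap.map_update_smul, map_smul, smul_smul, ← sgn_add,
      sum_filter_lt_lex (fun i j => (e i j : ZMod 2)) i j]
    simp only [Int.cast_sum]
    congr 1
    have h1 : (Function.update (fun i => PiTensorProduct.tprod Λ (a i)) i
        (PiTensorProduct.tprod Λ (Function.update (a i) j (K.d (a i j))))) =
        fun i' => PiTensorProduct.tprod Λ
          (Function.update a i (Function.update (a i) j (K.d (a i j))) i') := by
      funext i'
      by_cases h : i' = i
      · subst h; simp
      · simp [h]
    rw [h1, flatten_tprod]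
    congr 1
    funext q
    obtain ⟨⟨i', j'⟩, rfl⟩ := toLex.surjective q
    by_cases hi : i' = i
    · subst hi
      by_cases hj : j' = j
      · subst hj; simp
      · rw [Function.update_of_ne (a := toLex (i', j')) (by simpa using hj)]
        simp [hj]
    · rw [Function.update_of_ne (a := toLex (i', j')) (by simp [hi])]
      simp [hi]

/-- The permutation of the pairs `(i, j)` given by a permutation of the `i`. -/
abbrev permFst (κ : Type) [Fintype κ] [LinearOrder κ] (σ : Equiv.Perm ι) :
    Equiv.Perm (ι ×ₗ κ) :=
  (toLex (α := ι × κ)).permCongr (Equiv.prodCongr σ (Equiv.refl κ))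

/-- The permutation of the pairs `(i, j)` given by permutations of the `j`, for each `i`. -/
abbrev permSnd (σ : ι → Equiv.Perm κ) : Equiv.Perm (ι ×ₗ κ) :=
  (toLex (α := ι × κ)).permCongr (Equiv.prodCongrRight σ)

/-- Moving whole blocks inverts pairs only between different blocks, and an inverted pair of blocks
contributes the product of the total degrees, as the sum over all entries does. -/
theorem flatten_powPerm (σ : Equiv.Perm ι) :
    flatten K ι κ ∘ₗ powPerm (pow K κ) σ = powPerm K (permFst κ σ) ∘ₗ flatten K ι κ := by
  refine pow_pow_hom_ext K fun e a ha => ?_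
  rw [LinearMap.comp_apply, LinearMap.comp_apply, powPerm_tprod _ σ (tprod_mem_pow_pow K ha),
    map_smul, flatten_tprod K fun i => a (σ.symm i), flatten_tprod,
    powPerm_tprod K (permFst κ σ) (e := fun q : ι ×ₗ κ => e (ofLex q).1 (ofLex q).2)
      (a := fun q : ι ×ₗ κ => a (ofLex q).1 (ofLex q).2) (fun q => ha _ _)]
  congr 2
  rw [invSum_eq, invSum_eq, sumLt_lex]
  have h0 : ∀ i (j j' : κ), inv (permFst κ σ) (toLex (i, j)) (toLex (i, j')) = 0 := by
    intro i j j'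
    simp [inv, Prod.Lex.toLex_lt_toLex]
  have h1 : ∀ i i' (j j' : κ), i < i' →
      inv (permFst κ σ) (toLex (i, j)) (toLex (i', j')) = inv σ i i' := by
    intro i i' j j' hi
    have : σ i ≠ σ i' := fun h => hi.ne (σ.injective h)
    simp [inv, Prod.Lex.toLex_lt_toLex, hi, this]
  have h2 : (∑ i, sumLt fun j j' : κ => inv (permFst κ σ) (toLex (i, j)) (toLex (i, j')) *
      ((e (ofLex (toLex (i, j))).1 (ofLex (toLex (i, j))).2 : ZMod 2) *
        (e (ofLex (toLex (i, j'))).1 (ofLex (toLex (i, j'))).2 : ZMod 2))) = 0 :=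
    Finset.sum_eq_zero fun i _ => by simp [h0, sumLt]
  rw [h2, add_zero]
  refine sumLt_congr fun i i' hi => ?_
  simp only [h1 i i' _ _ hi, ← Finset.mul_sum, ofLex_toLex, ← Finset.sum_mul, Int.cast_sum]

/-- Here inversions occur only inside blocks, so the sign is the product of the signs of the blocks.
-/
theorem flatten_map_powPerm (σ : ι → Equiv.Perm κ) :
    flatten K ι κ ∘ₗ PiTensorProduct.map (fun i => powPerm K (σ i)) =
      powPerm K (permSnd σ) ∘ₗ flatten K ι κ := by
  refine pow_pow_hom_ext K fun e a ha => ?_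
  have h3 : (fun i => powPerm K (σ i) (PiTensorProduct.tprod Λ (a i))) = fun i =>
      sgn Λ (invSum (σ i) fun j => (e i j : ZMod 2)) •
        PiTensorProduct.tprod Λ fun j => a i ((σ i).symm j) :=
    funext fun i => powPerm_tprod K (σ i) (ha i)
  rw [LinearMap.comp_apply, LinearMap.comp_apply, PiTensorProduct.map_tprod, h3,
    MultilinearMap.map_smul_univ, map_smul,
    flatten_tprod K fun i j => a i ((σ i).symm j), flatten_tprod,
    powPerm_tprod K (permSnd σ) (e := fun q : ι ×ₗ κ => e (ofLex q).1 (ofLex q).2)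
      (a := fun q : ι ×ₗ κ => a (ofLex q).1 (ofLex q).2) (fun q => ha _ _)]
  have h4 : ∀ f : ι → ZMod 2, ∏ i, sgn Λ (f i) = sgn Λ (∑ i, f i) := by
    intro f
    induction (Finset.univ : Finset ι) using Finset.induction_on with
    | empty => simp
    | insert i s hi ih => rw [Finset.prod_insert hi, Finset.sum_insert hi, ih, sgn_add]
  rw [h4]
  congr 2
  rw [invSum_eq, sumLt_lex]
  have h0 : ∀ i (j j' : κ), inv (permSnd σ) (toLex (i, j)) (toLex (i, j')) = inv (σ i) j j' := by
    intro i j j'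
    simp [inv, Prod.Lex.toLex_lt_toLex]
  have h1 : ∀ i i' (j j' : κ), i < i' →
      inv (permSnd σ) (toLex (i, j)) (toLex (i', j')) = 0 := by
    intro i i' j j' hi
    simp [inv, Prod.Lex.toLex_lt_toLex, hi]
  have h2 : (sumLt fun i i' : ι => ∑ j : κ, ∑ j' : κ,
      inv (permSnd σ) (toLex (i, j)) (toLex (i', j')) *
      ((e (ofLex (toLex (i, j))).1 (ofLex (toLex (i, j))).2 : ZMod 2) *
        (e (ofLex (toLex (i', j'))).1 (ofLex (toLex (i', j'))).2 : ZMod 2))) = 0 := by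
    rw [sumLt_congr (h := fun _ _ => 0) fun i i' hi => by simp [h1 i i' _ _ hi]]
    simp [sumLt]
  rw [h2, zero_add]
  refine Finset.sum_congr rfl fun i _ => ?_
  rw [invSum_eq]
  exact sumLt_congr fun j j' _ => by rw [h0]; rfl

theorem permFst_mul (σ τ : Equiv.Perm ι) : permFst κ (σ * τ) = permFst κ σ * permFst κ τ := by
  ext q; rfl

theorem permSnd_mul (σ τ : ι → Equiv.Perm κ) : permSnd (σ * τ) = permSnd σ * permSnd τ := by
  ext q; rfl

/-- The commutation relation of the wreath product. -/
theorem permSnd_mul_permFst (σ : ι → Equiv.Perm κ) (τ : Equiv.Perm ι) :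
    permSnd σ * permFst κ τ = permFst κ τ * permSnd fun i => σ (τ i) := by
  ext q; rfl

theorem permAlpha_eq (p : ℕ) [NeZero p] : permAlpha p = permFst (Fin p) (finRotate p) := rfl

theorem permAlphaAt_eq (p : ℕ) [NeZero p] (i : Fin p) :
    permAlphaAt p i = permSnd (Pi.mulSingle i (finRotate p)) := by
  rw [permAlphaAt]
  congr 1
  ext ⟨k, j⟩ : 1
  by_cases h : k = i
  · subst h; simp [Equiv.Perm.prodExtendRight]
  · simp [Equiv.Perm.prodExtendRight, h]

end DGMod

end

section

/-! ### A contraction of the tensor powers of a contractible complex -/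

namespace DGMod

section Contraction

variable {ι : Type} [Fintype ι] [LinearOrder ι] (K : DGMod.{v} Λ) (h ρ : K →ₗ[Λ] K)

/-- The `i`-th summand of the contraction of a tensor power. -/
def powContrAt (i : ι) : pow K ι →ₗ[Λ] pow K ι :=
  PiTensorProduct.map fun j => if j < i then ρ else if j = i then h else LinearMap.id

variable (ι) in
/-- The contraction of a tensor power given by a contraction `h` of `K` onto the image of `ρ`. -/
def powContr : pow K ι →ₗ[Λ] pow K ι := ∑ i, powContrAt K h ρ i

theorem map_eq_zero {f : ι → K →ₗ[Λ] K} (i : ι) (hi : f i = 0) :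
    PiTensorProduct.map (R := Λ) f = 0 := by
  have := PiTensorProduct.map_update_smul f i (0 : Λ) (f i)
  rwa [zero_smul, zero_smul, ← hi, Function.update_eq_self] at this

/-- The terms ρ ⊗ ⋯ ⊗ ρ ⊗ (1 - ρ) ⊗ 1 ⊗ ⋯ ⊗ 1 telescope to 1 - ρ ⊗ ⋯ ⊗ ρ. The statement is relative
to a set S of positions so that a new largest position can be added. -/
theorem sum_telescope (S : Finset ι) :
    ∑ i ∈ S, PiTensorProduct.map (R := Λ) (fun j => if j ∈ S ∧ j < i then ρ
      else if j = i then LinearMap.id - ρ else LinearMap.id) =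
    LinearMap.id - PiTensorProduct.map (R := Λ)
      (fun j => if j ∈ S then ρ else LinearMap.id : ι → K →ₗ[Λ] K) := by
  induction S using Finset.induction_on_max with
  | empty => simp [PiTensorProduct.map_id]
  | insert a s hs ih =>
    have has : a ∉ s := fun h => lt_irrefl _ (hs a h)
    have h1 : ∀ i ∈ s, PiTensorProduct.map (R := Λ) (fun j => if j ∈ insert a s ∧ j < i then ρ
        else if j = i then LinearMap.id - ρ else LinearMap.id) =
        PiTensorProduct.map (R := Λ) (fun j => if j ∈ s ∧ j < i then ρ
        else if j = i then LinearMap.id - ρ else LinearMap.id) := by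
      intro i hi
      congr 1
      funext j
      by_cases hj : j = a
      · subst hj; simp [has, (hs i hi).not_gt]
      · simp [hj]
    set f : ι → K →ₗ[Λ] K := fun j => if j ∈ s then ρ else LinearMap.id with hf
    have h2 : (fun j => if j ∈ insert a s ∧ j < a then ρ
        else if j = a then LinearMap.id - ρ else LinearMap.id) =
        Function.update f a (LinearMap.id - ρ) := by
      funext j
      by_cases hj : j = a
      · subst hj; simp
      · rw [Function.update_of_ne hj]
        by_cases hjs : j ∈ s
        · simp [hjs, hs j hjs, hf]
        · simp [hjs, hj, hf]
    have h3 : (fun j => if j ∈ insert a s then ρ else LinearMap.id) =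
        Function.update f a ρ := by
      funext j
      by_cases hj : j = a
      · subst hj; simp
      · simp [hj, hf]
    have h4 : Function.update f a LinearMap.id = f := by
      rw [Function.update_eq_self_iff]; simp [hf, has]
    have h5 := PiTensorProduct.map_update_add f a (LinearMap.id - ρ) ρ
    rw [sub_add_cancel, h4] at h5
    rw [Finset.sum_insert has, Finset.sum_congr rfl h1, ih, h2, h3, h5]
    abel

/-- The contraction is the sum of ρ ⊗ ⋯ ⊗ ρ ⊗ h ⊗ 1 ⊗ ⋯ ⊗ 1. It needs no Koszul signs, since `par`
is invisible to ρ on either side. -/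
theorem powContr_spec (hh : ∀ x, K.par (h x) = -h (K.par x))
    (hd : ∀ x, K.d (h x) + h (K.d x) = x - ρ x) (hρp : ∀ x, ρ (K.par x) = ρ x)
    (hpρ : ∀ x, K.par (ρ x) = ρ x) (hdρ : ∀ x, K.d (ρ x) = 0) (hρd : ∀ x, ρ (K.d x) = 0)
    (x : pow K ι) :
    (pow K ι).d (powContr ι K h ρ x) + powContr ι K h ρ ((pow K ι).d x) =
      x - PiTensorProduct.map (fun _ => ρ) x := by
  -- Off the diagonal everything cancels: for j < i because ρ annihilates boundaries and has cycles
  -- as values, for j > i because h anticommutes with the sign operator.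
  have hne : ∀ i j : ι, j ≠ i →
      piD (fun _ => K) j ∘ₗ powContrAt K h ρ i + powContrAt K h ρ i ∘ₗ piD (fun _ => K) j = 0 := by
    intro i j hij
    rw [piD, powContrAt, ← PiTensorProduct.map_comp, ← PiTensorProduct.map_comp]
    rcases lt_or_gt_of_ne hij with hji | hji
    · rw [map_eq_zero K j (LinearMap.ext fun x => by simp [hji, hdρ]),
        map_eq_zero K j (LinearMap.ext fun x => by simp [hji, hρd]), add_zero]
    · set f : ι → K →ₗ[Λ] K := fun k =>
        (if k < i then ρ else if k = i then h else LinearMap.id) ∘ₗ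
          (if k < j then K.par else if k = j then K.d else LinearMap.id) with hf
      have : (fun k => (if k < j then K.par else if k = j then K.d else LinearMap.id) ∘ₗ
          (if k < i then ρ else if k = i then h else LinearMap.id)) =
          Function.update f i ((-1 : Λ) • f i) := by
        funext k
        by_cases hk : k = i
        · subst hk
          refine LinearMap.ext fun x => ?_
          simp [hf, hji, hh]
        · rw [Function.update_of_ne hk, hf]
          rcases lt_or_gt_of_ne hk with h' | h'
          · refine LinearMap.ext fun x => ?_
            simp [h', h'.trans hji, hpρ, hρp]
          · simp [h'.not_gt, hk]
      rw [this, PiTensorProduct.map_update_smul, Function.update_eq_self]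
      refine LinearMap.ext fun y => ?_
      change (-1 : Λ) • PiTensorProduct.map f y + PiTensorProduct.map f y = 0
      rw [neg_one_smul, neg_add_cancel]
  -- On the diagonal d h + h d = 1 - ρ in factor i, which gives the terms of the telescoping sum.
  have heq : ∀ i : ι,
      piD (fun _ => K) i ∘ₗ powContrAt K h ρ i + powContrAt K h ρ i ∘ₗ piD (fun _ => K) i =
      PiTensorProduct.map (fun j => if j ∈ Finset.univ ∧ j < i then ρ
        else if j = i then LinearMap.id - ρ else LinearMap.id) := by
    intro i
    rw [piD, powContrAt, ← PiTensorProduct.map_comp, ← PiTensorProduct.map_comp]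
    set f : ι → K →ₗ[Λ] K := fun j => if j < i then ρ else LinearMap.id with hf
    have h1 : (fun k => (if k < i then K.par else if k = i then K.d else LinearMap.id) ∘ₗ
          (if k < i then ρ else if k = i then h else LinearMap.id)) =
          Function.update f i (K.d ∘ₗ h) := by
      funext k
      by_cases hk : k = i
      · subst hk; simp
      · rw [Function.update_of_ne hk, hf]
        by_cases h' : k < i
        · refine LinearMap.ext fun x => ?_
          simp [h', hpρ]
        · simp [h', hk]
    have h2 : (fun k => (if k < i then ρ else if k = i then h else LinearMap.id) ∘ₗ
          (if k < i then K.par else if k = i then K.d else LinearMap.id)) =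
          Function.update f i (h ∘ₗ K.d) := by
      funext k
      by_cases hk : k = i
      · subst hk; simp
      · rw [Function.update_of_ne hk, hf]
        by_cases h' : k < i
        · refine LinearMap.ext fun x => ?_
          simp [h', hρp]
        · simp [h', hk]
    rw [h1, h2, ← PiTensorProduct.map_update_add]
    congr 1
    funext k
    by_cases hk : k = i
    · subst hk
      refine LinearMap.ext fun x => ?_
      simp [hd]
    · simp [hf, hk]
  have key : ∑ i, ∑ j, (piD (fun _ => K) j ∘ₗ powContrAt K h ρ i +
      powContrAt K h ρ i ∘ₗ piD (fun _ => K) j) =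
      LinearMap.id - PiTensorProduct.map (R := Λ) (fun _ : ι => ρ) := by
    have h1 := sum_telescope K ρ (Finset.univ : Finset ι)
    simp only [Finset.mem_univ, if_true] at h1
    rw [← h1]
    refine Finset.sum_congr rfl fun i _ => ?_
    rw [Finset.sum_eq_single i (fun j _ hj => hne i j hj)
      (fun h => absurd (Finset.mem_univ _) h), heq]
    simp only [Finset.mem_univ]
  have := LinearMap.congr_fun key x
  rw [LinearMap.sub_apply, LinearMap.id_apply] at this
  rw [← this]
  change (∑ j, piD (fun _ => K) j) ((∑ i, powContrAt K h ρ i) x) +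
    (∑ i, powContrAt K h ρ i) ((∑ j, piD (fun _ => K) j) x) = _
  simp only [LinearMap.sum_apply, LinearMap.add_apply, LinearMap.comp_apply, map_sum,
    Finset.sum_add_distrib]
  congr 1
  exact Finset.sum_comm

theorem powContr_mem (hh : ∀ n, ∀ x ∈ K.gr n, h x ∈ K.gr (n - 1))
    (hρ : ∀ n, ∀ x ∈ K.gr n, ρ x ∈ K.gr n) {n : ℤ} {x : pow K ι} (hx : x ∈ (pow K ι).gr n) :
    powContr ι K h ρ x ∈ (pow K ι).gr (n - 1) := by
  rw [powContr, LinearMap.sum_apply]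
  refine Submodule.sum_mem _ fun i _ => ?_
  refine pi_mem_iff_induction _ (powContrAt K h ρ i) (fun n => piGr (fun _ => K) (n - 1))
    (fun e a ha => ?_) hx
  rw [powContrAt, PiTensorProduct.map_tprod]
  have : ∑ j, e j - 1 = ∑ j, Function.update e i (e i - 1) j := by
    rw [Finset.sum_update_of_mem (Finset.mem_univ i),
      ← Finset.sum_sdiff (Finset.subset_univ {i})]
    simp [add_comm]
  rw [this]
  refine tprod_mem_piGr _ fun j => ?_
  rcases lt_trichotomy j i with h | h | h
  · simpa [h, h.ne] using hρ _ _ (ha j)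
  · subst h; simpa using hh _ _ (ha j)
  · simpa [h.not_gt, h.ne'] using ha j

theorem powContr_natural {L : DGMod.{v'} Λ} {h' ρ' : L →ₗ[Λ] L} (g : K →ₗ[Λ] L)
    (hg : g ∘ₗ h = h' ∘ₗ g) (hg' : g ∘ₗ ρ = ρ' ∘ₗ g) (x : pow K ι) :
    PiTensorProduct.map (fun _ => g) (powContr ι K h ρ x) =
      powContr ι L h' ρ' (PiTensorProduct.map (fun _ => g) x) := by
  simp only [powContr, LinearMap.sum_apply, map_sum]
  refine Finset.sum_congr rfl fun i _ => ?_
  rw [powContrAt, powContrAt, ← LinearMap.comp_apply, ← LinearMap.comp_apply,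
    ← PiTensorProduct.map_comp, ← PiTensorProduct.map_comp]
  congr 2
  funext j
  split_ifs
  · exact hg'
  · exact hg
  · rfl

end Contraction

end DGMod

/-! ### The cone contraction of the standard simplices -/

open CategoryTheory Opposite Simplicial DGMod

/-- The cone on a simplex of `Δ[n]` with vertex `0`. -/
def cone {n k : ℕ} (x : (Δ[n] : SSet.{u}) _⦋k⦌) : (Δ[n] : SSet.{u}) _⦋k + 1⦌ :=
  SSet.stdSimplex.objMk (n := ⦋n⦌) (m := op ⦋k + 1⦌)
    ⟨Fin.cons (α := fun _ => Fin (n + 1)) 0 fun i => x i, by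
      intro i j hij
      induction i using Fin.cases with
      | zero => exact Fin.zero_le _
      | succ i =>
        induction j using Fin.cases with
        | zero => exact absurd hij (by simp)
        | succ j => exact SSet.stdSimplex.monotone_apply x (Fin.succ_le_succ_iff.1 hij)⟩

theorem cone_zero {n k : ℕ} (x : (Δ[n] : SSet.{u}) _⦋k⦌) : cone x 0 = 0 := rfl

theorem cone_succ {n k : ℕ} (x : (Δ[n] : SSet.{u}) _⦋k⦌) (i : Fin (k + 1)) :
    cone x i.succ = x i := rfl

theorem δ_zero_cone {n k : ℕ} (x : (Δ[n] : SSet.{u}) _⦋k⦌) : Δ[n].δ 0 (cone x) = x := by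
  apply SSet.stdSimplex.ext
  intro j
  rw [SSet.stdSimplex.δ_apply, Fin.zero_succAbove, cone_succ]

/-- Together with `δ_zero_cone` this says that the boundary of a cone is its base minus the cone on
the boundary. -/
theorem δ_succ_cone {n k : ℕ} (x : (Δ[n] : SSet.{u}) _⦋k + 1⦌) (i : Fin (k + 2)) :
    Δ[n].δ i.succ (cone x) = cone (Δ[n].δ i x) := by
  apply SSet.stdSimplex.ext
  intro j
  rw [SSet.stdSimplex.δ_apply]
  induction j using Fin.cases with
  | zero => rw [Fin.succ_succAbove_zero]; rfl
  | succ j => rw [Fin.succ_succAbove_succ, cone_succ, cone_succ, SSet.stdSimplex.δ_apply]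

/-- The cone commutes with degeneracies up to a shift of index; hence coning is defined on
normalized chains. -/
theorem cone_degenerate {n k : ℕ} {x : (Δ[n] : SSet.{u}) _⦋k⦌} (hx : x ∈ Δ[n].degenerate k) :
    cone x ∈ Δ[n].degenerate (k + 1) := by
  cases k with
  | zero => simp at hx
  | succ k =>
    rw [SSet.degenerate_eq_iUnion_range_σ] at hx
    obtain ⟨j, y, rfl⟩ := Set.mem_iUnion.1 hx
    have : cone (Δ[n].σ j y) = Δ[n].σ j.succ (cone y) := by
      apply SSet.stdSimplex.ext
      intro i
      rw [SSet.stdSimplex.σ_apply]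
      induction i using Fin.cases with
      | zero => simp [cone_zero]
      | succ i => rw [cone_succ, Fin.succ_predAbove_succ, cone_succ, SSet.stdSimplex.σ_apply]
    rw [this]
    exact Δ[n].σ_mem_degenerate _ _

variable (Λ) in
/-- The cone contraction of `C(Δ[n])`. -/
def coneChain (n : ℕ) : chains Λ (Δ[n] : SSet.{u}) →ₗ[Λ] chains Λ (Δ[n] : SSet.{u}) :=
  chainsLift _ fun _ x => gen Λ _ (cone x)

theorem coneChain_gen {n k : ℕ} (x : (Δ[n] : SSet.{u}) _⦋k⦌) :
    coneChain Λ n (gen Λ _ x) = gen Λ _ (cone x) :=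
  chainsLift_gen _ (fun _ x => gen Λ _ (cone x))
    (fun _ _ hx => gen_of_degenerate _ (cone_degenerate hx)) x

variable (Λ) in
/-- The augmentation of the normalized chains. -/
def augC (L : SSet.{u}) : chains Λ L →ₗ[Λ] Λ := chainsLift L fun n _ => if n = 0 then 1 else 0

theorem augC_gen (L : SSet.{u}) {n : ℕ} (x : L _⦋n⦌) :
    augC Λ L (gen Λ L x) = if n = 0 then 1 else 0 := by
  refine chainsLift_gen L (fun n _ => if n = 0 then (1 : Λ) else 0) (fun n x hx => ?_) x
  rw [if_neg]
  rintro rfl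
  simp at hx

theorem augC_of_mem (L : SSet.{u}) {n : ℤ} (hn : n ≠ 0) {c : chains Λ L}
    (hc : c ∈ (chains Λ L).gr n) : augC Λ L c = 0 := by
  refine chains_induction L (P := fun c => augC Λ L c = 0) hc (fun k x hk => ?_) (map_zero _)
    (fun y z hy hz => by rw [map_add, hy, hz, add_zero]) (fun r y hy => by
      rw [map_smul, hy, smul_zero])
  rw [augC_gen, if_neg]
  rintro rfl
  exact hn (by simpa using hk.symm)

theorem augC_d (L : SSet.{u}) (c : chains Λ L) : augC Λ L ((chains Λ L).d c) = 0 := by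
  suffices h : augC Λ L ∘ₗ (chains Λ L).d = 0 from LinearMap.congr_fun h c
  refine chains_ext L fun n x _ => ?_
  rw [LinearMap.comp_apply, LinearMap.zero_apply]
  cases n with
  | zero => rw [chains_d_gen_zero, map_zero]
  | succ n =>
    rw [chains_d_gen, map_sum]
    simp only [map_smul, augC_gen]
    split_ifs with h
    · subst h; simp [Fin.sum_univ_two]
    · simp

theorem augC_natural {L L' : SSet.{u}} (g : L ⟶ L') (c : chains Λ L) :
    augC Λ L' (chainsMap g c) = augC Λ L c := by
  suffices h : augC Λ L' ∘ₗ chainsMap g = augC Λ L from LinearMap.congr_fun h c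
  refine chains_ext L fun n x _ => ?_
  rw [LinearMap.comp_apply, chainsMap_gen, augC_gen, augC_gen]

/-- The vertex `0` of `Δ[n]`. -/
def vtx (n : ℕ) : (Δ[n] : SSet.{u}) _⦋0⦌ := SSet.stdSimplex.const n 0 (op ⦋0⦌)

variable (Λ) in
/-- The projection of `C(Δ[n])` onto the span of the vertex `0`. -/
def coneProj (n : ℕ) : chains Λ (Δ[n] : SSet.{u}) →ₗ[Λ] chains Λ (Δ[n] : SSet.{u}) :=
  (augC Λ _).smulRight (gen Λ _ (vtx n))

theorem coneProj_apply {n : ℕ} (c : chains Λ (Δ[n] : SSet.{u})) :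
    coneProj Λ n c = augC Λ _ c • gen Λ _ (vtx n) := rfl

/-- In positive dimension the last terms cancel face by face. In dimension 0 the cone is an edge,
and its far face is vertex 0; this is where the projection comes from. -/
theorem coneChain_spec (n : ℕ) (c : chains Λ (Δ[n] : SSet.{u})) :
    (chains Λ Δ[n]).d (coneChain Λ n c) + coneChain Λ n ((chains Λ Δ[n]).d c) =
      c - coneProj Λ n c := by
  suffices h : (chains Λ Δ[n]).d ∘ₗ coneChain Λ n + coneChain Λ n ∘ₗ (chains Λ Δ[n]).d =
      LinearMap.id - coneProj Λ n from LinearMap.congr_fun h c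
  refine chains_ext _ fun k x _ => ?_
  simp only [LinearMap.add_apply, LinearMap.sub_apply, LinearMap.comp_apply, LinearMap.id_apply,
    coneChain_gen, coneProj_apply, augC_gen]
  rw [chains_d_gen, Fin.sum_univ_succ, δ_zero_cone]
  cases k with
  | zero =>
    have : (Δ[n] : SSet.{u}).δ 1 (cone x) = vtx n := by
      apply SSet.stdSimplex.ext
      intro j
      rw [SSet.stdSimplex.δ_apply]
      obtain rfl : j = 0 := Subsingleton.elim (α := Fin 1) _ _
      rfl
    rw [chains_d_gen_zero]
    simp [this, sub_eq_add_neg]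
  | succ k =>
    rw [chains_d_gen, map_sum]
    simp only [δ_succ_cone, map_smul, coneChain_gen, Fin.val_zero, pow_zero, one_smul,
      Fin.val_succ, pow_succ, mul_neg_one, neg_smul, Finset.sum_neg_distrib]
    simp

theorem coneChain_mem {n : ℕ} {k : ℤ} {c : chains Λ (Δ[n] : SSet.{u})}
    (hc : c ∈ (chains Λ Δ[n]).gr k) : coneChain Λ n c ∈ (chains Λ Δ[n]).gr (k - 1) := by
  refine chains_induction _ (P := fun c => coneChain Λ n c ∈ (chains Λ Δ[n]).gr (k - 1)) hc
    (fun m x hm => ?_) ?_ (fun y z hy hz => ?_) (fun r y hy => ?_)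
  · rw [coneChain_gen, ← hm]
    have := gen_mem (Λ := Λ) _ (cone x)
    rwa [show -((m + 1 : ℕ) : ℤ) = -(m : ℤ) - 1 by push_cast; ring] at this
  · rw [map_zero]; exact Submodule.zero_mem _
  · rw [map_add]; exact Submodule.add_mem _ hy hz
  · rw [map_smul]; exact Submodule.smul_mem _ _ hy

theorem coneProj_mem {n : ℕ} {k : ℤ} {c : chains Λ (Δ[n] : SSet.{u})}
    (hc : c ∈ (chains Λ Δ[n]).gr k) : coneProj Λ n c ∈ (chains Λ Δ[n]).gr k := by
  rw [coneProj_apply]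
  by_cases hk : k = 0
  · subst hk; exact Submodule.smul_mem _ _ (gen_mem _ (vtx n))
  · rw [augC_of_mem _ hk hc, zero_smul]; exact Submodule.zero_mem _

theorem par_coneChain {n : ℕ} (c : chains Λ (Δ[n] : SSet.{u})) :
    (chains Λ Δ[n]).par (coneChain Λ n c) = -coneChain Λ n ((chains Λ Δ[n]).par c) := by
  induction c using hom_induction with
  | h k y hy =>
    rw [par_eq_sgn _ hy, par_eq_sgn _ (coneChain_mem hy), map_smul, Int.cast_sub, Int.cast_one,
      CharTwo.sub_eq_add, sgn_add_one, neg_smul]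
  | h0 => simp only [map_zero, neg_zero]
  | ha y z hy hz => simp only [map_add, hy, hz, neg_add]

/-- The projection lives in degree 0, where `par` is the identity. This and the next lemma are the
sign conditions required by `powContr_spec`. -/
theorem coneProj_par {n : ℕ} (c : chains Λ (Δ[n] : SSet.{u})) :
    coneProj Λ n ((chains Λ Δ[n]).par c) = coneProj Λ n c := by
  induction c using hom_induction with
  | h k y hy =>
    rw [par_eq_sgn _ hy, map_smul]
    by_cases hk : k = 0
    · subst hk; simp
    · rw [coneProj_apply, augC_of_mem _ hk hy]; simp
  | h0 => simp only [map_zero]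
  | ha y z hy hz => simp only [map_add, hy, hz]

theorem par_coneProj {n : ℕ} (c : chains Λ (Δ[n] : SSet.{u})) :
    (chains Λ Δ[n]).par (coneProj Λ n c) = coneProj Λ n c := by
  rw [coneProj_apply, map_smul, par_eq_sgn _ (gen_mem _ (vtx n))]
  simp

/-! ### Contraction of the tensor powers of simplex chains -/

section PowContr

variable (Λ) (ι : Type) [Fintype ι] [LinearOrder ι]

/-- The contraction of the tensor powers of `C(Δ[n])`. -/
def simplexContr (n : ℕ) : pow (chains Λ (Δ[n] : SSet.{u})) ι →ₗ[Λ] pow (chains Λ Δ[n]) ι :=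
  powContr ι _ (coneChain Λ n) (coneProj Λ n)

/-- The augmentation of the tensor powers of the chains of a simplicial set. -/
def augPow (L : SSet.{u}) : pow (chains Λ L) ι →ₗ[Λ] Λ :=
  PiTensorProduct.lift (MultilinearMap.mkPiAlgebra Λ ι Λ) ∘ₗ
    PiTensorProduct.map fun _ => augC Λ L

variable {Λ ι}

theorem augPow_tprod (L : SSet.{u}) (a : ι → chains Λ L) :
    augPow Λ ι L (PiTensorProduct.tprod Λ a) = ∏ i, augC Λ L (a i) := by
  rw [augPow, LinearMap.comp_apply, PiTensorProduct.map_tprod, PiTensorProduct.lift.tprod,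
    MultilinearMap.mkPiAlgebra_apply]

theorem augPow_of_mem (L : SSet.{u}) {n : ℤ} (hn : n ≠ 0) {t : pow (chains Λ L) ι}
    (ht : t ∈ (pow (chains Λ L) ι).gr n) : augPow Λ ι L t = 0 := by
  refine pi_mem_iff_induction _ (augPow Λ ι L) (fun n => if n = 0 then ⊤ else ⊥)
    (fun e a ha => ?_) ht |> fun h => by simpa [hn] using h
  split_ifs with h
  · trivial
  · have : ∃ i, e i ≠ 0 := by
      by_contra! hc
      exact h (Finset.sum_eq_zero fun i _ => hc i)
    obtain ⟨i, hi⟩ := this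
    rw [Submodule.mem_bot, augPow_tprod]
    exact Finset.prod_eq_zero (Finset.mem_univ i) (augC_of_mem L hi (ha i))

theorem augPow_powPerm (L : SSet.{u}) (σ : Equiv.Perm ι) (t : pow (chains Λ L) ι) :
    augPow Λ ι L (powPerm (chains Λ L) σ t) = augPow Λ ι L t := by
  suffices h : augPow Λ ι L ∘ₗ powPerm (chains Λ L) σ = augPow Λ ι L from LinearMap.congr_fun h t
  refine pi_hom_ext _ fun e a ha => ?_
  rw [LinearMap.comp_apply, powPerm_tprod _ σ ha, map_smul, augPow_tprod, augPow_tprod,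
    Equiv.prod_comp σ.symm fun i => augC Λ L (a i)]
  by_cases h : ∀ i, e i = 0
  · have : invSum σ (fun i => (e i : ZMod 2)) = 0 := by
      simp [invSum, h]
    rw [this, sgn_zero, one_smul]
  · push Not at h
    obtain ⟨i, hi⟩ := h
    rw [Finset.prod_eq_zero (Finset.mem_univ i) (augC_of_mem L hi (ha i)), smul_zero]

theorem map_coneProj (n : ℕ) (t : pow (chains Λ (Δ[n] : SSet.{u})) ι) :
    PiTensorProduct.map (fun _ => coneProj Λ n) t =
      augPow Λ ι _ t • PiTensorProduct.tprod Λ fun _ => gen Λ _ (vtx n) := by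
  suffices h : PiTensorProduct.map (fun _ : ι => coneProj Λ n) = (augPow Λ ι _).smulRight
      (PiTensorProduct.tprod Λ fun _ => gen Λ _ (vtx n)) from LinearMap.congr_fun h t
  refine pi_hom_ext (fun _ => chains Λ Δ[n]) fun e a ha => ?_
  rw [PiTensorProduct.map_tprod, LinearMap.smulRight_apply, augPow_tprod,
    ← MultilinearMap.map_smul_univ]
  rfl

theorem simplexContr_spec (n : ℕ) (t : pow (chains Λ (Δ[n] : SSet.{u})) ι) :
    (pow (chains Λ Δ[n]) ι).d (simplexContr Λ ι n t) +
      simplexContr Λ ι n ((pow (chains Λ Δ[n]) ι).d t) =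
      t - augPow Λ ι _ t • PiTensorProduct.tprod Λ fun _ => gen Λ _ (vtx n) := by
  rw [← map_coneProj]
  refine powContr_spec _ _ _ par_coneChain (coneChain_spec n) coneProj_par par_coneProj
    (fun c => ?_) (fun c => ?_) t
  · rw [coneProj_apply, map_smul, chains_d_gen_zero, smul_zero]
  · rw [coneProj_apply, augC_d, zero_smul]

theorem simplexContr_mem {n : ℕ} {k : ℤ} {t : pow (chains Λ (Δ[n] : SSet.{u})) ι}
    (ht : t ∈ (pow (chains Λ Δ[n]) ι).gr k) :
    simplexContr Λ ι n t ∈ (pow (chains Λ Δ[n]) ι).gr (k - 1) :=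
  powContr_mem _ _ _ (fun _ _ h => coneChain_mem h) (fun _ _ h => coneProj_mem h) ht

/-- Coning uses nothing but vertex 0. The codegeneracies fix it, so primitives built with this
contraction remain normalized; the coface omitting 0 does not fix it. -/
theorem simplexContr_natural {n m : ℕ} (g : ⦋n⦌ ⟶ ⦋m⦌) (hg : g.toOrderHom 0 = 0)
    (t : pow (chains Λ (Δ[n] : SSet.{u})) ι) :
    PiTensorProduct.map (fun _ => chainsMap (SSet.stdSimplex.map g)) (simplexContr Λ ι n t) =
      simplexContr Λ ι m (PiTensorProduct.map (fun _ => chainsMap (SSet.stdSimplex.map g)) t) := by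
  refine powContr_natural _ _ _ _ ?_ ?_ t
  · refine chains_ext _ fun k x _ => ?_
    rw [LinearMap.comp_apply, LinearMap.comp_apply, chainsMap_gen, coneChain_gen, coneChain_gen,
      chainsMap_gen]
    congr 1
    apply SSet.stdSimplex.ext
    intro i
    induction i using Fin.cases with
    | zero => exact hg
    | succ i => rfl
  · refine LinearMap.ext fun c => ?_
    rw [LinearMap.comp_apply, LinearMap.comp_apply, coneProj_apply, coneProj_apply, map_smul,
      chainsMap_gen, augC_natural]
    congr 2
    apply SSet.stdSimplex.ext
    intro i
    exact hg

end PowContr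

end

section

/-! ### Natural operations from chains to tensor powers of chains -/

section NatOps

theorem isChainMap_chainsMap {X Y : SSet.{u}} (f : X ⟶ Y) :
    IsChainMap (chains Λ X) (chains Λ Y) (chainsMap f) :=
  ⟨fun _ _ hx => chainsMap_mem f hx, chainsMap_d f⟩

variable (Λ) (ι : Type) [Fintype ι] [LinearOrder ι]

/-- The map of tensor powers of chains induced by a map of simplicial sets. -/
def powMap {X Y : SSet.{u}} (f : X ⟶ Y) : pow (chains Λ X) ι →ₗ[Λ] pow (chains Λ Y) ι :=
  PiTensorProduct.map fun _ => chainsMap f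

/-- The submodule of the natural transformations `C(L) → C(L) ^ ι` of modules. -/
def natOpsSubmodule : Submodule Λ (∀ L : SSet.{u}, chains Λ L →ₗ[Λ] pow (chains Λ L) ι) where
  carrier := {z | ∀ (L L' : SSet.{u}) (g : L ⟶ L') c,
    powMap Λ ι g (z L c) = z L' (chainsMap g c)}
  add_mem' h h' L L' g c := by
    simp only [Pi.add_apply, LinearMap.add_apply, map_add, h L L' g, h' L L' g]
  zero_mem' L L' g c := by simp only [Pi.zero_apply, LinearMap.zero_apply, map_zero]
  smul_mem' r z h L L' g c := by
    simp only [Pi.smul_apply, LinearMap.smul_apply, map_smul, h L L' g]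

/-- The natural transformations `C(L) → C(L) ^ ι` of modules. -/
def natOps : Type (u + 1) := natOpsSubmodule.{u} Λ ι

instance : AddCommGroup (natOps.{u} Λ ι) :=
  inferInstanceAs (AddCommGroup (natOpsSubmodule.{u} Λ ι))

instance : Module Λ (natOps.{u} Λ ι) := inferInstanceAs (Module Λ (natOpsSubmodule.{u} Λ ι))

variable {Λ ι}

theorem isChainMap_powMap {X Y : SSet.{u}} (f : X ⟶ Y) :
    IsChainMap (pow (chains Λ X) ι) (pow (chains Λ Y) ι) (powMap Λ ι f) :=
  IsChainMap.piMap fun _ => isChainMap_chainsMap f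

theorem powMap_comp {X Y Z : SSet.{u}} (f : X ⟶ Y) (g : Y ⟶ Z) (t : pow (chains Λ X) ι) :
    powMap Λ ι (f ≫ g) t = powMap Λ ι g (powMap Λ ι f t) := by
  rw [powMap, powMap, powMap, ← LinearMap.comp_apply (PiTensorProduct.map _),
    ← PiTensorProduct.map_comp]
  congr 2
  funext _
  exact LinearMap.ext fun c => (chainsMap_comp f g c).symm

theorem powMap_powPerm {X Y : SSet.{u}} (f : X ⟶ Y) (σ : Equiv.Perm ι)
    (t : pow (chains Λ X) ι) :
    powMap Λ ι f (powPerm _ σ t) = powPerm _ σ (powMap Λ ι f t) :=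
  LinearMap.congr_fun (powPerm_natural (fun _ _ => chainsMap_mem f) σ) t

namespace natOps

/-- A natural operation from its components. -/
def mk (z : ∀ L : SSet.{u}, chains Λ L →ₗ[Λ] pow (chains Λ L) ι)
    (h : ∀ (L L' : SSet.{u}) (g : L ⟶ L') c, powMap Λ ι g (z L c) = z L' (chainsMap g c)) :
    natOps.{u} Λ ι := ⟨z, h⟩

/-- The components of a natural operation. -/
def app (z : natOps.{u} Λ ι) (L : SSet.{u}) : chains Λ L →ₗ[Λ] pow (chains Λ L) ι := z.1 L

theorem mk_app (z : ∀ L : SSet.{u}, chains Λ L →ₗ[Λ] pow (chains Λ L) ι) (h) (L : SSet.{u}) :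
    (mk z h).app L = z L := rfl

theorem add_apply (z z' : natOps.{u} Λ ι) (L : SSet.{u}) (c : chains Λ L) :
    (z + z').app L c = z.app L c + z'.app L c := rfl

theorem add_app (z z' : natOps.{u} Λ ι) (L : SSet.{u}) :
    (z + z').app L = z.app L + z'.app L := rfl

theorem smul_app (r : Λ) (z : natOps.{u} Λ ι) (L : SSet.{u}) : (r • z).app L = r • z.app L := rfl

theorem smul_apply (r : Λ) (z : natOps.{u} Λ ι) (L : SSet.{u}) (c : chains Λ L) :
    (r • z).app L c = r • z.app L c := rfl

theorem ext {z z' : natOps.{u} Λ ι} (h : ∀ (L : SSet.{u}) c, z.app L c = z'.app L c) : z = z' :=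
  Subtype.ext (funext fun L => LinearMap.ext (h L))

theorem natural (z : natOps.{u} Λ ι) {L L' : SSet.{u}} (g : L ⟶ L') (c : chains Λ L) :
    powMap Λ ι g (z.app L c) = z.app L' (chainsMap g c) := z.2 L L' g c

variable (Λ ι) in
/-- The natural operations of degree `r`. -/
def gr (r : ℤ) : Submodule Λ (natOps.{u} Λ ι) where
  carrier := {z | ∀ (L : SSet.{u}) (n : ℤ), ∀ c ∈ (chains Λ L).gr n,
    z.app L c ∈ (pow (chains Λ L) ι).gr (n + r)}
  add_mem' h h' L n c hc := Submodule.add_mem _ (h L n c hc) (h' L n c hc)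
  zero_mem' _ _ _ _ := Submodule.zero_mem _
  smul_mem' r _ h L n c hc := Submodule.smul_mem _ r (h L n c hc)

/-- The differential `D z = d z - (-1) ^ deg z • z d`. -/
def D : natOps.{u} Λ ι →ₗ[Λ] natOps.{u} Λ ι where
  toFun z := mk (fun L => (pow (chains Λ L) ι).d ∘ₗ z.app L -
      (pow (chains Λ L) ι).par ∘ₗ z.app L ∘ₗ (chains Λ L).par ∘ₗ (chains Λ L).d) (by
    intro L L' g c
    simp only [LinearMap.sub_apply, LinearMap.comp_apply, map_sub]
    rw [(isChainMap_powMap g).comm, natural z, par, par,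
      scale_comm _ (isChainMap_powMap g).degree, natural z,
      scale_comm _ (fun _ _ => chainsMap_mem g), chainsMap_d]
    rfl)
  map_add' z z' := ext fun L c => by
    rw [add_apply, mk_app, mk_app, mk_app]
    rw [add_app, LinearMap.comp_add, LinearMap.add_comp, LinearMap.comp_add]
    simp only [LinearMap.sub_apply, LinearMap.add_apply]
    abel
  map_smul' r z := ext fun L c => by
    rw [RingHom.id_apply, smul_apply, mk_app, mk_app]
    rw [smul_app, LinearMap.comp_smul, LinearMap.smul_comp, LinearMap.comp_smul, ← smul_sub]
    rfl

/-- `D` is defined on all operations at once, without a degree, by conjugating with `par`; in degree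
r the conjugation is the expected sign. -/
theorem par_comm {r : ℤ} {z : natOps.{u} Λ ι} (hz : z ∈ gr Λ ι r) (L : SSet.{u})
    (c : chains Λ L) : (pow (chains Λ L) ι).par (z.app L ((chains Λ L).par c)) =
      sgn Λ (r : ZMod 2) • z.app L c := by
  induction c using hom_induction with
  | h n y hy =>
    rw [par_eq_sgn _ hy, map_smul, map_smul, par_eq_sgn _ (hz L n y hy), smul_smul, Int.cast_add,
      sgn_add, ← mul_assoc, sgn_mul_self, one_mul]
  | h0 => simp only [map_zero, smul_zero]
  | ha y z hy hz => simp only [map_add, hy, hz, smul_add]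

theorem D_apply {r : ℤ} {z : natOps.{u} Λ ι} (hz : z ∈ gr Λ ι r) (L : SSet.{u})
    (c : chains Λ L) : (D z).app L c = (pow (chains Λ L) ι).d (z.app L c) -
      sgn Λ (r : ZMod 2) • z.app L ((chains Λ L).d c) := by
  rw [← par_comm hz]
  rfl

theorem D_mem {r : ℤ} {z : natOps.{u} Λ ι} (hz : z ∈ gr Λ ι r) : D z ∈ gr Λ ι (r + 1) := by
  intro L n c hc
  rw [D_apply hz]
  refine Submodule.sub_mem _ ?_ (Submodule.smul_mem _ _ ?_)
  · rw [← add_assoc]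
    exact d_mem _ (hz L n c hc)
  · rw [show n + (r + 1) = n + 1 + r by ring]
    exact hz L _ _ (d_mem _ hc)

/-- The action of a permutation on the natural operations. -/
def perm (σ : Equiv.Perm ι) : natOps.{u} Λ ι →ₗ[Λ] natOps.{u} Λ ι where
  toFun z := mk (fun L => powPerm (chains Λ L) σ ∘ₗ z.app L) fun L L' g c => by
    rw [LinearMap.comp_apply, powMap_powPerm, natural z]; rfl
  map_add' z z' := ext fun L c => map_add (powPerm (chains Λ L) σ) _ _
  map_smul' r z := ext fun L c => map_smul (powPerm (chains Λ L) σ) _ _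

theorem perm_apply (σ : Equiv.Perm ι) (z : natOps.{u} Λ ι) (L : SSet.{u}) (c : chains Λ L) :
    (perm σ z).app L c = powPerm (chains Λ L) σ (z.app L c) := rfl

theorem perm_mul (σ τ : Equiv.Perm ι) :
    perm (Λ := Λ) (σ * τ) = perm.{u} σ ∘ₗ perm τ := by
  refine LinearMap.ext fun z => ext fun L c => ?_
  rw [perm_apply, powPerm_mul]
  rfl

theorem perm_mem (σ : Equiv.Perm ι) {r : ℤ} {z : natOps.{u} Λ ι} (hz : z ∈ gr Λ ι r) :
    perm σ z ∈ gr Λ ι r :=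
  fun L n c hc => (isChainMap_powPerm _ σ).degree _ _ (hz L n c hc)

theorem perm_D (σ : Equiv.Perm ι) (z : natOps.{u} Λ ι) : perm σ (D z) = D (perm σ z) := by
  refine ext fun L c => ?_
  change powPerm (chains Λ L) σ (_ - _) = _ - _
  rw [map_sub]
  congr 1
  · exact (isChainMap_powPerm _ σ).comm _
  · exact scale_comm _ (isChainMap_powPerm _ σ).degree _ _

/-- The fundamental simplex of `Δ[n]`. -/
def _root_.SteenrodDG.fund (n : ℕ) : (Δ[n] : SSet.{u}) _⦋n⦌ := SSet.stdSimplex.objEquiv.symm (𝟙 ⦋n⦌)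

/-- The augmentation of a natural operation: its value on a point. -/
def aug : natOps.{u} Λ ι →ₗ[Λ] Λ where
  toFun z := augPow Λ ι _ (z.app Δ[0] (gen Λ _ (fund 0)))
  map_add' _ _ := map_add (augPow Λ ι _) _ _
  map_smul' _ _ := map_smul (augPow Λ ι _) _ _

theorem aug_apply (z : natOps.{u} Λ ι) :
    aug z = augPow Λ ι _ (z.app Δ[0] (gen Λ _ (fund 0))) := rfl

theorem aug_perm (σ : Equiv.Perm ι) (z : natOps.{u} Λ ι) : aug (perm σ z) = aug z :=
  augPow_powPerm _ σ _

/-! #### Acyclicity of the natural operations -/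

/-- The image of a chain of a standard simplex under the alternating sum of the coface maps. -/
def faceSum (n : ℕ) : pow (chains Λ (Δ[n] : SSet.{u})) ι →ₗ[Λ] pow (chains Λ Δ[n + 1]) ι :=
  ∑ i : Fin (n + 2), (-1 : Λ) ^ (i : ℕ) • powMap Λ ι (SSet.stdSimplex.map (SimplexCategory.δ i))

theorem faceSum_apply {n : ℕ} (t : pow (chains Λ (Δ[n] : SSet.{u})) ι) :
    faceSum n t = ∑ i : Fin (n + 2), (-1 : Λ) ^ (i : ℕ) •
      powMap Λ ι (SSet.stdSimplex.map (SimplexCategory.δ i)) t := by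
  simp only [faceSum, LinearMap.sum_apply, LinearMap.smul_apply]

/-- A family of values on the fundamental simplices is normalized if it vanishes on their
degeneracies. -/
def Normalized (s : ∀ n, pow (chains Λ (Δ[n] : SSet.{u})) ι) : Prop :=
  ∀ n (l : Fin (n + 1)), powMap Λ ι (SSet.stdSimplex.map (SimplexCategory.σ l)) (s (n + 1)) = 0

section OfVals

variable {s : ∀ n, pow (chains Λ (Δ[n] : SSet.{u})) ι}

theorem powMap_map_yoneda {L : SSet.{u}} {n m : ℕ} (x : L _⦋m⦌) (f : ⦋n⦌ ⟶ ⦋m⦌)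
    (t : pow (chains Λ (Δ[n] : SSet.{u})) ι) :
    powMap Λ ι (SSet.yonedaEquiv.symm (L.map f.op x)) t =
      powMap Λ ι (SSet.yonedaEquiv.symm x) (powMap Λ ι (SSet.stdSimplex.map f) t) := by
  rw [← SSet.yonedaEquiv_symm_naturality_left, powMap_comp]

/-- A degenerate simplex is classified by a map factoring through a codegeneracy. Normalization is
thus what lets an operation with given values descend to normalized chains. -/
theorem ofVals_degenerate (hs : Normalized s) (L : SSet.{u}) {n : ℕ} {x : L _⦋n⦌}
    (hx : x ∈ L.degenerate n) : powMap Λ ι (SSet.yonedaEquiv.symm x) (s n) = 0 := by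
  cases n with
  | zero => simp at hx
  | succ n =>
    rw [SSet.degenerate_eq_iUnion_range_σ] at hx
    obtain ⟨j, y, rfl⟩ := Set.mem_iUnion.1 hx
    exact (powMap_map_yoneda y (SimplexCategory.σ j) _).trans (by rw [hs, map_zero])

/-- The natural operation with prescribed normalized values on the fundamental simplices. -/
def ofVals (s : ∀ n, pow (chains Λ (Δ[n] : SSet.{u})) ι) (hs : Normalized s) :
    natOps.{u} Λ ι :=
  mk (fun L => chainsLift L fun n x => powMap Λ ι (SSet.yonedaEquiv.symm x) (s n)) (by
    intro L L' g c
    suffices h : powMap Λ ι g ∘ₗ chainsLift L (fun n x => powMap Λ ι (SSet.yonedaEquiv.symm x) (s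
        n))
        = chainsLift L' (fun n x => powMap Λ ι (SSet.yonedaEquiv.symm x) (s n)) ∘ₗ chainsMap g from
      LinearMap.congr_fun h c
    refine chains_ext L fun n x _ => ?_
    rw [LinearMap.comp_apply, LinearMap.comp_apply, chainsMap_gen,
      chainsLift_gen L _ (fun n x hx => ofVals_degenerate hs L hx),
      chainsLift_gen L' _ (fun n x hx => ofVals_degenerate hs L' hx), ← powMap_comp,
      SSet.yonedaEquiv_symm_comp])

theorem ofVals_gen (hs : Normalized s) (L : SSet.{u}) {n : ℕ} (x : L _⦋n⦌) :
    (ofVals s hs).app L (gen Λ L x) = powMap Λ ι (SSet.yonedaEquiv.symm x) (s n) :=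
  chainsLift_gen L _ (fun _ _ hx => ofVals_degenerate hs L hx) x

theorem ofVals_d_gen (hs : Normalized s) (L : SSet.{u}) {n : ℕ} (x : L _⦋n + 1⦌) :
    (ofVals s hs).app L ((chains Λ L).d (gen Λ L x)) =
      powMap Λ ι (SSet.yonedaEquiv.symm x) (faceSum n (s n)) := by
  rw [chains_d_gen, faceSum_apply, map_sum, map_sum]
  refine Finset.sum_congr rfl fun i _ => ?_
  rw [map_smul, map_smul, ofVals_gen]
  exact congrArg _ (powMap_map_yoneda x (SimplexCategory.δ i) _)

end OfVals

/-- One normalized value extends by zero in all other dimensions to an operation. This reduces facts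
about `faceSum` to facts about the boundary of chains. -/
theorem normalized_single {n : ℕ} {t : pow (chains Λ (Δ[n] : SSet.{u})) ι}
    (ht : ∀ m (h : m + 1 = n) (l : Fin (m + 1)),
      powMap Λ ι (SSet.stdSimplex.map (SimplexCategory.σ l)) (h ▸ t) = 0) :
    Normalized (Pi.single n t : ∀ n, pow (chains Λ (Δ[n] : SSet.{u})) ι) := by
  intro m l
  by_cases h : m + 1 = n
  · subst h
    rw [Pi.single_eq_same]
    exact ht m rfl l
  · rw [Pi.single_eq_of_ne h, map_zero]

/-- Apply the operation concentrated in dimension n with value t to the boundary of a degenerate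
(n+1)-simplex, which is zero. No simplicial identity has to be checked again. -/
theorem powMap_σ_faceSum {n : ℕ} {t : pow (chains Λ (Δ[n] : SSet.{u})) ι}
    (ht : Normalized (Pi.single n t : ∀ n, pow (chains Λ (Δ[n] : SSet.{u})) ι))
    (l : Fin (n + 1)) :
    powMap Λ ι (SSet.stdSimplex.map (SimplexCategory.σ l)) (faceSum n t) = 0 := by
  have h := ofVals_d_gen ht Δ[n] (SSet.stdSimplex.objEquiv.symm (SimplexCategory.σ l))
  have h1 : SSet.yonedaEquiv.symm (SSet.stdSimplex.objEquiv.{u}.symm (SimplexCategory.σ l)) =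
      SSet.stdSimplex.map (SimplexCategory.σ l) := by
    rw [Equiv.symm_apply_eq, SSet.yonedaEquiv_map]
  rw [gen_of_degenerate, map_zero, map_zero, Pi.single_eq_same] at h
  · rw [← h1]
    exact h.symm
  · exact Δ[n].σ_mem_degenerate l (fund n)

/-- The same device: apply the operation with value t to the double boundary of the fundamental
(n+2)-simplex. -/
theorem faceSum_faceSum {n : ℕ} {t : pow (chains Λ (Δ[n] : SSet.{u})) ι}
    (ht : Normalized (Pi.single n t : ∀ n, pow (chains Λ (Δ[n] : SSet.{u})) ι)) :
    faceSum (n + 1) (faceSum n t) = 0 := by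
  have h : (ofVals _ ht).app Δ[n + 2] ((chains Λ _).d ((chains Λ _).d (gen Λ _ (fund (n + 2))))) =
      faceSum (n + 1) (faceSum n t) := by
    rw [chains_d_gen (X := Δ[n + 2]) (n := n + 1), map_sum, map_sum, faceSum_apply]
    refine Finset.sum_congr rfl fun i _ => ?_
    rw [map_smul, map_smul, ofVals_d_gen, Pi.single_eq_same]
    congr 2
  rw [← h, d_d, map_zero]

/-- By naturality the value on a boundary depends only on the value one dimension lower; this turns
the equation D s = g into a recursion on n. -/
theorem eq_faceSum (g : natOps.{u} Λ ι) (n : ℕ) :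
    g.app Δ[n + 1] ((chains Λ _).d (gen Λ _ (fund (n + 1)))) =
      faceSum n (g.app Δ[n] (gen Λ _ (fund n))) := by
  rw [chains_d_gen, map_sum, faceSum_apply]
  refine Finset.sum_congr rfl fun i _ => ?_
  rw [map_smul, natural g, chainsMap_gen]
  rfl

/-- The value of a natural operation on a simplex. -/
theorem apply_gen (g : natOps.{u} Λ ι) (L : SSet.{u}) {n : ℕ} (x : L _⦋n⦌) :
    g.app L (gen Λ L x) = powMap Λ ι (SSet.yonedaEquiv.symm x) (g.app Δ[n] (gen Λ _ (fund n))) := by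
  rw [natural g, chainsMap_gen]
  congr 2
  exact (SSet.yonedaEquiv_symm_app_id x).symm

/-- The right-hand side of the equation for the next value of a primitive of `g`. -/
def primRhs (g : natOps.{u} Λ ι) (c : Λ) (s : ∀ n, pow (chains Λ (Δ[n] : SSet.{u})) ι)
    (n : ℕ) : pow (chains Λ (Δ[n] : SSet.{u})) ι :=
  match n with
  | 0 => g.app _ (gen Λ _ (fund 0))
  | n + 1 => g.app _ (gen Λ _ (fund (n + 1))) + c • faceSum n (s n)

/-- The values on the fundamental simplices of a primitive of `g`. -/
def primVals (g : natOps.{u} Λ ι) (c : Λ) (n : ℕ) : pow (chains Λ (Δ[n] : SSet.{u})) ι :=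
  match n with
  | 0 => simplexContr Λ ι 0 (g.app _ (gen Λ _ (fund 0)))
  | n + 1 => simplexContr Λ ι (n + 1)
      (g.app _ (gen Λ _ (fund (n + 1))) + c • faceSum n (primVals g c n))

theorem primVals_eq (g : natOps.{u} Λ ι) (c : Λ) (n : ℕ) :
    primVals g c n = simplexContr Λ ι n (primRhs g c (primVals g c) n) := by
  cases n <;> rfl

/-- The contraction commutes with the codegeneracies, which fix vertex 0. They kill both terms to
which it is applied: the value of g because g is defined on normalized chains, the face sum by
`powMap_σ_faceSum`. -/
theorem normalized_primVals (g : natOps.{u} Λ ι) (c : Λ) : Normalized (primVals g c) := by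
  suffices h : ∀ n, Normalized (Pi.single n (primVals g c n) :
      ∀ n, pow (chains Λ (Δ[n] : SSet.{u})) ι) by
    intro n l
    have := h (n + 1) n l
    rwa [Pi.single_eq_same] at this
  intro n
  induction n with
  | zero => exact normalized_single fun m h => absurd h (Nat.succ_ne_zero m)
  | succ n ih =>
    refine normalized_single fun m h l => ?_
    obtain rfl : m = n := Nat.succ_injective h
    change powMap Λ ι _ (simplexContr Λ ι _ _) = 0
    rw [powMap, simplexContr_natural]
    · rw [map_add, map_smul]
      have h1 := powMap_σ_faceSum ih l
      have h2 := natural g (SSet.stdSimplex.map (SimplexCategory.σ l)) (gen Λ _ (fund (m + 1)))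
      have h3 : gen Λ Δ[m] ((SSet.stdSimplex.map (SimplexCategory.σ l)).app (op ⦋m + 1⦌)
          (fund (m + 1))) = 0 := gen_of_degenerate _ (Δ[m].σ_mem_degenerate l (fund m))
      rw [chainsMap_gen, h3, map_zero] at h2
      rw [powMap] at h1 h2
      rw [h1, h2, smul_zero, add_zero, map_zero]
    · exact Fin.predAbove_right_zero (i := l)

theorem faceSum_comm {n : ℕ} (t : pow (chains Λ (Δ[n] : SSet.{u})) ι) :
    (pow (chains Λ Δ[n + 1]) ι).d (faceSum n t) = faceSum n ((pow (chains Λ Δ[n]) ι).d t) := by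
  rw [faceSum_apply, faceSum_apply, map_sum]
  refine Finset.sum_congr rfl fun i _ => ?_
  rw [map_smul, (isChainMap_powMap _).comm]

theorem faceSum_mem {n : ℕ} {k : ℤ} {t : pow (chains Λ (Δ[n] : SSet.{u})) ι}
    (ht : t ∈ (pow (chains Λ Δ[n]) ι).gr k) : faceSum n t ∈ (pow (chains Λ Δ[n + 1]) ι).gr k := by
  rw [faceSum_apply]
  exact Submodule.sum_mem _ fun i _ => Submodule.smul_mem _ _ ((isChainMap_powMap _).degree _ _ ht)

theorem primRhs_mem {k : ℤ} {g : natOps.{u} Λ ι} (hg : g ∈ gr Λ ι k) (c : Λ) (n : ℕ) :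
    primRhs g c (primVals g c) n ∈ (pow (chains Λ (Δ[n] : SSet.{u})) ι).gr (k - n) := by
  have h : ∀ n, g.app Δ[n] (gen Λ _ (fund n)) ∈ (pow (chains Λ (Δ[n] : SSet.{u})) ι).gr (k - n) :=
      by
    intro n
    have := hg Δ[n] _ _ (gen_mem _ (fund n))
    rwa [neg_add_eq_sub] at this
  induction n with
  | zero => exact h 0
  | succ n ih =>
    refine Submodule.add_mem _ (h _) (Submodule.smul_mem _ _ (faceSum_mem ?_))
    have := simplexContr_mem ih
    rw [← primVals_eq] at this
    rwa [show k - ((n + 1 : ℕ) : ℤ) = k - n - 1 by push_cast; ring]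

/-- On fundamental simplices D s = g reads d s_n = g_n + c • (face sum of s_(n-1)), where c is the
sign of the degree k - 1 of s. The contraction solves this equation as soon as its right-hand side
is a cycle of augmentation 0. -/
theorem d_primVals {k : ℤ} {g : natOps.{u} Λ ι} (hg : g ∈ gr Λ ι k) (hk : k ≤ 0) (hD : D g = 0)
    (ha : k = 0 → aug g = 0) (n : ℕ) :
    (pow (chains Λ (Δ[n] : SSet.{u})) ι).d (primVals g (sgn Λ ((k - 1 : ℤ) : ZMod 2)) n) =
      primRhs g (sgn Λ ((k - 1 : ℤ) : ZMod 2)) (primVals g (sgn Λ ((k - 1 : ℤ) : ZMod 2))) n := by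
  set c := sgn Λ ((k - 1 : ℤ) : ZMod 2) with hc
  have hck : c = -sgn Λ (k : ZMod 2) := by
    rw [hc, Int.cast_sub, Int.cast_one, CharTwo.sub_eq_add, sgn_add_one]
  have hdg : ∀ (L : SSet.{u}) x, (pow (chains Λ L) ι).d (g.app L x) =
      sgn Λ (k : ZMod 2) • g.app L ((chains Λ L).d x) := by
    intro L x
    rw [← sub_eq_zero, ← D_apply hg, hD]
    rfl
  -- The right-hand side has degree k - n, which vanishes only for k = n = 0 since k ≤ 0; that case
  -- is the hypothesis on g.
  have haug : ∀ n, augPow Λ ι _ (primRhs g c (primVals g c) n) = 0 := by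
    intro n
    by_cases h : k - (n : ℤ) = 0
    · obtain rfl : k = 0 := by omega
      obtain rfl : n = 0 := by omega
      exact ha rfl
    · exact augPow_of_mem _ h (primRhs_mem hg c n)
  suffices h : (pow (chains Λ (Δ[n] : SSet.{u})) ι).d (primRhs g c (primVals g c) n) = 0 by
    have := simplexContr_spec n (primRhs g c (primVals g c) n)
    rwa [h, map_zero, add_zero, haug, zero_smul, sub_zero, ← primVals_eq] at this
  induction n with
  | zero =>
    change (pow (chains Λ (Δ[0] : SSet.{u})) ι).d (g.app _ (gen Λ _ (fund 0))) = 0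
    rw [hdg, chains_d_gen_zero, map_zero, smul_zero]
  | succ n ih =>
    have h1 : (pow (chains Λ (Δ[n] : SSet.{u})) ι).d (primVals g c n) =
        primRhs g c (primVals g c) n := by
      have := simplexContr_spec n (primRhs g c (primVals g c) n)
      rwa [ih, map_zero, add_zero, haug, zero_smul, sub_zero, ← primVals_eq] at this
    change (pow (chains Λ (Δ[n + 1] : SSet.{u})) ι).d
      (g.app _ (gen Λ _ (fund (n + 1))) + c • faceSum n (primVals g c n)) = 0
    rw [map_add, map_smul, faceSum_comm, h1, hdg, eq_faceSum, hck, neg_smul, ← sub_eq_add_neg,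
      ← smul_sub, ← map_sub]
    -- The two contributions of g cancel. What is left is a double face sum, and in the lowest
    -- dimension nothing at all.
    cases n with
    | zero =>
      change sgn Λ (k : ZMod 2) • faceSum 0 (g.app _ (gen Λ _ (fund 0)) - g.app _ (gen Λ _ (fund
          0))) = 0
      rw [sub_self, map_zero, smul_zero]
    | succ n =>
      have h2 : Normalized (Pi.single n (primVals g (-sgn Λ (k : ZMod 2)) n) :
          ∀ n, pow (chains Λ (Δ[n] : SSet.{u})) ι) :=
        normalized_single fun m h l => by
          subst h
          exact normalized_primVals g (-sgn Λ (k : ZMod 2)) m l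
      change sgn Λ (k : ZMod 2) • faceSum (n + 1) (g.app _ (gen Λ _ (fund (n + 1))) -
        (g.app _ (gen Λ _ (fund (n + 1))) +
          (-sgn Λ (k : ZMod 2)) • faceSum n (primVals g (-sgn Λ (k : ZMod 2)) n))) = 0
      rw [sub_add_cancel_left, map_neg, map_smul, faceSum_faceSum h2, smul_zero, neg_zero,
        smul_zero]

/-- The complex of natural operations is acyclic in non-positive degrees. -/
theorem exists_D_eq {k : ℤ} {g : natOps.{u} Λ ι} (hg : g ∈ gr Λ ι k) (hk : k ≤ 0) (hD : D g = 0)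
    (ha : k = 0 → aug g = 0) : ∃ s ∈ gr Λ ι (k - 1), D s = g := by
  set c := sgn Λ ((k - 1 : ℤ) : ZMod 2) with hc
  have hs : ofVals (primVals g c) (normalized_primVals g c) ∈ gr Λ ι (k - 1) := by
    intro L n x hx
    refine chains_induction L (P := fun x => (ofVals (primVals g c) (normalized_primVals g c)).app
        L x
      ∈ (pow (chains Λ L) ι).gr (n + (k - 1))) hx (fun m x hm => ?_) ?_ (fun y z hy hz => ?_)
      (fun r y hy => ?_)
    · rw [ofVals_gen]
      refine (isChainMap_powMap _).degree _ _ ?_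
      rw [primVals_eq, ← hm, show -(m : ℤ) + (k - 1) = k - m - 1 by ring]
      exact simplexContr_mem (primRhs_mem hg c m)
    · rw [map_zero]; exact Submodule.zero_mem _
    · rw [map_add]; exact Submodule.add_mem _ hy hz
    · rw [map_smul]; exact Submodule.smul_mem _ _ hy
  refine ⟨_, hs, ext fun L x => ?_⟩
  rw [D_apply hs]
  suffices h : (pow (chains Λ L) ι).d ∘ₗ (ofVals (primVals g c) (normalized_primVals g c)).app L -
      sgn Λ ((k - 1 : ℤ) : ZMod 2) • (ofVals (primVals g c) (normalized_primVals g c)).app L ∘ₗ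
        (chains Λ L).d = g.app L from LinearMap.congr_fun h x
  refine chains_ext L fun n x _ => ?_
  rw [LinearMap.sub_apply, LinearMap.smul_apply, LinearMap.comp_apply, LinearMap.comp_apply,
    ofVals_gen, ← (isChainMap_powMap _).comm, d_primVals hg hk hD ha, apply_gen g L x]
  cases n with
  | zero => rw [chains_d_gen_zero, map_zero, smul_zero, sub_zero]; rfl
  | succ n =>
    rw [ofVals_d_gen]
    change powMap Λ ι _ (_ + c • _) - c • _ = _
    rw [map_add, map_smul, add_sub_cancel_right]

end natOps

end NatOps

end

section

/-! ### Equivariant acyclic models -/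

section FreeAction

/-- In a complex with a homogeneous basis, the elements of degree `k` are the combinations of the
basis elements of degree `k`. -/
theorem DGMod.basis_induction {F : DGMod.{v} Λ} {J : Type*} (b : Module.Basis J Λ F) (deg : J → ℤ)
    (hb : ∀ j, b j ∈ F.gr (deg j)) {P : F → Prop} {k : ℤ} {x : F} (hx : x ∈ F.gr k)
    (h : ∀ j, deg j = k → P (b j)) (h0 : P 0) (ha : ∀ y z, P y → P z → P (y + z))
    (hs : ∀ (c : Λ) y, P y → P (c • y)) : P x := by
  suffices H : ∀ y, P (F.scale (fun n => if n = k then 1 else 0) y) by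
    have := H x
    rwa [F.scale_of_mem _ hx, if_pos rfl, one_smul] at this
  intro y
  induction b.mem_span y using Submodule.span_induction with
  | zero => rwa [map_zero]
  | add y z _ _ hy hz => rw [map_add]; exact ha _ _ hy hz
  | smul c y _ hy => rw [map_smul]; exact hs _ _ hy
  | mem y hy =>
    obtain ⟨j, rfl⟩ := hy
    rw [F.scale_of_mem _ (hb j)]
    split_ifs with hj
    · rw [one_smul]; exact h j hj
    · rwa [zero_smul]

/-- A non-positively graded complex `F` with operators `act κ`, closed under composition, and with
a homogeneous basis consisting of the elements `act κ (gen i)`. -/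
structure FreeAction (F : DGMod.{v} Λ) (K : Type v') (I : Type w) where
  act : K → F →ₗ[Λ] F
  mul : K → K → K
  act_mul : ∀ κ κ', act (mul κ κ') = act κ ∘ₗ act κ'
  isChainMap : ∀ κ, IsChainMap F F (act κ)
  gen : I → F
  deg : I → ℤ
  deg_le : ∀ i, deg i ≤ 0
  gen_mem : ∀ i, gen i ∈ F.gr (deg i)
  basis : Module.Basis (K × I) Λ F
  basis_apply : ∀ κ i, basis (κ, i) = act κ (gen i)

namespace FreeAction

variable {F : DGMod.{v} Λ} {K : Type v'} {I : Type w} (A : FreeAction F K I)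

theorem basis_mem (q : K × I) : A.basis q ∈ F.gr (A.deg q.2) := by
  rw [show q = (q.1, q.2) from rfl, A.basis_apply]
  exact (A.isChainMap _).degree _ _ (A.gen_mem _)

theorem induction {P : F → Prop} {k : ℤ} {x : F} (hx : x ∈ F.gr k)
    (h : ∀ κ i, A.deg i = k → P (A.act κ (A.gen i))) (h0 : P 0)
    (ha : ∀ y z, P y → P z → P (y + z)) (hs : ∀ (c : Λ) y, P y → P (c • y)) : P x :=
  basis_induction A.basis (fun q => A.deg q.2) A.basis_mem hx
    (fun q hq => by rw [show q = (q.1, q.2) from rfl, A.basis_apply]; exact h _ _ hq) h0 ha hs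

theorem eq_zero_of_pos (A : FreeAction F K I) {k : ℤ} (hk : 0 < k) {x : F} (hx : x ∈ F.gr k) : x =
    0 := by
  refine A.induction (P := fun x => x = 0) hx (fun κ i hi => ?_) rfl
    (fun y z hy hz => by rw [hy, hz, add_zero]) (fun c y hy => by rw [hy, smul_zero])
  have := A.deg_le i
  omega

variable {N : Type*} [AddCommGroup N] [Module Λ N]

/-- The linear map with prescribed values `v κ i` on the basis. -/
def lift (v : K → I → N) : F →ₗ[Λ] N := A.basis.constr Λ fun q => v q.1 q.2

theorem lift_apply (v : K → I → N) (κ : K) (i : I) : A.lift v (A.act κ (A.gen i)) = v κ i := by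
  rw [← A.basis_apply, lift, Module.Basis.constr_basis]

theorem hom_ext {f g : F →ₗ[Λ] N}
    (h : ∀ κ i, f (A.act κ (A.gen i)) = g (A.act κ (A.gen i))) : f = g := by
  refine A.basis.ext fun q => ?_
  rw [show q = (q.1, q.2) from rfl, A.basis_apply]
  exact h _ _

/-- Recursion over degrees in the form of a fixed point. T Y in degree k depends only on Y above k,
and F vanishes in positive degrees, so the iterates of T become stationary in each degree. -/
theorem exists_fixedPoint (A : FreeAction F K I) (T : (F →ₗ[Λ] N) → F →ₗ[Λ] N)
    (hT : ∀ k Y Y', (∀ m, k < m → ∀ x ∈ F.gr m, Y x = Y' x) → ∀ x ∈ F.gr k, T Y x = T Y' x) :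
    ∃ X, T X = X := by
  have h1 : ∀ (n : ℕ) (k : ℤ), -(n : ℤ) < k → ∀ x ∈ F.gr k, T^[n + 1] 0 x = T^[n] 0 x := by
    intro n
    induction n with
    | zero =>
      intro k hk x hx
      rw [A.eq_zero_of_pos (by simpa using hk) hx, map_zero, map_zero]
    | succ n ih =>
      intro k hk x hx
      rw [Function.iterate_succ_apply']
      conv_rhs => rw [Function.iterate_succ_apply']
      exact hT k _ _ (fun m hm y hy => ih m (by push_cast at hk; omega) y hy) x hx
  have h2 : ∀ (n m : ℕ) (k : ℤ), n ≤ m → -(n : ℤ) < k → ∀ x ∈ F.gr k,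
      T^[m] 0 x = T^[n] 0 x := by
    intro n m k hnm hk x hx
    induction m, hnm using Nat.le_induction with
    | base => rfl
    | succ m hm ih => rw [h1 m k (by omega) x hx, ih]
  -- In degree k the iterates are constant from the stage -k + 1 on; X takes the stationary value on
  -- each basis element.
  let X : F →ₗ[Λ] N := A.lift fun κ i => T^[(-A.deg i).toNat + 1] 0 (A.act κ (A.gen i))
  have h3 : ∀ (n : ℕ) (k : ℤ), -(n : ℤ) < k → ∀ x ∈ F.gr k, X x = T^[n] 0 x := by
    intro n k hk x hx
    refine A.induction (P := fun x => X x = T^[n] 0 x) hx (fun κ i hi => ?_) ?_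
      (fun y z hy hz => by rw [map_add, map_add, hy, hz])
      (fun c y hy => by rw [map_smul, map_smul, hy])
    · have hle := A.deg_le i
      rw [A.lift_apply]
      exact (h2 _ _ k (by omega) (by omega) _
        (hi ▸ (A.isChainMap κ).degree _ _ (A.gen_mem i))).symm
    · rw [map_zero, map_zero]
  refine ⟨X, A.hom_ext fun κ i => ?_⟩
  have hle := A.deg_le i
  have hmem := (A.isChainMap κ).degree _ _ (A.gen_mem i)
  rw [h3 ((-A.deg i).toNat + 1) _ (by omega) _ hmem, Function.iterate_succ_apply']
  exact hT _ _ _ (fun m hm y hy => h3 _ m (by omega) y hy) _ hmem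

/-- The comparison theorem: an equivariant cycle `G` of degree `r + 1` with values in a family
`gr'` of submodules on which `D` is exact has an equivariant primitive. -/
theorem exists_primitive (D : N →ₗ[Λ] N) (g : K → N →ₗ[Λ] N)
    (hg : ∀ κ κ', g (A.mul κ κ') = g κ ∘ₗ g κ') (hgD : ∀ κ x, g κ (D x) = D (g κ x))
    (gr' : ℤ → Submodule Λ N) (hgr : ∀ κ m, ∀ x ∈ gr' m, g κ x ∈ gr' m)
    (hex : ∀ m, ∀ x ∈ gr' m, D x = 0 → ∃ y ∈ gr' (m - 1), D y = x)
    (r : ℤ) (s : Λ) (G : F →ₗ[Λ] N)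
    (hG : ∀ n, ∀ x ∈ F.gr n, G x ∈ gr' (n + r + 1))
    (hGg : ∀ κ x, G (A.act κ x) = g κ (G x)) (hGD : ∀ x, D (G x) = s • G (F.d x)) :
    ∃ X : F →ₗ[Λ] N, (∀ n, ∀ x ∈ F.gr n, X x ∈ gr' (n + r)) ∧
      (∀ x, D (X x) + s • X (F.d x) = G x) ∧ (∀ κ x, X (A.act κ x) = g κ (X x)) ∧
      ((∀ x ∈ F.gr 0, G x = 0) → ∀ x ∈ F.gr 0, X x = 0) := by
  classical
  -- A choice of primitives, normalized to be 0 at 0. The normalization yields the last clause: the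
  -- solution vanishes in degree 0 whenever G does.
  let S : ℤ → N → N := fun m x =>
    if h : x ≠ 0 ∧ ∃ y ∈ gr' (m - 1), D y = x then h.2.choose else 0
  have hS : ∀ m, ∀ x ∈ gr' m, D x = 0 → S m x ∈ gr' (m - 1) ∧ D (S m x) = x := by
    intro m x hx hDx
    by_cases h0 : x = 0
    · have : S m x = 0 := dif_neg fun h => h.1 h0
      rw [this, h0, map_zero]
      exact ⟨Submodule.zero_mem _, rfl⟩
    · have h : x ≠ 0 ∧ ∃ y ∈ gr' (m - 1), D y = x := ⟨h0, hex m x hx hDx⟩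
      have h' : S m x = h.2.choose := dif_pos h
      rw [h']
      exact h.2.choose_spec
  -- Only generators receive a chosen primitive; their translates receive the translates of it,
  -- which makes the solution equivariant.
  let T : (F →ₗ[Λ] N) → F →ₗ[Λ] N := fun Y => A.lift fun κ i =>
    g κ (S (A.deg i + r + 1) (G (A.gen i) - s • Y (F.d (A.gen i))))
  obtain ⟨X, hX⟩ := A.exists_fixedPoint T (by
    intro k Y Y' h x hx
    refine A.induction (P := fun x => T Y x = T Y' x) hx (fun κ i hi => ?_) ?_
      (fun y z hy hz => by rw [map_add, map_add, hy, hz])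
      (fun c y hy => by rw [map_smul, map_smul, hy])
    · rw [A.lift_apply, A.lift_apply, h (k + 1) (by omega) _ (hi ▸ F.d_mem (A.gen_mem i))]
    · rw [map_zero, map_zero])
  have hX' : ∀ κ i, X (A.act κ (A.gen i)) =
      g κ (S (A.deg i + r + 1) (G (A.gen i) - s • X (F.d (A.gen i)))) := by
    intro κ i
    conv_lhs => rw [← hX]
    exact A.lift_apply _ _ _
  have hXg : ∀ κ x, X (A.act κ x) = g κ (X x) := by
    intro κ x
    suffices h : X ∘ₗ A.act κ = g κ ∘ₗ X from LinearMap.congr_fun h x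
    refine A.hom_ext fun κ' i => ?_
    rw [LinearMap.comp_apply, LinearMap.comp_apply, ← LinearMap.comp_apply (A.act κ), ← A.act_mul,
      hX', hX', hg]
    rfl
  -- Induction downwards on the degree k. The case n = 0 concerns positive degrees only, where F is
  -- zero.
  have key : ∀ (n : ℕ) (k : ℤ), -(n : ℤ) < k → ∀ x ∈ F.gr k,
      X x ∈ gr' (k + r) ∧ D (X x) + s • X (F.d x) = G x := by
    intro n
    induction n with
    | zero =>
      intro k hk x hx
      rw [A.eq_zero_of_pos (by simpa using hk) hx]
      simp only [map_zero, smul_zero, add_zero, Submodule.zero_mem, and_self]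
    | succ n ih =>
      intro k hk x hx
      refine A.induction (P := fun x => X x ∈ gr' (k + r) ∧ D (X x) + s • X (F.d x) = G x) hx
        (fun κ i hi => ?_) ?_ ?_ ?_
      · subst hi
        have h1 := ih (A.deg i + 1) (by push_cast at hk; omega) _ (F.d_mem (A.gen_mem i))
        -- The equation already known one degree higher, at the boundary of the generator, says that
        -- the obstruction is a cycle.
        have h2 : D (G (A.gen i) - s • X (F.d (A.gen i))) = 0 := by
          have := h1.2
          rw [F.d_d, map_zero, smul_zero, add_zero] at this
          rw [map_sub, map_smul, this, hGD, sub_self]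
        have h3 := hS (A.deg i + r + 1) _ (Submodule.sub_mem _ (hG _ _ (A.gen_mem i))
          (Submodule.smul_mem _ s (by rw [add_right_comm]; exact h1.1))) h2
        refine ⟨?_, ?_⟩
        · rw [add_sub_cancel_right] at h3
          rw [hX']
          exact hgr _ _ _ h3.1
        · rw [hX', ← hgD, h3.2, ← (A.isChainMap κ).comm, hXg, hGg, ← map_smul (g κ), ← map_add,
            sub_add_cancel]
      · simp only [map_zero, smul_zero, add_zero, Submodule.zero_mem, and_self]
      · rintro y z ⟨hy, hy'⟩ ⟨hz, hz'⟩
        refine ⟨by rw [map_add]; exact Submodule.add_mem _ hy hz, ?_⟩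
        simp only [map_add, smul_add, ← hy', ← hz']
        abel
      · rintro c y ⟨hy, hy'⟩
        refine ⟨by rw [map_smul]; exact Submodule.smul_mem _ _ hy, ?_⟩
        simp only [map_smul, ← hy', smul_add]
        rw [smul_comm]
  refine ⟨X, fun n x hx => (key ((-n).toNat + 1) n (by push_cast; omega) x hx).1, fun x => ?_, hXg,
    fun h0 x hx => ?_⟩
  · induction x using F.hom_induction with
    | h n x hx => exact (key ((-n).toNat + 1) n (by push_cast; omega) x hx).2
    | h0 => simp only [map_zero, smul_zero, add_zero]
    | ha y z hy hz =>
      simp only [map_add, smul_add, ← hy, ← hz]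
      abel
  · refine A.induction (P := fun x => X x = 0) hx (fun κ i hi => ?_) (map_zero _)
      (fun y z hy hz => by rw [map_add, hy, hz, add_zero])
      (fun c y hy => by rw [map_smul, hy, smul_zero])
    have h1 : F.d (A.gen i) = 0 :=
      A.eq_zero_of_pos (k := A.deg i + 1) (by omega) (F.d_mem (A.gen_mem i))
    have h2 : G (A.gen i) = 0 := h0 _ (hi ▸ A.gen_mem i)
    have h3 : S (A.deg i + r + 1) 0 = 0 := dif_neg fun h => h.1 rfl
    rw [hX', h1, h2, map_zero, smul_zero, sub_zero, h3, map_zero]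

end FreeAction

end FreeAction

/-! ### Equivariant families of natural operations -/

section Operations

variable {F : DGMod.{v} Λ} {K : Type v'} {I : Type w} (A : FreeAction F K I)
variable {ι : Type} [Fintype ι] [LinearOrder ι]

namespace natOps

theorem aug_of_mem {k : ℤ} (hk : k ≠ 0) {z : natOps.{u} Λ ι} (hz : z ∈ gr Λ ι k) : aug z = 0 := by
  refine augPow_of_mem _ hk ?_
  have := hz Δ[0] _ _ (gen_mem _ (fund 0))
  simpa using this

variable (Λ ι) in
/-- The natural operations of degree `k ≤ 0` with vanishing augmentation. -/
def redGr (k : ℤ) : Submodule Λ (natOps.{u} Λ ι) :=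
  if k ≤ 0 then gr Λ ι k ⊓ LinearMap.ker aug else ⊥

theorem mem_redGr {k : ℤ} (hk : k ≤ 0) {z : natOps.{u} Λ ι} :
    z ∈ redGr Λ ι k ↔ z ∈ gr Λ ι k ∧ aug z = 0 := by
  rw [redGr, if_pos hk, Submodule.mem_inf, LinearMap.mem_ker]

theorem redGr_pos {k : ℤ} (hk : 0 < k) {z : natOps.{u} Λ ι} : z ∈ redGr Λ ι k ↔ z = 0 := by
  rw [redGr, if_neg (not_le.2 hk), Submodule.mem_bot]

theorem redGr_le (k : ℤ) : redGr.{u} Λ ι k ≤ gr Λ ι k := by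
  rw [redGr]
  split_ifs
  · exact inf_le_left
  · exact bot_le

theorem perm_mem_redGr (σ : Equiv.Perm ι) (k : ℤ) (z : natOps.{u} Λ ι) (hz : z ∈ redGr Λ ι k) :
    perm σ z ∈ redGr Λ ι k := by
  by_cases hk : k ≤ 0
  · rw [mem_redGr hk] at hz ⊢
    exact ⟨perm_mem σ hz.1, by rw [aug_perm, hz.2]⟩
  · rw [redGr_pos (not_le.1 hk)] at hz ⊢
    rw [hz, map_zero]

/-- The primitive has negative degree and therefore augmentation 0 automatically. Positive degrees
are cut off because acyclicity is only known in degrees ≤ 0, and families over a non-positive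
complex never need more. -/
theorem redGr_exact (k : ℤ) (z : natOps.{u} Λ ι) (hz : z ∈ redGr Λ ι k) (hD : D z = 0) :
    ∃ y ∈ redGr Λ ι (k - 1), D y = z := by
  by_cases hk : k ≤ 0
  · rw [mem_redGr hk] at hz
    obtain ⟨y, hy, rfl⟩ := exists_D_eq hz.1 hk hD fun _ => hz.2
    exact ⟨y, (mem_redGr (by omega)).2 ⟨hy, aug_of_mem (by omega) hy⟩, rfl⟩
  · rw [redGr_pos (not_le.1 hk)] at hz
    exact ⟨0, Submodule.zero_mem _, by rw [hz, map_zero]⟩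

end natOps

open natOps

/-- A family of natural operations parametrized by a complex: a chain map to the complex of natural
operations. -/
structure IsOpFamily (E : F →ₗ[Λ] natOps.{u} Λ ι) : Prop where
  degree : ∀ n, ∀ x ∈ F.gr n, E x ∈ gr Λ ι n
  comm : ∀ x, E (F.d x) = D (E x)

/-- Equivariant families of natural operations with prescribed augmentation exist. -/
theorem FreeAction.exists_opFamily (φ : K → Equiv.Perm ι)
    (hφ : ∀ κ κ', φ (A.mul κ κ') = φ κ * φ κ') (ε : F →ₗ[Λ] Λ)
    (hε_gr : ∀ n, n ≠ 0 → ∀ x ∈ F.gr n, ε x = 0) (hε_d : ∀ x, ε (F.d x) = 0)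
    (hε_act : ∀ κ x, ε (A.act κ x) = ε x) {z : natOps.{u} Λ ι} (hz : z ∈ gr Λ ι 0)
    (hDz : D z = 0) (haz : aug z = 1) :
    ∃ E : F →ₗ[Λ] natOps.{u} Λ ι, IsOpFamily E ∧ (∀ κ x, E (A.act κ x) = perm (φ κ) (E x)) ∧
      (∀ x, aug (E x) = ε x) ∧
      ∀ κ i, A.deg i = 0 → E (A.act κ (A.gen i)) = ε (A.gen i) • perm (φ κ) z := by
  -- First approximation: translates of z, weighted by the augmentation. It has the right
  -- augmentation and equivariance and takes cycles as values, but need not vanish on boundaries.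
  let E₀ : F →ₗ[Λ] natOps.{u} Λ ι := A.lift (N :=
      natOps.{u} Λ ι) fun κ i => ε (A.gen i) • perm (φ κ) z
  have hE₀ : ∀ κ i, E₀ (A.act κ (A.gen i)) = ε (A.gen i) • perm (φ κ) z :=
    fun κ i => A.lift_apply _ κ i
  have hE₀_deg : ∀ n, ∀ x ∈ F.gr n, E₀ x ∈ gr Λ ι n := by
    intro n x hx
    refine A.induction (P := fun x => E₀ x ∈ gr Λ ι n) hx (fun κ i hi => ?_) ?_
      (fun y z hy hz => by rw [map_add]; exact Submodule.add_mem _ hy hz)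
      (fun c y hy => by rw [map_smul]; exact Submodule.smul_mem _ _ hy)
    · rw [hE₀]
      by_cases h0 : n = 0
      · rw [h0]; exact Submodule.smul_mem _ _ (perm_mem _ hz)
      · rw [hε_gr (A.deg i) (by omega) _ (A.gen_mem i), zero_smul]; exact Submodule.zero_mem _
    · rw [map_zero]; exact Submodule.zero_mem _
  have hE₀_act : ∀ κ x, E₀ (A.act κ x) = perm (φ κ) (E₀ x) := by
    intro κ x
    suffices h : E₀ ∘ₗ A.act κ = perm (φ κ) ∘ₗ E₀ from LinearMap.congr_fun h x
    refine A.hom_ext (N := natOps.{u} Λ ι) fun κ' i => ?_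
    rw [LinearMap.comp_apply, LinearMap.comp_apply, ← LinearMap.comp_apply (A.act κ), ← A.act_mul,
      hE₀, hE₀, hφ, perm_mul, map_smul]
    rfl
  have hE₀_aug : ∀ x, aug (E₀ x) = ε x := by
    intro x
    suffices h : (aug : natOps.{u} Λ ι →ₗ[Λ] Λ) ∘ₗ E₀ = ε from LinearMap.congr_fun h x
    refine A.hom_ext (N := Λ) fun κ i => ?_
    rw [LinearMap.comp_apply, hE₀, map_smul, aug_perm, haz, smul_eq_mul, mul_one, hε_act]
  have hDE₀ : ∀ x, D (E₀ x) = 0 := by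
    intro x
    suffices h : (D : natOps.{u} Λ ι →ₗ[Λ] natOps.{u} Λ ι) ∘ₗ E₀ = 0 from LinearMap.congr_fun h x
    refine A.hom_ext (N := natOps.{u} Λ ι) fun κ i => ?_
    rw [LinearMap.comp_apply, hE₀, map_smul, ← perm_D, hDz, map_zero, smul_zero]
    rfl
  -- The failure of `E₀` to be a chain map. Its augmentation is 0, so it lies in the acyclic part
  -- and can be corrected.
  let G : F →ₗ[Λ] natOps.{u} Λ ι := E₀ ∘ₗ F.d
  have hG0 : ∀ x ∈ F.gr 0, G x = 0 := by
    intro x hx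
    change E₀ (F.d x) = 0
    rw [A.eq_zero_of_pos (k := 0 + 1) (by omega) (F.d_mem hx), map_zero]
  -- With r = 0 and s = -1 the correction satisfies D X - X d = E₀ d, so E₀ + X is a chain map. X is
  -- 0 in degree 0, hence the values on degree-zero generators are exactly those of `E₀`.
  obtain ⟨X, hX_deg, hX, hX_act, hX0⟩ := A.exists_primitive (N :=
      natOps.{u} Λ ι) D (fun κ => perm (φ κ))
    (fun κ κ' => by rw [hφ, perm_mul]) (fun κ x => perm_D _ x) (redGr Λ ι)
    (fun κ m x hx => perm_mem_redGr _ m x hx) redGr_exact 0 (-1) G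
    (fun n x hx => by
      rw [add_zero]
      by_cases hn : n + 1 ≤ 0
      · rw [mem_redGr hn]
        exact ⟨hE₀_deg _ _ (F.d_mem hx), by rw [LinearMap.comp_apply, hE₀_aug, hε_d]⟩
      · rw [redGr_pos (not_le.1 hn)]
        change E₀ (F.d x) = 0
        rw [A.eq_zero_of_pos (not_le.1 hn) (F.d_mem hx), map_zero])
    (fun κ x => by
      change E₀ (F.d _) = perm _ (E₀ (F.d _))
      rw [← (A.isChainMap κ).comm, hE₀_act])
    (fun x => by
      change D (E₀ (F.d x)) = _ • E₀ (F.d (F.d x))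
      rw [hDE₀, F.d_d, map_zero, smul_zero])
  refine ⟨E₀ + X, ⟨fun n x hx => Submodule.add_mem _ (hE₀_deg n x hx) ?_, fun x => ?_⟩,
    fun κ x => ?_, fun x => ?_, fun κ i hi => ?_⟩
  · have := redGr_le _ (hX_deg n x hx)
    rwa [add_zero] at this
  · have h := hX x
    change _ = E₀ (F.d x) at h
    rw [LinearMap.add_apply, LinearMap.add_apply, map_add, hDE₀, ← h]
    simp
  · rw [LinearMap.add_apply, LinearMap.add_apply, map_add, hX_act, hE₀_act]
  · rw [LinearMap.add_apply, map_add, hE₀_aug, add_eq_left]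
    induction x using F.hom_induction with
    | h n x hx =>
      have h := hX_deg n x hx
      rw [add_zero] at h
      by_cases hn : n ≤ 0
      · exact ((mem_redGr hn).1 h).2
      · rw [(redGr_pos (not_le.1 hn)).1 h, map_zero]
    | h0 => rw [map_zero, map_zero]
    | ha y z hy hz => rw [map_add, map_add, hy, hz, add_zero]
  · rw [LinearMap.add_apply, hE₀, hX0 hG0, add_zero]
    exact hi ▸ (A.isChainMap κ).degree _ _ (A.gen_mem i)

/-- Equivariant families of natural operations with the same augmentation are equivariantly
homotopic. -/
theorem FreeAction.exists_opHomotopy (φ : K → Equiv.Perm ι)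
    (hφ : ∀ κ κ', φ (A.mul κ κ') = φ κ * φ κ') {E E' : F →ₗ[Λ] natOps.{u} Λ ι}
    (hE : IsOpFamily E) (hE' : IsOpFamily E') (hE_act : ∀ κ x, E (A.act κ x) = perm (φ κ) (E x))
    (hE'_act : ∀ κ x, E' (A.act κ x) = perm (φ κ) (E' x)) (haug : ∀ x, aug (E x) = aug (E' x)) :
    ∃ X : F →ₗ[Λ] natOps.{u} Λ ι, (∀ n, ∀ x ∈ F.gr n, X x ∈ gr Λ ι (n - 1)) ∧
      (∀ x, E x - E' x = D (X x) + X (F.d x)) ∧ ∀ κ x, X (A.act κ x) = perm (φ κ) (X x) := by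
  -- The difference E - E' has augmentation 0. The values r = -1 and s = 1 turn the primitive into a
  -- homotopy.
  obtain ⟨X, hX_deg, hX, hX_act, -⟩ := A.exists_primitive (N :=
      natOps.{u} Λ ι) D (fun κ => perm (φ κ))
    (fun κ κ' => by rw [hφ, perm_mul]) (fun κ x => perm_D _ x) (redGr Λ ι)
    (fun κ m x hx => perm_mem_redGr _ m x hx) redGr_exact (-1) 1 (E - E')
    (fun n x hx => by
      rw [neg_add_cancel_right]
      by_cases hn : n ≤ 0
      · rw [mem_redGr hn, LinearMap.sub_apply]
        exact ⟨Submodule.sub_mem _ (hE.degree _ _ hx) (hE'.degree _ _ hx), by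
          rw [map_sub, haug, sub_self]⟩
      · rw [A.eq_zero_of_pos (not_le.1 hn) hx, map_zero]
        exact Submodule.zero_mem _)
    (fun κ x => by
      rw [LinearMap.sub_apply, LinearMap.sub_apply, map_sub, hE_act, hE'_act])
    (fun x => by
      rw [LinearMap.sub_apply, LinearMap.sub_apply, map_sub, hE.comm, hE'.comm, one_smul])
  refine ⟨X, fun n x hx => redGr_le _ (hX_deg n x hx), fun x => ?_, hX_act⟩
  have h := hX x
  rw [one_smul, LinearMap.sub_apply] at h
  exact h.symm

end Operations

end

section

/-! ### Faces of simplices -/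

section Pick

/-- The order preserving map `⦋m⦌ ⟶ ⦋n⦌` given by `t ↦ min (φ t) n`. -/
def clampHom (m n : ℕ) (φ : ℕ →o ℕ) : ⦋m⦌ ⟶ ⦋n⦌ :=
  SimplexCategory.Hom.mk ⟨fun t => ⟨min (φ t) n, Nat.lt_succ_of_le (min_le_right _ _)⟩, fun _ _ h =>
    min_le_min_right n (φ.monotone h)⟩

theorem clampHom_apply (m n : ℕ) (φ : ℕ →o ℕ) (t : Fin (m + 1)) :
    (((clampHom m n φ).toOrderHom t : Fin (n + 1)) : ℕ) = min (φ t) n := rfl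

/-- The cap at n is only a default value, inactive when φ already lands in 0, …, n. Faces of
simplices can thus be compared by arithmetic on natural numbers. -/
theorem eq_clampHom {m n : ℕ} (f : ⦋m⦌ ⟶ ⦋n⦌) (φ : ℕ →o ℕ)
    (h : ∀ t : Fin (m + 1), ((f.toOrderHom t : Fin (n + 1)) : ℕ) = φ t) : f = clampHom m n φ := by
  ext t
  have h1 : (f.toOrderHom t : ℕ) < n + 1 := (f.toOrderHom t).2
  refine Eq.trans ?_ (clampHom_apply m n φ t).symm
  refine Eq.trans (h t) ?_
  rw [← h t]
  omega

variable (Λ) in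
/-- The generator of the normalized chains given by the face of `x` with vertices
`φ 0, …, φ m`. -/
def pick {X : SSet.{u}} {n : ℕ} (x : X _⦋n⦌) (m : ℕ) (φ : ℕ →o ℕ) : chains Λ X :=
  gen Λ X (X.map (clampHom m n φ).op x)

theorem pick_mem {X : SSet.{u}} {n : ℕ} (x : X _⦋n⦌) (m : ℕ) (φ : ℕ →o ℕ) :
    pick Λ x m φ ∈ (chains Λ X).gr (-(m : ℤ)) := gen_mem _ _

theorem pick_congr {X : SSet.{u}} {n : ℕ} (x : X _⦋n⦌) (m : ℕ) {φ ψ : ℕ →o ℕ}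
    (h : ∀ t ≤ m, φ t = ψ t) : pick Λ x m φ = pick Λ x m ψ := by
  have : clampHom m n φ = clampHom m n ψ := by
    ext t
    exact congrArg (min · n) (h t (Nat.le_of_lt_succ t.2))
  rw [pick, this, pick]

theorem gen_map {X : SSet.{u}} {n m : ℕ} (x : X _⦋n⦌) (f : ⦋m⦌ ⟶ ⦋n⦌) (φ : ℕ →o ℕ)
    (h : ∀ t : Fin (m + 1), ((f.toOrderHom t : Fin (n + 1)) : ℕ) = φ t) :
    gen Λ X (X.map f.op x) = pick Λ x m φ := by
  rw [pick, ← eq_clampHom f φ h]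

theorem chainsMap_pick {X Y : SSet.{u}} (f : X ⟶ Y) {n : ℕ} (x : X _⦋n⦌) (m : ℕ) (φ : ℕ →o ℕ) :
    chainsMap f (pick Λ x m φ) = pick Λ (f.app (op ⦋n⦌) x) m φ := by
  rw [pick, chainsMap_gen, pick]
  exact congrArg _ (NatTrans.naturality_apply f _ x)

/-- The order preserving map `t ↦ a + t`. -/
def shiftHom (a : ℕ) : ℕ →o ℕ := ⟨fun t => a + t, fun _ _ h => Nat.add_le_add_left h a⟩

theorem shiftHom_apply (a t : ℕ) : shiftHom a t = a + t := rfl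

/-- The injective order preserving map whose image omits `v`. -/
def skipHom (v : ℕ) : ℕ →o ℕ := ⟨fun t => if t < v then t else t + 1, fun s t h => by
  dsimp only
  split_ifs <;> omega⟩

theorem skipHom_apply (v t : ℕ) : skipHom v t = if t < v then t else t + 1 := rfl

theorem map_pick_comp {X : SSet.{u}} {n m : ℕ} (x : X _⦋n⦌) (f : ⦋m⦌ ⟶ ⦋n⦌) (k : ℕ)
    (φ ψ χ : ℕ →o ℕ) (hf : ∀ t : Fin (m + 1), ((f.toOrderHom t : Fin (n + 1)) : ℕ) = φ t)
    (hψ : ∀ t ≤ k, ψ t ≤ m) (hχ : ∀ t ≤ k, φ (ψ t) = χ t) :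
    pick Λ (X.map f.op x) k ψ = pick Λ x k χ := by
  have h : X.map (clampHom k m ψ).op (X.map f.op x) = X.map (clampHom k m ψ ≫ f).op x := by
    rw [op_comp, Functor.map_comp, CategoryTheory.comp_apply]
  rw [pick, h]
  refine gen_map x _ _ fun t => ?_
  refine (hf ((clampHom k m ψ).toOrderHom t)).trans ?_
  rw [clampHom_apply, min_eq_left (hψ t (by omega)), hχ t (by omega)]

theorem pick_δ {X : SSet.{u}} {n : ℕ} (x : X _⦋n + 1⦌) (v : Fin (n + 2)) (k : ℕ)
    {ψ χ : ℕ →o ℕ} (hψ : ∀ t ≤ k, ψ t ≤ n) (hχ : ∀ t ≤ k, skipHom v (ψ t) = χ t) :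
    pick Λ (X.δ v x) k ψ = pick Λ x k χ := by
  refine map_pick_comp x (SimplexCategory.δ v) k (skipHom v) ψ χ (fun t => ?_) hψ hχ
  change ((v.succAbove t : Fin (n + 2)) : ℕ) = _
  rw [skipHom_apply, Fin.succAbove]
  split_ifs with h1 h2 h2
  · rfl
  · exact absurd h1 h2
  · exact absurd h2 h1
  · rfl

theorem d_pick_zero {X : SSet.{u}} {n : ℕ} (x : X _⦋n⦌) (φ : ℕ →o ℕ) :
    (chains Λ X).d (pick Λ x 0 φ) = 0 := chains_d_gen_zero _ _

theorem d_pick_succ {X : SSet.{u}} {n : ℕ} (x : X _⦋n⦌) (m : ℕ) (φ : ℕ →o ℕ)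
    (hφ : ∀ t ≤ m + 1, φ t ≤ n) :
    (chains Λ X).d (pick Λ x (m + 1) φ) =
      ∑ l ∈ Finset.range (m + 2), (-1 : Λ) ^ l • pick Λ x m (φ.comp (skipHom l)) := by
  rw [pick, chains_d_gen, ← Fin.sum_univ_eq_sum_range
    (fun l => (-1 : Λ) ^ l • pick Λ x m (φ.comp (skipHom l)))]
  refine Finset.sum_congr rfl fun l _ => ?_
  congr 1
  have h : X.δ l (X.map (clampHom (m + 1) n φ).op x) =
      X.map (SimplexCategory.δ l ≫ clampHom (m + 1) n φ).op x := by
    rw [op_comp, Functor.map_comp, CategoryTheory.comp_apply]; rfl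
  rw [h]
  refine gen_map x _ _ fun t => ?_
  have h2 : (((SimplexCategory.δ l ≫ clampHom (m + 1) n φ).toOrderHom t : Fin (n + 1)) : ℕ) =
      min (φ (l.succAbove t : Fin (m + 2))) n := rfl
  have h3 : ((l.succAbove t : Fin (m + 2)) : ℕ) = skipHom l t := by
    rw [skipHom_apply, Fin.succAbove]
    split_ifs with h1 h2 h2
    · rfl
    · exact absurd h1 h2
    · exact absurd h2 h1
    · rfl
  rw [h2, min_eq_left (hφ _ (by omega)), h3]
  rfl

/-- The face uses both vertices l and l + 1, which the degeneracy identifies; it is therefore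
degenerate itself. -/
theorem pick_σ {X : SSet.{u}} {n : ℕ} (y : X _⦋n⦌) (l : Fin (n + 1)) (m : ℕ) (φ : ℕ →o ℕ)
    {t : ℕ} (ht : t + 1 ≤ m) (h : φ t = l) (h' : φ (t + 1) = l + 1) :
    pick Λ (X.σ l y) m φ = 0 := by
  refine gen_of_degenerate X ?_
  have h3 : X.map (clampHom m (n + 1) φ).op (X.σ l y) =
      X.map (clampHom m (n + 1) φ ≫ SimplexCategory.σ l).op y := by
    rw [op_comp, Functor.map_comp, CategoryTheory.comp_apply]; rfl
  rw [h3]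
  apply mem_degenerate_of_not_injective
  intro hinj
  have ha : (clampHom m (n + 1) φ).toOrderHom ⟨t, Nat.lt_succ_of_lt ht⟩ = l.castSucc := by
    ext
    rw [clampHom_apply, h]
    exact min_eq_left (by omega)
  have hb : (clampHom m (n + 1) φ).toOrderHom ⟨t + 1, Nat.lt_succ_of_le ht⟩ = l.succ := by
    ext
    rw [clampHom_apply, h']
    exact min_eq_left (by omega)
  have hab : (⟨t, by omega⟩ : Fin (m + 1)) = ⟨t + 1, by omega⟩ := by
    apply hinj
    change l.predAbove ((clampHom m (n + 1) φ).toOrderHom _) =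
      l.predAbove ((clampHom m (n + 1) φ).toOrderHom _)
    rw [ha, hb]
    simp
  simp at hab

end Pick

/-! ### The Alexander–Whitney map is a chain map -/

section AW

variable {ι : Type} [Fintype ι] [LinearOrder ι]

/-- The sum of `e j` over `j < i`. -/
def sumBelow (e : ι → ℕ) (i : ι) : ℕ := ∑ j with j < i, e j

theorem sumBelow_add_le (e : ι → ℕ) (i : ι) : sumBelow e i + e i ≤ ∑ j, e j := by
  have h : (∑ j with j < i, e j) + e i = ∑ j ∈ insert i (Finset.univ.filter (· < i)), e j := by
    rw [Finset.sum_insert (by simp), add_comm]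
  rw [sumBelow, h]
  exact Finset.sum_le_sum_of_subset (Finset.subset_univ _)

theorem sumBelow_add_le_of_lt (e : ι → ℕ) {i j : ι} (hij : i < j) :
    sumBelow e i + e i ≤ sumBelow e j := by
  have h : (∑ j with j < i, e j) + e i = ∑ j ∈ insert i (Finset.univ.filter (· < i)), e j := by
    rw [Finset.sum_insert (by simp), add_comm]
  rw [sumBelow, h]
  refine Finset.sum_le_sum_of_subset fun k hk => ?_
  simp only [Finset.mem_insert, Finset.mem_filter_univ] at hk ⊢
  rcases hk with rfl | hk
  · exact hij
  · exact hk.trans hij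

/-- Telescoping over the initial segments of a finite linear order. -/
theorem sum_initial_telescope {M : Type*} [AddCommGroup M] (g : Finset ι → M) :
    ∑ i, (g (Finset.univ.filter (· ≤ i)) - g (Finset.univ.filter (· < i))) =
        g Finset.univ - g ∅ := by
  suffices h : ∀ s : Finset ι, ∑ i ∈ s, (g (s.filter (· ≤ i)) - g (s.filter (· < i))) =
      g s - g ∅ from
    h Finset.univ
  intro s
  induction s using Finset.induction_on_max with
  | empty => simp
  | insert a s ha ih =>
    have has : a ∉ s := fun h => (ha a h).false
    have h1 : (insert a s).filter (· ≤ a) = insert a s := by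
      refine Finset.filter_true_of_mem fun j hj => ?_
      rcases Finset.mem_insert.1 hj with rfl | hj
      · exact le_rfl
      · exact (ha j hj).le
    have h2 : (insert a s).filter (· < a) = s := by
      rw [Finset.filter_insert, if_neg (lt_irrefl a)]
      exact Finset.filter_true_of_mem ha
    rw [Finset.sum_insert has, h1, h2, ← sub_add_sub_cancel (g (insert a s)) (g s) (g ∅), ← ih]
    congr 1
    refine Finset.sum_congr rfl fun i hi => ?_
    rw [Finset.filter_insert, Finset.filter_insert, if_neg (not_le.2 (ha i hi)),
      if_neg (ha i hi).not_gt]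

/-- A position `l` below `∑ i, e i` lies in one of the blocks. -/
theorem exists_block (e : ι → ℕ) {l : ℕ} (hl : l < ∑ i, e i) :
    ∃ i, sumBelow e i ≤ l ∧ l < sumBelow e i + e i := by
  by_contra! h
  -- If no block contains l, then each block that starts at or before l also ends there, and the
  -- next block starts where it ends. The last block ends at the total sum, which exceeds l.
  have key : ∀ i, sumBelow e i ≤ l := by
    intro i
    induction i using (Finite.wellFounded_of_trans_of_irrefl (α := ι) (· < ·)).induction with
    | _ i ih =>
      rw [sumBelow]
      rcases (Finset.univ.filter (· < i) : Finset ι).eq_empty_or_nonempty with h0 | hne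
      · rw [h0, Finset.sum_empty]; exact Nat.zero_le _
      · have hj := Finset.max'_mem _ hne
        set j := Finset.max' _ hne with hjdef
        rw [Finset.mem_filter_univ] at hj
        have h1 : Finset.univ.filter (· < i) = insert j (Finset.univ.filter (· < j)) := by
          ext k
          simp only [Finset.mem_filter_univ, Finset.mem_insert]
          constructor
          · intro hk
            exact (Finset.le_max' _ k (by simpa using hk)).eq_or_lt
          · rintro (rfl | hk)
            · exact hj
            · exact hk.trans hj
        rw [h1, Finset.sum_insert (by simp), add_comm]
        exact h j (ih j hj)
  rcases (Finset.univ : Finset ι).eq_empty_or_nonempty with h0 | hne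
  · rw [h0, Finset.sum_empty] at hl
    exact absurd hl (Nat.not_lt_zero l)
  · set j := Finset.max' _ hne with hjdef
    have h1 : (Finset.univ : Finset ι) = insert j (Finset.univ.filter (· < j)) := by
      ext k
      simp only [Finset.mem_univ, Finset.mem_filter_univ, Finset.mem_insert, true_iff]
      exact (Finset.le_max' _ k (Finset.mem_univ k)).eq_or_lt
    rw [h1, Finset.sum_insert (by simp), add_comm] at hl
    exact absurd hl (not_lt.2 (h j (key j)))

/-- The default branch in `aw` never occurs: a block of a decomposition of n ends at or before n. -/
theorem aw_eq (L : ι → SSet.{u}) {n : ℕ} (x : ∀ i, (L i) _⦋n⦌) :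
    aw (Λ := Λ) L x = ∑ e ∈ Finset.piAntidiag Finset.univ n,
      PiTensorProduct.tprod Λ fun i => pick Λ (x i) (e i) (shiftHom (sumBelow e i)) := by
  refine Finset.sum_congr rfl fun e he => ?_
  congr 1
  funext i
  have h := sumBelow_add_le e i
  rw [(Finset.mem_piAntidiag.1 he).1] at h
  rw [sumBelow] at h
  rw [dif_pos h]
  exact gen_map _ _ _ fun t => add_comm _ _

/-- The Alexander–Whitney map on the diagonal. -/
def awVal (ι : Type) [Fintype ι] [LinearOrder ι] {X : SSet.{u}} {n : ℕ} (x : X _⦋n⦌) :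
    pow (chains Λ X) ι := aw (fun _ => X) fun _ => x

theorem awVal_eq {X : SSet.{u}} {n : ℕ} (x : X _⦋n⦌) :
    awVal (Λ := Λ) ι x = ∑ e ∈ Finset.piAntidiag Finset.univ n,
      PiTensorProduct.tprod Λ fun i => pick Λ x (e i) (shiftHom (sumBelow e i)) :=
  aw_eq (fun _ => X) fun _ => x

/-- Consecutive blocks share their endpoint, so the identified vertices l and l + 1 always lie
together in one block, and that factor is degenerate. -/
theorem awVal_degenerate {X : SSet.{u}} {n : ℕ} {x : X _⦋n⦌} (hx : x ∈ X.degenerate n) :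
    awVal (Λ := Λ) ι x = 0 := by
  cases n with
  | zero => simp at hx
  | succ n =>
    rw [SSet.degenerate_eq_iUnion_range_σ] at hx
    obtain ⟨l, y, rfl⟩ := Set.mem_iUnion.1 hx
    rw [awVal_eq]
    refine Finset.sum_eq_zero fun e he => ?_
    obtain ⟨i, hi, hi'⟩ := exists_block e (l := l) (by
      rw [(Finset.mem_piAntidiag.1 he).1]; omega)
    refine MultilinearMap.map_coord_zero _ i ?_
    exact pick_σ y l _ _ (t := l - sumBelow e i) (by omega) (by rw [shiftHom_apply]; omega)
      (by rw [shiftHom_apply]; omega)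

theorem awVal_natural {X Y : SSet.{u}} (g : X ⟶ Y) {n : ℕ} (x : X _⦋n⦌) :
    powMap Λ ι g (awVal ι x) = awVal ι (g.app (op ⦋n⦌) x) := by
  rw [awVal_eq, awVal_eq, map_sum]
  refine Finset.sum_congr rfl fun e _ => ?_
  rw [powMap, PiTensorProduct.map_tprod]
  congr 1
  funext i
  exact chainsMap_pick g x _ _

/-- The Alexander–Whitney map as a natural operation. -/
def awOp (Λ : Type) [Field Λ] (ι : Type) [Fintype ι] [LinearOrder ι] : natOps.{u} Λ ι :=
  natOps.mk (fun L => chainsLift L fun _ x => awVal ι x) (by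
    intro L L' g c
    suffices h : powMap Λ ι g ∘ₗ chainsLift L (fun _ x => awVal ι x)
        = chainsLift L' (fun _ x => awVal ι x) ∘ₗ chainsMap g from
      LinearMap.congr_fun h c
    refine chains_ext L fun n x _ => ?_
    rw [LinearMap.comp_apply, LinearMap.comp_apply, chainsMap_gen,
      chainsLift_gen L _ (fun n x hx => awVal_degenerate hx),
      chainsLift_gen L' _ (fun n x hx => awVal_degenerate hx), awVal_natural])

theorem awOp_gen (L : SSet.{u}) {n : ℕ} (x : L _⦋n⦌) :
    (awOp Λ ι).app L (gen Λ L x) = awVal ι x :=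
  chainsLift_gen L _ (fun _ _ hx => awVal_degenerate hx) x

theorem awVal_mem {X : SSet.{u}} {n : ℕ} (x : X _⦋n⦌) :
    awVal ι x ∈ (pow (chains Λ X) ι).gr (-(n : ℤ)) := by
  rw [awVal_eq]
  refine Submodule.sum_mem _ fun e he => ?_
  have h : -(n : ℤ) = ∑ i, -(e i : ℤ) := by
    rw [Finset.sum_neg_distrib, ← (Finset.mem_piAntidiag.1 he).1, Nat.cast_sum]
  rw [h]
  exact tprod_mem_piGr _ fun i => pick_mem _ _ _

theorem awOp_mem : awOp Λ ι ∈ natOps.gr.{u} Λ ι 0 := by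
  intro L n c hc
  rw [add_zero]
  refine chains_induction L (P := fun c => (awOp Λ ι).app L c ∈ (pow (chains Λ L) ι).gr n) hc
    (fun m x hm => ?_) ?_ (fun y z hy hz => ?_) (fun r y hy => ?_)
  · rw [awOp_gen, ← hm]; exact awVal_mem x
  · rw [map_zero]; exact Submodule.zero_mem _
  · rw [map_add]; exact Submodule.add_mem _ hy hz
  · rw [map_smul]; exact Submodule.smul_mem _ _ hy

theorem aug_awOp : natOps.aug (awOp.{u} Λ ι) = 1 := by
  rw [natOps.aug_apply, awOp_gen, awVal_eq, Finset.piAntidiag_zero, Finset.sum_singleton,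
    augPow_tprod]
  refine Finset.prod_eq_one fun i _ => ?_
  exact augC_gen _ _

end AW

end

/-! ### The boundary of the Alexander–Whitney map: faces and cuts -/

section

section AWChainMap

variable {ι : Type} [Fintype ι] [LinearOrder ι]

theorem sumBelow_add_single (e : ι → ℕ) (i j : ι) :
    sumBelow (e + Pi.single i 1) j = sumBelow e j + if i < j then 1 else 0 := by
  rw [sumBelow, sumBelow]
  simp only [Pi.add_apply, Finset.sum_add_distrib]
  congr 1
  simp only [Pi.single_apply, Finset.sum_ite_eq', Finset.mem_filter_univ]

/-- Decompositions of n + 1 with non-empty i-th block correspond to decompositions of n. Only these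
contribute when the i-th factor is differentiated. -/
theorem sum_piAntidiag_add_single {M : Type*} [AddCommMonoid M] (n : ℕ) (i : ι)
    (f : (ι → ℕ) → M) (hf : ∀ e, e i = 0 → f e = 0) :
    ∑ e ∈ Finset.piAntidiag Finset.univ (n + 1), f e =
      ∑ e ∈ Finset.piAntidiag Finset.univ n, f (e + Pi.single i 1) := by
  symm
  refine Finset.sum_of_injOn (fun e => e + Pi.single i 1) (fun e _ e' _ h => add_right_cancel h)
    (fun e he => ?_) (fun e he he' => ?_) fun _ _ => rfl
  · have h := (Finset.mem_piAntidiag.1 he).1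
    refine Finset.mem_piAntidiag.2 ⟨?_, fun i _ => Finset.mem_univ i⟩
    simp only [Pi.add_apply, Finset.sum_add_distrib, h]
    simp
  · by_cases h0 : e i = 0
    · exact hf e h0
    · refine absurd ⟨e - Pi.single i 1, ?_, ?_⟩ he'
      · have h1 : e - Pi.single i 1 + Pi.single i 1 = e := by
          refine tsub_add_cancel_of_le fun j => ?_
          by_cases hj : j = i
          · subst hj; rw [Pi.single_eq_same]; exact Nat.one_le_iff_ne_zero.2 h0
          · rw [Pi.single_eq_of_ne hj]; exact Nat.zero_le _
        have h := (Finset.mem_piAntidiag.1 he).1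
        rw [← h1] at h
        simp only [Pi.add_apply, Finset.sum_add_distrib] at h
        refine Finset.mem_piAntidiag.2 ⟨?_, fun i _ => Finset.mem_univ i⟩
        simpa using h
      · refine tsub_add_cancel_of_le fun j => ?_
        by_cases hj : j = i
        · subst hj; rw [Pi.single_eq_same]; exact Nat.one_le_iff_ne_zero.2 h0
        · rw [Pi.single_eq_of_ne hj]; exact Nat.zero_le _

theorem d_tprod_pick {X : SSet.{u}} {n : ℕ} (x : X _⦋n⦌) (e : ι → ℕ) (φ : ι → ℕ →o ℕ) :
    (pow (chains Λ X) ι).d (PiTensorProduct.tprod Λ fun i => pick Λ x (e i) (φ i)) =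
      ∑ i, (-1 : Λ) ^ sumBelow e i • PiTensorProduct.tprod Λ
        (Function.update (fun i => pick Λ x (e i) (φ i)) i
          ((chains Λ X).d (pick Λ x (e i) (φ i)))) := by
  rw [pi_d_tprod _ fun i => pick_mem x (e i) (φ i)]
  refine Finset.sum_congr rfl fun i _ => ?_
  rw [neg_one_pow_eq_sgn, sumBelow]
  simp [CharTwo.neg_eq]

section Faces

variable {X : SSet.{u}} {n : ℕ} (x : X _⦋n + 1⦌) (e : ι → ℕ)

/-- The summand of the Alexander–Whitney map of the face of `x` opposite to the vertex `v`. -/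
def awFace (v : ℕ) : pow (chains Λ X) ι :=
  PiTensorProduct.tprod Λ fun j => pick Λ x (e j) ((skipHom v).comp (shiftHom (sumBelow e j)))

/-- The tensor of the blocks of a decomposition of `n + 1` in which the blocks of `S` are placed
before those which are not in `S`. -/
def awCut (S : Finset ι) : pow (chains Λ X) ι :=
  PiTensorProduct.tprod Λ fun j =>
    pick Λ x (e j) (shiftHom (if j ∈ S then sumBelow e j else sumBelow e j + 1))

/-- Bookkeeping for one term of the Leibniz sum: enlarging block i leaves the earlier blocks in
place and pushes the later ones by one vertex. -/
theorem tprod_update_pick (i : ι) {φ : ℕ →o ℕ} {ψ : ι → ℕ →o ℕ}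
    (hlt : ∀ j, j < i → ∀ t ≤ e j, ψ j t = sumBelow e j + t) (heq : ∀ t ≤ e i, ψ i t = φ t)
    (hgt : ∀ j, i < j → ∀ t ≤ e j, ψ j t = sumBelow e j + 1 + t) :
    PiTensorProduct.tprod Λ (Function.update (fun j => pick Λ x ((e + Pi.single i 1 : ι → ℕ) j)
      (shiftHom (sumBelow (e + Pi.single i 1 : ι → ℕ) j))) i (pick Λ x (e i) φ)) =
      PiTensorProduct.tprod Λ fun j => pick Λ x (e j) (ψ j) := by
  congr 1
  funext j
  by_cases hj : j = i
  · subst hj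
    rw [Function.update_self]
    exact pick_congr _ _ fun t ht => (heq t ht).symm
  · rw [Function.update_of_ne hj, Pi.add_apply, Pi.single_eq_of_ne hj, add_zero,
      sumBelow_add_single]
    refine pick_congr _ _ fun t ht => ?_
    rw [shiftHom_apply]
    rcases lt_or_gt_of_ne hj with h | h
    · rw [if_neg h.not_gt, add_zero, hlt j h t ht]
    · rw [if_pos h, hgt j h t ht]

/-- The boundary of block i omits one of its vertices. An interior vertex gives a summand for a face
of x; the first or last vertex leaves a gap between neighbouring blocks, a cut. Both contributions
are written as differences over initial segments, ready to telescope. -/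
theorem awTerm_eq (i : ι) (hi : sumBelow e i + e i ≤ n) :
    (-1 : Λ) ^ sumBelow (e + Pi.single i 1 : ι → ℕ) i • PiTensorProduct.tprod Λ
        (Function.update (fun j => pick Λ x ((e + Pi.single i 1 : ι → ℕ) j)
          (shiftHom (sumBelow (e + Pi.single i 1 : ι → ℕ) j))) i
          ((chains Λ X).d (pick Λ x ((e + Pi.single i 1 : ι → ℕ) i)
            (shiftHom (sumBelow (e + Pi.single i 1 : ι → ℕ) i))))) =
      ((∑ v ∈ Finset.range (sumBelow e i + e i + 1), (-1 : Λ) ^ v • awFace x e v) -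
        ∑ v ∈ Finset.range (sumBelow e i + 1), (-1 : Λ) ^ v • awFace x e v) +
      ((-1 : Λ) ^ sumBelow e i • awCut x e (Finset.univ.filter (· < i)) -
        (-1 : Λ) ^ (sumBelow e i + e i) • awCut x e (Finset.univ.filter (· ≤ i))) := by
  rw [sumBelow_add_single, if_neg (lt_irrefl i), add_zero, Pi.add_apply, Pi.single_eq_same,
    d_pick_succ _ _ _ (fun t ht => by rw [shiftHom_apply]; omega)]
  have hsum := map_sum ((PiTensorProduct.tprod Λ).toLinearMap (fun j => pick Λ x
    ((e + Pi.single i 1 : ι → ℕ) j) (shiftHom (sumBelow (e + Pi.single i 1 : ι → ℕ) j))) i)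
    (fun l => (-1 : Λ) ^ l • pick Λ x (e i) ((shiftHom (sumBelow e i)).comp (skipHom l)))
    (Finset.range (e i + 2))
  simp only [map_smul, MultilinearMap.toLinearMap_apply] at hsum
  rw [hsum, Finset.sum_range_succ, Finset.sum_range_succ', smul_add, smul_add, Finset.smul_sum]
  have h0 : PiTensorProduct.tprod Λ (Function.update (fun j => pick Λ x ((e + Pi.single i 1 : ι →
      ℕ) j)
      (shiftHom (sumBelow (e + Pi.single i 1 : ι → ℕ) j))) i
        (pick Λ x (e i) ((shiftHom (sumBelow e i)).comp (skipHom 0)))) =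
      awCut x e (Finset.univ.filter (· < i)) := by
    refine tprod_update_pick x e i (fun j hj t _ => ?_) (fun t _ => ?_) fun j hj t _ => ?_
    · rw [if_pos (by simpa using hj), shiftHom_apply]
    · rw [if_neg (by simp), OrderHom.comp_coe, Function.comp_apply, shiftHom_apply, shiftHom_apply,
        skipHom_apply]
      simp only [not_lt_zero, if_false]
      omega
    · rw [if_neg (by simpa using hj.le), shiftHom_apply]
  have h1 : PiTensorProduct.tprod Λ (Function.update (fun j => pick Λ x ((e + Pi.single i 1 : ι →
      ℕ) j)
      (shiftHom (sumBelow (e + Pi.single i 1 : ι → ℕ) j))) i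
        (pick Λ x (e i) ((shiftHom (sumBelow e i)).comp (skipHom (e i + 1))))) =
      awCut x e (Finset.univ.filter (· ≤ i)) := by
    refine tprod_update_pick x e i (fun j hj t _ => ?_) (fun t ht => ?_) fun j hj t _ => ?_
    · rw [if_pos (by simpa using hj.le), shiftHom_apply]
    · rw [if_pos (by simp), OrderHom.comp_coe, Function.comp_apply, shiftHom_apply, shiftHom_apply,
        skipHom_apply, if_pos (by omega)]
    · rw [if_neg (by simpa using hj), shiftHom_apply]
  have hl : ∀ l ∈ Finset.range (e i),
      PiTensorProduct.tprod Λ (Function.update (fun j => pick Λ x ((e + Pi.single i 1 : ι → ℕ) j)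
      (shiftHom (sumBelow (e + Pi.single i 1 : ι → ℕ) j))) i
        (pick Λ x (e i) ((shiftHom (sumBelow e i)).comp (skipHom (l + 1))))) =
      awFace x e (sumBelow e i + 1 + l) := by
    intro l hl
    rw [Finset.mem_range] at hl
    refine tprod_update_pick x e i (fun j hj t ht => ?_) (fun t ht => ?_) fun j hj t _ => ?_
    · have := sumBelow_add_le_of_lt e hj
      rw [OrderHom.comp_coe, Function.comp_apply, shiftHom_apply, skipHom_apply,
        if_pos (by omega)]
    · rw [OrderHom.comp_coe, OrderHom.comp_coe, Function.comp_apply, Function.comp_apply,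
        shiftHom_apply, shiftHom_apply, skipHom_apply, skipHom_apply]
      split_ifs <;> omega
    · have := sumBelow_add_le_of_lt e hj
      rw [OrderHom.comp_coe, Function.comp_apply, shiftHom_apply, skipHom_apply,
        if_neg (by omega)]
      omega
  -- The interior vertices of block i are numbered sumBelow e i + 1, …, sumBelow e i + e i.
  have h2 : (∑ v ∈ Finset.range (sumBelow e i + e i + 1),
      (-1 : Λ) ^ v • awFace (Λ := Λ) x e v) -
      ∑ v ∈ Finset.range (sumBelow e i + 1), (-1 : Λ) ^ v • awFace (Λ := Λ) x e v =
      ∑ l ∈ Finset.range (e i), (-1 : Λ) ^ (sumBelow e i + 1 + l) •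
        awFace x e (sumBelow e i + 1 + l) := by
    rw [show sumBelow e i + e i + 1 = (sumBelow e i + 1) + e i by ring, Finset.sum_range_add,
      add_sub_cancel_left]
  rw [h0, h1, h2, smul_smul, smul_smul, pow_zero, mul_one, ← pow_add, ← add_assoc, pow_succ,
    mul_neg_one, neg_smul, ← sub_eq_add_neg, add_sub_assoc]
  congr 1
  refine Finset.sum_congr rfl fun l hl' => ?_
  rw [hl l hl', smul_smul, ← pow_add, show sumBelow e i + (l + 1) = sumBelow e i + 1 + l by ring]

/-- The cut after block i cancels the cut before the next block. The two outermost cuts are the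
faces of x opposite its first and last vertices. -/
theorem sum_awTerm_eq (he : ∑ i, e i = n) :
    ∑ i, (-1 : Λ) ^ sumBelow (e + Pi.single i 1 : ι → ℕ) i • PiTensorProduct.tprod Λ
        (Function.update (fun j => pick Λ x ((e + Pi.single i 1 : ι → ℕ) j)
          (shiftHom (sumBelow (e + Pi.single i 1 : ι → ℕ) j))) i
          ((chains Λ X).d (pick Λ x ((e + Pi.single i 1 : ι → ℕ) i)
            (shiftHom (sumBelow (e + Pi.single i 1 : ι → ℕ) i))))) =
      ∑ v ∈ Finset.range (n + 2), (-1 : Λ) ^ v • awFace x e v := by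
  -- The potential whose differences over initial segments are the terms of `awTerm_eq`. It vanishes
  -- on the empty set and equals the full alternating face sum on the whole set.
  let g : Finset ι → pow (chains Λ X) ι := fun S =>
    (∑ v ∈ Finset.range (∑ j ∈ S, e j + 1), (-1 : Λ) ^ v • awFace x e v) -
      (-1 : Λ) ^ (∑ j ∈ S, e j) • awCut x e S
  have hle : ∀ i, ∑ j with j ≤ i, e j = sumBelow e i + e i := by
    intro i
    have : Finset.univ.filter (· ≤ i) = insert i (Finset.univ.filter (· < i)) := by
      ext j
      simp [le_iff_eq_or_lt]
    rw [this, Finset.sum_insert (by simp), add_comm, sumBelow]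
  have h0 : awCut (Λ := Λ) x e ∅ = awFace x e 0 := by
    rw [awCut, awFace]
    congr 1
    funext j
    refine pick_congr _ _ fun t _ => ?_
    rw [if_neg (Finset.notMem_empty j), OrderHom.comp_coe, Function.comp_apply, shiftHom_apply,
      shiftHom_apply, skipHom_apply, if_neg (Nat.not_lt_zero _)]
    ring
  have h1 : awCut (Λ := Λ) x e Finset.univ = awFace x e (n + 1) := by
    rw [awCut, awFace]
    congr 1
    funext j
    have := sumBelow_add_le e j
    refine pick_congr _ _ fun t _ => ?_
    rw [if_pos (Finset.mem_univ j), OrderHom.comp_coe, Function.comp_apply, shiftHom_apply,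
      skipHom_apply, if_pos (by omega)]
  have key := sum_initial_telescope g
  have hu : g Finset.univ = ∑ v ∈ Finset.range (n + 2), (-1 : Λ) ^ v • awFace x e v := by
    change _ - _ • awCut x e Finset.univ = _
    rw [he, h1, Finset.sum_range_succ _ (n + 1), pow_succ, mul_neg_one, neg_smul, sub_eq_add_neg]
  have he0 : g ∅ = 0 := by
    change _ - _ • awCut x e ∅ = _
    rw [Finset.sum_empty, zero_add, Finset.sum_range_one, h0, sub_self]
  rw [hu, he0, sub_zero] at key
  rw [← key]
  refine Finset.sum_congr rfl fun i _ => ?_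
  rw [awTerm_eq x e i (he ▸ sumBelow_add_le e i)]
  change _ = (_ - _) - (_ - _)
  rw [hle]
  change _ = (_ - _) - ((∑ v ∈ Finset.range (sumBelow e i + 1), _) -
    (-1 : Λ) ^ (sumBelow e i) • _)
  abel

end Faces

theorem d_awVal {X : SSet.{u}} {n : ℕ} (x : X _⦋n + 1⦌) :
    (pow (chains Λ X) ι).d (awVal ι x) =
      ∑ v : Fin (n + 2), (-1 : Λ) ^ (v : ℕ) • awVal ι (X.δ v x) := by
  rw [awVal_eq, map_sum]
  rw [Finset.sum_congr rfl fun e _ => d_tprod_pick x e fun i => shiftHom (sumBelow e i),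
    Finset.sum_comm]
  have h1 : ∀ i : ι, ∀ e : ι → ℕ, e i = 0 → (-1 : Λ) ^ sumBelow e i • PiTensorProduct.tprod Λ
        (Function.update (fun j => pick Λ x (e j) (shiftHom (sumBelow e j))) i
          ((chains Λ X).d (pick Λ x (e i) (shiftHom (sumBelow e i))))) = 0 := by
    intro i e he
    rw [he, d_pick_zero, MultilinearMap.map_coord_zero _ i (Function.update_self _ _ _), smul_zero]
  rw [Finset.sum_congr rfl fun i _ => sum_piAntidiag_add_single n i _ (h1 i), Finset.sum_comm]
  rw [Finset.sum_congr rfl fun e he => sum_awTerm_eq x e (Finset.mem_piAntidiag.1 he).1,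
    Finset.sum_comm, ← Fin.sum_univ_eq_sum_range (fun v =>
      ∑ e ∈ Finset.piAntidiag Finset.univ n, (-1 : Λ) ^ v • awFace x e v)]
  refine Finset.sum_congr rfl fun v _ => ?_
  rw [awVal_eq, Finset.smul_sum]
  refine Finset.sum_congr rfl fun e he => ?_
  rw [awFace]
  congr 2
  funext j
  have h := sumBelow_add_le e j
  rw [(Finset.mem_piAntidiag.1 he).1] at h
  refine (pick_δ x v _ (fun t ht => ?_) fun t ht => rfl).symm
  rw [shiftHom_apply]
  omega

theorem D_awOp : natOps.D (awOp.{u} Λ ι) = 0 := by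
  refine natOps.ext fun L c => ?_
  rw [natOps.D_apply awOp_mem]
  suffices h : (pow (chains Λ L) ι).d ∘ₗ (awOp Λ ι).app L =
      (awOp Λ ι).app L ∘ₗ (chains Λ L).d by
    rw [Int.cast_zero, sgn_zero, one_smul, ← LinearMap.comp_apply, h, LinearMap.comp_apply,
      sub_self]
    rfl
  refine chains_ext L fun n x _ => ?_
  rw [LinearMap.comp_apply, LinearMap.comp_apply, awOp_gen]
  cases n with
  | zero =>
    rw [chains_d_gen_zero, map_zero, awVal_eq, Finset.piAntidiag_zero, Finset.sum_singleton,
      d_tprod_pick]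
    refine Finset.sum_eq_zero fun i _ => ?_
    rw [Pi.zero_apply, d_pick_zero,
      MultilinearMap.map_coord_zero _ i (Function.update_self _ _ _), smul_zero]
  | succ n =>
    rw [chains_d_gen, map_sum, d_awVal]
    exact Finset.sum_congr rfl fun v _ => by rw [map_smul, awOp_gen]

end AWChainMap

end

section

/-! ### The resolution `W` as a free complex -/

section StdRes

variable (p : ℕ) [NeZero p]

variable (Λ) in
/-- The basis element `α ^ k e_i` of `W`. -/
def stdGen (i : ℕ) (k : ZMod p) : stdRes Λ p := (Finsupp.single (i, k) 1 : ℕ × ZMod p →₀ Λ)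

variable (Λ) in
/-- The action of `α ^ k` on `W`. -/
def stdShift (k : ZMod p) : stdRes Λ p →ₗ[Λ] stdRes Λ p :=
  Finsupp.lmapDomain Λ Λ fun q : ℕ × ZMod p => (q.1, q.2 + k)

variable {p}

theorem stdGen_mem (i : ℕ) (k : ZMod p) : stdGen Λ p i k ∈ (stdRes Λ p).gr (-(i : ℤ)) :=
  Finsupp.single_mem_supported _ _ rfl

theorem stdShift_gen (k l : ZMod p) (i : ℕ) :
    stdShift Λ p k (stdGen Λ p i l) = stdGen Λ p i (l + k) := Finsupp.mapDomain_single

theorem stdAlpha_eq : stdAlpha Λ p = stdShift Λ p 1 := rfl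

theorem stdE0_eq : stdE0 Λ p = stdGen Λ p 0 0 := rfl

theorem stdEps_gen (i : ℕ) (k : ZMod p) : stdEps Λ p (stdGen Λ p i k) = if i = 0 then 1 else 0 :=
  (Finsupp.linearCombination_single _ _ _).trans (one_smul _ _)

theorem std_hom_ext {M : Type*} [AddCommGroup M] [Module Λ M] {f g : stdRes Λ p →ₗ[Λ] M}
    (h : ∀ i k, f (stdGen Λ p i k) = g (stdGen Λ p i k)) : f = g :=
  Finsupp.lhom_ext' fun q => LinearMap.ext_ring (h q.1 q.2)

theorem std_d_zero (k : ZMod p) : (stdRes Λ p).d (stdGen Λ p 0 k) = 0 := by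
  change Finsupp.linearCombination Λ (stdD Λ p) (Finsupp.single (0, k) 1) = 0
  rw [Finsupp.linearCombination_single, one_smul, stdD]

theorem std_d_odd {i : ℕ} (hi : Even i) (k : ZMod p) :
    (stdRes Λ p).d (stdGen Λ p (i + 1) k) = stdGen Λ p i (k + 1) - stdGen Λ p i k := by
  change Finsupp.linearCombination Λ (stdD Λ p) (Finsupp.single (i + 1, k) 1) = _
  rw [Finsupp.linearCombination_single, one_smul, stdD, if_pos hi]
  rfl

theorem std_d_even {i : ℕ} (hi : ¬ Even i) (k : ZMod p) :
    (stdRes Λ p).d (stdGen Λ p (i + 1) k) = ∑ l, stdGen Λ p i l := by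
  change Finsupp.linearCombination Λ (stdD Λ p) (Finsupp.single (i + 1, k) 1) = _
  rw [Finsupp.linearCombination_single, one_smul, stdD, if_neg hi]
  rfl

theorem isChainMap_stdShift (k : ZMod p) :
    IsChainMap (stdRes Λ p) (stdRes Λ p) (stdShift Λ p k) := by
  constructor
  · intro n x hx
    change x ∈ Finsupp.supported Λ Λ _ at hx
    rw [Finsupp.supported_eq_span_single] at hx
    induction hx using Submodule.span_induction with
    | zero => rw [map_zero]; exact Submodule.zero_mem _
    | add y z _ _ hy hz => rw [map_add]; exact Submodule.add_mem _ hy hz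
    | smul r y _ hy => rw [map_smul]; exact Submodule.smul_mem _ _ hy
    | mem y hy =>
      obtain ⟨⟨i, l⟩, hb, rfl⟩ := hy
      change stdShift Λ p k (stdGen Λ p i l) ∈ _
      rw [stdShift_gen, ← show -(i : ℤ) = n from hb]
      exact stdGen_mem _ _
  · refine LinearMap.congr_fun (f := stdShift Λ p k ∘ₗ (stdRes Λ p).d)
      (g := (stdRes Λ p).d ∘ₗ stdShift Λ p k) (std_hom_ext fun i l => ?_)
    rw [LinearMap.comp_apply, LinearMap.comp_apply, stdShift_gen]
    rcases i with _ | i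
    · rw [std_d_zero, std_d_zero, map_zero]
    · by_cases hi : Even i
      · rw [std_d_odd hi, std_d_odd hi, map_sub, stdShift_gen, stdShift_gen, add_right_comm]
      · rw [std_d_even hi, std_d_even hi, map_sum]
        simp only [stdShift_gen]
        exact Fintype.sum_equiv (Equiv.addRight k) _ _ fun _ => rfl

theorem stdEps_d (x : stdRes Λ p) : stdEps Λ p ((stdRes Λ p).d x) = 0 := by
  suffices h : stdEps Λ p ∘ₗ (stdRes Λ p).d = 0 from LinearMap.congr_fun h x
  refine std_hom_ext fun i l => ?_
  rw [LinearMap.comp_apply, LinearMap.zero_apply]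
  rcases i with _ | i
  · rw [std_d_zero, map_zero]
  · by_cases hi : Even i
    · rw [std_d_odd hi, map_sub, stdEps_gen, stdEps_gen, sub_self]
    · have h0 : i ≠ 0 := by rintro rfl; simp at hi
      rw [std_d_even hi, map_sum]
      exact Finset.sum_eq_zero fun l _ => by rw [stdEps_gen, if_neg h0]

theorem stdEps_shift (k : ZMod p) (x : stdRes Λ p) :
    stdEps Λ p (stdShift Λ p k x) = stdEps Λ p x := by
  suffices h : stdEps Λ p ∘ₗ stdShift Λ p k = stdEps Λ p from LinearMap.congr_fun h x
  refine std_hom_ext fun i l => ?_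
  rw [LinearMap.comp_apply, stdShift_gen, stdEps_gen, stdEps_gen]

variable (Λ p) in
/-- The free action of the cyclic group on `W`. -/
def stdAction : FreeAction (stdRes Λ p) (ZMod p) ℕ where
  act := stdShift Λ p
  mul k k' := k + k'
  act_mul k k' := std_hom_ext fun i l => by
    rw [LinearMap.comp_apply, stdShift_gen, stdShift_gen, stdShift_gen, add_assoc, add_comm k k']
  isChainMap := isChainMap_stdShift
  gen i := stdGen Λ p i 0
  deg i := -(i : ℤ)
  deg_le i := by omega
  gen_mem i := stdGen_mem i 0
  basis := (Finsupp.basisSingleOne (R := Λ) (ι := ℕ × ZMod p)).reindex (Equiv.prodComm _ _)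
  basis_apply k i := by
    have h : ((Finsupp.basisSingleOne (R := Λ) (ι := ℕ × ZMod p)).reindex (Equiv.prodComm _ _))
        (k, i) = Finsupp.single (i, k) 1 := by simp
    exact h.trans (by rw [stdShift_gen, zero_add]; rfl)

theorem finRotate_pow_val (n m : ℕ) (i : Fin (n + 1)) :
    (((finRotate (n + 1) ^ m) i : Fin (n + 1)) : ℕ) = (i + m) % (n + 1) := by
  induction m with
  | zero => exact (Nat.mod_eq_of_lt i.2).symm
  | succ m ih =>
    rw [pow_succ', Equiv.Perm.mul_apply, finRotate_apply, Fin.val_add, ih, Fin.val_one',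
      ← Nat.add_mod, add_assoc]

theorem finRotate_pow_self : finRotate p ^ p = 1 := by
  have h : ∀ n, finRotate (n + 1) ^ (n + 1) = 1 := by
    intro n
    ext i
    rw [finRotate_pow_val, Nat.add_mod_right, Nat.mod_eq_of_lt i.2, Equiv.Perm.one_apply]
  obtain ⟨n, rfl⟩ := Nat.exists_eq_succ_of_ne_zero (NeZero.ne p)
  exact h n

variable (p) in
/-- The rotation by `k`. -/
def rot (k : ZMod p) : Equiv.Perm (Fin p) := finRotate p ^ k.val

theorem rot_add (k k' : ZMod p) : rot p (k + k') = rot p k * rot p k' := by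
  rw [rot, rot, rot, ← pow_add, ZMod.val_add, ← pow_eq_pow_mod _ finRotate_pow_self]

theorem rot_natCast (m : ℕ) : rot p (m : ZMod p) = finRotate p ^ m := by
  rw [rot, ZMod.val_natCast, ← pow_eq_pow_mod _ finRotate_pow_self]

theorem rot_one : rot p 1 = finRotate p := by
  have := rot_natCast (p := p) 1
  rwa [Nat.cast_one, pow_one] at this

/-- Equivariance under the generator implies equivariance under the group. -/
theorem forall_rot_of_one {P : ZMod p → Prop} (h0 : P 0) (h : ∀ k, P k → P (k + 1)) (k : ZMod p) :
    P k := by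
  rw [← ZMod.natCast_zmod_val k]
  induction k.val with
  | zero => rwa [Nat.cast_zero]
  | succ m ih => rw [Nat.cast_succ]; exact h _ ih

theorem stdShift_zero : stdShift Λ p 0 = LinearMap.id :=
  std_hom_ext fun i l => by rw [stdShift_gen, add_zero]; rfl

theorem stdShift_add_one (k : ZMod p) : stdShift Λ p (k + 1) = stdAlpha Λ p ∘ₗ stdShift Λ p k :=
  std_hom_ext fun i l => by
    rw [stdAlpha_eq, LinearMap.comp_apply, stdShift_gen, stdShift_gen, stdShift_gen, add_assoc]

/-! #### The contraction of `W` and the diagonal -/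

variable (Λ p) in
/-- The contraction of `W`. -/
def stdContr : stdRes Λ p →ₗ[Λ] stdRes Λ p :=
  Finsupp.linearCombination Λ fun q : ℕ × ZMod p =>
    if Even q.1 then ∑ l ∈ Finset.range q.2.val, stdGen Λ p (q.1 + 1) (l : ZMod p)
    else if q.2 + 1 = 0 then stdGen Λ p (q.1 + 1) 0 else 0

theorem stdContr_even {i : ℕ} (hi : Even i) (k : ZMod p) : stdContr Λ p (stdGen Λ p i k) =
    ∑ l ∈ Finset.range k.val, stdGen Λ p (i + 1) (l : ZMod p) :=
  (Finsupp.linearCombination_single _ _ _).trans ((one_smul _ _).trans (if_pos hi))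

theorem stdContr_odd {i : ℕ} (hi : ¬ Even i) (k : ZMod p) : stdContr Λ p (stdGen Λ p i k) =
    if k + 1 = 0 then stdGen Λ p (i + 1) 0 else 0 :=
  (Finsupp.linearCombination_single _ _ _).trans ((one_smul _ _).trans (if_neg hi))

theorem stdContr_mem {n : ℤ} {x : stdRes Λ p} (hx : x ∈ (stdRes Λ p).gr n) :
    stdContr Λ p x ∈ (stdRes Λ p).gr (n - 1) := by
  change x ∈ Finsupp.supported Λ Λ _ at hx
  rw [Finsupp.supported_eq_span_single] at hx
  induction hx using Submodule.span_induction with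
  | zero => rw [map_zero]; exact Submodule.zero_mem _
  | add y z _ _ hy hz => rw [map_add]; exact Submodule.add_mem _ hy hz
  | smul r y _ hy => rw [map_smul]; exact Submodule.smul_mem _ _ hy
  | mem y hy =>
    obtain ⟨⟨i, k⟩, hb, rfl⟩ := hy
    change stdContr Λ p (stdGen Λ p i k) ∈ _
    have hn : n - 1 = -((i + 1 : ℕ) : ℤ) := by
      rw [← show -(i : ℤ) = n from hb]; push_cast; ring
    rw [hn]
    by_cases hi : Even i
    · rw [stdContr_even hi]
      exact Submodule.sum_mem _ fun l _ => stdGen_mem _ _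
    · rw [stdContr_odd hi]
      split_ifs
      · exact stdGen_mem _ _
      · exact Submodule.zero_mem _

theorem sum_zmod {M : Type*} [AddCommMonoid M] (f : ZMod p → M) :
    ∑ l ∈ Finset.range p, f l = ∑ l, f l := by
  symm
  refine Finset.sum_nbij' (fun l => l.val) (fun m => (m : ZMod p)) (fun l _ => ?_)
    (fun _ _ => Finset.mem_univ _) (fun l _ => ?_) (fun m hm => ?_) fun l _ => ?_
  · exact Finset.mem_range.2 l.val_lt
  · exact ZMod.natCast_zmod_val l
  · exact ZMod.val_natCast_of_lt (Finset.mem_range.1 hm)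
  · rw [ZMod.natCast_zmod_val]

theorem val_of_add_one_eq_zero {k : ZMod p} (h : k + 1 = 0) : k.val + 1 = p := by
  have h1 := k.val_lt
  have h2 : ((k.val + 1 : ℕ) : ZMod p) = 0 := by
    rw [Nat.cast_succ, ZMod.natCast_zmod_val, h]
  have h3 := Nat.le_of_dvd (Nat.succ_pos _) ((ZMod.natCast_eq_zero_iff _ _).1 h2)
  omega

theorem val_add_one {k : ZMod p} (h : k + 1 ≠ 0) : (k + 1).val = k.val + 1 := by
  have h1 : k.val + 1 < p := by
    refine lt_of_le_of_ne k.val_lt fun h' => h ?_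
    rw [← ZMod.natCast_zmod_val k, ← Nat.cast_succ, Nat.succ_eq_add_one, h', ZMod.natCast_self]
  conv_lhs => rw [← ZMod.natCast_zmod_val k, ← Nat.cast_succ]
  exact ZMod.val_natCast_of_lt h1

/-- In even degree the partial sums 1 + α + ⋯ + α^(k-1) telescope against α - 1. In odd degree only
α^(p-1) has a non-zero image, whose boundary is the norm; this corrects the wrap-around from α^(p-1)
to 1. -/
theorem stdContr_spec (x : stdRes Λ p) : (stdRes Λ p).d (stdContr Λ p x) +
    stdContr Λ p ((stdRes Λ p).d x) = x - stdEps Λ p x • stdE0 Λ p := by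
  suffices h : (stdRes Λ p).d ∘ₗ stdContr Λ p + stdContr Λ p ∘ₗ (stdRes Λ p).d =
      LinearMap.id - (stdEps Λ p).smulRight (stdE0 Λ p) from LinearMap.congr_fun h x
  refine std_hom_ext fun i k => ?_
  simp only [LinearMap.add_apply, LinearMap.comp_apply, LinearMap.sub_apply, LinearMap.id_apply,
    LinearMap.smulRight_apply, stdEps_gen]
  have hd : ∀ i, Even i → (stdRes Λ p).d (stdContr Λ p (stdGen Λ p i k)) =
      stdGen Λ p i k - stdGen Λ p i 0 := by
    intro i hi
    rw [stdContr_even hi, map_sum]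
    simp only [std_d_odd hi]
    have := Finset.sum_range_sub (fun l : ℕ => stdGen Λ p i (l : ZMod p)) k.val
    rw [ZMod.natCast_zmod_val, Nat.cast_zero] at this
    rw [← this]
    exact Finset.sum_congr rfl fun l _ => by rw [Nat.cast_succ]
  rcases i with _ | i
  · rw [hd 0 Even.zero, std_d_zero, map_zero, add_zero, if_pos rfl, one_smul, stdE0_eq]
  · rw [if_neg (Nat.succ_ne_zero i), zero_smul, sub_zero]
    by_cases hi : Even i
    · have hi' : ¬ Even (i + 1) := by simp [hi, parity_simps]
      rw [stdContr_odd hi', std_d_odd hi, map_sub, stdContr_even hi, stdContr_even hi]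
      by_cases hk : k + 1 = 0
      · rw [if_pos hk, hk, ZMod.val_zero, Finset.sum_range_zero, zero_sub, std_d_even hi',
          ← sum_zmod,
          show Finset.range p = Finset.range (k.val + 1) by rw [val_of_add_one_eq_zero hk],
          Finset.sum_range_succ, ZMod.natCast_zmod_val]
        abel
      · rw [if_neg hk, map_zero, val_add_one hk, Finset.sum_range_succ, ZMod.natCast_zmod_val]
        abel
    · have hi' : Even (i + 1) := by simpa [parity_simps] using hi
      rw [hd _ hi', std_d_even hi, map_sum]
      have h1 : ∀ l : ZMod p, stdContr Λ p (stdGen Λ p i l) =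
          if l = -1 then stdGen Λ p (i + 1) 0 else 0 := by
        intro l
        rw [stdContr_odd hi]
        simp only [eq_neg_iff_add_eq_zero]
      simp only [h1, Finset.sum_ite_eq', Finset.mem_univ, if_true, sub_add_cancel]

variable (Λ p) in
/-- The map `id ⊗ ε : W ⊗ W → W`. -/
def epsRight : tensor (stdRes Λ p) (stdRes Λ p) →ₗ[Λ] stdRes Λ p :=
  (TensorProduct.rid Λ _).toLinearMap ∘ₗ TensorProduct.map LinearMap.id (stdEps Λ p)

theorem epsRight_tmul (a b : stdRes Λ p) : epsRight Λ p (a ⊗ₜ b) = stdEps Λ p b • a := rfl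

theorem isChainMap_epsRight :
    IsChainMap (tensor (stdRes Λ p) (stdRes Λ p)) (stdRes Λ p) (epsRight Λ p) := by
  constructor
  · intro n x hx
    refine tensor_mem_induction _ _ (epsRight Λ p) (stdRes Λ p).gr (fun i j a ha b hb => ?_) hx
    rw [epsRight_tmul]
    by_cases hj : j = 0
    · rw [hj, add_zero]; exact Submodule.smul_mem _ _ ha
    · rw [stdEps_of_mem hj hb, zero_smul]; exact Submodule.zero_mem _
  · refine LinearMap.congr_fun (f := epsRight Λ p ∘ₗ (tensor (stdRes Λ p) (stdRes Λ p)).d)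
      (g := (stdRes Λ p).d ∘ₗ epsRight Λ p) (tensor_hom_ext _ _ fun i j a ha b hb => ?_)
    rw [LinearMap.comp_apply, LinearMap.comp_apply, tensor_d_tmul _ _ ha, map_add, map_smul,
      epsRight_tmul, epsRight_tmul, epsRight_tmul, stdEps_d, zero_smul, smul_zero, add_zero,
      map_smul]

theorem epsRight_shift (k : ZMod p) (z : tensor (stdRes Λ p) (stdRes Λ p)) :
    epsRight Λ p (TensorProduct.map (stdShift Λ p k) (stdShift Λ p k) z) =
      stdShift Λ p k (epsRight Λ p z) := by
  induction z using TensorProduct.induction_on with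
  | zero => simp only [map_zero]
  | add y z hy hz => simp only [map_add, hy, hz]
  | tmul a b => rw [TensorProduct.map_tmul, epsRight_tmul, epsRight_tmul, stdEps_shift, map_smul]

/-- The kernel of `id ⊗ ε` is acyclic. -/
theorem exact_epsRight {m : ℤ} {z : tensor (stdRes Λ p) (stdRes Λ p)}
    (hz : z ∈ (tensor (stdRes Λ p) (stdRes Λ p)).gr m) (hε : epsRight Λ p z = 0)
    (hd : (tensor (stdRes Λ p) (stdRes Λ p)).d z = 0) :
    ∃ y ∈ (tensor (stdRes Λ p) (stdRes Λ p)).gr (m - 1), epsRight Λ p y = 0 ∧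
      (tensor (stdRes Λ p) (stdRes Λ p)).d y = z := by
  -- The contraction id ⊗ h, with its Koszul sign supplied by `par`. It contracts onto W ⊗ e_0, and
  -- its image lies in the kernel of id ⊗ ε because h lowers the degree.
  let S : tensor (stdRes Λ p) (stdRes Λ p) →ₗ[Λ] tensor (stdRes Λ p) (stdRes Λ p) :=
    TensorProduct.map (stdRes Λ p).par (stdContr Λ p)
  have hS : (tensor (stdRes Λ p) (stdRes Λ p)).d ∘ₗ S + S ∘ₗ (tensor (stdRes Λ p) (stdRes Λ p)).d =
      LinearMap.id - (TensorProduct.mk Λ (stdRes Λ p) (stdRes Λ p)).flip (stdE0 Λ p) ∘ₗ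
        epsRight Λ p := by
    refine tensor_hom_ext _ _ fun i j a ha b hb => ?_
    change (tensor (stdRes Λ p) (stdRes Λ p)).d (S (a ⊗ₜ b)) +
      S ((tensor (stdRes Λ p) (stdRes Λ p)).d (a ⊗ₜ b)) = a ⊗ₜ b - _
    rw [tensor_d_tmul _ _ ha, map_add, map_smul]
    have h1 : ∀ a b, S (a ⊗ₜ b) = (stdRes Λ p).par a ⊗ₜ stdContr Λ p b := fun _ _ => rfl
    rw [h1, h1, h1, par_eq_sgn _ ha, par_eq_sgn _ (d_mem _ ha), ← TensorProduct.smul_tmul',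
        map_smul,
      tensor_d_tmul _ _ ha, Int.cast_add, Int.cast_one, sgn_add_one, neg_smul,
      TensorProduct.neg_tmul, ← TensorProduct.smul_tmul', ← TensorProduct.smul_tmul', smul_add,
      smul_smul, smul_smul, sgn_mul_self, one_smul, one_smul, LinearMap.comp_apply, epsRight_tmul,
      LinearMap.flip_apply, TensorProduct.mk_apply, TensorProduct.smul_tmul, ←
          TensorProduct.tmul_sub,
      ← stdContr_spec, TensorProduct.tmul_add]
    abel
  refine ⟨S z, ?_, ?_, ?_⟩
  · refine tensor_mem_induction _ _ S (fun n => (tensor (stdRes Λ p) (stdRes Λ p)).gr (n - 1))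
      (fun i j a ha b hb => ?_) hz
    change S (a ⊗ₜ b) ∈ tensorGr _ _ _
    rw [add_sub_assoc]
    exact tmul_mem_tensorGr _ _ (par_mem _ ha) (stdContr_mem hb)
  · suffices h : epsRight Λ p ∘ₗ S = 0 from LinearMap.congr_fun h z
    refine TensorProduct.ext (LinearMap.ext fun a => std_hom_ext fun i k => ?_)
    change stdEps Λ p (stdContr Λ p (stdGen Λ p i k)) • (stdRes Λ p).par a = 0
    have h1 := stdContr_mem (stdGen_mem (Λ := Λ) i k)
    rw [stdEps_of_mem (by omega) h1, zero_smul]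
  · have h1 := LinearMap.congr_fun hS z
    have h2 := congrArg S hd
    rw [map_zero] at h2
    change (tensor (stdRes Λ p) (stdRes Λ p)).d (S z) + S ((tensor (stdRes Λ p) (stdRes Λ p)).d z) =
      z - epsRight Λ p z ⊗ₜ stdE0 Λ p at h1
    rwa [h2, hε, TensorProduct.zero_tmul, add_zero, sub_zero] at h1

/-- An equivariant diagonal `W → W ⊗ W`. -/
theorem exists_stdDiag : ∃ ψ : stdRes Λ p →ₗ[Λ] tensor (stdRes Λ p) (stdRes Λ p),
    IsChainMap (stdRes Λ p) (tensor (stdRes Λ p) (stdRes Λ p)) ψ ∧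
    (∀ k x, ψ (stdShift Λ p k x) =
      TensorProduct.map (stdShift Λ p k) (stdShift Λ p k) (ψ x)) ∧
    (∀ x, epsRight Λ p (ψ x) = x) ∧ ψ (stdE0 Λ p) = stdE0 Λ p ⊗ₜ stdE0 Λ p := by
  let A := stdAction Λ p
  -- First approximation α^k e_i ↦ α^k e_i ⊗ α^k e_0: equivariant and right inverse to id ⊗ ε, but
  -- not a chain map.
  let E₀ : stdRes Λ p →ₗ[Λ] tensor (stdRes Λ p) (stdRes Λ p) :=
    A.lift fun k i => stdGen Λ p i k ⊗ₜ stdGen Λ p 0 k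
  have hE₀ : ∀ k i, E₀ (stdGen Λ p i k) = stdGen Λ p i k ⊗ₜ stdGen Λ p 0 k := by
    intro k i
    have := A.lift_apply (fun k i => stdGen Λ p i k ⊗ₜ[Λ] stdGen Λ p 0 k) k i
    rwa [show A.act k (A.gen i) = stdGen Λ p i k from
      (stdShift_gen k 0 i).trans (by rw [zero_add])] at this
  have hE₀_deg : ∀ n, ∀ x ∈ (stdRes Λ p).gr n,
      E₀ x ∈ (tensor (stdRes Λ p) (stdRes Λ p)).gr n := by
    intro n x hx
    refine A.induction (P := fun x => E₀ x ∈ (tensor (stdRes Λ p) (stdRes Λ p)).gr n) hx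
      (fun k i hi => ?_) ?_
      (fun y z hy hz => by rw [map_add]; exact Submodule.add_mem _ hy hz)
      (fun c y hy => by rw [map_smul]; exact Submodule.smul_mem _ _ hy)
    · change E₀ (stdShift Λ p k (stdGen Λ p i 0)) ∈ tensorGr _ _ _
      rw [stdShift_gen, hE₀, ← show -(i : ℤ) = n from hi]
      have := tmul_mem_tensorGr _ _ (stdGen_mem (Λ := Λ) i (0 + k)) (stdGen_mem (Λ := Λ) 0 (0 + k))
      rwa [Nat.cast_zero, neg_zero, add_zero] at this
    · rw [map_zero]; exact Submodule.zero_mem _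
  have hE₀_act : ∀ k x, E₀ (stdShift Λ p k x) =
      TensorProduct.map (stdShift Λ p k) (stdShift Λ p k) (E₀ x) := by
    intro k x
    suffices h : E₀ ∘ₗ stdShift Λ p k = TensorProduct.map (stdShift Λ p k) (stdShift Λ p k) ∘ₗ E₀
      from LinearMap.congr_fun h x
    refine std_hom_ext fun i l => ?_
    rw [LinearMap.comp_apply, LinearMap.comp_apply, stdShift_gen, hE₀, hE₀, TensorProduct.map_tmul,
      stdShift_gen, stdShift_gen]
  have hE₀_eps : ∀ x, epsRight Λ p (E₀ x) = x := by
    intro x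
    suffices h : epsRight Λ p ∘ₗ E₀ = LinearMap.id from LinearMap.congr_fun h x
    refine std_hom_ext fun i l => ?_
    rw [LinearMap.comp_apply, hE₀, epsRight_tmul, stdEps_gen, if_pos rfl, one_smul]
    rfl
  let D := (tensor (stdRes Λ p) (stdRes Λ p)).d
  -- The defect lies in the acyclic kernel of id ⊗ ε. Correcting inside this kernel keeps the
  -- identity (id ⊗ ε) ψ = id strict, as the condition on vertices for Φ demands.
  let G : stdRes Λ p →ₗ[Λ] tensor (stdRes Λ p) (stdRes Λ p) := E₀ ∘ₗ (stdRes Λ p).d - D ∘ₗ E₀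
  have hshift : ∀ k, IsChainMap (tensor (stdRes Λ p) (stdRes Λ p))
      (tensor (stdRes Λ p) (stdRes Λ p))
      (TensorProduct.map (stdShift Λ p k) (stdShift Λ p k)) :=
    fun k => (isChainMap_stdShift k).tensorMap (isChainMap_stdShift k)
  obtain ⟨X, hX_deg, hX, hX_act, hX0⟩ := A.exists_primitive D
    (fun k => TensorProduct.map (stdShift Λ p k) (stdShift Λ p k))
    (fun k k' => by
      rw [← TensorProduct.map_comp]
      exact congrArg₂ TensorProduct.map (A.act_mul k k') (A.act_mul k k'))
    (fun k x => (hshift k).comm x)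
    (fun m => (tensor (stdRes Λ p) (stdRes Λ p)).gr m ⊓ LinearMap.ker (epsRight Λ p))
    (fun k m x hx => ⟨(hshift k).degree _ _ hx.1, LinearMap.mem_ker.2 (by
      rw [epsRight_shift, LinearMap.mem_ker.1 hx.2, map_zero])⟩)
    (fun m x hx hd => by
      obtain ⟨y, hy, hy', rfl⟩ := exact_epsRight hx.1 hx.2 hd
      exact ⟨y, ⟨hy, hy'⟩, rfl⟩) 0 (-1) G
    (fun n x hx => by
      rw [add_zero]
      refine ⟨Submodule.sub_mem _ (hE₀_deg _ _ (d_mem _ hx)) (d_mem _ (hE₀_deg _ _ hx)), ?_⟩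
      change epsRight Λ p (E₀ ((stdRes Λ p).d x) - D (E₀ x)) = 0
      rw [map_sub, hE₀_eps, isChainMap_epsRight.comm, hE₀_eps, sub_self])
    (fun k x => by
      change E₀ ((stdRes Λ p).d (stdShift Λ p k x)) - D (E₀ (stdShift Λ p k x)) =
        TensorProduct.map (stdShift Λ p k) (stdShift Λ p k) (_ - _)
      rw [← (isChainMap_stdShift k).comm, hE₀_act, hE₀_act, map_sub]
      congr 1
      exact ((hshift k).comm _).symm)
    (fun x => by
      change D (E₀ ((stdRes Λ p).d x) - D (E₀ x)) =
        (-1 : Λ) • (E₀ ((stdRes Λ p).d ((stdRes Λ p).d x)) - D (E₀ ((stdRes Λ p).d x)))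
      rw [map_sub, d_d, d_d, map_zero, sub_zero, zero_sub, neg_smul, one_smul, neg_neg])
  refine ⟨E₀ + X, ⟨fun n x hx => Submodule.add_mem _ (hE₀_deg n x hx) ?_, fun x => ?_⟩,
    fun k x => ?_, fun x => ?_, ?_⟩
  · have := (hX_deg n x hx).1
    rwa [add_zero] at this
  · have h := hX x
    change _ = E₀ ((stdRes Λ p).d x) - D (E₀ x) at h
    change E₀ ((stdRes Λ p).d x) + X ((stdRes Λ p).d x) = D (E₀ x + X x)
    rw [map_add, eq_add_of_sub_eq h.symm, neg_smul, one_smul]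
    abel
  · rw [LinearMap.add_apply, LinearMap.add_apply, map_add, ← hE₀_act]
    exact congrArg _ (hX_act k x)
  · rw [LinearMap.add_apply, map_add, hE₀_eps, add_eq_left]
    induction x using DGMod.hom_induction with
    | h n x hx => exact (hX_deg n x hx).2
    | h0 => rw [map_zero, map_zero]
    | ha y z hy hz => rw [map_add, map_add, hy, hz, add_zero]
  -- There is no defect in degree 0, hence no correction there, and e_0 is sent exactly to e_0 ⊗
  -- e_0. The Alexander–Whitney condition for Φ needs this.
  · have hG0 : ∀ x ∈ (stdRes Λ p).gr 0, G x = 0 := by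
      intro x hx
      have h1 : (stdRes Λ p).d x = 0 := A.eq_zero_of_pos (k := 0 + 1) (by omega) (d_mem _ hx)
      change E₀ ((stdRes Λ p).d x) - D (E₀ x) = 0
      rw [h1, map_zero, zero_sub, neg_eq_zero]
      refine A.induction (P := fun x => D (E₀ x) = 0) hx (fun k i hi => ?_)
        (by rw [map_zero, map_zero]) (fun y z hy hz => by rw [map_add, map_add, hy, hz, add_zero])
        (fun c y hy => by rw [map_smul, map_smul, hy, smul_zero])
      obtain rfl : i = 0 := by
        have : -(i : ℤ) = 0 := hi
        omega
      change D (E₀ (stdShift Λ p k (stdGen Λ p 0 0))) = 0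
      rw [stdShift_gen, hE₀]
      refine (tensor_d_tmul _ _ (stdGen_mem (Λ := Λ) 0 (0 + k)) _).trans ?_
      rw [std_d_zero, TensorProduct.zero_tmul, TensorProduct.tmul_zero, smul_zero, add_zero]
    rw [LinearMap.add_apply, hX0 hG0 (stdE0 Λ p) (stdGen_mem (Λ := Λ) (p := p) 0 0), add_zero,
      stdE0_eq, hE₀]

end StdRes

end

section

/-! ### Families of natural operations as chain maps -/

section EvOp

variable {F : DGMod.{v} Λ} {ι : Type} [Fintype ι] [LinearOrder ι]

namespace natOps

/-- The evaluation of natural operations at a simplicial set. -/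
def appₗ (L : SSet.{u}) : natOps.{u} Λ ι →ₗ[Λ] chains Λ L →ₗ[Λ] pow (chains Λ L) ι where
  toFun z := z.app L
  map_add' _ _ := rfl
  map_smul' _ _ := rfl

/-- The map `F ⊗ C(L) → C(L) ^ ι` of a family of natural operations. -/
def ev (E : F →ₗ[Λ] natOps.{u} Λ ι) (L : SSet.{u}) :
    tensor F (chains Λ L) →ₗ[Λ] pow (chains Λ L) ι := TensorProduct.lift (appₗ L ∘ₗ E)

theorem ev_tmul (E : F →ₗ[Λ] natOps.{u} Λ ι) (L : SSet.{u}) (x : F) (c : chains Λ L) :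
    ev E L (x ⊗ₜ c) = (E x).app L c := rfl

theorem app_d {r : ℤ} {z : natOps.{u} Λ ι} (hz : z ∈ gr Λ ι r) (L : SSet.{u}) (c : chains Λ L) :
    (pow (chains Λ L) ι).d (z.app L c) =
      (D z).app L c + sgn Λ (r : ZMod 2) • z.app L ((chains Λ L).d c) := by
  rw [D_apply hz, sub_add_cancel]

end natOps

/-- The adjunction between tensor product and Hom complex; `isOpFamily_ofNatural` is the converse.
-/
theorem IsOpFamily.isChainMap {E : F →ₗ[Λ] natOps.{u} Λ ι} (hE : IsOpFamily E) (L : SSet.{u}) :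
    IsChainMap (tensor F (chains Λ L)) (pow (chains Λ L) ι) (natOps.ev E L) := by
  constructor
  · intro n x hx
    refine tensor_mem_induction _ _ (natOps.ev E L) (pow (chains Λ L) ι).gr
      (fun i j a ha c hc => ?_) hx
    rw [natOps.ev_tmul, add_comm]
    exact hE.degree i a ha L j c hc
  · refine LinearMap.congr_fun (f := natOps.ev E L ∘ₗ (tensor F (chains Λ L)).d)
      (g := (pow (chains Λ L) ι).d ∘ₗ natOps.ev E L) (tensor_hom_ext _ _ fun i j a ha c hc => ?_)
    rw [LinearMap.comp_apply, LinearMap.comp_apply, tensor_d_tmul _ _ ha, map_add, map_smul,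
      natOps.ev_tmul, natOps.ev_tmul, natOps.ev_tmul, natOps.app_d (hE.degree i a ha), hE.comm]

theorem isChainMap_assoc (A : DGMod.{v} Λ) (B : DGMod.{v'} Λ) (C : DGMod.{w} Λ) :
    IsChainMap (tensor (tensor A B) C) (tensor A (tensor B C))
      (TensorProduct.assoc Λ A.carrier B.carrier C.carrier).toLinearMap := by
  constructor
  · intro n x hx
    refine tensor_mem_induction (tensor A B) C
      (TensorProduct.assoc Λ A.carrier B.carrier C.carrier).toLinearMap (tensor A (tensor B C)).gr
      (fun i j a ha c hc => ?_) hx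
    refine tensor_mem_induction A B ((TensorProduct.assoc Λ A.carrier B.carrier
        C.carrier).toLinearMap
      ∘ₗ (TensorProduct.mk Λ _ C.carrier).flip c)
      (fun i => (tensor A (tensor B C)).gr (i + j)) (fun i k a ha b hb => ?_) ha
    rw [add_assoc]
    exact tmul_mem_tensorGr A _ ha (tmul_mem_tensorGr B C hb hc)
  · refine LinearMap.congr_fun
      (f := (TensorProduct.assoc Λ A.carrier B.carrier C.carrier).toLinearMap ∘ₗ
        (tensor (tensor A B) C).d)
      (g := (tensor A (tensor B C)).d ∘ₗ
        (TensorProduct.assoc Λ A.carrier B.carrier C.carrier).toLinearMap) ?_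
    refine TensorProduct.ext (tensor_hom_ext A B fun i j a ha b hb => LinearMap.ext fun c => ?_)
    change TensorProduct.assoc Λ A.carrier B.carrier C.carrier
      ((tensor (tensor A B) C).d ((a ⊗ₜ b) ⊗ₜ c)) = (tensor A (tensor B C)).d (a ⊗ₜ (b ⊗ₜ c))
    rw [tensor_d_tmul _ _ (tmul_mem_tensorGr A B ha hb), tensor_d_tmul _ _ ha,
      tensor_d_tmul _ _ ha, tensor_d_tmul _ _ hb, map_add, map_smul, TensorProduct.add_tmul,
      map_add, TensorProduct.tmul_add, TensorProduct.tmul_smul, smul_add, smul_smul, Int.cast_add,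
      sgn_add, add_assoc]
    rfl

end EvOp

/-! ### Chains of standard simplices -/

section Std

theorem chains_stdSimplex_eq_zero {n : ℕ} {k : ℤ} (hk : k < -(n : ℤ))
    {c : chains Λ (Δ[n] : SSet.{u})} (hc : c ∈ (chains Λ Δ[n]).gr k) : c = 0 := by
  refine chains_induction Δ[n] (P := fun c => c = 0) hc (fun m x hm => ?_) rfl
    (fun y z hy hz => by rw [hy, hz, add_zero]) (fun r y hy => by rw [hy, smul_zero])
  refine gen_of_degenerate _ ?_
  rw [SSet.degenerate_eq_univ_of_hasDimensionLT Δ[n] (n + 1) m (by omega)]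
  trivial

theorem gen_eq_map {L : SSet.{u}} {n : ℕ} (x : L _⦋n⦌) :
    gen Λ L x = chainsMap (SSet.yonedaEquiv.symm x) (gen Λ _ (fund n)) := by
  rw [chainsMap_gen]
  congr 1
  exact (SSet.yonedaEquiv_symm_app_id x).symm

theorem chains_point (c : chains Λ (Δ[0] : SSet.{u})) :
    c = augC Λ _ c • gen Λ _ (fund 0) := by
  suffices h : LinearMap.id = (augC Λ (Δ[0] : SSet.{u})).smulRight (gen Λ _ (fund 0)) from
    LinearMap.congr_fun h c
  refine chains_ext _ fun n x hx => ?_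
  rw [LinearMap.id_apply, LinearMap.smulRight_apply, augC_gen]
  split_ifs with hn
  · subst hn
    rw [one_smul]
    congr 1
    refine SSet.stdSimplex.objEquiv.injective ?_
    ext
    exact congrArg Fin.val (Subsingleton.elim (α := Fin 1) _ _)
  · rw [zero_smul]
    exact chains_stdSimplex_eq_zero (n := 0) (by simp; omega) (gen_mem _ x)

variable {ι : Type} [Fintype ι] [LinearOrder ι]

theorem pow_point (t : pow (chains Λ (Δ[0] : SSet.{u})) ι) :
    t = augPow Λ ι _ t • PiTensorProduct.tprod Λ fun _ => gen Λ _ (fund 0) := by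
  induction t using PiTensorProduct.induction_on with
  | add x y hx hy => rw [map_add, add_smul, ← hx, ← hy]
  | smul_tprod r a =>
    rw [map_smul, augPow_tprod, smul_assoc, ← MultilinearMap.map_smul_univ]
    congr 2
    funext i
    exact chains_point (a i)

/-- The value of a natural operation on a vertex. -/
theorem natOps.app_vertex (z : natOps.{u} Λ ι) (L : SSet.{u}) (x : L _⦋0⦌) :
    z.app L (gen Λ L x) = natOps.aug z • PiTensorProduct.tprod Λ fun _ => gen Λ L x := by
  rw [natOps.apply_gen z L x, pow_point (z.app _ _), map_smul, ← natOps.aug_apply, powMap,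
    PiTensorProduct.map_tprod, gen_eq_map x]

end Std

end

section

/-! ### Existence of Eilenberg–Zilber maps -/

section Existence

theorem chains_eq_zero_of_pos {L : SSet.{u}} {k : ℤ} (hk : 0 < k) {c : chains Λ L}
    (hc : c ∈ (chains Λ L).gr k) : c = 0 :=
  chains_induction L (P := fun c => c = 0) hc (fun m x hm => by omega) rfl
    (fun y z hy hz => by rw [hy, hz, add_zero]) (fun r y hy => by rw [hy, smul_zero])

/-- Normalized chains of Δ[n] vanish above dimension n, so its tensor power vanishes above dimension
|ι| n. The filtration condition on Φ comes from here, by naturality. -/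
theorem pow_stdSimplex_mem {ι : Type} [Fintype ι] [LinearOrder ι] (n : ℕ)
    (t : pow (chains Λ (Δ[n] : SSet.{u})) ι) :
    t ∈ Submodule.span Λ {b | ∃ k : ℕ, k ≤ Fintype.card ι * n ∧
      b ∈ (pow (chains Λ (Δ[n] : SSet.{u})) ι).gr (-(k : ℤ))} := by
  induction t using pi_induction (fun _ : ι => chains Λ (Δ[n] : SSet.{u})) with
  | h0 => exact Submodule.zero_mem _
  | ha y z hy hz => exact Submodule.add_mem _ hy hz
  | hs c y hy => exact Submodule.smul_mem _ _ hy
  | h e a ha =>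
    by_cases h : ∀ i, -(n : ℤ) ≤ e i ∧ e i ≤ 0
    · refine Submodule.subset_span ⟨∑ i, (-e i).toNat, ?_, ?_⟩
      · rw [← smul_eq_mul, ← Finset.card_univ, ← Finset.sum_const]
        exact Finset.sum_le_sum fun i _ => by have := h i; omega
      · have h1 : (-((∑ i, (-e i).toNat : ℕ) : ℤ)) = ∑ i, e i := by
          rw [Nat.cast_sum, ← Finset.sum_neg_distrib]
          exact Finset.sum_congr rfl fun i _ => by have := h i; omega
        rw [h1]
        exact tprod_mem_piGr _ ha
    · obtain ⟨i, hi⟩ := not_forall.1 h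
      have h0 : a i = 0 := by
        by_cases h1 : -(n : ℤ) ≤ e i
        · exact chains_eq_zero_of_pos (by omega) (ha i)
        · exact chains_stdSimplex_eq_zero (by omega) (ha i)
      rw [(PiTensorProduct.tprod Λ).map_coord_zero i h0]
      exact Submodule.zero_mem _

/-- The projection of a product of simplicial sets to a factor. -/
def piSSetProj {ι : Type} (L : ι → SSet.{u}) (i : ι) : piSSet L ⟶ L i where
  app U := ↾ fun x => x i

variable {p : ℕ} [NeZero p]

/-- The map `W ⊗ C(∏ i, L i) → ⨂ i, C(L i)` of a family of natural operations. -/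
def prodOp (E : stdRes Λ p →ₗ[Λ] natOps.{u} Λ (Fin p)) (L : Fin p → SSet.{u}) :
    tensor (stdRes Λ p) (chains Λ (piSSet L)) →ₗ[Λ] pi fun i => chains Λ (L i) :=
  PiTensorProduct.map (fun i => chainsMap (piSSetProj L i)) ∘ₗ natOps.ev E (piSSet L)

theorem prodOp_tmul (E : stdRes Λ p →ₗ[Λ] natOps.{u} Λ (Fin p)) (L : Fin p → SSet.{u})
    (w : stdRes Λ p) (c : chains Λ (piSSet L)) : prodOp E L (w ⊗ₜ c) =
      PiTensorProduct.map (fun i => chainsMap (piSSetProj L i)) ((E w).app _ c) := rfl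

theorem isChainMap_prodOp {E : stdRes Λ p →ₗ[Λ] natOps.{u} Λ (Fin p)} (hE : IsOpFamily E)
    (L : Fin p → SSet.{u}) : IsChainMap (tensor (stdRes Λ p) (chains Λ (piSSet L)))
      (pi fun i => chains Λ (L i)) (prodOp E L) :=
  (IsChainMap.piMap fun _ => isChainMap_chainsMap _).comp (hE.isChainMap _)

theorem map_map_chainsMap {ι : Type} {L L' L'' : ι → SSet.{u}} (f : ∀ i, L i ⟶ L' i)
    (g : ∀ i, L' i ⟶ L'' i) (t : ⨂[Λ] i, (chains Λ (L i)).carrier) :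
    PiTensorProduct.map (fun i => chainsMap (g i)) (PiTensorProduct.map (fun i => chainsMap (f i))
        t)
      = PiTensorProduct.map (fun i => chainsMap (f i ≫ g i)) t := by
  have h : (fun i => chainsMap (Λ := Λ) (f i ≫ g i)) =
      fun i => chainsMap (g i) ∘ₗ chainsMap (f i) :=
    funext fun i => LinearMap.ext fun c => (chainsMap_comp _ _ c).symm
  rw [h, PiTensorProduct.map_comp]
  rfl

theorem prodOp_natural (E : stdRes Λ p →ₗ[Λ] natOps.{u} Λ (Fin p)) {L L' : Fin p → SSet.{u}}
    (g : ∀ i, L i ⟶ L' i) (w : stdRes Λ p) (c : chains Λ (piSSet L)) :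
    prodOp E L' (w ⊗ₜ chainsMap (piSSetMap g) c) =
      PiTensorProduct.map (fun i => chainsMap (g i)) (prodOp E L (w ⊗ₜ c)) := by
  rw [prodOp_tmul, prodOp_tmul, ← natOps.natural, powMap, map_map_chainsMap, map_map_chainsMap]
  rfl

/-- After permuting the factors of the product, the i-th projection is the old projection number σ⁻¹
i. Equivariance of E and naturality of signed permutations do the rest. -/
theorem prodOp_perm (E : stdRes Λ p →ₗ[Λ] natOps.{u} Λ (Fin p)) (L : Fin p → SSet.{u})
    (σ : Equiv.Perm (Fin p)) (w w' : stdRes Λ p) (h : E w' = natOps.perm σ (E w))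
    (c : chains Λ (piSSet L)) :
    prodOp E (fun i => L (σ.symm i)) (w' ⊗ₜ chainsMap (piSSetPerm L σ) c) =
      permMap (fun i => chains Λ (L i)) σ (prodOp E L (w ⊗ₜ c)) := by
  have h1 := permMap_natural (A := fun _ : Fin p => chains Λ (piSSet L))
    (B := fun i => chains Λ (L i)) (f := fun i => chainsMap (piSSetProj L i))
    (fun i _ _ hx => chainsMap_mem _ hx) σ
  rw [prodOp_tmul, prodOp_tmul, h, natOps.perm_apply, ← natOps.natural, ← powMap_powPerm, powMap,
    map_map_chainsMap]
  exact LinearMap.congr_fun h1 ((E w).app _ c)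

theorem prodOp_vertex (E : stdRes Λ p →ₗ[Λ] natOps.{u} Λ (Fin p)) (L : Fin p → SSet.{u})
    (w : stdRes Λ p) (x : ∀ i, (L i) _⦋0⦌) :
    prodOp E L (w ⊗ₜ gen Λ (piSSet L) (n := 0) x) =
      natOps.aug (E w) • PiTensorProduct.tprod Λ fun i => gen Λ (L i) (x i) := by
  rw [prodOp_tmul]
  refine (congrArg _ (natOps.app_vertex (E w) (piSSet L) x)).trans ?_
  rw [map_smul, PiTensorProduct.map_tprod]
  congr 2
  funext i
  exact chainsMap_gen _ _

theorem prodOp_aw (E : stdRes Λ p →ₗ[Λ] natOps.{u} Λ (Fin p)) (L : Fin p → SSet.{u})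
    (w : stdRes Λ p) (hw : E w = awOp Λ (Fin p)) {n : ℕ} (x : ∀ i, (L i) _⦋n⦌) :
    prodOp E L (w ⊗ₜ gen Λ (piSSet L) (n := n) x) = aw L x := by
  rw [prodOp_tmul, hw]
  refine (congrArg _ ((awOp_gen (piSSet L) x).trans
    (awVal_eq (X := piSSet L) (n := n) x))).trans ?_
  rw [aw_eq, map_sum]
  refine Finset.sum_congr rfl fun e _ => ?_
  rw [PiTensorProduct.map_tprod]
  congr 1
  funext i
  exact chainsMap_pick (piSSetProj L i) (n := n) x _ _

/-- The value on a j-simplex is the image of a value in the chains of Δ[j], where dimensions above p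
j do not occur. -/
theorem prodOp_filtration (E : stdRes Λ p →ₗ[Λ] natOps.{u} Λ (Fin p)) (L : Fin p → SSet.{u})
    (j : ℕ) (w : stdRes Λ p) {c : chains Λ (piSSet L)}
    (hc : c ∈ (chains Λ (piSSet L)).gr (-(j : ℤ))) :
    prodOp E L (w ⊗ₜ c) ∈ Submodule.span Λ {b | ∃ k : ℕ, k ≤ p * j ∧
      b ∈ (pi fun i => chains Λ (L i)).gr (-(k : ℤ))} := by
  refine chains_induction _ (P := fun c => prodOp E L (w ⊗ₜ c) ∈ Submodule.span Λ {b | ∃ k : ℕ,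
    k ≤ p * j ∧ b ∈ (pi fun i => chains Λ (L i)).gr (-(k : ℤ))}) hc (fun n x hn => ?_) ?_
    (fun y z hy hz => ?_) (fun r y hy => ?_)
  · obtain rfl : n = j := by omega
    rw [prodOp_tmul, natOps.apply_gen]
    have h := pow_stdSimplex_mem n ((E w).app Δ[n] (gen Λ _ (fund n)))
    generalize (E w).app Δ[n] (gen Λ _ (fund n)) = t at h
    induction h using Submodule.span_induction with
    | zero => rw [map_zero, map_zero]; exact Submodule.zero_mem _
    | add y z _ _ hy hz => rw [map_add, map_add]; exact Submodule.add_mem _ hy hz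
    | smul r y _ hy => rw [map_smul, map_smul]; exact Submodule.smul_mem _ _ hy
    | mem y hy =>
      obtain ⟨k, hk, hy⟩ := hy
      rw [Fintype.card_fin] at hk
      refine Submodule.subset_span ⟨k, hk, ?_⟩
      exact piMap_mem (fun i _ _ hx => chainsMap_mem _ hx)
        ((isChainMap_powMap _).degree _ _ hy)
  · rw [TensorProduct.tmul_zero, map_zero]; exact Submodule.zero_mem _
  · rw [TensorProduct.tmul_add, map_add]; exact Submodule.add_mem _ hy hz
  · rw [TensorProduct.tmul_smul, map_smul]; exact Submodule.smul_mem _ _ hy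

/-- The map `(id ⊗ Ψ) ∘ (ψ ⊗ id)` for a map `Ψ : W ⊗ C → D` and a diagonal `ψ : W → W ⊗ W`. -/
def diagExtend (ψ : stdRes Λ p →ₗ[Λ] tensor (stdRes Λ p) (stdRes Λ p)) {C : DGMod.{v} Λ}
    {D : DGMod.{v'} Λ} (Ψ : tensor (stdRes Λ p) C →ₗ[Λ] D) :
    tensor (stdRes Λ p) C →ₗ[Λ] tensor (stdRes Λ p) D :=
  TensorProduct.map LinearMap.id Ψ ∘ₗ
    (TensorProduct.assoc Λ (stdRes Λ p).carrier (stdRes Λ p).carrier C.carrier).toLinearMap ∘ₗ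
      TensorProduct.map ψ LinearMap.id

/-- `diagExtend` of compatible maps. -/
theorem diagExtend_intertwine {ψ : stdRes Λ p →ₗ[Λ] tensor (stdRes Λ p) (stdRes Λ p)}
    {C C' : DGMod.{v} Λ} {D D' : DGMod.{v'} Λ} (Ψ : tensor (stdRes Λ p) C →ₗ[Λ] D)
    (Ψ' : tensor (stdRes Λ p) C' →ₗ[Λ] D') (a : stdRes Λ p →ₗ[Λ] stdRes Λ p)
    (f : C →ₗ[Λ] C') (g : D →ₗ[Λ] D') (hψ : ∀ w, ψ (a w) = TensorProduct.map a a (ψ w))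
    (h : ∀ w c, Ψ' (a w ⊗ₜ f c) = g (Ψ (w ⊗ₜ c))) (w : stdRes Λ p) (c : C) :
    diagExtend ψ Ψ' (a w ⊗ₜ f c) = TensorProduct.map a g (diagExtend ψ Ψ (w ⊗ₜ c)) := by
  change TensorProduct.map LinearMap.id Ψ' (TensorProduct.assoc Λ _ _ _ (ψ (a w) ⊗ₜ f c)) =
    TensorProduct.map a g (TensorProduct.map LinearMap.id Ψ
      (TensorProduct.assoc Λ _ _ _ (ψ w ⊗ₜ c)))
  rw [hψ]
  induction ψ w using TensorProduct.induction_on with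
  | zero => simp only [map_zero, TensorProduct.zero_tmul]
  | add y z hy hz => simp only [map_add, TensorProduct.add_tmul, hy, hz]
  | tmul b b' =>
    change a b ⊗ₜ Ψ' (a b' ⊗ₜ f c) = a b ⊗ₜ g (Ψ (b' ⊗ₜ c))
    rw [h]

/-- Φ = (id ⊗ Ψ)(ψ ⊗ id). Here Ψ comes from an equivariant family of operations on the product,
projected to the factors, and ψ is the diagonal of W, which restores the factor W in the target. -/
theorem exists_eilenbergZilberMap (p : ℕ) [NeZero p] :
    Nonempty (EilenbergZilberMap.{u} Λ p) := by
  obtain ⟨ψ, hψ, hψ_act, hψ_eps, hψ_zero⟩ := exists_stdDiag (Λ := Λ) (p := p)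
  obtain ⟨E, hE, hE_act, hE_aug, hE_zero⟩ := (stdAction Λ p).exists_opFamily (rot p) rot_add
    (stdEps Λ p) (fun n hn x hx => stdEps_of_mem hn hx) stdEps_d stdEps_shift
    (awOp_mem (Λ := Λ) (ι := Fin p)) D_awOp aug_awOp
  have hE0 : E (stdE0 Λ p) = awOp Λ (Fin p) := by
    have h := hE_zero 0 0 rfl
    have h1 : (stdAction Λ p).act 0 ((stdAction Λ p).gen 0) = stdE0 Λ p :=
      (stdShift_gen _ _ _).trans (by rw [add_zero]; rfl)
    have h2 : stdEps Λ p ((stdAction Λ p).gen 0) = 1 := (stdEps_gen _ _).trans (if_pos rfl)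
    have h3 : natOps.perm (rot p 0) (awOp Λ (Fin p)) = awOp.{u} Λ (Fin p) := by
      refine natOps.ext fun L c => ?_
      rw [natOps.perm_apply, rot, ZMod.val_zero, pow_zero, powPerm_one]
      rfl
    rwa [h1, h2, h3, one_smul] at h
  refine ⟨⟨fun L => diagExtend ψ (prodOp E L), fun L => ?_, ?_, ?_, ?_, ?_, ?_⟩⟩
  · exact ((IsChainMap.id _).tensorMap (isChainMap_prodOp hE L)).comp
      ((isChainMap_assoc _ _ _).comp (hψ.tensorMap (IsChainMap.id _)))
  · intro L L' g
    refine TensorProduct.ext' fun w c => ?_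
    exact diagExtend_intertwine (prodOp E L) (prodOp E L') LinearMap.id _ _
      (fun w => by rw [TensorProduct.map_id]; rfl) (fun w c => prodOp_natural E g w c) w c
  · intro L
    refine TensorProduct.ext' fun w c => ?_
    refine diagExtend_intertwine (prodOp E L) (prodOp E _) (stdAlpha Λ p) _ _
      (fun w => ?_) (fun w c => prodOp_perm E L _ _ _ ?_ c) w c
    · rw [stdAlpha_eq]; exact hψ_act 1 w
    · rw [stdAlpha_eq, ← rot_one]; exact hE_act 1 w
  · intro L w x
    -- On vertices Ψ is just the augmentation, so Φ reduces to (id ⊗ ε) ψ, which is the identity.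
    suffices h : ∀ t : tensor (stdRes Λ p) (stdRes Λ p),
        TensorProduct.map LinearMap.id (prodOp E L)
          (TensorProduct.assoc Λ _ _ _ (t ⊗ₜ gen Λ (piSSet L) (n := 0) x)) =
        epsRight Λ p t ⊗ₜ PiTensorProduct.tprod Λ fun i => gen Λ (L i) (x i) by
      exact (h (ψ w)).trans (by rw [hψ_eps])
    intro t
    induction t using TensorProduct.induction_on with
    | zero => simp only [map_zero, TensorProduct.zero_tmul]
    | add y z hy hz => simp only [map_add, TensorProduct.add_tmul, hy, hz]
    | tmul b b' =>
      change b ⊗ₜ prodOp E L (b' ⊗ₜ gen Λ (piSSet L) (n := 0) x) = _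
      rw [prodOp_vertex, hE_aug, epsRight_tmul, TensorProduct.tmul_smul, TensorProduct.smul_tmul']
  · intro L n x
    change TensorProduct.map LinearMap.id (prodOp E L)
      (TensorProduct.assoc Λ _ _ _ (ψ (stdE0 Λ p) ⊗ₜ gen Λ (piSSet L) (n := n) x)) = _
    rw [hψ_zero]
    change stdE0 Λ p ⊗ₜ prodOp E L (stdE0 Λ p ⊗ₜ gen Λ (piSSet L) (n := n) x) = _
    rw [prodOp_aw E L _ hE0]
  · intro L j w c hc
    change TensorProduct.map LinearMap.id (prodOp E L) (TensorProduct.assoc Λ _ _ _ (ψ w ⊗ₜ c)) ∈ _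
    induction ψ w using TensorProduct.induction_on with
    | zero => simp only [map_zero, TensorProduct.zero_tmul]; exact Submodule.zero_mem _
    | add y z hy hz =>
      simp only [map_add, TensorProduct.add_tmul]
      exact Submodule.add_mem _ hy hz
    | tmul b b' =>
      change b ⊗ₜ prodOp E L (b' ⊗ₜ c) ∈ _
      have h := prodOp_filtration E L j b' hc
      generalize prodOp E L (b' ⊗ₜ c) = t at h
      induction h using Submodule.span_induction with
      | zero => rw [TensorProduct.tmul_zero]; exact Submodule.zero_mem _
      | add y z _ _ hy hz => rw [TensorProduct.tmul_add]; exact Submodule.add_mem _ hy hz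
      | smul r y _ hy => rw [TensorProduct.tmul_smul]; exact Submodule.smul_mem _ _ hy
      | mem y hy =>
        obtain ⟨k, hk, hy⟩ := hy
        exact Submodule.subset_span ⟨k, b, y, hk, hy, rfl⟩

end Existence

end

section

variable {G : Type w} [Group G] (A : AObj.{v, u, w, w'} Λ G)

variable {ι : Type} [Fintype ι] [LinearOrder ι]

/-! ### The pairing of tensor powers of cochains and chains -/

theorem AObj.alphaPow_tprod_tprod (X : (OrbitCat G)ᵒᵖ) (f : ι → A.cochains) {e : ι → ℤ}
    {t : ι → chains Λ (A.T.obj X)} (ht : ∀ i, t i ∈ (chains Λ (A.T.obj X)).gr (e i)) :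
    A.alphaPow ι X (PiTensorProduct.tprod Λ f) (PiTensorProduct.tprod Λ t) =
      sgn Λ (pairSum (fun i => (e i : ZMod 2)) fun i => (e i : ZMod 2)) •
        ∏ i, A.ev X (f i) (t i) := by
  rw [alphaPow_tprod, revSign_tprod _ ht, map_smul, map_smul, PiTensorProduct.map_tprod,
    PiTensorProduct.lift.tprod, MultilinearMap.mkPiAlgebra_apply]

theorem AObj.ev_d (X : (OrbitCat G)ᵒᵖ) (φ : A.cochains) {k : ℤ} {c : chains Λ (A.T.obj X)}
    (hc : c ∈ (chains Λ (A.T.obj X)).gr k) :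
    A.ev X (A.cochains.d φ) c = sgn Λ (k : ZMod 2) • A.ev X φ ((chains Λ (A.T.obj X)).d c) := by
  change A.ev X φ ((chains Λ (A.T.obj X)).d ((chains Λ (A.T.obj X)).par c)) = _
  rw [par_eq_sgn _ hc, map_smul, map_smul]

theorem pairSum_add_single_self (k : ι → ZMod 2) (i : ι) :
    pairSum (k + Pi.single i 1) (k + Pi.single i 1) =
      pairSum k k + (∑ j with j < i, k j) + ∑ j with i < j, k j := by
  rw [pairSum_add_single_left, pairSum_add_single_right]
  congr 1
  refine Finset.sum_congr rfl fun j hj => ?_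
  rw [Pi.add_apply, Pi.single_eq_of_ne (Finset.mem_filter.1 hj).2.ne', add_zero]

/-- The pairing respects differentials with the same sign (-1)^(n+1) as the coboundary of a single
cochain. The Leibniz sums are compared term by term in i. -/
theorem AObj.alphaPow_d (X : (OrbitCat G)ᵒᵖ) {n : ℤ} {z : pow A.cochains ι}
    (hz : z ∈ (pow A.cochains ι).gr n) (t : pow (chains Λ (A.T.obj X)) ι) :
    A.alphaPow ι X ((pow A.cochains ι).d z) t =
      -(sgn Λ (n : ZMod 2) • A.alphaPow ι X z ((pow (chains Λ (A.T.obj X)) ι).d t)) := by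
  change z ∈ piGr _ n at hz
  induction hz using Submodule.span_induction with
  | zero => simp only [map_zero, LinearMap.zero_apply, smul_zero, neg_zero]
  | add y z _ _ hy hz => simp only [map_add, LinearMap.add_apply, hy, hz, smul_add, neg_add]
  | smul r y _ hy => rw [map_smul, map_smul, map_smul, LinearMap.smul_apply, LinearMap.smul_apply,
      hy, smul_neg, smul_comm]
  | mem y hy =>
    obtain ⟨e, f, hf, rfl, rfl⟩ := hy
    refine LinearMap.congr_fun (f := A.alphaPow ι X ((pow A.cochains ι).d (PiTensorProduct.tprod Λ
        f)))
      (g := -(sgn Λ ((∑ i, e i : ℤ) : ZMod 2) • A.alphaPow ι X (PiTensorProduct.tprod Λ f) ∘ₗ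
        (pow (chains Λ (A.T.obj X)) ι).d)) (pi_hom_ext _ fun k t ht => ?_) t
    change _ = -(sgn Λ ((∑ i, e i : ℤ) : ZMod 2) • A.alphaPow ι X (PiTensorProduct.tprod Λ f)
        ((pow (chains Λ (A.T.obj X)) ι).d (PiTensorProduct.tprod Λ t)))
    rw [pi_d_tprod _ hf, pi_d_tprod _ ht, map_sum, map_sum, LinearMap.sum_apply, Finset.smul_sum,
      ← Finset.sum_neg_distrib]
    refine Finset.sum_congr rfl fun i _ => ?_
    have hP : ∏ j, A.ev X (Function.update f i (A.cochains.d (f i)) j) (t j) =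
        sgn Λ (k i : ZMod 2) •
          ∏ j, A.ev X (f j) (Function.update t i ((chains Λ (A.T.obj X)).d (t i)) j) := by
      rw [← Finset.mul_prod_erase _ _ (Finset.mem_univ i),
        ← Finset.mul_prod_erase _ _ (Finset.mem_univ i), Function.update_self,
        Function.update_self, A.ev_d X _ (ht i), smul_mul_assoc]
      congr 2
      refine Finset.prod_congr rfl fun j hj => ?_
      rw [Function.update_of_ne (Finset.ne_of_mem_erase hj),
        Function.update_of_ne (Finset.ne_of_mem_erase hj)]
    rw [map_smul, LinearMap.smul_apply, map_smul, A.alphaPow_tprod_tprod X _ ht,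
      A.alphaPow_tprod_tprod X _ (update_mem (fun _ => chains Λ (A.T.obj X)) ht i), hP, cast_update,
      pairSum_add_single_self]
    -- Unless the degrees of cochains and chains are opposite in each factor, both sides vanish. If
    -- they are, the degrees e are those of t, raised by 1 at i, modulo 2, and only an identity in
    -- ZMod 2 remains.
    by_cases h : ∀ j, Function.update k i (k i + 1) j = -e j
    · have hE : (fun j => (e j : ZMod 2)) = (fun j => (k j : ZMod 2)) + Pi.single i 1 := by
        rw [← cast_update]
        funext j
        rw [h j, Int.cast_neg, ZMod.neg_eq_self_mod_two]
      have hlt : ∑ j with j < i, (e j : ZMod 2) = ∑ j with j < i, (k j : ZMod 2) := by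
        refine Finset.sum_congr rfl fun j hj => ?_
        rw [congrFun hE j, Pi.add_apply, Pi.single_eq_of_ne (Finset.mem_filter.1 hj).2.ne, add_zero]
      have hsum : ((∑ j, e j : ℤ) : ZMod 2) = (∑ j, (k j : ZMod 2)) + 1 := by
        rw [Int.cast_sum, hE]
        simp only [Pi.add_apply, Finset.sum_add_distrib, Finset.sum_pi_single', Finset.mem_univ,
          if_true]
      rw [hlt, hsum, sgn_add_one, neg_smul, neg_neg, smul_smul, smul_smul, smul_smul, smul_smul,
        ← sgn_add, ← sgn_add, ← sgn_add, ← sgn_add]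
      congr 2
      rw [sum_split (fun j => (k j : ZMod 2)) i]
      generalize (∑ j with j < i, (k j : ZMod 2)) = a
      generalize (∑ j with i < j, (k j : ZMod 2)) = b
      generalize (k i : ZMod 2) = c
      generalize pairSum (fun j => (k j : ZMod 2)) (fun j => (k j : ZMod 2)) = q
      revert a b c q
      decide
    · obtain ⟨j, hj⟩ := not_forall.1 h
      rw [Finset.prod_eq_zero (Finset.mem_univ j) (A.ev_degree X hj (hf j)
        (update_mem (fun _ => chains Λ (A.T.obj X)) ht i j))]
      simp only [smul_zero, neg_zero]

/-- When the pairing is non-zero, the degrees on both sides agree modulo 2, so the two Koszul signs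
cancel. The sign in α is symmetric in the factors, and M₀ is commutative. -/
theorem AObj.alphaPow_perm (X : (OrbitCat G)ᵒᵖ) (σ : Equiv.Perm ι) (z : pow A.cochains ι)
    (t : pow (chains Λ (A.T.obj X)) ι) :
    A.alphaPow ι X (powPerm _ σ z) (powPerm _ σ t) = A.alphaPow ι X z t := by
  refine LinearMap.congr_fun (LinearMap.congr_fun
    (f := (A.alphaPow ι X).compl₁₂ (powPerm A.cochains σ) (powPerm (chains Λ (A.T.obj X)) σ))
    (g := A.alphaPow ι X) (pi_hom_ext _ fun e f hf => pi_hom_ext _ fun k t ht => ?_) z) t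
  rw [LinearMap.compl₁₂_apply, powPerm_tprod _ σ hf, powPerm_tprod _ σ ht, map_smul,
    map_smul, LinearMap.smul_apply, A.alphaPow_tprod_tprod X _ ht,
    A.alphaPow_tprod_tprod X _ (t := fun i => t (σ.symm i)) (e := fun i => k (σ.symm i))
      (fun i => ht _), Equiv.prod_comp σ.symm (fun i => A.ev X (f i) (t i))]
  by_cases h : ∀ j, k j = -e j
  · have hE : (fun j => (e j : ZMod 2)) = fun j => (k j : ZMod 2) := by
      funext j
      rw [h j, Int.cast_neg, ZMod.neg_eq_self_mod_two]
    have hs : pairSum (fun i => (k (σ.symm i) : ZMod 2)) (fun i => (k (σ.symm i) : ZMod 2)) =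
        pairSum (fun i => (k i : ZMod 2)) fun i => (k i : ZMod 2) := by
      rw [pairSum_eq, pairSum_eq]
      exact sumLt_perm (fun i j => (k i : ZMod 2) * (k j : ZMod 2)) (fun i j => mul_comm _ _) σ.symm
    rw [hE, hs, smul_smul, smul_smul, sgn_mul_self, one_mul]
  · obtain ⟨j, hj⟩ := not_forall.1 h
    rw [Finset.prod_eq_zero (Finset.mem_univ j) (A.ev_degree X hj (hf j) (ht j))]
    simp only [smul_zero]

/-! ### The action of natural operations on cochains -/

/-- The family of linear maps `c ↦ α(f)(z(c))` given by a natural operation `z` and an element `f`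
of a tensor power of the cochain complex. -/
def AObj.opFam : natOps.{u} Λ ι →ₗ[Λ] pow A.cochains ι →ₗ[Λ] A.Fam :=
  LinearMap.mk₂ Λ (fun z f => A.toFam fun X => A.alphaPow ι X f ∘ₗ z.app (A.T.obj X))
    (fun z z' f => funext fun X => LinearMap.ext fun c => map_add (A.alphaPow ι X f) _ _)
    (fun r z f => funext fun X => LinearMap.ext fun c => map_smul (A.alphaPow ι X f) _ _)
    (fun z f f' => funext fun X => LinearMap.ext fun _ => by
      change A.alphaPow ι X (f + f') _ = _
      rw [map_add]
      rfl)
    (fun r z f => funext fun X => LinearMap.ext fun _ => by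
      change A.alphaPow ι X (r • f) _ = _
      rw [map_smul]
      rfl)

theorem AObj.opFam_apply (z : natOps.{u} Λ ι) (f : pow A.cochains ι) (X : (OrbitCat G)ᵒᵖ)
    (c : chains Λ (A.T.obj X)) : A.opFam z f X c = A.alphaPow ι X f (z.app _ c) := rfl

theorem AObj.opFam_mem {r j : ℤ} {z : natOps.{u} Λ ι} (hz : z ∈ natOps.gr Λ ι r)
    {f : pow A.cochains ι} (hf : f ∈ (pow A.cochains ι).gr j) : A.opFam z f ∈ A.homρ (r + j) := by
  refine ⟨fun {X Y} m c => ?_, fun X a c => ?_, fun X k hk c hc => ?_⟩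
  · rw [A.opFam_apply, A.opFam_apply, ← z.natural]
    exact A.alphaPow_natural _ _ (A.ev_natural m) _ _
  · rw [A.opFam_apply, A.opFam_apply, ← z.natural]
    exact A.alphaPow_natural _ _ (A.ev_act a) _ _
  · rw [A.opFam_apply]
    exact A.alphaPow_degree X (n := j) (k := k + r) (by omega) hf (hz _ _ _ hc)

/-- The Leibniz rule relating δ, the differential of the cochain tensor and the differential D of
operations; everything about actions of families follows from it. -/
theorem AObj.coboundary_opFam {r j : ℤ} {z : natOps.{u} Λ ι} (hz : z ∈ natOps.gr Λ ι r)
    {f : pow A.cochains ι} (hf : f ∈ (pow A.cochains ι).gr j) :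
    A.coboundary (A.opFam z f) = A.opFam z ((pow A.cochains ι).d f) +
      sgn Λ (j : ZMod 2) • A.opFam (natOps.D z) f := by
  refine A.Fam_ext fun X k c => ?_
  obtain ⟨c, hc⟩ := c
  rw [A.Fam_add_apply, A.Fam_smul_apply, A.coboundary_apply, par_eq_sgn _ hc, map_smul, map_smul,
    A.opFam_apply, A.opFam_apply, A.opFam_apply, A.alphaPow_d X hf, natOps.app_d hz, map_add,
    map_smul]
  -- In any other degree each term vanishes for degree reasons; here the parity of k is determined
  -- by r and j, and the signs can be compared.
  by_cases h : k = -(r + j + 1)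
  · subst h
    have h1 : ((-(r + j + 1) : ℤ) : ZMod 2) = r + j + 1 := by
      rw [Int.cast_neg, ZMod.neg_eq_self_mod_two]; push_cast; rfl
    rw [h1, sgn_add_one, sgn_add, smul_add, neg_add, smul_smul, neg_add_cancel_comm, ← neg_smul]
    rw [mul_comm]
  · rw [A.alphaPow_degree X (n := j) (k := k + 1 + r) (by omega) hf
      (hz _ _ _ ((chains Λ (A.T.obj X)).d_mem hc)),
      A.alphaPow_degree X (n := j) (k := k + (r + 1)) (by omega) hf
      (natOps.D_mem hz _ _ _ hc)]
    simp only [smul_zero, add_zero, neg_zero]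

theorem AObj.opFam_perm (σ : Equiv.Perm ι) (z : natOps.{u} Λ ι) (f : pow A.cochains ι) :
    A.opFam (natOps.perm σ z) (powPerm _ σ f) = A.opFam z f :=
  funext fun X => LinearMap.ext fun _ => A.alphaPow_perm X σ f _

/-! ### Actions of families of operations on cochains and their homotopies -/

section Act

variable {F : DGMod.{v'} Λ}

/-- The map `x ⊗ f ↦ (-1) ^ (deg x * deg f) • α(f) ∘ E(x)` to families of linear maps. -/
def AObj.actFam (E : F →ₗ[Λ] natOps.{u} Λ ι) : tensor F (pow A.cochains ι) →ₗ[Λ] A.Fam :=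
  TensorProduct.lift (A.opFam ∘ₗ E) ∘ₗ swapSign F (pow A.cochains ι)

theorem AObj.actFam_tmul (E : F →ₗ[Λ] natOps.{u} Λ ι) {i j : ℤ} {x : F} (hx : x ∈ F.gr i)
    {f : pow A.cochains ι} (hf : f ∈ (pow A.cochains ι).gr j) :
    A.actFam E (x ⊗ₜ f) = sgn Λ (i * j : ZMod 2) • A.opFam (E x) f := by
  rw [actFam, LinearMap.comp_apply, swapSign_tmul _ _ hx hf, map_smul]
  rfl

theorem AObj.actFam_mem {E : F →ₗ[Λ] natOps.{u} Λ ι} {s : ℤ}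
    (hE : ∀ n, ∀ x ∈ F.gr n, E x ∈ natOps.gr Λ ι (n + s)) {n : ℤ}
    {x : tensor F (pow A.cochains ι)} (hx : x ∈ (tensor F (pow A.cochains ι)).gr n) :
    A.actFam E x ∈ A.homρ (n + s) := by
  refine tensor_mem_induction F (pow A.cochains ι) (A.actFam E) (fun n => A.homρ (n + s))
    (fun i j a ha b hb => ?_) hx
  rw [A.actFam_tmul E ha hb, show i + j + s = i + s + j by ring]
  exact Submodule.smul_mem _ _ (A.opFam_mem (hE i a ha) hb)

/-- The action `F ⊗ C_ρ^*(T; M₀) ^ ι → C_ρ^*(T; M₀)` of a family of natural operations. -/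
def AObj.act (E : F →ₗ[Λ] natOps.{u} Λ ι) (s : ℤ)
    (hE : ∀ n, ∀ x ∈ F.gr n, E x ∈ natOps.gr Λ ι (n + s)) :
    tensor F (pow A.cochains ι) →ₗ[Λ] A.cochains :=
  LinearMap.codRestrict A.total (A.actFam E) fun x => by
    induction x using (tensor F (pow A.cochains ι)).hom_induction with
    | h n y hy => exact Submodule.mem_iSup_of_mem _ (A.actFam_mem hE hy)
    | h0 => rw [map_zero]; exact Submodule.zero_mem _
    | ha y z hy hz => rw [map_add]; exact Submodule.add_mem _ hy hz

variable {E : F →ₗ[Λ] natOps.{u} Λ ι} {s : ℤ}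
    (hE : ∀ n, ∀ x ∈ F.gr n, E x ∈ natOps.gr Λ ι (n + s))

theorem AObj.act_val (x : tensor F (pow A.cochains ι)) : (A.act E s hE x).1 = A.actFam E x := rfl

theorem AObj.act_mem {n : ℤ} {x : tensor F (pow A.cochains ι)}
    (hx : x ∈ (tensor F (pow A.cochains ι)).gr n) : A.act E s hE x ∈ A.cochains.gr (n + s) :=
  A.actFam_mem hE hx

/-- An equivariant family permutes the chains and the diagonal action permutes the cochains, so the
pairing does not change and the action is invariant. -/
theorem AObj.act_perm (σ : Equiv.Perm ι) {a : F →ₗ[Λ] F} (ha : ∀ n, ∀ x ∈ F.gr n, a x ∈ F.gr n)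
    (hEa : ∀ x, E (a x) = natOps.perm σ (E x)) :
    A.act E s hE ∘ₗ TensorProduct.map a (powPerm _ σ) = A.act E s hE := by
  refine tensor_hom_ext _ _ fun i j x hx f hf => Subtype.ext ?_
  rw [LinearMap.comp_apply, TensorProduct.map_tmul, A.act_val, A.act_val, A.actFam_tmul E hx hf,
    A.actFam_tmul E (ha _ _ hx) ((isChainMap_powPerm _ σ).degree _ _ hf), hEa, A.opFam_perm]

theorem AObj.cochains_d_val (φ : A.cochains) : (A.cochains.d φ).1 = A.coboundary φ.1 := rfl

theorem AObj.act_d {i j : ℤ} {x : F} (hx : x ∈ F.gr i)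
    {f : pow A.cochains ι} (hf : f ∈ (pow A.cochains ι).gr j) :
    (A.cochains.d (A.act E s hE (x ⊗ₜ f))).1 =
      sgn Λ (i : ZMod 2) • A.actFam E (x ⊗ₜ (pow A.cochains ι).d f) +
        sgn Λ (i * j + j : ZMod 2) • A.opFam (natOps.D (E x)) f := by
  rw [A.cochains_d_val, A.act_val, A.actFam_tmul E hx hf, map_smul,
    A.coboundary_opFam (hE i x hx) hf, A.actFam_tmul E hx ((pow A.cochains ι).d_mem hf),
    smul_smul, smul_add, smul_smul, ← sgn_add, ← sgn_add]
  congr 3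
  push_cast
  generalize (i : ZMod 2) = a
  generalize (j : ZMod 2) = b
  revert a b
  decide

theorem IsOpFamily.degree' {E : F →ₗ[Λ] natOps.{u} Λ ι} (hE : IsOpFamily E) (n : ℤ) :
    ∀ x ∈ F.gr n, E x ∈ natOps.gr Λ ι (n + 0) := by
  rw [add_zero]; exact hE.degree n

/-- The action of a family of natural operations. -/
def AObj.opAct {E : F →ₗ[Λ] natOps.{u} Λ ι} (hE : IsOpFamily E) :
    tensor F (pow A.cochains ι) →ₗ[Λ] A.cochains := A.act E 0 hE.degree'

theorem AObj.isChainMap_opAct {E : F →ₗ[Λ] natOps.{u} Λ ι} (hE : IsOpFamily E) :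
    IsChainMap (tensor F (pow A.cochains ι)) A.cochains (A.opAct hE) := by
  constructor
  · intro n x hx
    have := A.act_mem hE.degree' hx
    rwa [add_zero] at this
  · refine LinearMap.congr_fun (f := A.opAct hE ∘ₗ (tensor F (pow A.cochains ι)).d)
      (g := A.cochains.d ∘ₗ A.opAct hE) (tensor_hom_ext _ _ fun i j x hx f hf => Subtype.ext ?_)
    change _ = (A.cochains.d (A.act E 0 hE.degree' (x ⊗ₜ f))).1
    rw [A.act_d _ hx hf, LinearMap.comp_apply, tensor_d_tmul _ _ hx]
    change A.actFam E _ = _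
    rw [map_add, map_smul, A.actFam_tmul E (F.d_mem hx) hf, hE.comm, add_comm]
    congr 3
    push_cast
    ring

/-- Homotopic equivariant families of natural operations have homotopic actions. -/
theorem AObj.opAct_homotopic {E E' : F →ₗ[Λ] natOps.{u} Λ ι} (hE : IsOpFamily E)
    (hE' : IsOpFamily E') {H : F →ₗ[Λ] natOps.{u} Λ ι}
    (hH : ∀ n, ∀ x ∈ F.gr n, H x ∈ natOps.gr Λ ι (n - 1))
    (hEE : ∀ x, E x - E' x = natOps.D (H x) + H (F.d x)) :
    ∃ h : tensor F (pow A.cochains ι) →ₗ[Λ] A.cochains,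
      (∀ n, ∀ x ∈ (tensor F (pow A.cochains ι)).gr n, h x ∈ A.cochains.gr (n - 1)) ∧
      (∀ x, A.opAct hE x - A.opAct hE' x =
        A.cochains.d (h x) + h ((tensor F (pow A.cochains ι)).d x)) ∧
      ∀ (σ : Equiv.Perm ι) (a : F →ₗ[Λ] F), (∀ n, ∀ x ∈ F.gr n, a x ∈ F.gr n) →
        (∀ x, H (a x) = natOps.perm σ (H x)) → h ∘ₗ TensorProduct.map a (powPerm _ σ) = h := by
  -- By `act_d` the term in D(H x) carries an additional sign (-1)^(deg f), because H has odd
  -- degree. The factor `par` cancels it.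
  refine ⟨A.act H (-1) hH ∘ₗ TensorProduct.map LinearMap.id (pow A.cochains ι).par, ?_, ?_, ?_⟩
  · intro n x hx
    exact A.act_mem hH (tensorMap_mem (fun _ _ h => h) (fun _ _ h => par_mem _ h) hx)
  · refine fun x => LinearMap.congr_fun (f := A.opAct hE - A.opAct hE')
      (g := A.cochains.d ∘ₗ (A.act H (-1) hH ∘ₗ TensorProduct.map LinearMap.id
        (pow A.cochains ι).par) + (A.act H (-1) hH ∘ₗ TensorProduct.map LinearMap.id
        (pow A.cochains ι).par) ∘ₗ (tensor F (pow A.cochains ι)).d)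
      (tensor_hom_ext _ _ fun i j x hx f hf => Subtype.ext ?_) x
    change A.actFam E (x ⊗ₜ f) - A.actFam E' (x ⊗ₜ f) =
      (A.cochains.d (A.act H (-1) hH (x ⊗ₜ (pow A.cochains ι).par f))).1 +
        A.actFam H (TensorProduct.map LinearMap.id (pow A.cochains ι).par
          ((tensor F (pow A.cochains ι)).d (x ⊗ₜ f)))
    have hpar := par_eq_sgn _ hf
    have hpard := par_eq_sgn _ ((pow A.cochains ι).d_mem hf)
    rw [tensor_d_tmul _ _ hx, map_add, map_smul, TensorProduct.map_tmul, TensorProduct.map_tmul,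
      hpar, hpard, TensorProduct.tmul_smul, TensorProduct.tmul_smul, map_smul, map_smul]
    change _ = (sgn Λ (j : ZMod 2) • (A.cochains.d (A.act H (-1) hH (x ⊗ₜ f))).1) + _
    rw [A.act_d _ hx hf, TensorProduct.tmul_smul, map_add, map_smul, map_smul, map_smul,
        LinearMap.id_apply,
      LinearMap.id_apply, A.actFam_tmul E hx hf, A.actFam_tmul E' hx hf,
      A.actFam_tmul H (F.d_mem hx) hf, ← smul_sub, ← LinearMap.sub_apply, ← map_sub, hEE, map_add,
      LinearMap.add_apply, smul_add, smul_add, smul_smul, smul_smul, smul_smul, smul_smul,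
      ← sgn_add, ← sgn_add, ← sgn_add, ← sgn_add]
    push_cast
    have h1 : (j + (i * j + j) : ZMod 2) = i * j := by
      generalize (i : ZMod 2) = a
      generalize (j : ZMod 2) = b
      revert a b
      decide
    have h2 : (j + (i + 1) * j : ZMod 2) = i * j := by
      generalize (i : ZMod 2) = a
      generalize (j : ZMod 2) = b
      revert a b
      decide
    have h3 : (i + (j + 1) : ZMod 2) = j + i + 1 := by ring
    rw [h1, h2, h3, sgn_add_one, neg_smul]
    abel
  · intro σ a ha hHa
    have h1 : (pow A.cochains ι).par ∘ₗ powPerm A.cochains σ =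
        powPerm A.cochains σ ∘ₗ (pow A.cochains ι).par :=
      LinearMap.ext fun x => (scale_comm _ (isChainMap_powPerm A.cochains σ).degree _ x).symm
    rw [LinearMap.comp_assoc, ← TensorProduct.map_comp, h1, LinearMap.id_comp,
      show a = a ∘ₗ LinearMap.id from rfl, TensorProduct.map_comp, ← LinearMap.comp_assoc,
      A.act_perm hH σ ha hHa]

end Act

end

section

/-! ### Families of natural operations from natural chain maps -/

section OfNatural

variable {F : DGMod.{v} Λ} {ι : Type} [Fintype ι] [LinearOrder ι]
  (T : ∀ L : SSet.{u}, tensor F (chains Λ L) →ₗ[Λ] pow (chains Λ L) ι)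
  (hT : ∀ {L L' : SSet.{u}} (g : L ⟶ L') (x : F) (c : chains Λ L),
    powMap Λ ι g (T L (x ⊗ₜ c)) = T L' (x ⊗ₜ chainsMap g c))

/-- The natural operations `c ↦ T(x ⊗ c)` for natural maps `T : F ⊗ C(L) → C(L) ^ ι`. -/
def natOps.ofNatural : F →ₗ[Λ] natOps.{u} Λ ι where
  toFun x := natOps.mk (fun L => TensorProduct.curry (T L) x) fun _ _ g c => hT g x c
  map_add' x y := natOps.ext fun L c => by
    change T L ((x + y) ⊗ₜ c) = T L (x ⊗ₜ c) + T L (y ⊗ₜ c)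
    rw [TensorProduct.add_tmul, map_add]
  map_smul' r x := natOps.ext fun L c => by
    change T L ((r • x) ⊗ₜ c) = r • T L (x ⊗ₜ c)
    rw [← TensorProduct.smul_tmul', map_smul]

theorem natOps.ofNatural_app (x : F) (L : SSet.{u}) (c : chains Λ L) :
    (natOps.ofNatural T hT x).app L c = T L (x ⊗ₜ c) := rfl

theorem isOpFamily_ofNatural
    (hc : ∀ L, IsChainMap (tensor F (chains Λ L)) (pow (chains Λ L) ι) (T L)) :
    IsOpFamily (natOps.ofNatural T hT) := by
  have hgr : ∀ n, ∀ x ∈ F.gr n, natOps.ofNatural T hT x ∈ natOps.gr Λ ι n := by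
    intro n x hx L k c hk
    rw [add_comm]
    exact (hc L).degree _ _ (tmul_mem_tensorGr _ _ hx hk)
  refine ⟨hgr, LinearMap.congr_fun (f := natOps.ofNatural T hT ∘ₗ F.d)
    (g := natOps.D ∘ₗ natOps.ofNatural T hT) (hom_ext _ fun n x hx => natOps.ext fun L c => ?_)⟩
  rw [LinearMap.comp_apply, LinearMap.comp_apply, natOps.D_apply (hgr n x hx), natOps.ofNatural_app,
    natOps.ofNatural_app, natOps.ofNatural_app, ← (hc L).comm, tensor_d_tmul _ _ hx, map_add,
    map_smul, add_sub_cancel_right]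

end OfNatural

/-! ### The family of natural operations of an Eilenberg–Zilber map -/

section Theta

variable {p : ℕ} [NeZero p] (Φ : EilenbergZilberMap.{u} Λ p)

theorem augLeft_isChainMap (C : DGMod.{v} Λ) :
    IsChainMap (tensor (stdRes Λ p) C) C
      ((TensorProduct.lid Λ _).toLinearMap ∘ₗ TensorProduct.map (stdEps Λ p) LinearMap.id) := by
  constructor
  · intro n x hx
    refine tensor_mem_induction (stdRes Λ p) C _ C.gr (fun i j a ha b hb => ?_) hx
    change stdEps Λ p a • b ∈ _
    by_cases hi : i = 0
    · rw [hi, zero_add]; exact Submodule.smul_mem _ _ hb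
    · rw [stdEps_of_mem hi ha, zero_smul]; exact Submodule.zero_mem _
  · refine LinearMap.congr_fun (f := ((TensorProduct.lid Λ _).toLinearMap ∘ₗ
      TensorProduct.map (stdEps Λ p) LinearMap.id) ∘ₗ (tensor (stdRes Λ p) C).d)
      (g := C.d ∘ₗ ((TensorProduct.lid Λ _).toLinearMap ∘ₗ
        TensorProduct.map (stdEps Λ p) LinearMap.id)) (tensor_hom_ext _ _ fun i j a ha b hb => ?_)
    rw [LinearMap.comp_apply, tensor_d_tmul _ _ ha, map_add, map_smul]
    change stdEps Λ p ((stdRes Λ p).d a) • b + sgn Λ (i : ZMod 2) • stdEps Λ p a • C.d b =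
      C.d (stdEps Λ p a • b)
    rw [stdEps_d, zero_smul, zero_add, map_smul]
    by_cases hi : i = 0
    · rw [hi, Int.cast_zero, sgn_zero, one_smul]
    · rw [stdEps_of_mem hi ha, zero_smul, smul_zero]

theorem delta_isChainMap (L : SSet.{u}) :
    IsChainMap (tensor (stdRes Λ p) (chains Λ L)) (pow (chains Λ L) (Fin p)) (delta Φ L) :=
  (augLeft_isChainMap (pow (chains Λ L) (Fin p))).comp ((Φ.isChainMap fun _ => L).comp
    ((IsChainMap.id _).tensorMap (isChainMap_chainsMap _)))

/-- The natural operations `c ↦ Δ(w ⊗ c)`. -/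
def deltaOp : stdRes Λ p →ₗ[Λ] natOps.{u} Λ (Fin p) :=
  natOps.ofNatural (delta Φ) fun g w c => delta_natural Φ g w c

theorem deltaOp_app (w : stdRes Λ p) (L : SSet.{u}) (c : chains Λ L) :
    (deltaOp Φ w).app L c = delta Φ L (w ⊗ₜ c) := rfl

theorem isOpFamily_deltaOp : IsOpFamily (deltaOp Φ) :=
  isOpFamily_ofNatural _ _ (delta_isChainMap Φ)

theorem delta_eq (L : SSet.{u}) (w : stdRes Λ p) (c : chains Λ L) : delta Φ L (w ⊗ₜ c) =
    TensorProduct.lid Λ _ (TensorProduct.map (stdEps Λ p) LinearMap.id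
      (Φ.toFun (fun _ => L) (w ⊗ₜ chainsMap (diag L (Fin p)) c))) := rfl

theorem augLeft_alpha {C : DGMod.{v} Λ} (g : C →ₗ[Λ] C) (t : stdRes Λ p ⊗[Λ] C.carrier) :
    TensorProduct.lid Λ _ (TensorProduct.map (stdEps Λ p) LinearMap.id
      (TensorProduct.map (stdAlpha Λ p) g t)) =
      g (TensorProduct.lid Λ _ (TensorProduct.map (stdEps Λ p) LinearMap.id t)) := by
  induction t using TensorProduct.induction_on with
  | zero => simp only [map_zero]
  | add y z hy hz => simp only [map_add, hy, hz]
  | tmul a b =>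
    simp only [TensorProduct.map_tmul, LinearMap.id_apply, TensorProduct.lid_tmul, map_smul,
      stdAlpha_eq, stdEps_shift]

/-- The diagonal L → L^p is fixed by permutations of the factors, so the equivariance of Φ passes to
Δ. -/
theorem deltaOp_alpha (w : stdRes Λ p) :
    deltaOp Φ (stdAlpha Λ p w) = natOps.perm (finRotate p) (deltaOp Φ w) := by
  refine natOps.ext fun L c => ?_
  have h := LinearMap.congr_fun (Φ.equivariant fun _ => L)
    (w ⊗ₜ chainsMap (diag L (Fin p)) c)
  have h2 : diag L (Fin p) ≫ piSSetPerm (fun _ => L) (finRotate p) = diag L (Fin p) := rfl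
  rw [LinearMap.comp_apply, LinearMap.comp_apply, TensorProduct.map_tmul, chainsMap_comp, h2] at h
  rw [natOps.perm_apply, deltaOp_app, deltaOp_app, delta_eq, delta_eq]
  refine (congrArg _ (congrArg _ h)).trans ?_
  exact augLeft_alpha (powPerm (chains Λ L) (finRotate p)) _

theorem deltaOp_shift (k : ZMod p) (w : stdRes Λ p) :
    deltaOp Φ (stdShift Λ p k w) = natOps.perm (rot p k) (deltaOp Φ w) := by
  induction k using forall_rot_of_one with
  | h0 =>
    have h : natOps.perm (rot p 0) (deltaOp Φ w) = deltaOp Φ w := by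
      refine natOps.ext fun L c => ?_
      rw [natOps.perm_apply, rot, ZMod.val_zero, pow_zero, powPerm_one]
      rfl
    rw [stdShift_zero, h]
    rfl
  | h k ih => rw [stdShift_add_one, LinearMap.comp_apply, deltaOp_alpha, ih, add_comm k, rot_add,
      rot_one, natOps.perm_mul]; rfl

/-- The condition that Φ is the identity on vertices, read off on a point. It fixes the homotopy
class of the family Δ. -/
theorem aug_deltaOp (w : stdRes Λ p) : natOps.aug (deltaOp Φ w) = stdEps Λ p w := by
  have h1 := Φ.vertices (fun _ => Δ[0]) w fun _ => fund 0
  have h2 : chainsMap (Λ := Λ) (diag (Δ[0] : SSet.{u}) (Fin p)) (gen Λ _ (fund 0)) =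
      gen Λ (piSSet fun _ => Δ[0]) (n := 0) fun _ => fund 0 := chainsMap_gen _ _
  rw [natOps.aug_apply, deltaOp_app, delta_eq, h2]
  refine (congrArg (fun t => augPow Λ (Fin p) _ (TensorProduct.lid Λ _
    (TensorProduct.map (stdEps Λ p) LinearMap.id t))) h1).trans ?_
  rw [TensorProduct.map_tmul, TensorProduct.lid_tmul, map_smul, LinearMap.id_apply, augPow_tprod]
  simp only [augC_gen, if_true, Finset.prod_const_one, smul_eq_mul, mul_one]

theorem deltaOp_zero : deltaOp Φ (stdE0 Λ p) = awOp Λ (Fin p) := by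
  refine natOps.ext fun L c => ?_
  refine LinearMap.congr_fun (f := (deltaOp Φ (stdE0 Λ p)).app L) (g := (awOp Λ (Fin p)).app L)
    (chains_ext L fun n x _ => ?_) c
  have h1 := Φ.alexanderWhitney (fun _ => L) n fun _ => x
  rw [awOp_gen, deltaOp_app, delta_eq, chainsMap_gen]
  refine (congrArg (fun t => TensorProduct.lid Λ _
    (TensorProduct.map (stdEps Λ p) LinearMap.id t)) h1).trans ?_
  have h2 : stdEps Λ p (stdE0 Λ p) = 1 := (stdEps_gen _ _).trans (if_pos rfl)
  rw [TensorProduct.map_tmul, TensorProduct.lid_tmul, h2, one_smul]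
  rfl

variable {G : Type w} [Group G] (A : AObj.{v, u, w, w'} Λ G)

/-- θ is the action of the family Δ by definition; all its properties now follow from general facts
about families. -/
theorem AObj.theta_eq : A.theta Φ = A.opAct (isOpFamily_deltaOp Φ) := by
  refine LinearMap.ext fun z => Subtype.ext (funext fun X => ?_)
  change TensorProduct.lift _ (swapSign _ _ z) =
    TensorProduct.lift (A.opFam ∘ₗ deltaOp Φ) (swapSign _ _ z) X
  induction swapSign (stdRes Λ p) (pow A.cochains (Fin p)) z using TensorProduct.induction_on with
  | zero => rw [map_zero, map_zero]; rfl
  | add y z hy hz => rw [map_add, map_add, hy, hz]; rfl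
  | tmul a b => rfl

end Theta

end

section

/-! ### Concatenation of multi-indices -/

section Append

variable {m n : ℕ}

/-- A decomposition of N into m + n blocks is a cut of N at k together with decompositions of the
front part and of the back part. -/
theorem sum_piAntidiag_append {M : Type*} [AddCommMonoid M] (N : ℕ) (T : (Fin (m + n) → ℕ) → M) :
    ∑ e ∈ Finset.piAntidiag Finset.univ N, T e =
      ∑ k ∈ Finset.range (N + 1), ∑ a ∈ Finset.piAntidiag Finset.univ k,
        ∑ b ∈ Finset.piAntidiag Finset.univ (N - k), T (Fin.append a b) := by
  simp only [Finset.sum_sigma']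
  symm
  refine Finset.sum_bij (fun q _ => Fin.append q.2.1 q.2.2) ?_ ?_ ?_ fun _ _ => rfl
  · rintro ⟨k, a, b⟩ h
    simp only [Finset.mem_sigma, Finset.mem_range, Finset.mem_piAntidiag, Finset.mem_univ,
      implies_true, and_true] at h ⊢
    have ha : ∑ i, a i = k := h.2.1
    have hb : ∑ i, b i = N - k := h.2.2
    rw [Fin.sum_univ_add]
    simp only [Fin.append_left, Fin.append_right]
    rw [ha, hb]
    omega
  · rintro ⟨k, a, b⟩ h ⟨k', a', b'⟩ h' heq
    simp only [Finset.mem_sigma, Finset.mem_range, Finset.mem_piAntidiag, Finset.mem_univ,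
      implies_true, and_true] at h h'
    have ha : a = a' := funext fun i => by
      have := congrFun heq (Fin.castAdd n i)
      simpa only [Fin.append_left] using this
    have hb : b = b' := funext fun i => by
      have := congrFun heq (Fin.natAdd m i)
      simpa only [Fin.append_right] using this
    subst ha hb
    obtain rfl : k = k' := h.2.1.symm.trans h'.2.1
    rfl
  · intro e he
    simp only [Finset.mem_piAntidiag, Finset.mem_univ, implies_true, and_true] at he
    rw [Fin.sum_univ_add] at he
    refine ⟨⟨∑ i, e (Fin.castAdd n i), fun i => e (Fin.castAdd n i),
      fun i => e (Fin.natAdd m i)⟩, Finset.mem_sigma.2 ⟨Finset.mem_range.2 ?_, Finset.mem_sigma.2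
        ⟨Finset.mem_piAntidiag.2 ⟨rfl, fun _ _ => Finset.mem_univ _⟩,
          Finset.mem_piAntidiag.2 ⟨?_, fun _ _ => Finset.mem_univ _⟩⟩⟩, Fin.append_castAdd_natAdd⟩
    · change ∑ i, e (Fin.castAdd n i) < N + 1
      omega
    · change ∑ i, e (Fin.natAdd m i) = N - ∑ i, e (Fin.castAdd n i)
      omega

theorem sumBelow_append_left (a : Fin m → ℕ) (b : Fin n → ℕ) (i : Fin m) :
    sumBelow (Fin.append a b) (Fin.castAdd n i) = sumBelow a i := by
  have h : ∀ j : Fin n, ¬ Fin.natAdd m j < Fin.castAdd n i := fun j h => by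
    rw [Fin.lt_def, Fin.val_natAdd, Fin.val_castAdd] at h
    omega
  rw [sumBelow, sumBelow, Finset.sum_filter, Finset.sum_filter, Fin.sum_univ_add]
  simp only [h, if_false, Finset.sum_const_zero, add_zero, Fin.append_left]
  rfl

theorem sumBelow_append_right (a : Fin m → ℕ) (b : Fin n → ℕ) (i : Fin n) :
    sumBelow (Fin.append a b) (Fin.natAdd m i) = ∑ j, a j + sumBelow b i := by
  have h : ∀ j : Fin m, Fin.castAdd n j < Fin.natAdd m i := fun j => by
    rw [Fin.lt_def, Fin.val_natAdd, Fin.val_castAdd]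
    omega
  rw [sumBelow, sumBelow, Finset.sum_filter, Finset.sum_filter, Fin.sum_univ_add]
  simp only [h, if_true, Fin.append_left, Fin.append_right, Fin.natAdd_lt_natAdd_iff]

/-- The cross term is the product of the total degrees: it is the sign in the binary cup product. -/
theorem pairSum_append (a : Fin m → ℕ) (b : Fin n → ℕ) :
    pairSum (fun i => ((Fin.append a b i : ℕ) : ZMod 2)) (fun i => ((Fin.append a b i : ℕ) : ZMod
        2)) =
      pairSum (fun i => (a i : ZMod 2)) (fun i => (a i : ZMod 2)) +
        pairSum (fun i => (b i : ZMod 2)) (fun i => (b i : ZMod 2)) +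
        (∑ i, (a i : ZMod 2)) * ∑ i, (b i : ZMod 2) := by
  have h1 : ∀ (i : Fin m) (j : Fin n), Fin.castAdd n i < Fin.natAdd m j := fun i j => by
    rw [Fin.lt_def, Fin.val_natAdd, Fin.val_castAdd]
    omega
  have h2 : ∀ (i : Fin n) (j : Fin m), ¬ Fin.natAdd m i < Fin.castAdd n j := fun i j h => by
    rw [Fin.lt_def, Fin.val_natAdd, Fin.val_castAdd] at h
    omega
  have h3 : ∀ i j : Fin m, Fin.castAdd n i < Fin.castAdd n j ↔ i < j := fun i j => Iff.rfl
  rw [pairSum_eq, pairSum_eq, pairSum_eq, sumLt, sumLt, sumLt, Fin.sum_univ_add,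
    Finset.sum_mul_sum]
  simp only [Fin.sum_univ_add, Fin.append_left, Fin.append_right, h1, h2, h3, if_true, if_false,
    Finset.sum_const_zero, zero_add, Fin.natAdd_lt_natAdd_iff, Finset.sum_add_distrib]
  ring

end Append

/-! ### Iterated cup products -/

section Cup

variable {G : Type w} [Group G] (A : AObj.{v, u, w, w'} Λ G)

theorem AObj.cochains_ext {φ ψ : A.cochains}
    (h : ∀ X (n : ℕ) (x : (A.T.obj X) _⦋n⦌), A.ev X φ (gen Λ _ x) = A.ev X ψ (gen Λ _ x)) :
    φ = ψ :=
  Subtype.ext (funext fun X => chains_ext _ fun n x _ => h X n x)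

/-- The iterated cup product, given by the Alexander–Whitney operation. -/
def AObj.awPow (n : ℕ) : pow A.cochains (Fin n) →ₗ[Λ] A.cochains :=
  LinearMap.codRestrict A.total (A.opFam (awOp Λ (Fin n))) fun x => by
    induction x using (pow A.cochains (Fin n)).hom_induction with
    | h n y hy => exact Submodule.mem_iSup_of_mem _ (A.opFam_mem awOp_mem hy)
    | h0 => rw [map_zero]; exact Submodule.zero_mem _
    | ha y z hy hz => rw [map_add]; exact Submodule.add_mem _ hy hz

theorem AObj.isChainMap_awPow (n : ℕ) :
    IsChainMap (pow A.cochains (Fin n)) A.cochains (A.awPow n) := by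
  constructor
  · intro k x hx
    have h : A.opFam (awOp Λ (Fin n)) x ∈ A.homρ (0 + k) := A.opFam_mem awOp_mem hx
    rwa [zero_add] at h
  · refine LinearMap.congr_fun (f := A.awPow n ∘ₗ (pow A.cochains (Fin n)).d)
      (g := A.cochains.d ∘ₗ A.awPow n) (hom_ext _ fun k x hx => Subtype.ext ?_)
    change A.opFam (awOp Λ (Fin n)) _ = A.coboundary (A.opFam (awOp Λ (Fin n)) x)
    rw [A.coboundary_opFam awOp_mem hx, D_awOp, map_zero, LinearMap.zero_apply, smul_zero, add_zero]

theorem AObj.awPow_gen {n : ℕ} (f : Fin n → A.cochains) (X : (OrbitCat G)ᵒᵖ) {N : ℕ}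
    (x : (A.T.obj X) _⦋N⦌) :
    A.ev X (A.awPow n (PiTensorProduct.tprod Λ f)) (gen Λ _ x) =
      ∑ e ∈ Finset.piAntidiag Finset.univ N,
        sgn Λ (pairSum (fun i => (e i : ZMod 2)) fun i => (e i : ZMod 2)) •
          ∏ i, A.ev X (f i) (pick Λ x (e i) (shiftHom (sumBelow e i))) := by
  change A.alphaPow (Fin n) X (PiTensorProduct.tprod Λ f) ((awOp Λ (Fin n)).app _ (gen Λ _ x)) = _
  rw [awOp_gen, awVal_eq, map_sum]
  refine Finset.sum_congr rfl fun e _ => ?_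
  rw [A.alphaPow_tprod_tprod X f fun i => pick_mem _ _ _]
  have h : (fun i => ((-(e i : ℤ) : ℤ) : ZMod 2)) = fun i => (e i : ZMod 2) := by
    funext i
    rw [Int.cast_neg, ZMod.neg_eq_self_mod_two, Int.cast_natCast]
  rw [h]

theorem AObj.cup_gen (f g : A.cochains) (X : (OrbitCat G)ᵒᵖ) {N : ℕ} (x : (A.T.obj X) _⦋N⦌) :
    A.ev X (A.cup (f ⊗ₜ g)) (gen Λ _ x) =
        ∑ k : Fin (N + 1), sgn Λ ((k : ℕ) * (N - k : ℕ) : ZMod 2) •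
      (A.ev X f (gen Λ _ ((A.T.obj X).map (SimplexCategory.subinterval 0 k (by omega)).op x)) *
        A.ev X g (gen Λ _ ((A.T.obj X).map
          (SimplexCategory.subinterval k (N - k) (by omega)).op x))) := by
  change A.alpha₂ X (f ⊗ₜ g) (awDiag (A.T.obj X) (gen Λ _ x)) = _
  rw [awDiag_gen, map_sum]
  refine Finset.sum_congr rfl fun k _ => ?_
  rw [A.alpha₂_tmul, swapSign_tmul _ _ (gen_mem _ _) (gen_mem _ _), map_smul, map_smul,
    TensorProduct.map_tmul, LinearMap.mul'_apply, Int.cast_neg, Int.cast_neg,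
    ZMod.neg_eq_self_mod_two, ZMod.neg_eq_self_mod_two, Int.cast_natCast, Int.cast_natCast]

theorem pick_subinterval {X : SSet.{u}} {N : ℕ} (x : X _⦋N⦌) (k l : ℕ) (h : k + l ≤ N) (m a : ℕ)
    (ham : a + m ≤ l) :
    pick Λ (X.map (SimplexCategory.subinterval k l h).op x) m (shiftHom a) =
      pick Λ x m (shiftHom (k + a)) := by
  refine map_pick_comp x _ m (shiftHom k) _ _ (fun t => Nat.add_comm _ _) (fun t ht => ?_)
    fun t _ => ?_
  · rw [shiftHom_apply]; omega
  · rw [shiftHom_apply, shiftHom_apply, shiftHom_apply, add_assoc]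

/-- Blocks of the front face 0, …, k followed by blocks of the back face k, …, N are blocks of the
whole simplex. Strict associativity and the description of iterated products both follow. -/
theorem AObj.cup_awPow {m n : ℕ} (f : Fin m → A.cochains) (g : Fin n → A.cochains) :
    A.cup (A.awPow m (PiTensorProduct.tprod Λ f) ⊗ₜ A.awPow n (PiTensorProduct.tprod Λ g)) =
      A.awPow (m + n) (PiTensorProduct.tprod Λ (Fin.append f g)) := by
  refine A.cochains_ext fun X N x => ?_
  rw [A.awPow_gen, A.cup_gen, sum_piAntidiag_append, ← Fin.sum_univ_eq_sum_range
    (fun k => ∑ a ∈ Finset.piAntidiag Finset.univ k, ∑ b ∈ Finset.piAntidiag Finset.univ (N - k),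
      sgn Λ (pairSum (fun i => ((Fin.append a b i : ℕ) : ZMod 2)) fun i => ((Fin.append a b i : ℕ)
          : ZMod 2)) •
          ∏ i, A.ev X (Fin.append f g i) (pick Λ x (Fin.append a b i)
            (shiftHom (sumBelow (Fin.append a b) i))))]
  refine Finset.sum_congr rfl fun k _ => ?_
  rw [A.awPow_gen, A.awPow_gen, Finset.sum_mul_sum, Finset.smul_sum]
  refine Finset.sum_congr rfl fun a ha => ?_
  rw [Finset.smul_sum]
  refine Finset.sum_congr rfl fun b hb => ?_
  have ha' : ∑ i, a i = k := (Finset.mem_piAntidiag.1 ha).1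
  have hb' : ∑ i, b i = N - k := (Finset.mem_piAntidiag.1 hb).1
  rw [smul_mul_smul_comm, smul_smul, pairSum_append, sgn_add, sgn_add, Fin.prod_univ_add]
  congr 1
  · rw [← Nat.cast_sum, ← Nat.cast_sum, ha', hb', mul_comm]
  · congr 1
    · refine Finset.prod_congr rfl fun i _ => ?_
      have := sumBelow_add_le a i
      rw [pick_subinterval _ _ _ _ _ _ (by omega), zero_add, sumBelow_append_left, Fin.append_left,
        Fin.append_left]
    · refine Finset.prod_congr rfl fun i _ => ?_
      have := sumBelow_add_le b i
      rw [pick_subinterval _ _ _ _ _ _ (by omega), sumBelow_append_right, Fin.append_right,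
        Fin.append_right, ha']

theorem pick_self {X : SSet.{u}} {N : ℕ} (x : X _⦋N⦌) : pick Λ x N (shiftHom 0) = gen Λ X x := by
  have h : clampHom N N (shiftHom 0) = 𝟙 ⦋N⦌ := by
    ext t
    rw [clampHom_apply, shiftHom_apply, zero_add]
    exact min_eq_left (Nat.le_of_lt_succ t.2)
  rw [pick, h, op_id, CategoryTheory.Functor.map_id]
  rfl

theorem AObj.awPow_one (f : Fin 1 → A.cochains) :
    A.awPow 1 (PiTensorProduct.tprod Λ f) = f 0 := by
  refine A.cochains_ext fun X N x => ?_
  rw [A.awPow_gen, Finset.sum_eq_single (fun _ => N)]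
  · have h1 : pairSum (fun _ : Fin 1 => (N : ZMod 2)) (fun _ => (N : ZMod 2)) = 0 := by
      rw [pairSum_eq, sumLt]
      simp
    have h2 : sumBelow (fun _ : Fin 1 => N) 0 = 0 := by
      rw [sumBelow]
      simp
    rw [h1, sgn_zero, one_smul, Fin.prod_univ_one, h2, pick_self]
  · intro e he hne
    refine absurd (funext fun i => ?_) hne
    have := (Finset.mem_piAntidiag.1 he).1
    rw [Fin.sum_univ_one] at this
    rw [Subsingleton.elim i 0, this]
  · intro h
    refine absurd (Finset.mem_piAntidiag.2 ⟨?_, fun i _ => Finset.mem_univ i⟩) h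
    rw [Fin.sum_univ_one]

theorem AObj.cup_tmul (f g : A.cochains) :
    A.cup (f ⊗ₜ g) = A.awPow 2 (PiTensorProduct.tprod Λ ![f, g]) := by
  have h := A.cup_awPow (fun _ : Fin 1 => f) fun _ : Fin 1 => g
  rw [A.awPow_one, A.awPow_one] at h
  rw [h]
  refine congrArg (fun a : Fin 2 → A.cochains => A.awPow 2 (PiTensorProduct.tprod Λ a))
    (funext fun i => ?_)
  fin_cases i <;> rfl

theorem AObj.cup_cup (f g h : A.cochains) :
    A.cup (A.cup (f ⊗ₜ g) ⊗ₜ h) = A.cup (f ⊗ₜ A.cup (g ⊗ₜ h)) := by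
  have h1 := A.cup_awPow ![f, g] fun _ : Fin 1 => h
  have h2 := A.cup_awPow (fun _ : Fin 1 => f) ![g, h]
  rw [A.awPow_one, ← A.cup_tmul] at h1 h2
  rw [h1, h2]
  refine congrArg (fun a : Fin 3 → A.cochains => A.awPow 3 (PiTensorProduct.tprod Λ a))
    (funext fun i => ?_)
  fin_cases i <;> rfl

/-- The cup product is `awPow 2`, so the Leibniz rule is inherited from the fact that the
Alexander–Whitney operation is a cycle. -/
theorem AObj.isChainMap_cup : IsChainMap (tensor A.cochains A.cochains) A.cochains A.cup := by
  have hmem : ∀ {i j : ℤ} {f g : A.cochains}, f ∈ A.cochains.gr i → g ∈ A.cochains.gr j →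
      ∀ l : Fin 2, ![f, g] l ∈ A.cochains.gr (![i, j] l) := by
    intro i j f g hf hg l
    fin_cases l
    · exact hf
    · exact hg
  constructor
  · intro n x hx
    refine tensor_mem_induction _ _ A.cup A.cochains.gr (fun i j f hf g hg => ?_) hx
    have h := tprod_mem_piGr (fun _ : Fin 2 => A.cochains) (hmem hf hg)
    rw [Fin.sum_univ_two] at h
    rw [A.cup_tmul]
    exact (A.isChainMap_awPow 2).degree _ _ h
  · refine LinearMap.congr_fun (f := A.cup ∘ₗ (tensor A.cochains A.cochains).d)
      (g := A.cochains.d ∘ₗ A.cup) (tensor_hom_ext _ _ fun i j f hf g hg => ?_)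
    rw [LinearMap.comp_apply, LinearMap.comp_apply, tensor_d_tmul _ _ hf, map_add, map_smul,
      A.cup_tmul, A.cup_tmul, A.cup_tmul, ← (A.isChainMap_awPow 2).comm,
      pi_d_tprod (fun _ : Fin 2 => A.cochains) (hmem hf hg), Fin.sum_univ_two, map_add, map_smul,
      map_smul]
    have h0 : ∑ l : Fin 2 with l < 0, ((![i, j] l : ℤ) : ZMod 2) = 0 := by
      rw [Finset.sum_filter, Fin.sum_univ_two]; simp
    have h1 : ∑ l : Fin 2 with l < 1, ((![i, j] l : ℤ) : ZMod 2) = i := by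
      rw [Finset.sum_filter, Fin.sum_univ_two]; simp
    rw [h0, h1, sgn_zero, one_smul]
    congr 1
    · congr 2
      funext l
      fin_cases l <;> rfl
    · congr 3
      funext l
      fin_cases l <;> rfl

theorem AObj.isHomotopyAssocAlgebra_cup : IsHomotopyAssocAlgebra A.cochains A.cup where
  isChainMap := A.isChainMap_cup
  assoc := by
    -- The product is strictly associative, so the zero homotopy suffices.
    refine ⟨0, fun n x _ => Submodule.zero_mem _, ?_, by simp⟩
    have h : A.cup ∘ₗ TensorProduct.map A.cup LinearMap.id =
        A.cup ∘ₗ TensorProduct.map LinearMap.id A.cup ∘ₗ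
          (TensorProduct.assoc Λ A.cochains.carrier A.cochains.carrier
            A.cochains.carrier).toLinearMap :=
      TensorProduct.ext_threefold fun f g h => A.cup_cup f g h
    intro x
    rw [h, sub_self, LinearMap.zero_apply, LinearMap.zero_apply, map_zero, add_zero]

theorem AObj.awPow_comp_mulEquiv (m n : ℕ) :
    A.awPow (m + n) ∘ₗ (TensorPower.mulEquiv (R := Λ) (M := A.cochains.carrier) (n := m)
      (m := n)).toLinearMap = A.cup ∘ₗ TensorProduct.map (A.awPow m) (A.awPow n) := by
  refine TensorProduct.ext (PiTensorProduct.ext (MultilinearMap.ext fun f =>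
    PiTensorProduct.ext (MultilinearMap.ext fun g => ?_)))
  refine Eq.trans ?_ (A.cup_awPow f g).symm
  exact congrArg (A.awPow (m + n)) (TensorPower.tprod_mul_tprod Λ f g)

theorem AObj.isIteratedProduct_awPow_one : IsIteratedProduct A.cup 1 (A.awPow 1) := by
  have h : A.awPow 1 = (PiTensorProduct.subsingletonEquiv (R := Λ)
      (s := fun _ : Fin 1 => A.cochains.carrier) 0).toLinearMap := by
    refine PiTensorProduct.ext (MultilinearMap.ext fun f => ?_)
    refine (A.awPow_one f).trans ?_
    exact (PiTensorProduct.subsingletonEquiv_apply_tprod 0 f).symm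
  rw [h]
  exact IsIteratedProduct.one

theorem AObj.isIteratedProduct_awPow (n : ℕ) :
    IsIteratedProduct A.cup (n + 1) (A.awPow (n + 1)) := by
  induction n with
  | zero => exact A.isIteratedProduct_awPow_one
  | succ n ih =>
    -- The factors are associated from the left, one new factor at a time.
    have h := ih.mul A.isIteratedProduct_awPow_one
    rw [← LinearMap.comp_assoc, ← A.awPow_comp_mulEquiv, LinearMap.comp_assoc] at h
    have h2 : (TensorPower.mulEquiv (R := Λ) (M := A.cochains.carrier) (n := n + 1)
        (m := 1)).toLinearMap ∘ₗ (TensorPower.mulEquiv (R := Λ) (M := A.cochains.carrier)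
          (n := n + 1) (m := 1)).symm.toLinearMap = LinearMap.id :=
      LinearMap.ext fun t => (TensorPower.mulEquiv (R := Λ) (M := A.cochains.carrier)
        (n := n + 1) (m := 1)).apply_symm_apply t
    rwa [h2, LinearMap.comp_id] at h

end Cup

end

section

/-! ### Free resolutions over symmetric groups -/

section Resolution

variable {ι : Type} [Fintype ι] [LinearOrder ι]

/-- The free action of `Γ` on a free resolution. -/
theorem FreeResolution.exists_freeAction {Γ : Type} [Group Γ] (V : FreeResolution.{v} Λ Γ) :
    ∃ (I : Type v) (B : FreeAction V.X Γ I), (∀ γ, B.act γ = V.act γ) ∧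
      ∀ γ γ', B.mul γ γ' = γ * γ' := by
  obtain ⟨I, deg, b, hb⟩ := V.free
  refine ⟨I, ⟨fun γ => V.act γ, (· * ·), fun γ γ' => V.act.map_mul γ γ', V.isChainMap_act,
    fun i => b (1, i), deg, fun i => ?_, fun i => (hb 1 i).1, b, fun γ i => (hb γ i).2⟩,
    fun _ => rfl, fun _ _ => rfl⟩
  -- A generator is a basis element, hence non-zero, and the resolution vanishes in positive
  -- degrees.
  by_contra h
  have h1 := (hb 1 i).1
  rw [V.gr_pos _ (not_le.1 h), Submodule.mem_bot] at h1
  exact b.ne_zero _ h1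

/-- The source of both ϕ and η: a resolution over the full symmetric group carries an equivariant
family of operations, started from Alexander–Whitney. -/
theorem FreeResolution.exists_opFamily (V : FreeResolution.{v} Λ (Equiv.Perm ι)) :
    ∃ E : V.X →ₗ[Λ] natOps.{u} Λ ι, IsOpFamily E ∧
      (∀ σ x, E (V.act σ x) = natOps.perm σ (E x)) ∧ ∀ x, natOps.aug (E x) = V.ε x := by
  obtain ⟨I, B, hB, hmul⟩ := V.exists_freeAction
  obtain ⟨E, hE, hE_act, hE_aug, -⟩ := B.exists_opFamily (fun σ => σ) hmul V.ε V.ε_gr V.ε_d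
    (fun γ x => by rw [hB, V.ε_act]) (awOp_mem (Λ := Λ) (ι := ι)) D_awOp aug_awOp
  exact ⟨E, hE, fun σ x => by rw [← hB, hE_act], hE_aug⟩

end Resolution

/-! ### Actions over free complexes and membership in ℭ(p) -/

section Objects

universe u₁ u₂

variable {G : Type w} [Group G] (A : AObj.{v, u, w, w'} Λ G)

variable {ι : Type} [Fintype ι] [LinearOrder ι]

theorem IsOpFamily.comp {F : DGMod.{u₁} Λ} {F' : DGMod.{u₂} Λ} {E : F →ₗ[Λ] natOps.{u} Λ ι}
    (hE : IsOpFamily E) {j : F' →ₗ[Λ] F} (hj : IsChainMap F' F j) : IsOpFamily (E ∘ₗ j) :=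
  ⟨fun n x hx => hE.degree n _ (hj.degree n x hx), fun x => by
    rw [LinearMap.comp_apply, hj.comm, hE.comm]; rfl⟩

/-- Maps of the form ϕ(j ⊗ 1) and η(w ⊗ 1) are actions of pulled-back families, so they can be
compared with θ and its iterate at the level of families. -/
theorem AObj.opAct_comp {F : DGMod.{u₁} Λ} {F' : DGMod.{u₂} Λ} {E : F →ₗ[Λ] natOps.{u} Λ ι}
    (hE : IsOpFamily E) {j : F' →ₗ[Λ] F} (hj : IsChainMap F' F j) :
    A.opAct (hE.comp hj) = A.opAct hE ∘ₗ TensorProduct.map j LinearMap.id := by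
  refine tensor_hom_ext _ _ fun i k x hx f hf => Subtype.ext ?_
  rw [LinearMap.comp_apply, TensorProduct.map_tmul]
  change A.actFam _ _ = A.actFam _ _
  rw [A.actFam_tmul _ hx hf, LinearMap.id_apply, A.actFam_tmul _ (hj.degree _ _ hx) hf]
  rfl

/-- Equivariant families of natural operations with the same augmentation, parametrized by a free
complex, have equivariantly homotopic actions. -/
theorem AObj.opAct_homotopic_of_free {F : DGMod.{v'} Λ} {K : Type*} {I : Type*}
    (B : FreeAction F K I) (φ : K → Equiv.Perm ι) (hφ : ∀ κ κ', φ (B.mul κ κ') = φ κ * φ κ')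
    {E E' : F →ₗ[Λ] natOps.{u} Λ ι} (hE : IsOpFamily E) (hE' : IsOpFamily E')
    (hE_act : ∀ κ x, E (B.act κ x) = natOps.perm (φ κ) (E x))
    (hE'_act : ∀ κ x, E' (B.act κ x) = natOps.perm (φ κ) (E' x))
    (haug : ∀ x, natOps.aug (E x) = natOps.aug (E' x)) :
    ∃ h : tensor F (pow A.cochains ι) →ₗ[Λ] A.cochains,
      (∀ n, ∀ x ∈ (tensor F (pow A.cochains ι)).gr n, h x ∈ A.cochains.gr (n - 1)) ∧
      (∀ x, A.opAct hE x - A.opAct hE' x =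
        A.cochains.d (h x) + h ((tensor F (pow A.cochains ι)).d x)) ∧
      ∀ κ, h ∘ₗ TensorProduct.map (B.act κ) (powPerm A.cochains (φ κ)) = h := by
  obtain ⟨H, hH, hEE, hH_act⟩ := B.exists_opHomotopy φ hφ hE hE' hE_act hE'_act haug
  obtain ⟨h, h1, h2, h3⟩ := A.opAct_homotopic hE hE' hH hEE
  exact ⟨h, h1, h2, fun κ => h3 _ _ (B.isChainMap κ).degree (hH_act κ)⟩

theorem AObj.isSymmetricMorphism_opAct {V : FreeResolution.{v'} Λ (Equiv.Perm ι)}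
    {E : V.X →ₗ[Λ] natOps.{u} Λ ι} (hE : IsOpFamily E)
    (hE_act : ∀ σ x, E (V.act σ x) = natOps.perm σ (E x)) :
    IsSymmetricMorphism V A.cochains (A.opAct hE) :=
  ⟨A.isChainMap_opAct hE, fun σ => A.act_perm hE.degree' σ (V.isChainMap_act σ).degree (hE_act σ)⟩

variable {p : ℕ} [NeZero p] (Φ : EilenbergZilberMap.{u} Λ p)

theorem AObj.theta_zero (f : pow A.cochains (Fin p)) :
    A.theta Φ (stdE0 Λ p ⊗ₜ f) = A.awPow p f := by
  refine LinearMap.congr_fun (f := TensorProduct.curry (A.theta Φ) (stdE0 Λ p)) (g := A.awPow p)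
    (hom_ext _ fun n f hf => Subtype.ext ?_) f
  rw [TensorProduct.curry_apply, A.theta_eq]
  change A.actFam _ _ = A.opFam _ _
  have h0 : stdE0 Λ p ∈ (stdRes Λ p).gr 0 := by
    have := stdGen_mem (Λ := Λ) (p := p) 0 0
    rw [stdE0_eq]
    simpa using this
  rw [A.actFam_tmul _ h0 hf, Int.cast_zero, zero_mul, sgn_zero, one_smul, deltaOp_zero]

theorem map_stdShift_of_map_stdAlpha {V : FreeResolution.{v'} Λ (Equiv.Perm (Fin p))} {j : stdRes Λ
    p →ₗ[Λ] V.X}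
    (hj : j ∘ₗ stdAlpha Λ p = V.act (finRotate p) ∘ₗ j) (k : ZMod p) (x : stdRes Λ p) :
    j (stdShift Λ p k x) = V.act (rot p k) (j x) := by
  induction k using forall_rot_of_one with
  | h0 =>
    have h : rot p 0 = 1 := by rw [rot, ZMod.val_zero, pow_zero]
    rw [stdShift_zero, h, map_one]
    rfl
  | h k ih =>
    rw [stdShift_add_one, add_comm k, rot_add, rot_one, map_mul]
    exact (LinearMap.congr_fun hj _).trans (congrArg _ ih)

/-- All clauses concern the single family Δ: it is an equivariant chain map, it is Alexander–Whitney
at e_0, and it is homotopic to any other π-equivariant family over W with the same augmentation. -/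
theorem AObj.isCpObject : IsCpObject.{max w u v, v'} p A.cochains A.cup (A.theta Φ) where
  algebra := A.isHomotopyAssocAlgebra_cup
  isChainMap := by
    rw [A.theta_eq]
    exact A.isChainMap_opAct _
  equivariant := by
    rw [A.theta_eq]
    exact A.act_perm _ _ (fun n x hx => by
      rw [stdAlpha_eq]; exact (isChainMap_stdShift 1).degree n x hx) (deltaOp_alpha Φ)
  restriction := by
    -- At e_0 the map θ equals the iterated cup product on the nose, so the homotopy is zero.
    refine ⟨A.awPow p, ?_, 0, fun n x _ => Submodule.zero_mem _, fun f => ?_, by simp⟩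
    · obtain ⟨n, hn⟩ := Nat.exists_eq_succ_of_ne_zero (NeZero.ne p)
      have h := A.isIteratedProduct_awPow n
      rwa [← Nat.succ_eq_add_one, ← hn] at h
    · rw [TensorProduct.curry_apply, A.theta_zero, sub_self, LinearMap.zero_apply,
        LinearMap.zero_apply, map_zero, add_zero]
  extension := by
    intro V j hj hjε hjα
    obtain ⟨E, hE, hE_act, hE_aug⟩ := V.exists_opFamily
    refine ⟨A.opAct hE, A.isSymmetricMorphism_opAct hE hE_act, ?_⟩
    -- W is free over π, and both families over W have augmentation ε because j is a map over Λ.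
    obtain ⟨h, h1, h2, h3⟩ := A.opAct_homotopic_of_free (stdAction Λ p) (rot p) rot_add
      (isOpFamily_deltaOp Φ) (hE.comp hj) (deltaOp_shift Φ)
      (fun k x => by
        rw [LinearMap.comp_apply, LinearMap.comp_apply, ← hE_act]
        exact congrArg E (map_stdShift_of_map_stdAlpha hjα k x))
      (fun x => by
        rw [aug_deltaOp, LinearMap.comp_apply, hE_aug]
        exact (LinearMap.congr_fun hjε x).symm)
    refine ⟨h, h1, fun x => ?_, fun γ hγ => ?_⟩
    · rw [A.theta_eq, ← A.opAct_comp hE hj]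
      exact h2 x
    · rw [Set.mem_singleton_iff.1 hγ]
      have h4 := h3 1
      rw [rot_one] at h4
      have h5 : alphaAct p A.cochains = TensorProduct.map ((stdAction Λ p).act 1)
          (powPerm A.cochains (finRotate p)) := by
        rw [alphaAct, stdAlpha_eq]
        rfl
      rw [h5, h4]

end Objects

end

section

/-! ### The free action of the wreath product on `W ⊗ W ^ p` -/

theorem powPerm_map {K : DGMod.{v} Λ} {L : DGMod.{v'} Λ} {ι : Type} [Fintype ι] [LinearOrder ι]
    {f : ι → K →ₗ[Λ] L} (hf : ∀ i n, ∀ x ∈ K.gr n, f i x ∈ L.gr n) (σ : Equiv.Perm ι) :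
    PiTensorProduct.map f ∘ₗ powPerm K σ =
      powPerm L σ ∘ₗ PiTensorProduct.map fun i => f (σ i) := by
  have h := permMap_natural (A := fun _ : ι => K) (B := fun _ => L) (f := fun i => f (σ i))
    (fun i => hf (σ i)) σ
  simp only [Equiv.apply_symm_apply] at h
  exact h

section Wreath

variable (Λ) (p : ℕ) [NeZero p]

/-- The complex `W ⊗ W ^ p`. -/
abbrev wreathRes : DGMod.{0} Λ := tensor (stdRes Λ p) (pow (stdRes Λ p) (Fin p))

/-- The action of the `k`-th power of the cyclic permutation of the factors on `W ⊗ W ^ p`. -/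
def wreathRot (k : ZMod p) : wreathRes Λ p →ₗ[Λ] wreathRes Λ p :=
  TensorProduct.map (stdShift Λ p k) (powPerm (stdRes Λ p) (rot p k))

/-- The factorwise action on `W ⊗ W ^ p`. -/
def wreathShift (f : Fin p → ZMod p) : wreathRes Λ p →ₗ[Λ] wreathRes Λ p :=
  TensorProduct.map LinearMap.id (PiTensorProduct.map fun j => stdShift Λ p (f j))

/-- The permutation of `Fin p ×ₗ Fin p` given by an element of the wreath product. -/
def wreathPerm (κ : ZMod p × (Fin p → ZMod p)) : Equiv.Perm (Fin p ×ₗ Fin p) :=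
  permFst (Fin p) (rot p κ.1) * permSnd fun i => rot p (κ.2 i)

variable {Λ p}

theorem isChainMap_wreathRot (k : ZMod p) :
    IsChainMap (wreathRes Λ p) (wreathRes Λ p) (wreathRot Λ p k) :=
  (isChainMap_stdShift k).tensorMap (isChainMap_powPerm _ _)

theorem isChainMap_wreathShift (f : Fin p → ZMod p) :
    IsChainMap (wreathRes Λ p) (wreathRes Λ p) (wreathShift Λ p f) :=
  (IsChainMap.id _).tensorMap (IsChainMap.piMap fun j => isChainMap_stdShift (f j))

theorem stdShift_add (k l : ZMod p) :
    stdShift Λ p (k + l) = stdShift Λ p k ∘ₗ stdShift Λ p l := (stdAction Λ p).act_mul k l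

theorem wreathRot_add (k l : ZMod p) :
    wreathRot Λ p (k + l) = wreathRot Λ p k ∘ₗ wreathRot Λ p l := by
  rw [wreathRot, wreathRot, wreathRot, ← TensorProduct.map_comp, stdShift_add, rot_add, powPerm_mul]

theorem wreathShift_add (f g : Fin p → ZMod p) :
    wreathShift Λ p (f + g) = wreathShift Λ p f ∘ₗ wreathShift Λ p g := by
  rw [wreathShift, wreathShift, wreathShift, ← TensorProduct.map_comp, ← PiTensorProduct.map_comp]
  simp only [Pi.add_apply, stdShift_add]
  rfl

theorem wreathShift_wreathRot (f : Fin p → ZMod p) (k : ZMod p) :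
    wreathShift Λ p f ∘ₗ wreathRot Λ p k =
      wreathRot Λ p k ∘ₗ wreathShift Λ p fun i => f (rot p k i) := by
  rw [wreathShift, wreathRot, wreathShift, ← TensorProduct.map_comp, ← TensorProduct.map_comp,
    powPerm_map fun i => (isChainMap_stdShift (f i)).degree]
  rfl

/-- The pairs κ form the wreath product τ of π with itself; `wreathPerm` is its embedding into the
permutations of p² symbols. -/
theorem wreathPerm_mul (κ κ' : ZMod p × (Fin p → ZMod p)) :
    wreathPerm p (κ.1 + κ'.1, (fun i => κ.2 (rot p κ'.1 i)) + κ'.2) =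
      wreathPerm p κ * wreathPerm p κ' := by
  have h1 : (fun i => rot p (((fun i => κ.2 (rot p κ'.1 i)) + κ'.2) i)) =
      (fun i => rot p (κ.2 (rot p κ'.1 i))) * fun i => rot p (κ'.2 i) := by
    funext i
    rw [Pi.add_apply, rot_add]
    rfl
  rw [wreathPerm, wreathPerm, wreathPerm, h1, rot_add, permFst_mul, permSnd_mul, mul_assoc,
    mul_assoc, ← mul_assoc (permSnd _) (permFst _ _), permSnd_mul_permFst, mul_assoc]

variable (Λ p) in
/-- The index bijection for the free action of the wreath product. -/
def wreathIndex : (ZMod p × (Fin p → ZMod p)) × (ℕ × (Fin p → ℕ)) ≃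
    (ZMod p × ℕ) × (Fin p → ZMod p × ℕ) where
  toFun q := ((q.1.1, q.2.1), fun j => (q.1.2 ((rot p q.1.1).symm j), q.2.2 ((rot p q.1.1).symm j)))
  invFun r := ((r.1.1, fun j => (r.2 (rot p r.1.1 j)).1), (r.1.2, fun j => (r.2 (rot p r.1.1 j)).2))
  left_inv q := by simp
  right_inv r := by simp

variable (Λ p) in
/-- The free action of the wreath product on `W ⊗ W ^ p`. -/
def wreathAction : FreeAction (wreathRes Λ p) (ZMod p × (Fin p → ZMod p)) (ℕ × (Fin p → ℕ)) where
  act κ := wreathRot Λ p κ.1 ∘ₗ wreathShift Λ p κ.2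
  mul κ κ' := (κ.1 + κ'.1, (fun i => κ.2 (rot p κ'.1 i)) + κ'.2)
  act_mul κ κ' := by
    rw [wreathRot_add, wreathShift_add, LinearMap.comp_assoc,
      ← LinearMap.comp_assoc (wreathShift Λ p κ'.2), ← wreathShift_wreathRot]
    rfl
  isChainMap κ := (isChainMap_wreathRot _).comp (isChainMap_wreathShift _)
  gen i := stdGen Λ p i.1 0 ⊗ₜ PiTensorProduct.tprod Λ fun j => stdGen Λ p (i.2 j) 0
  deg i := -(i.1 : ℤ) + ∑ j, -(i.2 j : ℤ)
  deg_le i := by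
    rw [Finset.sum_neg_distrib, ← Nat.cast_sum]
    omega
  gen_mem i := tmul_mem_tensorGr _ _ (stdGen_mem _ _)
    (tprod_mem_piGr (fun _ : Fin p => stdRes Λ p) fun j => stdGen_mem (i.2 j) 0)
  -- Rotating factors of odd degree costs a Koszul sign, so the translates of the generators are the
  -- tensor product basis only up to signs. The basis is rescaled by these units.
  basis := (((stdAction Λ p).basis.tensorProduct
    (Basis.piTensorProduct fun _ : Fin p => (stdAction Λ p).basis)).reindex
      (wreathIndex p).symm).isUnitSMul
      (w := fun q => sgn Λ (invSum (rot p q.1.1) fun j => ((-(q.2.2 j : ℤ) : ℤ) : ZMod 2)))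
      fun _ => (sgn_ne_zero _).isUnit
  basis_apply κ i := by
    rw [Module.Basis.isUnitSMul_apply, Module.Basis.reindex_apply,
      Module.Basis.tensorProduct_apply', Basis.piTensorProduct_apply]
    have h : ∀ k l, (stdAction Λ p).basis (k, l) = stdGen Λ p l k := fun k l => by
      rw [(stdAction Λ p).basis_apply]
      exact (stdShift_gen _ _ _).trans (by rw [zero_add])
    simp only [wreathIndex, Equiv.symm_symm, Equiv.coe_fn_mk, h]
    rw [LinearMap.comp_apply, wreathShift, TensorProduct.map_tmul, PiTensorProduct.map_tprod,
      wreathRot, TensorProduct.map_tmul]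
    simp only [LinearMap.id_apply, stdShift_gen, zero_add]
    rw [powPerm_tprod _ _ fun j => stdGen_mem (i.2 j) (κ.2 j), TensorProduct.tmul_smul]

/-- Induction over `(ℤ/p) ^ p` with respect to the standard generators. -/
theorem forall_of_single {P : (Fin p → ZMod p) → Prop} (h0 : P 0)
    (h : ∀ f i, P f → P (Pi.single i 1 + f)) (f : Fin p → ZMod p) : P f := by
  have h1 : ∀ i (k : ZMod p) f, P f → P (Pi.single i k + f) := by
    intro i k f hf
    induction k using forall_rot_of_one with
    | h0 => rwa [Pi.single_zero, zero_add]
    | h k ih =>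
      rw [add_comm k, Pi.single_add, add_assoc]
      exact h _ _ ih
  have h2 : ∀ s : Finset (Fin p), P (∑ i ∈ s, Pi.single i (f i)) := by
    intro s
    induction s using Finset.induction_on with
    | empty => rwa [Finset.sum_empty]
    | insert i s his ih =>
      rw [Finset.sum_insert his]
      exact h1 _ _ _ ih
  have h3 := h2 Finset.univ
  rwa [Finset.univ_sum_single] at h3

theorem wreathShift_zero : wreathShift Λ p 0 = LinearMap.id := by
  rw [wreathShift]
  simp only [Pi.zero_apply, stdShift_zero]
  rw [PiTensorProduct.map_id, TensorProduct.map_id]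

theorem wreathShift_single (i : Fin p) : wreathShift Λ p (Pi.single i 1) =
    tauAlphaAt p (stdRes Λ p) (stdAlpha Λ p) i := by
  rw [wreathShift, tauAlphaAt]
  congr 2
  funext j
  by_cases hj : j = i
  · subst hj
    rw [Pi.single_eq_same, Function.update_self, stdAlpha_eq]
  · rw [Pi.single_eq_of_ne hj, Function.update_of_ne hj, stdShift_zero]

theorem wreathRot_one : wreathRot Λ p 1 = tauAlpha p (stdRes Λ p) := by
  rw [wreathRot, rot_one, tauAlpha, stdAlpha_eq]
  rfl

theorem rot_zero : rot p 0 = 1 := by rw [rot, ZMod.val_zero, pow_zero]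

theorem permSnd_one : permSnd (fun _ : Fin p => (1 : Equiv.Perm (Fin p))) = 1 := by
  ext q; rfl

theorem wreathPerm_single (i : Fin p) : wreathPerm p (0, Pi.single i 1) = permAlphaAt p i := by
  rw [wreathPerm, permAlphaAt_eq]
  have h1 : permFst (Fin p) (rot p (0 : ZMod p)) = 1 := by
    rw [rot_zero]; ext q; rfl
  have h2 : (fun j => rot p ((Pi.single i 1 : Fin p → ZMod p) j)) =
      Pi.mulSingle i (finRotate p) := by
    funext j
    by_cases hj : j = i
    · subst hj
      rw [Pi.single_eq_same, Pi.mulSingle_eq_same, rot_one]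
    · rw [Pi.single_eq_of_ne hj, Pi.mulSingle_eq_of_ne hj, rot_zero]
  change permFst (Fin p) (rot p (0 : ZMod p)) * permSnd (fun j => rot p
    ((Pi.single i 1 : Fin p → ZMod p) j)) = _
  rw [h1, h2, one_mul]

theorem wreathPerm_one : wreathPerm p (1, 0) = permAlpha p := by
  rw [wreathPerm, permAlpha_eq]
  simp only [Pi.zero_apply, rot_zero, rot_one, permSnd_one, mul_one]

/-- A map which commutes with the generators of the wreath product is equivariant. -/
theorem IsTauMorphism.map_act {Y : FreeResolution.{v'} Λ (Equiv.Perm (Fin p ×ₗ Fin p))}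
    {y : wreathRes Λ p →ₗ[Λ] Y.X} (hy : IsTauMorphism p Y y) (κ : ZMod p × (Fin p → ZMod p))
    (x : wreathRes Λ p) : y ((wreathAction Λ p).act κ x) = Y.act (wreathPerm p κ) (y x) := by
  have h1 : ∀ f : Fin p → ZMod p, ∀ x,
      y (wreathShift Λ p f x) = Y.act (wreathPerm p (0, f)) (y x) := by
    intro f
    induction f using forall_of_single with
    | h0 =>
      intro x
      have h : wreathPerm p (0, 0) = 1 := by
        rw [wreathPerm]
        simp only [Pi.zero_apply, rot_zero, permSnd_one, mul_one]
        ext q; rfl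
      rw [wreathShift_zero, h, map_one]
      rfl
    | h f i ih =>
      intro x
      have h0 : (fun j => (Pi.single i 1 : Fin p → ZMod p) (rot p 0 j)) = Pi.single i 1 := by
        funext j; rw [rot_zero]; rfl
      have h := wreathPerm_mul (p := p) (0, Pi.single i 1) (0, f)
      change wreathPerm p (0 + 0, (fun j => (Pi.single i 1 : Fin p → ZMod p) (rot p 0 j)) + f) =
        _ at h
      rw [add_zero, h0] at h
      rw [wreathShift_add, LinearMap.comp_apply, wreathShift_single]
      refine (LinearMap.congr_fun (hy.map_alphaAt i) _).trans ?_
      rw [LinearMap.comp_apply, ih, ← wreathPerm_single, ← Module.End.mul_apply, ← map_mul]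
      exact congrArg (fun σ => Y.act σ (y x)) h.symm
  have h2 : ∀ k : ZMod p, ∀ x, y (wreathRot Λ p k x) = Y.act (wreathPerm p (k, 0)) (y x) := by
    intro k
    induction k using forall_rot_of_one with
    | h0 =>
      intro x
      have h := h1 0 x
      have h3 : wreathRot Λ p 0 = LinearMap.id := by
        rw [wreathRot, rot_zero, stdShift_zero, powPerm_one, TensorProduct.map_id]
      rw [wreathShift_zero] at h
      rw [h3]
      exact h
    | h k ih =>
      intro x
      have h := wreathPerm_mul (p := p) (1, 0) (k, 0)
      have h0 : (fun i => (0 : Fin p → ZMod p) (rot p k i)) + 0 = 0 := add_zero _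
      simp only [h0] at h
      rw [add_comm k, wreathRot_add, LinearMap.comp_apply, wreathRot_one]
      refine (LinearMap.congr_fun hy.map_alpha _).trans ?_
      rw [LinearMap.comp_apply, ih, ← wreathPerm_one, ← Module.End.mul_apply, ← map_mul]
      exact congrArg (fun σ => Y.act σ (y x)) h.symm
  have h := wreathPerm_mul (p := p) (κ.1, 0) (0, κ.2)
  have h0 : (fun i => (0 : Fin p → ZMod p) (rot p 0 i)) + κ.2 = κ.2 := zero_add _
  simp only [h0, add_zero] at h
  change y (wreathRot Λ p κ.1 (wreathShift Λ p κ.2 x)) = _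
  rw [h2, h1, ← Module.End.mul_apply, ← map_mul]
  exact congrArg (fun σ => Y.act σ (y x)) h.symm

end Wreath

end

section

/-! ### The iterated Eilenberg–Zilber operations -/

/-- The signed interchange of two factors. -/
def swapMap (A : DGMod.{v} Λ) (B : DGMod.{v'} Λ) : tensor A B →ₗ[Λ] tensor B A :=
  (TensorProduct.comm Λ A.carrier B.carrier).toLinearMap ∘ₗ swapSign A B

theorem swapMap_tmul (A : DGMod.{v} Λ) (B : DGMod.{v'} Λ) {i j : ℤ} {a : A} {b : B}
    (ha : a ∈ A.gr i) (hb : b ∈ B.gr j) :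
    swapMap A B (a ⊗ₜ b) = sgn Λ (i * j : ZMod 2) • b ⊗ₜ[Λ] a := by
  rw [swapMap, LinearMap.comp_apply, swapSign_tmul A B ha hb, map_smul]
  rfl

theorem isChainMap_swapMap (A : DGMod.{v} Λ) (B : DGMod.{v'} Λ) :
    IsChainMap (tensor A B) (tensor B A) (swapMap A B) := by
  constructor
  · intro n x hx
    refine tensor_mem_induction A B (swapMap A B) (tensor B A).gr (fun i j a ha b hb => ?_) hx
    rw [swapMap_tmul A B ha hb, add_comm]
    exact Submodule.smul_mem _ _ (tmul_mem_tensorGr B A hb ha)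
  · refine LinearMap.congr_fun (f := swapMap A B ∘ₗ (tensor A B).d)
      (g := (tensor B A).d ∘ₗ swapMap A B) (tensor_hom_ext A B fun i j a ha b hb => ?_)
    rw [LinearMap.comp_apply, LinearMap.comp_apply, tensor_d_tmul A B ha, swapMap_tmul A B ha hb,
      map_add, map_smul, map_smul, swapMap_tmul A B (A.d_mem ha) hb,
      swapMap_tmul A B ha (B.d_mem hb), tensor_d_tmul B A hb, smul_add, smul_smul, smul_smul,
      add_comm, ← sgn_add, ← sgn_add]
    push_cast
    congr 3
    all_goals
      generalize (i : ZMod 2) = i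
      generalize (j : ZMod 2) = j
      revert i j
      decide

theorem flatten_map_map {K : DGMod.{v} Λ} {K' : DGMod.{v'} Λ} {ι κ : Type} [Fintype ι]
    [LinearOrder ι] [Fintype κ] [LinearOrder κ] (g : K →ₗ[Λ] K') :
    flatten K' ι κ ∘ₗ PiTensorProduct.map (fun _ => PiTensorProduct.map fun _ => g) =
      PiTensorProduct.map (fun _ => g) ∘ₗ flatten K ι κ := by
  refine pow_pow_hom_ext K fun e a _ => ?_
  rw [LinearMap.comp_apply, LinearMap.comp_apply, PiTensorProduct.map_tprod, flatten_tprod,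
    PiTensorProduct.map_tprod]
  simp only [PiTensorProduct.map_tprod]
  exact flatten_tprod K' _

/-! ### The family over W ⊗ W^p obtained by iterating Δ -/

section IteratedDelta

variable {p : ℕ} [NeZero p] (Φ : EilenbergZilberMap.{u} Λ p)

/-- The map `W ^ p ⊗ C(L) ^ p → C(L) ^ (p²)` which applies `Δ` in every factor. -/
def deltaPow (L : SSet.{u}) :
    tensor (pow (stdRes Λ p) (Fin p)) (pow (chains Λ L) (Fin p)) →ₗ[Λ]
      pow (chains Λ L) (Fin p ×ₗ Fin p) :=
  flatten (chains Λ L) (Fin p) (Fin p) ∘ₗ PiTensorProduct.map (fun _ => delta Φ L) ∘ₗ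
    zipS (fun _ => stdRes Λ p) (fun _ => chains Λ L)

theorem isChainMap_deltaPow (L : SSet.{u}) :
    IsChainMap (tensor (pow (stdRes Λ p) (Fin p)) (pow (chains Λ L) (Fin p)))
      (pow (chains Λ L) (Fin p ×ₗ Fin p)) (deltaPow Φ L) :=
  (isChainMap_flatten _).comp ((IsChainMap.piMap fun _ => delta_isChainMap Φ L).comp
    (isChainMap_zipS _ _))

theorem powMap_deltaPow {L L' : SSet.{u}} (g : L ⟶ L') :
    powMap Λ (Fin p ×ₗ Fin p) g ∘ₗ deltaPow Φ L =
      deltaPow Φ L' ∘ₗ TensorProduct.map LinearMap.id (powMap Λ (Fin p) g) := by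
  have h1 : PiTensorProduct.map (fun _ : Fin p => PiTensorProduct.map fun _ : Fin p =>
      chainsMap (Λ := Λ) g) ∘ₗ PiTensorProduct.map (fun _ => delta Φ L) =
      PiTensorProduct.map (fun _ => delta Φ L') ∘ₗ PiTensorProduct.map (fun _ =>
        TensorProduct.map LinearMap.id (chainsMap g)) := by
    rw [← PiTensorProduct.map_comp, ← PiTensorProduct.map_comp]
    congr 1
    funext _
    exact TensorProduct.ext' fun w c => delta_natural Φ g w c
  have h2 := zipS_map (A := fun _ : Fin p => stdRes Λ p) (A' := fun _ => stdRes Λ p)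
    (B := fun _ => chains Λ L) (B' := fun _ => chains Λ L') (fun _ => LinearMap.id)
    (fun _ => chainsMap g) (fun _ _ _ hx => hx) (fun _ _ _ hx => chainsMap_mem g hx)
  rw [PiTensorProduct.map_id] at h2
  rw [deltaPow, deltaPow, powMap, powMap, ← LinearMap.comp_assoc, ← flatten_map_map,
    LinearMap.comp_assoc, LinearMap.comp_assoc, LinearMap.comp_assoc, ← h2,
    ← LinearMap.comp_assoc _ _ (PiTensorProduct.map fun _ => delta Φ L'), ← h1]
  rfl

/-- Permuting the p copies of Δ permutes the blocks of the p² output factors. Equivariance under the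
α_i, inside the blocks, is `deltaPow_shift`. -/
theorem deltaPow_powPerm (L : SSet.{u}) (σ : Equiv.Perm (Fin p)) :
    deltaPow Φ L ∘ₗ TensorProduct.map (powPerm (stdRes Λ p) σ) (powPerm (chains Λ L) σ) =
      powPerm (chains Λ L) (permFst (Fin p) σ) ∘ₗ deltaPow Φ L := by
  rw [deltaPow, LinearMap.comp_assoc, LinearMap.comp_assoc, ← zipS_powPerm,
    ← LinearMap.comp_assoc _ _ (PiTensorProduct.map fun _ => delta Φ L),
    powPerm_natural (delta_isChainMap Φ L).degree, ← LinearMap.comp_assoc, ← LinearMap.comp_assoc,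
    flatten_powPerm]
  rfl

theorem delta_shift (L : SSet.{u}) (k : ZMod p) :
    delta Φ L ∘ₗ TensorProduct.map (stdShift Λ p k) LinearMap.id =
      powPerm (chains Λ L) (rot p k) ∘ₗ delta Φ L :=
  TensorProduct.ext' fun w c => congrArg (fun z : natOps.{u} Λ (Fin p) => z.app L c)
    (deltaOp_shift Φ k w)

theorem deltaPow_shift (L : SSet.{u}) (f : Fin p → ZMod p) :
    deltaPow Φ L ∘ₗ TensorProduct.map (PiTensorProduct.map fun i => stdShift Λ p (f i))
        LinearMap.id =
      powPerm (chains Λ L) (permSnd fun i => rot p (f i)) ∘ₗ deltaPow Φ L := by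
  have h2 := zipS_map (A := fun _ : Fin p => stdRes Λ p) (A' := fun _ => stdRes Λ p)
    (B := fun _ => chains Λ L) (B' := fun _ => chains Λ L) (fun i => stdShift Λ p (f i))
    (fun _ => LinearMap.id) (fun i => (isChainMap_stdShift (f i)).degree) (fun _ _ _ hx => hx)
  rw [PiTensorProduct.map_id] at h2
  have h1 : PiTensorProduct.map (fun _ : Fin p => delta Φ L) ∘ₗ PiTensorProduct.map (fun i =>
      TensorProduct.map (stdShift Λ p (f i)) LinearMap.id) =
      PiTensorProduct.map (fun i => powPerm (chains Λ L) (rot p (f i))) ∘ₗ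
        PiTensorProduct.map (fun _ => delta Φ L) := by
    rw [← PiTensorProduct.map_comp, ← PiTensorProduct.map_comp]
    exact congrArg _ (funext fun i => delta_shift Φ L (f i))
  rw [deltaPow, LinearMap.comp_assoc, LinearMap.comp_assoc, ← h2,
    ← LinearMap.comp_assoc _ _ (PiTensorProduct.map fun _ => delta Φ L), h1,
    ← LinearMap.comp_assoc, ← LinearMap.comp_assoc, flatten_map_powPerm]
  rfl

/-- The map `(x ⊗ y) ⊗ c ↦ ± Δ ^ p (y ⊗ Δ(x ⊗ c))`. -/
def deltaTwo (L : SSet.{u}) :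
    tensor (wreathRes Λ p) (chains Λ L) →ₗ[Λ] pow (chains Λ L) (Fin p ×ₗ Fin p) :=
  deltaPow Φ L ∘ₗ TensorProduct.map LinearMap.id (delta Φ L) ∘ₗ
    (TensorProduct.assoc Λ (pow (stdRes Λ p) (Fin p)).carrier (stdRes Λ p).carrier
      (chains Λ L).carrier).toLinearMap ∘ₗ
    TensorProduct.map (swapMap (stdRes Λ p) (pow (stdRes Λ p) (Fin p))) LinearMap.id

theorem deltaTwo_tmul (L : SSet.{u}) {a b : ℤ} {x : stdRes Λ p} {y : pow (stdRes Λ p) (Fin p)}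
    (hx : x ∈ (stdRes Λ p).gr a) (hy : y ∈ (pow (stdRes Λ p) (Fin p)).gr b) (c : chains Λ L) :
    deltaTwo Φ L ((x ⊗ₜ y) ⊗ₜ c) =
      sgn Λ (a * b : ZMod 2) • deltaPow Φ L (y ⊗ₜ delta Φ L (x ⊗ₜ c)) := by
  rw [deltaTwo, LinearMap.comp_apply, LinearMap.comp_apply, LinearMap.comp_apply,
    TensorProduct.map_tmul, swapMap_tmul _ _ hx hy, ← TensorProduct.smul_tmul', map_smul, map_smul,
    map_smul]
  rfl

theorem isChainMap_deltaTwo (L : SSet.{u}) :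
    IsChainMap (tensor (wreathRes Λ p) (chains Λ L)) (pow (chains Λ L) (Fin p ×ₗ Fin p))
      (deltaTwo Φ L) :=
  (isChainMap_deltaPow Φ L).comp (((IsChainMap.id _).tensorMap (delta_isChainMap Φ L)).comp
    ((isChainMap_assoc _ _ _).comp ((isChainMap_swapMap _ _).tensorMap (IsChainMap.id _))))

theorem deltaTwo_natural {L L' : SSet.{u}} (g : L ⟶ L') (x : wreathRes Λ p) (c : chains Λ L) :
    powMap Λ (Fin p ×ₗ Fin p) g (deltaTwo Φ L (x ⊗ₜ c)) = deltaTwo Φ L' (x ⊗ₜ chainsMap g c) := by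
  refine LinearMap.congr_fun (f := powMap Λ (Fin p ×ₗ Fin p) g ∘ₗ deltaTwo Φ L ∘ₗ
      (TensorProduct.mk Λ _ _).flip c) (g :=
          deltaTwo Φ L' ∘ₗ (TensorProduct.mk Λ _ _).flip (chainsMap g c))
    (tensor_hom_ext _ _ fun i j a ha b hb => ?_) x
  change powMap Λ (Fin p ×ₗ Fin p) g (deltaTwo Φ L ((a ⊗ₜ b) ⊗ₜ c)) =
    deltaTwo Φ L' ((a ⊗ₜ b) ⊗ₜ chainsMap g c)
  rw [deltaTwo_tmul Φ L ha hb, deltaTwo_tmul Φ L' ha hb, map_smul, ← delta_natural]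
  exact congrArg _ (LinearMap.congr_fun (powMap_deltaPow Φ g) _)

/-- The natural operations `c ↦ ± Δ ^ p (y ⊗ Δ(x ⊗ c))`. -/
def deltaTwoOp : wreathRes Λ p →ₗ[Λ] natOps.{u} Λ (Fin p ×ₗ Fin p) :=
  natOps.ofNatural (deltaTwo Φ) fun g x c => deltaTwo_natural Φ g x c

theorem isOpFamily_deltaTwoOp : IsOpFamily (deltaTwoOp Φ) :=
  isOpFamily_ofNatural _ _ (isChainMap_deltaTwo Φ)

theorem deltaTwoOp_rot (k : ZMod p) (x : wreathRes Λ p) :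
    deltaTwoOp Φ (wreathRot Λ p k x) =
      natOps.perm (permFst (Fin p) (rot p k)) (deltaTwoOp Φ x) := by
  refine LinearMap.congr_fun (f := deltaTwoOp Φ ∘ₗ wreathRot Λ p k)
    (g := natOps.perm (permFst (Fin p) (rot p k)) ∘ₗ deltaTwoOp Φ)
    (tensor_hom_ext _ _ fun i j a ha b hb => natOps.ext fun L c => ?_) x
  change deltaTwo Φ L ((stdShift Λ p k a ⊗ₜ powPerm (stdRes Λ p) (rot p k) b) ⊗ₜ c) =
    powPerm (chains Λ L) (permFst (Fin p) (rot p k)) (deltaTwo Φ L ((a ⊗ₜ b) ⊗ₜ c))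
  rw [deltaTwo_tmul Φ L ((isChainMap_stdShift k).degree _ _ ha)
    ((isChainMap_powPerm _ _).degree _ _ hb), deltaTwo_tmul Φ L ha hb, map_smul]
  have h := LinearMap.congr_fun (delta_shift Φ L k) (a ⊗ₜ c)
  rw [LinearMap.comp_apply, TensorProduct.map_tmul, LinearMap.id_apply] at h
  rw [h]
  exact congrArg _ (LinearMap.congr_fun (deltaPow_powPerm Φ L (rot p k)) (b ⊗ₜ _))

theorem deltaTwoOp_shift (f : Fin p → ZMod p) (x : wreathRes Λ p) :
    deltaTwoOp Φ (wreathShift Λ p f x) =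
      natOps.perm (permSnd fun i => rot p (f i)) (deltaTwoOp Φ x) := by
  refine LinearMap.congr_fun (f := deltaTwoOp Φ ∘ₗ wreathShift Λ p f)
    (g := natOps.perm (permSnd fun i => rot p (f i)) ∘ₗ deltaTwoOp Φ)
    (tensor_hom_ext _ _ fun i j a ha b hb => natOps.ext fun L c => ?_) x
  change deltaTwo Φ L ((a ⊗ₜ PiTensorProduct.map (fun i => stdShift Λ p (f i)) b) ⊗ₜ c) =
    powPerm (chains Λ L) (permSnd fun i => rot p (f i)) (deltaTwo Φ L ((a ⊗ₜ b) ⊗ₜ c))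
  rw [deltaTwo_tmul Φ L ha
    ((IsChainMap.piMap fun i => isChainMap_stdShift (f i)).degree _ _ hb), deltaTwo_tmul Φ L ha hb,
    map_smul]
  exact congrArg _ (LinearMap.congr_fun (deltaPow_shift Φ L f) (b ⊗ₜ _))

theorem deltaTwoOp_act (κ : ZMod p × (Fin p → ZMod p)) (x : wreathRes Λ p) :
    deltaTwoOp Φ ((wreathAction Λ p).act κ x) =
      natOps.perm (wreathPerm p κ) (deltaTwoOp Φ x) := by
  change deltaTwoOp Φ (wreathRot Λ p κ.1 (wreathShift Λ p κ.2 x)) = _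
  rw [deltaTwoOp_rot, deltaTwoOp_shift, wreathPerm, natOps.perm_mul]
  rfl

theorem delta_vertex (L : SSet.{u}) (x : L _⦋0⦌) (w : stdRes Λ p) :
    delta Φ L (w ⊗ₜ gen Λ L x) =
      stdEps Λ p w • PiTensorProduct.tprod Λ fun _ => gen Λ L x := by
  rw [← deltaOp_app, natOps.app_vertex, aug_deltaOp]

theorem deltaPow_vertex (L : SSet.{u}) {e : Fin p → ℤ} {y : Fin p → stdRes Λ p}
    (hy : ∀ i, y i ∈ (stdRes Λ p).gr (e i)) (x : L _⦋0⦌) :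
    deltaPow Φ L (PiTensorProduct.tprod Λ y ⊗ₜ PiTensorProduct.tprod Λ fun _ => gen Λ L x) =
      (∏ i, stdEps Λ p (y i)) • PiTensorProduct.tprod Λ fun _ => gen Λ L x := by
  have h0 : pairSum (fun _ : Fin p => ((0 : ℤ) : ZMod 2)) (fun i => (e i : ZMod 2)) = 0 := by
    simp [pairSum]
  have hx : gen Λ L x ∈ (chains Λ L).gr 0 := by simpa using gen_mem (Λ := Λ) L x
  rw [deltaPow, LinearMap.comp_apply, LinearMap.comp_apply,
    zipS_tmul (fun _ => stdRes Λ p) (fun _ => chains Λ L) hy (f := fun _ => 0) fun _ => hx,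
    h0, sgn_zero, one_smul, PiTensorProduct.map_tprod]
  refine (congrArg (fun t => flatten (chains Λ L) (Fin p) (Fin p) (PiTensorProduct.tprod Λ t))
    (funext fun i => delta_vertex Φ L x (y i))).trans ?_
  rw [MultilinearMap.map_smul_univ, map_smul, flatten_tprod (chains Λ L) fun _ _ => gen Λ L x]

theorem deltaTwo_vertex (L : SSet.{u}) {a : ℤ} {w : stdRes Λ p} (hw : w ∈ (stdRes Λ p).gr a)
    {e : Fin p → ℤ} {y : Fin p → stdRes Λ p} (hy : ∀ i, y i ∈ (stdRes Λ p).gr (e i)) (x : L _⦋0⦌) :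
    deltaTwo Φ L ((w ⊗ₜ PiTensorProduct.tprod Λ y) ⊗ₜ gen Λ L x) =
      (stdEps Λ p w * ∏ i, stdEps Λ p (y i)) • PiTensorProduct.tprod Λ fun _ => gen Λ L x := by
  rw [deltaTwo_tmul Φ L hw (tprod_mem_piGr (fun _ => stdRes Λ p) hy), delta_vertex,
    TensorProduct.tmul_smul, map_smul, deltaPow_vertex Φ L hy]
  by_cases ha : a = 0
  · rw [ha, Int.cast_zero, zero_mul, sgn_zero, one_smul, smul_smul]
  · rw [stdEps_of_mem ha hw, zero_smul, smul_zero, zero_mul, zero_smul]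

/-- On a vertex the inner and outer Δ both reduce to augmentations, and the interchange sign
disappears since only degree 0 survives. The result agrees with the condition that w is a map over
Λ. -/
theorem aug_deltaTwoOp {a : ℤ} {w : stdRes Λ p} (hw : w ∈ (stdRes Λ p).gr a)
    {e : Fin p → ℤ} {y : Fin p → stdRes Λ p} (hy : ∀ i, y i ∈ (stdRes Λ p).gr (e i)) :
    natOps.aug (deltaTwoOp Φ (w ⊗ₜ PiTensorProduct.tprod Λ y)) =
      stdEps Λ p w * ∏ i, stdEps Λ p (y i) := by
  rw [natOps.aug_apply]
  refine (congrArg _ (deltaTwo_vertex Φ Δ[0] hw hy (fund 0))).trans ?_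
  rw [map_smul, augPow_tprod]
  simp only [augC_gen, if_true, Finset.prod_const_one, smul_eq_mul, mul_one]

end IteratedDelta

end

section

/-! ### Signs -/

section Signs

variable {ι : Type} [Fintype ι] [LinearOrder ι]

theorem pairSum_add_left (a b c : ι → ZMod 2) :
    pairSum (a + b) c = pairSum a c + pairSum b c := by
  rw [pairSum_eq, pairSum_eq, pairSum_eq, ← sumLt_add]
  simp only [Pi.add_apply, add_mul]

theorem pairSum_add_right (a b c : ι → ZMod 2) :
    pairSum a (b + c) = pairSum a b + pairSum a c := by
  rw [pairSum_eq, pairSum_eq, pairSum_eq, ← sumLt_add]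
  simp only [Pi.add_apply, mul_add]

theorem sum_mul_sum_eq_pairSum (b c : ι → ZMod 2) :
    (∑ i, b i) * ∑ i, c i = ∑ i, b i * c i + pairSum b c + pairSum c b := by
  have h : pairSum c b = ∑ i, ∑ j, if j < i then b i * c j else 0 := by
    rw [pairSum_eq, sumLt, Finset.sum_comm]
    simp only [mul_comm]
  rw [h, pairSum_eq, sumLt, Finset.sum_mul_sum, ← Finset.sum_add_distrib, ← Finset.sum_add_distrib]
  refine Finset.sum_congr rfl fun i _ => ?_
  have h2 : b i * c i = ∑ j, if i = j then b i * c j else 0 := by simp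
  rw [h2, ← Finset.sum_add_distrib, ← Finset.sum_add_distrib]
  refine Finset.sum_congr rfl fun j _ => ?_
  rcases lt_trichotomy i j with h | rfl | h
  · simp [h, h.ne, h.not_gt]
  · simp
  · simp [h, h.ne', h.not_gt]

/-- The sign identity behind `AObj.alphaPow_theta`: there b_i is the degree of y_i, a_i the total
degree of the i-th block of cochains, and a_i + b_i the degree of the chain paired with it. -/
theorem pairSum_add_self_add_sum (a b : ι → ZMod 2) :
    pairSum (a + b) (a + b) + ∑ i, b i * a i =
      pairSum a b + (∑ i, b i) * (∑ i, a i) + pairSum (a + b) b + pairSum a a := by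
  rw [sum_mul_sum_eq_pairSum]
  simp only [pairSum_add_left, pairSum_add_right]
  generalize pairSum a b = w
  generalize pairSum b a = x
  generalize pairSum a a = y
  generalize pairSum b b = z
  generalize ∑ i, b i * a i = s
  revert w x y z s
  decide

theorem sgn_sum {κ : Type*} (s : Finset κ) (f : κ → ZMod 2) :
    sgn Λ (∑ i ∈ s, f i) = ∏ i ∈ s, sgn Λ (f i) := by
  classical
  induction s using Finset.induction_on with
  | empty => rw [Finset.sum_empty, Finset.prod_empty, sgn_zero]
  | insert a s ha ih => rw [Finset.sum_insert ha, Finset.prod_insert ha, sgn_add, ih]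

end Signs

/-! ### The shuffle -/

theorem DGMod.IsChainMap.symm {A : DGMod.{v} Λ} {B : DGMod.{v'} Λ} {e : A.carrier ≃ₗ[Λ] B.carrier}
    (h : IsChainMap A B e.toLinearMap) : IsChainMap B A e.symm.toLinearMap := by
  constructor
  · intro n x hx
    refine degree_of_comm_scale (A := B) (B := A) e.symm.toLinearMap
      (fun c => LinearMap.ext fun y => ?_) hx
    obtain ⟨z, rfl⟩ := e.surjective y
    refine e.injective ?_
    have := LinearMap.congr_fun (f := e.toLinearMap ∘ₗ A.scale c) (g := B.scale c ∘ₗ e.toLinearMap)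
      (LinearMap.ext fun x => scale_comm _ h.degree c x) z
    simp only [LinearMap.comp_apply, LinearEquiv.coe_coe, e.symm_apply_apply,
      e.apply_symm_apply] at this ⊢
    exact this.symm
  · intro x
    obtain ⟨z, rfl⟩ := e.surjective x
    refine e.injective ?_
    have := h.comm z
    simp only [LinearEquiv.coe_coe, e.symm_apply_apply, e.apply_symm_apply] at this ⊢
    exact this.symm

section Shuffle

variable {p : ℕ} [NeZero p] (K : DGMod.{v} Λ)

theorem isChainMap_shuffle :
    IsChainMap (tensor (stdRes Λ p) (pow (tensor (stdRes Λ p) (pow K (Fin p))) (Fin p)))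
      (tensor (wreathRes Λ p) (pow K (Fin p ×ₗ Fin p))) (shuffle p K) :=
  (isChainMap_assoc _ _ _).symm.comp ((IsChainMap.id _).tensorMap
    (((IsChainMap.id _).tensorMap (isChainMap_flatten K)).comp (isChainMap_unzip _ _)))

theorem shuffle_tmul (x : stdRes Λ p) (t : pow (tensor (stdRes Λ p) (pow K (Fin p))) (Fin p)) :
    shuffle p K (x ⊗ₜ t) = (TensorProduct.assoc Λ _ _ _).symm (x ⊗ₜ
      TensorProduct.map LinearMap.id (flatten K (Fin p) (Fin p))
        (unzip (fun _ => stdRes Λ p) (fun _ => pow K (Fin p)) t)) := rfl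

theorem shuffle_tprod (x : stdRes Λ p) {b : Fin p → ℤ} {y : Fin p → stdRes Λ p}
    (hy : ∀ i, y i ∈ (stdRes Λ p).gr (b i)) {e : Fin p → Fin p → ℤ} {f : Fin p → Fin p → K}
    (hf : ∀ i j, f i j ∈ K.gr (e i j)) :
    shuffle p K (x ⊗ₜ PiTensorProduct.tprod Λ fun i => y i ⊗ₜ[Λ] PiTensorProduct.tprod Λ (f i)) =
      sgn Λ (pairSum (fun i => ((∑ j, e i j : ℤ) : ZMod 2)) fun i => (b i : ZMod 2)) •
        (x ⊗ₜ PiTensorProduct.tprod Λ y) ⊗ₜ[Λ]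
          PiTensorProduct.tprod Λ fun q : Fin p ×ₗ Fin p => f (ofLex q).1 (ofLex q).2 := by
  rw [shuffle_tmul, unzip_tprod (fun _ => stdRes Λ p) (fun _ => pow K (Fin p)) hy
    (tprod_mem_pow_pow K hf), map_smul, TensorProduct.tmul_smul, map_smul, TensorProduct.map_tmul,
    flatten_tprod]
  rfl

/-- The shuffle is `unzip` followed by `flatten`, so equivariance can be checked for these two
separately. -/
theorem shuffle_comp_map {g : stdRes Λ p →ₗ[Λ] stdRes Λ p}
    {T : pow (tensor (stdRes Λ p) (pow K (Fin p))) (Fin p) →ₗ[Λ]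
      pow (tensor (stdRes Λ p) (pow K (Fin p))) (Fin p)}
    {g₁ : pow (stdRes Λ p) (Fin p) →ₗ[Λ] pow (stdRes Λ p) (Fin p)}
    {g₂ : pow (pow K (Fin p)) (Fin p) →ₗ[Λ] pow (pow K (Fin p)) (Fin p)}
    {h : pow K (Fin p ×ₗ Fin p) →ₗ[Λ] pow K (Fin p ×ₗ Fin p)}
    (h₁ : unzip (fun _ => stdRes Λ p) (fun _ => pow K (Fin p)) ∘ₗ T =
      TensorProduct.map g₁ g₂ ∘ₗ unzip (fun _ => stdRes Λ p) (fun _ => pow K (Fin p)))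
    (h₂ : flatten K (Fin p) (Fin p) ∘ₗ g₂ = h ∘ₗ flatten K (Fin p) (Fin p)) :
    shuffle p K ∘ₗ TensorProduct.map g T =
      TensorProduct.map (TensorProduct.map g g₁) h ∘ₗ shuffle p K := by
  refine TensorProduct.ext' fun x t => ?_
  have h₃ := LinearMap.congr_fun h₁ t
  rw [LinearMap.comp_apply] at h₃
  rw [LinearMap.comp_apply, LinearMap.comp_apply, TensorProduct.map_tmul, shuffle_tmul,
    shuffle_tmul, h₃, LinearMap.comp_apply]
  generalize unzip (fun _ => stdRes Λ p) (fun _ => pow K (Fin p)) t = s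
  induction s using TensorProduct.induction_on with
  | zero => simp only [map_zero, TensorProduct.tmul_zero]
  | add s s' hs hs' => simp only [map_add, TensorProduct.tmul_add, hs, hs']
  | tmul a b =>
    have h₄ := LinearMap.congr_fun h₂ b
    rw [LinearMap.comp_apply, LinearMap.comp_apply] at h₄
    simp only [TensorProduct.map_tmul, LinearMap.id_apply, TensorProduct.assoc_symm_tmul, h₄]

theorem shuffle_tauAlpha :
    shuffle p K ∘ₗ tauAlpha p (tensor (stdRes Λ p) (pow K (Fin p))) =
      TensorProduct.map (tauAlpha p (stdRes Λ p)) (powPerm K (permAlpha p)) ∘ₗ shuffle p K :=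
  shuffle_comp_map K (unzip_powPerm (stdRes Λ p) (pow K (Fin p)) (finRotate p))
    (by rw [permAlpha_eq]; exact flatten_powPerm K (finRotate p))

theorem shuffle_tauAlphaAt (i : Fin p) :
    shuffle p K ∘ₗ tauAlphaAt p (tensor (stdRes Λ p) (pow K (Fin p))) (alphaAct p K) i =
      TensorProduct.map (tauAlphaAt p (stdRes Λ p) (stdAlpha Λ p) i)
        (powPerm K (permAlphaAt p i)) ∘ₗ shuffle p K := by
  have hα : ∀ n, ∀ x ∈ (stdRes Λ p).gr n, stdAlpha Λ p x ∈ (stdRes Λ p).gr n := by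
    rw [stdAlpha_eq]
    exact (isChainMap_stdShift 1).degree
  -- The action on one factor M = W ⊗ K^p is rewritten as a family of tensor products of maps, the
  -- form to which naturality of `unzip` applies.
  have hu : (Function.update (fun _ => LinearMap.id) i (alphaAct p K) :
      Fin p → tensor (stdRes Λ p) (pow K (Fin p)) →ₗ[Λ] tensor (stdRes Λ p) (pow K (Fin p))) =
      fun j => TensorProduct.map
        ((Function.update (fun _ => LinearMap.id) i (stdAlpha Λ p) :
          Fin p → stdRes Λ p →ₗ[Λ] stdRes Λ p) j)
        (powPerm K ((Pi.mulSingle i (finRotate p) : Fin p → Equiv.Perm (Fin p)) j)) := by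
    funext j
    by_cases hj : j = i
    · subst hj
      rw [Function.update_self, Function.update_self, Pi.mulSingle_eq_same]
      rfl
    · rw [Function.update_of_ne hj, Function.update_of_ne hj, Pi.mulSingle_eq_of_ne hj, powPerm_one,
        TensorProduct.map_id]
  rw [tauAlphaAt, tauAlphaAt, hu]
  refine shuffle_comp_map K (unzip_map (A := fun _ => stdRes Λ p) (A' := fun _ => stdRes Λ p)
    (B := fun _ => pow K (Fin p)) (B' := fun _ => pow K (Fin p)) _ _ (fun j n x hx => ?_)
    fun j => (isChainMap_powPerm K _).degree) ?_
  · by_cases hj : j = i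
    · subst hj
      rw [Function.update_self]
      exact hα n x hx
    · rwa [Function.update_of_ne hj]
  · rw [permAlphaAt_eq]
    exact flatten_map_powPerm K _

/-- Linear maps out of `⨂_i (A_i ⊗ K ^ κ)` are determined by their values on homogeneous tensors. -/
theorem pi_tensor_pow_hom_ext {ι κ : Type} [Fintype ι] [LinearOrder ι] [Fintype κ] [LinearOrder κ]
    (A : ι → DGMod.{v'} Λ) {M : Type*} [AddCommGroup M] [Module Λ M]
    {f g : (pi fun i => tensor (A i) (pow K κ)).carrier →ₗ[Λ] M}
    (h : ∀ (b : ι → ℤ) (e : ι → κ → ℤ) (y : ∀ i, A i) (a : ι → κ → K),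
      (∀ i, y i ∈ (A i).gr (b i)) → (∀ i j, a i j ∈ K.gr (e i j)) →
      f (PiTensorProduct.tprod Λ fun i => y i ⊗ₜ[Λ] PiTensorProduct.tprod Λ (a i)) =
        g (PiTensorProduct.tprod Λ fun i => y i ⊗ₜ[Λ] PiTensorProduct.tprod Λ (a i))) : f = g := by
  have key : f ∘ₗ zip A (fun _ => pow K κ) = g ∘ₗ zip A (fun _ => pow K κ) := by
    refine TensorProduct.ext (pi_hom_ext A fun b y hy => pow_pow_hom_ext K fun e a ha => ?_)
    change f (zip A (fun _ => pow K κ) (_ ⊗ₜ _)) = g (zip A (fun _ => pow K κ) (_ ⊗ₜ _))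
    rw [zip_tmul]
    exact h b e y a hy ha
  refine LinearMap.ext fun x => ?_
  obtain ⟨z, rfl⟩ := (zip_bijective A fun _ => pow K κ).2 x
  exact LinearMap.congr_fun key z

end Shuffle

end

section

/-! ### The pairing of iterated tensor powers -/

section Factorization

variable {G : Type w} [Group G] (A : AObj.{v, u, w, w'} Λ G)

/-- Pairing all factors at once is the same as pairing inside each block and multiplying the
results; the remaining sign involves only the total degrees of the blocks. -/
theorem AObj.alphaPow_flatten {ι κ : Type} [Fintype ι] [LinearOrder ι] [Fintype κ] [LinearOrder κ]
    (X : (OrbitCat G)ᵒᵖ) (f : ι → κ → A.cochains) {υ : ι → ℤ}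
    {t : ι → pow (chains Λ (A.T.obj X)) κ}
    (ht : ∀ i, t i ∈ (pow (chains Λ (A.T.obj X)) κ).gr (υ i)) :
    A.alphaPow (ι ×ₗ κ) X (PiTensorProduct.tprod Λ fun q : ι ×ₗ κ => f (ofLex q).1 (ofLex q).2)
        (flatten (chains Λ (A.T.obj X)) ι κ (PiTensorProduct.tprod Λ t)) =
      sgn Λ (pairSum (fun i => (υ i : ZMod 2)) fun i => (υ i : ZMod 2)) •
        ∏ i, A.alphaPow κ X (PiTensorProduct.tprod Λ (f i)) (t i) := by
  have key : A.alphaPow (ι ×ₗ κ) X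
      (PiTensorProduct.tprod Λ fun q : ι ×ₗ κ => f (ofLex q).1 (ofLex q).2) ∘ₗ
        flatten (chains Λ (A.T.obj X)) ι κ =
      PiTensorProduct.lift (MultilinearMap.mkPiAlgebra Λ ι (A.M₀.obj X)) ∘ₗ
        PiTensorProduct.map (fun i => A.alphaPow κ X (PiTensorProduct.tprod Λ (f i))) ∘ₗ
          revSign fun _ => pow (chains Λ (A.T.obj X)) κ := by
    refine pow_pow_hom_ext _ fun e c hc => ?_
    rw [LinearMap.comp_apply, LinearMap.comp_apply, LinearMap.comp_apply, flatten_tprod,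
      A.alphaPow_tprod_tprod X _ (e := fun q : ι ×ₗ κ => e (ofLex q).1 (ofLex q).2)
        fun q => hc _ _, revSign_tprod _ (tprod_mem_pow_pow _ hc), map_smul, map_smul,
      PiTensorProduct.map_tprod, PiTensorProduct.lift.tprod, MultilinearMap.mkPiAlgebra_apply]
    have h1 : ∀ i, A.alphaPow κ X (PiTensorProduct.tprod Λ (f i)) (PiTensorProduct.tprod Λ (c i)) =
        sgn Λ (pairSum (fun j => (e i j : ZMod 2)) fun j => (e i j : ZMod 2)) •
          ∏ j, A.ev X (f i j) (c i j) := fun i => A.alphaPow_tprod_tprod X _ (hc i)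
    have h2 : ∏ q : ι ×ₗ κ, A.ev X (f (ofLex q).1 (ofLex q).2) (c (ofLex q).1 (ofLex q).2) =
        ∏ i, ∏ j, A.ev X (f i j) (c i j) :=
      (Equiv.prod_comp (toLex (α := ι × κ)) fun q => A.ev X (f (ofLex q).1 (ofLex q).2)
        (c (ofLex q).1 (ofLex q).2)).symm.trans (Fintype.prod_prod_type _)
    rw [h2]
    simp only [h1]
    rw [Finset.prod_smul, smul_smul, ← sgn_sum, ← sgn_add]
    congr 2
    -- Pairs in different blocks give the outer sign, pairs in the same block the inner signs.
    rw [pairSum_eq, sumLt_lex, pairSum_eq]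
    simp only [pairSum_eq, ofLex_toLex, Int.cast_sum, Finset.sum_mul_sum]
  have h := LinearMap.congr_fun key (PiTensorProduct.tprod Λ t)
  rw [LinearMap.comp_apply] at h
  rw [h, LinearMap.comp_apply, LinearMap.comp_apply, revSign_tprod _ ht, map_smul, map_smul,
    PiTensorProduct.map_tprod, PiTensorProduct.lift.tprod, MultilinearMap.mkPiAlgebra_apply]

/-! ### The iterated morphism `θ` as the action of the iterated Eilenberg–Zilber operations -/

variable {p : ℕ} [NeZero p] (Φ : EilenbergZilberMap.{u} Λ p)

theorem AObj.ev_theta (X : (OrbitCat G)ᵒᵖ) {b k : ℤ} {y : stdRes Λ p}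
    (hy : y ∈ (stdRes Λ p).gr b) {f : pow A.cochains (Fin p)}
    (hf : f ∈ (pow A.cochains (Fin p)).gr k) (c : chains Λ (A.T.obj X)) :
    A.ev X (A.theta Φ (y ⊗ₜ f)) c =
      sgn Λ (b * k : ZMod 2) • A.alphaPow (Fin p) X f (delta Φ _ (y ⊗ₜ c)) := by
  rw [A.theta_eq]
  change A.actFam (deltaOp Φ) (y ⊗ₜ f) X c = _
  rw [A.actFam_tmul _ hy hf]
  rfl

/-- Evaluating p values of θ on chains amounts to applying Δ to each chain factor and pairing all p²
factors. The scalar combines the shuffle sign with the sign for moving the y_i past the cochains. -/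
theorem AObj.alphaPow_theta (X : (OrbitCat G)ᵒᵖ) {b : Fin p → ℤ} {y : Fin p → stdRes Λ p}
    (hy : ∀ i, y i ∈ (stdRes Λ p).gr (b i)) {e : Fin p → Fin p → ℤ}
    {f : Fin p → Fin p → A.cochains} (hf : ∀ i j, f i j ∈ A.cochains.gr (e i j))
    (t : pow (chains Λ (A.T.obj X)) (Fin p)) :
    A.alphaPow (Fin p) X
        (PiTensorProduct.tprod Λ fun i => A.theta Φ (y i ⊗ₜ PiTensorProduct.tprod Λ (f i))) t =
      sgn Λ (pairSum (fun i => ((∑ j, e i j : ℤ) : ZMod 2)) (fun i => (b i : ZMod 2)) +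
          (∑ i, (b i : ZMod 2)) * ∑ i, ((∑ j, e i j : ℤ) : ZMod 2)) •
        A.alphaPow (Fin p ×ₗ Fin p) X
          (PiTensorProduct.tprod Λ fun q : Fin p ×ₗ Fin p => f (ofLex q).1 (ofLex q).2)
          (deltaPow Φ _ (PiTensorProduct.tprod Λ y ⊗ₜ t)) := by
  set s := sgn Λ (pairSum (fun i => ((∑ j, e i j : ℤ) : ZMod 2)) (fun i => (b i : ZMod 2)) +
    (∑ i, (b i : ZMod 2)) * ∑ i, ((∑ j, e i j : ℤ) : ZMod 2)) with hs
  refine LinearMap.congr_fun (f := A.alphaPow (Fin p) X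
      (PiTensorProduct.tprod Λ fun i => A.theta Φ (y i ⊗ₜ PiTensorProduct.tprod Λ (f i))))
    (g := s • A.alphaPow (Fin p ×ₗ Fin p) X
      (PiTensorProduct.tprod Λ fun q : Fin p ×ₗ Fin p => f (ofLex q).1 (ofLex q).2) ∘ₗ
        deltaPow Φ _ ∘ₗ TensorProduct.mk Λ _ _ (PiTensorProduct.tprod Λ y))
    (pi_hom_ext _ fun k c hc => ?_) t
  change _ = s • A.alphaPow (Fin p ×ₗ Fin p) X
      (PiTensorProduct.tprod Λ fun q : Fin p ×ₗ Fin p => f (ofLex q).1 (ofLex q).2)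
      (deltaPow Φ _ (PiTensorProduct.tprod Λ y ⊗ₜ PiTensorProduct.tprod Λ c))
  have hδ : ∀ i, delta Φ _ (y i ⊗ₜ c i) ∈ (pow (chains Λ (A.T.obj X)) (Fin p)).gr (b i + k i) :=
    fun i => delta_mem Φ _ (tmul_mem_tensorGr _ _ (hy i) (hc i))
  rw [A.alphaPow_tprod_tprod X _ hc, deltaPow, LinearMap.comp_apply, LinearMap.comp_apply,
    zipS_tmul (fun _ => stdRes Λ p) (fun _ => chains Λ (A.T.obj X)) hy hc, map_smul, map_smul,
    map_smul, PiTensorProduct.map_tprod, A.alphaPow_flatten X f hδ]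
  simp only [fun i => A.ev_theta Φ X (hy i) (tprod_mem_pow_pow _ hf i) (c i)]
  rw [Finset.prod_smul, smul_smul, smul_smul, smul_smul, ← sgn_sum, hs, ← sgn_add, ← sgn_add,
    ← sgn_add]
  -- Signs matter only when each block pairs in complementary degrees; otherwise one factor of the
  -- product is zero.
  by_cases h : ∀ i, b i + k i = -∑ j, e i j
  · congr 2
    have hk : (fun i => (k i : ZMod 2)) =
        (fun i => ((∑ j, e i j : ℤ) : ZMod 2)) + fun i => (b i : ZMod 2) := by
      funext i
      have : k i = -∑ j, e i j - b i := by linarith [h i]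
      rw [this, Pi.add_apply, Int.cast_sub, Int.cast_neg, ZMod.neg_eq_self_mod_two,
        CharTwo.sub_eq_add]
    have hbk : (fun i => ((b i + k i : ℤ) : ZMod 2)) = fun i => ((∑ j, e i j : ℤ) : ZMod 2) := by
      funext i
      rw [h i, Int.cast_neg, ZMod.neg_eq_self_mod_two]
    rw [hk, hbk]
    exact pairSum_add_self_add_sum _ _
  · obtain ⟨i, hi⟩ := not_forall.1 h
    have h0 : A.alphaPow (Fin p) X (PiTensorProduct.tprod Λ (f i)) (delta Φ _ (y i ⊗ₜ c i)) = 0 :=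
      A.alphaPow_degree X hi (tprod_mem_pow_pow _ hf i) (hδ i)
    rw [Finset.prod_eq_zero (Finset.mem_univ i) h0, smul_zero, smul_zero]

/-- The iterate of θ is again the action of a family of operations, namely the iterate of Δ over W ⊗
W^p, precomposed with the shuffle. The equality is strict, so the Adem homotopy reduces to comparing
two families. -/
theorem AObj.theta_theta_eq :
    A.theta Φ ∘ₗ TensorProduct.map LinearMap.id (PiTensorProduct.map fun _ => A.theta Φ) =
      A.opAct (isOpFamily_deltaTwoOp Φ) ∘ₗ shuffle p A.cochains := by
  refine TensorProduct.ext ((stdRes Λ p).hom_ext fun a x hx =>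
    pi_tensor_pow_hom_ext A.cochains (fun _ => stdRes Λ p) fun b e y f hy hf => ?_)
  change A.theta Φ (x ⊗ₜ PiTensorProduct.map (fun _ => A.theta Φ) (PiTensorProduct.tprod Λ _)) =
    A.opAct (isOpFamily_deltaTwoOp Φ) (shuffle p A.cochains (x ⊗ₜ PiTensorProduct.tprod Λ _))
  rw [PiTensorProduct.map_tprod, shuffle_tprod A.cochains x hy hf, map_smul]
  have hθ : ∀ i, A.theta Φ (y i ⊗ₜ PiTensorProduct.tprod Λ (f i)) ∈
      A.cochains.gr (b i + ∑ j, e i j) := fun i => by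
    rw [A.theta_eq]
    exact (A.isChainMap_opAct _).degree _ _
      (tmul_mem_tensorGr _ _ (hy i) (tprod_mem_pow_pow A.cochains hf i))
  have hy' : PiTensorProduct.tprod Λ y ∈ (pow (stdRes Λ p) (Fin p)).gr (∑ i, b i) :=
    tprod_mem_piGr (fun _ => stdRes Λ p) hy
  have hf' : (PiTensorProduct.tprod Λ fun q : Fin p ×ₗ Fin p => f (ofLex q).1 (ofLex q).2) ∈
      (pow A.cochains (Fin p ×ₗ Fin p)).gr (∑ i, ∑ j, e i j) := by
    have := (isChainMap_flatten (ι := Fin p) (κ := Fin p) A.cochains).degree _ _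
      (tprod_mem_piGr (fun _ => pow A.cochains (Fin p)) (tprod_mem_pow_pow A.cochains hf))
    rwa [flatten_tprod] at this
  refine Subtype.ext (funext fun X => LinearMap.ext fun c => ?_)
  change A.ev X (A.theta Φ (x ⊗ₜ PiTensorProduct.tprod Λ _)) c = (_ • A.actFam (deltaTwoOp Φ)
    ((x ⊗ₜ PiTensorProduct.tprod Λ y) ⊗ₜ PiTensorProduct.tprod Λ _)) X c
  rw [A.ev_theta Φ X hx (tprod_mem_piGr (fun _ => A.cochains) hθ) c, A.alphaPow_theta Φ X hy hf,
    A.actFam_tmul _ (tmul_mem_tensorGr _ _ hx hy') hf', smul_smul, smul_smul]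
  change _ = ((_ : Λ) • A.alphaPow _ X _ (deltaTwo Φ _ ((x ⊗ₜ PiTensorProduct.tprod Λ y) ⊗ₜ c)))
  rw [deltaTwo_tmul Φ _ hx hy', map_smul, smul_smul, ← sgn_add, ← sgn_add, ← sgn_add]
  congr 2
  push_cast
  rw [Finset.sum_add_distrib]
  generalize pairSum (ι := Fin p) _ _ = s
  generalize (∑ i, (b i : ZMod 2)) = b
  generalize (∑ i, ∑ j, (e i j : ZMod 2)) = φ
  generalize (a : ZMod 2) = a
  revert s b φ a
  decide

/-! ### Adem objects -/

/-- The family over Y pulled back along w and the iterated family Δ are both τ-equivariant over the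
τ-free complex W ⊗ W^p and have the same augmentation, so their actions are τ-homotopic. -/
theorem AObj.isAdemObject : IsAdemObject.{max w u v, v'} p A.cochains A.cup (A.theta Φ) where
  isCpObject := A.isCpObject Φ
  adem := by
    intro Y _ y hy
    obtain ⟨E, hE, hE_act, hE_aug⟩ := Y.exists_opFamily
    refine ⟨A.opAct hE, A.isSymmetricMorphism_opAct hE hE_act, ?_⟩
    obtain ⟨h, h1, h2, h3⟩ := A.opAct_homotopic_of_free (wreathAction Λ p) (wreathPerm p)
      wreathPerm_mul (hE.comp hy.isChainMap) (isOpFamily_deltaTwoOp Φ)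
      (fun κ x => by
        rw [LinearMap.comp_apply, LinearMap.comp_apply, ← hE_act]
        exact congrArg E (hy.map_act κ x))
      (deltaTwoOp_act Φ)
      -- Both augmentations are the product of the augmentations of the p + 1 factors.
      (LinearMap.congr_fun (f := natOps.aug ∘ₗ E ∘ₗ y) (g := natOps.aug ∘ₗ deltaTwoOp Φ)
        (TensorProduct.ext ((stdRes Λ p).hom_ext fun a x hx => pi_hom_ext _ fun b y' hy' => by
          change natOps.aug (E (y (x ⊗ₜ PiTensorProduct.tprod Λ y'))) =
            natOps.aug (deltaTwoOp Φ (x ⊗ₜ PiTensorProduct.tprod Λ y'))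
          rw [hE_aug, hy.augmentation, aug_deltaTwoOp Φ hx hy'])))
    have hS := isChainMap_shuffle (p := p) A.cochains
    -- The shuffle is a τ-equivariant chain map, so precomposing with it carries the homotopy to the
    -- required source.
    refine ⟨h ∘ₗ shuffle p A.cochains, fun n x hx => h1 _ _ (hS.degree _ _ hx), fun x => ?_, ?_⟩
    · rw [A.theta_theta_eq]
      have h4 := h2 (shuffle p A.cochains x)
      rw [A.opAct_comp hE hy.isChainMap, ← hS.comm] at h4
      exact h4
    · rintro γ (hγ | ⟨i, rfl⟩)
      · rw [Set.mem_singleton_iff.1 hγ, LinearMap.comp_assoc, shuffle_tauAlpha,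
          ← LinearMap.comp_assoc]
        have h4 := h3 (1, 0)
        rw [wreathPerm_one] at h4
        have h5 : (wreathAction Λ p).act (1, 0) = tauAlpha p (stdRes Λ p) := by
          change wreathRot Λ p 1 ∘ₗ wreathShift Λ p 0 = _
          rw [wreathShift_zero, wreathRot_one]
          rfl
        rw [h5] at h4
        exact congrArg (· ∘ₗ shuffle p A.cochains) h4
      · rw [LinearMap.comp_assoc, shuffle_tauAlphaAt, ← LinearMap.comp_assoc]
        have h4 := h3 (0, Pi.single i 1)
        rw [wreathPerm_single] at h4
        have h5 : (wreathAction Λ p).act (0, Pi.single i 1) =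
            tauAlphaAt p (stdRes Λ p) (stdAlpha Λ p) i := by
          change wreathRot Λ p 0 ∘ₗ wreathShift Λ p (Pi.single i 1) = _
          rw [wreathShift_single, wreathRot, rot_zero, stdShift_zero, powPerm_one,
            TensorProduct.map_id]
          rfl
        rw [h5] at h4
        exact congrArg (· ∘ₗ shuffle p A.cochains) h4

end Factorization

end

end

end SteenrodDG

theorem proposition5p12 (p : ℕ) [Fact p.Prime] (hp : p ≠ 2) :
    Nonempty (SteenrodDG.EilenbergZilberMap.{u} (ZMod p) p) ∧
    ∀ (G : Type w) [Group G] (A : SteenrodDG.AObj.{v, u, w, w'} (ZMod p) G)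
      (Φ : SteenrodDG.EilenbergZilberMap.{u} (ZMod p) p),
      SteenrodDG.IsAdemObject.{max w u v, v'} p A.cochains A.cup (A.theta Φ) := by
  exact ⟨SteenrodDG.exists_eilenbergZilberMap p, fun G _ A Φ => A.isAdemObject Φ⟩
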